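/- Let $M$ be an oriented smooth $6$-manifold (Hausdorff, second countable; spin or not) and let $(E,\langle\cdot,\cdot\rangle,[\cdot,\cdot],\pi)$ be an exact Courant algebroid over $M$ with Ševera class $\tau\in H^3(M,\mathbb R)$. Here $[\cdot,\cdot]$ is the Dorfman bracket, $[\![a,b]\!]=\tfrac12([a,b]-[b,a])$, $\pi^*:T^*M\to E$ is defined by $\langle\pi^*\xi,e\rangle=\xi(\pi e)$, and the $3$-form of an isotropic splitting $s:TM\to E$ is $H(X,Y,Z)=2\langle[sX,sY],sZ\rangle$ (so that $s+\frac12\pi^*$ identifies $E$ with $TM\oplus T^*M$ with its $H$-twisted bracket); $\tau$ is the de Rham class of this form. A generalized metric of signature $(1,5)$ (one plus, five minuses) is a subbundle $V_+\subset E$ on which $\langle\cdot,\cdot\rangle$ has that signature, with $V_-=V_+^\perp$. It is admissible if $V_+\cap\pi^*T^*M=0$; with the orientation that $V_+\cong TM$ inherits from $M$ it is an admissible $SO(1,5)\times SO(5,1)$-metric. It then induces a metric $g(v,w)=\langle\pi_+^{-1}v,\pi_+^{-1}w\rangle$ of signature $(1,5)$ on $M$, where $\pi_+=\pi|_{V_+}$,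 and the $3$-form $H$ of the isotropic splitting $s(v)=\pi_+^{-1}v-\frac12\pi^*g(v)$. It is self-dual if $\star H=H$, where $\star=-e_6\cdots e_1$ acts on $\Lambda^*T^*M$ by the Clifford action $(v+\xi)\cdot\alpha=\iota_v\alpha+\xi\wedge\alpha$, for positive orthonormal bases $e_i=v_i+g(v_i)$ of $V_+$. Let $C:E\to E$ be the bundle map which exchanges $V_+$ and $V_-$ and satisfies $\pi C=\pi$. Let $$D^B_ab=[a_-,b_+]_++[a_+,b_-]_-+[Ca_-,b_-]_-+[Ca_+,b_+]_+$$ be the Gualtieri–Bismut connection and $D=D^B-\frac13T_{D^B}$ the canonical Levi-Civita connection, where $T_D(a,b,c)=\langle D_ab-D_ba-[\![a,b]\!],c\rangle+\frac12(\langle D_ca,b\rangle-\langle D_cb,a\rangle)$. For $b\in V_-$, $c\in V_+$, $\mathrm{GRic}(b,c)$ is the trace over $a\in V_+$ of $a\mapsto (D_aD_b-D_bD_a-D_{[\![a,b]\!]})c$. The generalized scalar curvature $\mathrm{GS}$ is the function for which $$(\slashed D^S_+)^2\epsilon=(D^S_-)^*D^S_-\,\epsilon+\mathrm{GS}\,\epsilon$$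 for all local sections $\epsilon$ of the positive spinor bundle $S_+(V_+)$. Here $D^S_\pm$ is the spin connection induced by $D$ in the directions of $V_\pm$, $\slashed D^S_+$ is the Dirac operator of $D^S_+$ with Clifford relation $v^2=-\langle v,v\rangle$, and $(D^S_-)^*D^S_-$ is minus the trace of the second covariant derivative along $V_-$ with respect to the metric $-\langle\cdot,\cdot\rangle$ on $V_-$. (The bundle $S_+(V_+)$ always exists locally, which is all that the definition of $\mathrm{GS}$ uses; it is the restriction of the global one when the latter exists.) **Theorem.** The assignment $\Phi:V_+\mapsto(g,H)$ is a well-defined map from the admissible generalized metrics of signature $(1,5)$ on $E$ onto the set of all pairs of a metric $g$ of signature $(1,5)$ and a closed $3$-form $H$ with $[H]=\tau$. Two admissible generalized metrics have the same image if and only if they differ by a transformation $e\mapsto e+\frac12\pi^*(\iota_{\pi e}B)$ with $B$ a closed $2$-form. Moreover, $V_+$ is self-dual and satisfies the generalized vacuum Einstein equations $$\mathrm{GRic}=0,\qquad \mathrm{GS}=0$$ if and only if $(g,H)=\Phi(V_+)$ solves the equations of motion of pure $\mathcal N=1$ six-dimensional supergravity $$\mathrm{Ric}^g=\tfrac14H\circ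 H,\qquad d{*}H=0,\qquad H={*}H,$$ where $(H\circ H)_{ij}=H_{ikl}H_j{}^{kl}$ and $({*}H)_{abc}=\frac1{3!}\varepsilon_{abc}{}^{def}H_{def}$ with $\varepsilon$ the volume form of $g$, equal to $1$ on positive orthonormal bases. Hence the solutions $(g,H)$ with $[H]=\tau$ correspond exactly to the self-dual admissible generalized $SO(1,5)\times SO(5,1)$-metrics on $E$ with $\mathrm{GRic}=0$ and $\mathrm{GS}=0$, modulo closed $B$-field transformations. -/

import Mathlib

open Bundle Filter Set
open scoped Manifold ContDiff Topology Matrix Kronecker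

noncomputable section

namespace GenSugra

/-! ## Linear algebra in signature (1,5) -/

/-- The diagonal signs of the flat metric of signature `(1,5)`: one plus, five minuses. -/
def eta : Fin 6 → ℝ := ![1, -1, -1, -1, -1, -1]

/-- `v` is an orthonormal 6-tuple of signature `(1,5)` for the bilinear form `B`. -/
def IsOrtho {V : Type*} [AddCommGroup V] [Module ℝ V]
    (B : LinearMap.BilinForm ℝ V) (v : Fin 6 → V) : Prop :=
  ∀ i j, B (v i) (v j) = if i = j then eta i else 0

/-- Exterior forms of mixed degree on `V`. -/
abbrev MixedForm (V : Type*) [AddCommGroup V] [Module ℝ V] : Type _ :=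
  ∀ k : ℕ, V [⋀^Fin k]→ₗ[ℝ] ℝ

/-- Clifford action of `v + ξ ∈ V ⊕ V*` on mixed forms: `α ↦ ι_v α + ξ ∧ α`.
It squares to `ξ(v)`, the value on `v + ξ` of the pairing
`⟨v + ξ, w + ζ⟩ = (ξ(w) + ζ(v)) / 2`. -/
def cliffAct {V : Type*} [AddCommGroup V] [Module ℝ V] (v : V) (ξ : Module.Dual ℝ V)
    (α : MixedForm V) : MixedForm V
  | 0 => (α 1).curryLeft v
  | k + 1 => (α (k + 2)).curryLeft v +
      AlternatingMap.alternatizeUncurryFin (LinearMap.smulRight ξ (α k))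

/-- The generalized Hodge star `⋆ α = - e₆ ⋯ e₁ · α`, where `e_i = v_i + g(v_i)`. -/
def genStar {V : Type*} [AddCommGroup V] [Module ℝ V] (g : LinearMap.BilinForm ℝ V)
    (v : Fin 6 → V) (α : MixedForm V) : MixedForm V :=
  let c : Fin 6 → MixedForm V → MixedForm V := fun i => cliffAct (v i) (g (v i))
  (-1 : ℝ) • c 5 (c 4 (c 3 (c 2 (c 1 (c 0 α)))))

/-- The contraction `ι_v β` of a 2-form, as a linear functional. -/
def contract2 {V : Type*} [AddCommGroup V] [Module ℝ V] (β : V [⋀^Fin 2]→ₗ[ℝ] ℝ) (v : V) :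
    Module.Dual ℝ V :=
  (AlternatingMap.ofSubsingleton ℝ V ℝ (0 : Fin 1)).symm (β.curryLeft v)

/-! ## The Dirac representation -/

/-- Dirac spinors `ℂ² ⊗ ℂ² ⊗ ℂ²`. -/
abbrev Spinor : Type := Fin 2 × Fin 2 × Fin 2 → ℂ

abbrev SpinMat : Type := Matrix (Fin 2 × Fin 2 × Fin 2) (Fin 2 × Fin 2 × Fin 2) ℂ

def pauli1 : Matrix (Fin 2) (Fin 2) ℂ := !![0, 1; 1, 0]
def pauli2 : Matrix (Fin 2) (Fin 2) ℂ := !![0, -Complex.I; Complex.I, 0]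
def pauli3 : Matrix (Fin 2) (Fin 2) ℂ := !![1, 0; 0, -1]

/-- Gamma matrices with `γ_i γ_j + γ_j γ_i = -2 η_{ij}`. -/
def gam : Fin 6 → SpinMat :=
  ![Complex.I • (pauli1 ⊗ₖ ((1 : Matrix (Fin 2) (Fin 2) ℂ) ⊗ₖ (1 : Matrix (Fin 2) (Fin 2) ℂ))),
    pauli2 ⊗ₖ ((1 : Matrix (Fin 2) (Fin 2) ℂ) ⊗ₖ (1 : Matrix (Fin 2) (Fin 2) ℂ)),
    pauli3 ⊗ₖ (pauli1 ⊗ₖ (1 : Matrix (Fin 2) (Fin 2) ℂ)),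
    pauli3 ⊗ₖ (pauli2 ⊗ₖ (1 : Matrix (Fin 2) (Fin 2) ℂ)),
    pauli3 ⊗ₖ (pauli3 ⊗ₖ pauli1),
    pauli3 ⊗ₖ (pauli3 ⊗ₖ pauli2)]

/-- The chirality operator; it squares to `1`. Positive spinors are its `+1`-eigenvectors. -/
def chirality : SpinMat := gam 0 * gam 1 * gam 2 * gam 3 * gam 4 * gam 5

/-! ## Vector fields, forms, metrics, orientations on a 6-manifold -/

/-- The model space. -/
abbrev R6 : Type := EuclideanSpace ℝ (Fin 6)

section Base

variable (M : Type*) [TopologicalSpace M] [ChartedSpace R6 M] [IsManifold (𝓡 6) ∞ M]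

/-- Smooth vector fields. -/
abbrev VF : Type _ := Cₛ^∞⟮𝓡 6; R6, (TangentSpace (𝓡 6) : M → Type)⟯

variable {M}

/-- The differential of a function, as a covector at `x`. -/
def dFun (f : M → ℝ) (x : M) : Module.Dual ℝ (TangentSpace (𝓡 6) x) :=
  (mfderiv (𝓡 6) 𝓘(ℝ, ℝ) f x).toLinearMap

/-- Smooth `k`-forms: fields of alternating `k`-linear forms whose values on smooth vector fields
are smooth functions. -/
def Form (M : Type*) [TopologicalSpace M] [ChartedSpace R6 M] [IsManifold (𝓡 6) ∞ M] (k : ℕ) :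
    Submodule ℝ (∀ x : M, (TangentSpace (𝓡 6) x) [⋀^Fin k]→ₗ[ℝ] ℝ) where
  carrier := {θ | ∀ X : Fin k → VF M,
    ContMDiff (𝓡 6) 𝓘(ℝ, ℝ) ∞ (fun x => θ x (fun i => X i x))}
  add_mem' := fun h h' X => (h X).add (h' X)
  zero_mem' := fun _ => contMDiff_const
  smul_mem' := fun c _ h X => (contMDiff_const (c := c)).mul (h X)

instance formAddCommGroup (k : ℕ) : AddCommGroup (Form M k) := Submodule.addCommGroup _

instance formModule (k : ℕ) : Module ℝ (Form M k) := Submodule.module _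

/-- The bracket of two smooth vector fields, at a point. -/
abbrev lieAt (X Y : VF M) (x : M) : TangentSpace (𝓡 6) x :=
  VectorField.mlieBracket (𝓡 6) (fun y => X y) (fun y => Y y) x

/-- The value `(dβ)(X, Y, Z)` at `x` of the exterior derivative of a 2-form. -/
def d2 (β : ∀ x : M, (TangentSpace (𝓡 6) x) [⋀^Fin 2]→ₗ[ℝ] ℝ) (X Y Z : VF M) (x : M) : ℝ :=
  dFun (fun y => β y ![Y y, Z y]) x (X x)
    - dFun (fun y => β y ![X y, Z y]) x (Y x)
    + dFun (fun y => β y ![X y, Y y]) x (Z x)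
    - β x ![lieAt X Y x, Z x] + β x ![lieAt X Z x, Y x] - β x ![lieAt Y Z x, X x]

/-- The value `(dθ)(W, X, Y, Z)` at `x` of the exterior derivative of a 3-form. -/
def d3 (θ : ∀ x : M, (TangentSpace (𝓡 6) x) [⋀^Fin 3]→ₗ[ℝ] ℝ) (W X Y Z : VF M) (x : M) : ℝ :=
  dFun (fun y => θ y ![X y, Y y, Z y]) x (W x)
    - dFun (fun y => θ y ![W y, Y y, Z y]) x (X x)
    + dFun (fun y => θ y ![W y, X y, Z y]) x (Y x)
    - dFun (fun y => θ y ![W y, X y, Y y]) x (Z x)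
    - θ x ![lieAt W X x, Y x, Z x] + θ x ![lieAt W Y x, X x, Z x]
    - θ x ![lieAt W Z x, X x, Y x] - θ x ![lieAt X Y x, W x, Z x]
    + θ x ![lieAt X Z x, W x, Y x] - θ x ![lieAt Y Z x, W x, X x]

lemma form2_mdiff (β : Form M 2) (X Y : VF M) (x : M) :
    MDifferentiableAt (𝓡 6) 𝓘(ℝ, ℝ) (fun y => β.1 y ![X y, Y y]) x := by
  have h := β.2 ![X, Y]
  have e : (fun y : M => β.1 y (fun i => (![X, Y] : Fin 2 → VF M) i y))
      = fun y => β.1 y ![X y, Y y] := by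
    funext y; congr 1; funext i; fin_cases i <;> rfl
  rw [e] at h
  exact h.mdifferentiable (by simp) x

lemma form3_mdiff (θ : Form M 3) (X Y Z : VF M) (x : M) :
    MDifferentiableAt (𝓡 6) 𝓘(ℝ, ℝ) (fun y => θ.1 y ![X y, Y y, Z y]) x := by
  have h := θ.2 ![X, Y, Z]
  have e : (fun y : M => θ.1 y (fun i => (![X, Y, Z] : Fin 3 → VF M) i y))
      = fun y => θ.1 y ![X y, Y y, Z y] := by
    funext y; congr 1; funext i; fin_cases i <;> rfl
  rw [e] at h
  exact h.mdifferentiable (by simp) x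

lemma dFun_add {f f' : M → ℝ} {x : M} (hf : MDifferentiableAt (𝓡 6) 𝓘(ℝ, ℝ) f x)
    (hf' : MDifferentiableAt (𝓡 6) 𝓘(ℝ, ℝ) f' x) (v : TangentSpace (𝓡 6) x) :
    dFun (fun y => f y + f' y) x v = dFun f x v + dFun f' x v := by
  have := mfderiv_add hf hf'
  exact congrArg (fun L => L v) this

lemma dFun_smul {f : M → ℝ} {x : M} (hf : MDifferentiableAt (𝓡 6) 𝓘(ℝ, ℝ) f x) (c : ℝ)
    (v : TangentSpace (𝓡 6) x) :
    dFun (fun y => c * f y) x v = c * dFun f x v := by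
  have := const_smul_mfderiv hf c
  exact congrArg (fun L => L v) this

lemma d2_add (β β' : Form M 2) (X Y Z : VF M) (x : M) :
    d2 (β + β' : Form M 2).1 X Y Z x = d2 β.1 X Y Z x + d2 β'.1 X Y Z x := by
  have h := fun (A B : VF M) (v : TangentSpace (𝓡 6) x) =>
    dFun_add (form2_mdiff β A B x) (form2_mdiff β' A B x) v
  simp only [d2, Submodule.coe_add, Pi.add_apply, AlternatingMap.add_apply, h]
  ring

lemma d2_smul (c : ℝ) (β : Form M 2) (X Y Z : VF M) (x : M) :
    d2 (c • β : Form M 2).1 X Y Z x = c * d2 β.1 X Y Z x := by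
  have h := fun (A B : VF M) (v : TangentSpace (𝓡 6) x) =>
    dFun_smul (form2_mdiff β A B x) c v
  simp only [d2, Submodule.coe_smul, Pi.smul_apply, AlternatingMap.smul_apply, smul_eq_mul, h]
  ring

lemma d3_add (β β' : Form M 3) (W X Y Z : VF M) (x : M) :
    d3 (β + β' : Form M 3).1 W X Y Z x = d3 β.1 W X Y Z x + d3 β'.1 W X Y Z x := by
  have h := fun (A B C : VF M) (v : TangentSpace (𝓡 6) x) =>
    dFun_add (form3_mdiff β A B C x) (form3_mdiff β' A B C x) v
  simp only [d3, Submodule.coe_add, Pi.add_apply, AlternatingMap.add_apply, h]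
  ring

lemma d3_smul (c : ℝ) (β : Form M 3) (W X Y Z : VF M) (x : M) :
    d3 (c • β : Form M 3).1 W X Y Z x = c * d3 β.1 W X Y Z x := by
  have h := fun (A B C : VF M) (v : TangentSpace (𝓡 6) x) =>
    dFun_smul (form3_mdiff β A B C x) c v
  simp only [d3, Submodule.coe_smul, Pi.smul_apply, AlternatingMap.smul_apply, smul_eq_mul, h]
  ring

/-- Closed 3-forms. -/
def closed3 (M : Type*) [TopologicalSpace M] [ChartedSpace R6 M] [IsManifold (𝓡 6) ∞ M] :
    Submodule ℝ (Form M 3) where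
  carrier := {θ | ∀ (W X Y Z : VF M) (x : M), d3 θ.1 W X Y Z x = 0}
  add_mem' := fun {a b} ha hb W X Y Z x => by rw [d3_add, ha, hb, add_zero]
  zero_mem' := fun W X Y Z x => by
    have := d3_smul (0 : ℝ) (0 : Form M 3) W X Y Z x
    rwa [zero_smul, zero_mul] at this
  smul_mem' := fun c a ha W X Y Z x => by rw [d3_smul, ha, mul_zero]

/-- Exact 3-forms. -/
def exact3 (M : Type*) [TopologicalSpace M] [ChartedSpace R6 M] [IsManifold (𝓡 6) ∞ M] :
    Submodule ℝ (Form M 3) where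
  carrier := {θ | ∃ β : Form M 2, ∀ (X Y Z : VF M) (x : M),
    θ.1 x ![X x, Y x, Z x] = d2 β.1 X Y Z x}
  add_mem' := by
    rintro a b ⟨β, hβ⟩ ⟨β', hβ'⟩
    refine ⟨β + β', fun X Y Z x => ?_⟩
    rw [d2_add, ← hβ, ← hβ']; rfl
  zero_mem' := ⟨0, fun X Y Z x => by
    have := d2_smul (0 : ℝ) (0 : Form M 2) X Y Z x
    rw [zero_smul, zero_mul] at this
    rw [this]; rfl⟩
  smul_mem' := by
    rintro c a ⟨β, hβ⟩
    refine ⟨c • β, fun X Y Z x => ?_⟩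
    rw [d2_smul, ← hβ]; rfl

/-- The third de Rham cohomology `H³(M, ℝ)`. -/
abbrev H3dR (M : Type*) [TopologicalSpace M] [ChartedSpace R6 M] [IsManifold (𝓡 6) ∞ M] : Type _ :=
  (closed3 M) ⧸ ((exact3 M).comap (closed3 M).subtype)

/-- `H` is closed and `[H] = τ`. -/
def HasClass (H : Form M 3) (τ : H3dR M) : Prop :=
  ∃ h : H ∈ closed3 M, Submodule.Quotient.mk (⟨H, h⟩ : closed3 M) = τ

/-- A smooth pseudo-Riemannian metric of signature `(1,5)`. -/
structure LorentzMetric (M : Type*) [TopologicalSpace M] [ChartedSpace R6 M]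
    [IsManifold (𝓡 6) ∞ M] where
  val : ∀ x : M, LinearMap.BilinForm ℝ (TangentSpace (𝓡 6) x)
  symm' : ∀ x v w, val x v w = val x w v
  smooth' : ∀ X Y : VF M, ContMDiff (𝓡 6) 𝓘(ℝ, ℝ) ∞ (fun x => val x (X x) (Y x))
  signature' : ∀ x, ∃ b : Module.Basis (Fin 6) ℝ (TangentSpace (𝓡 6) x), IsOrtho (val x) b

/-- An orientation of `M`: orientations of all tangent spaces, locally given by the value of a
smooth frame. -/
structure ManifoldOrientation (M : Type*) [TopologicalSpace M] [ChartedSpace R6 M]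
    [IsManifold (𝓡 6) ∞ M] where
  at' : ∀ x : M, Orientation ℝ (TangentSpace (𝓡 6) x) (Fin 6)
  locally_frame' : ∀ x : M, ∃ X : Fin 6 → VF M, ∀ᶠ y in 𝓝 x,
    ∃ b : Module.Basis (Fin 6) ℝ (TangentSpace (𝓡 6) y),
      (∀ i, b i = X i y) ∧ b.orientation = at' y

/-- `v` is a positively oriented basis of `T_x M`. -/
def ManifoldOrientation.IsPos (o : ManifoldOrientation M) (x : M)
    (v : Fin 6 → TangentSpace (𝓡 6) x) : Prop :=
  ∃ b : Module.Basis (Fin 6) ℝ (TangentSpace (𝓡 6) x), (∀ i, b i = v i) ∧ b.orientation = o.at' x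

/-- `H' = *H`, with `(*H)_{abc} = (1/3!) ε_{abc}{}^{def} H_{def}`, where `ε` is the volume form of
`g`, equal to `1` on positive orthonormal bases. -/
def IsHodgeStar (o : ManifoldOrientation M) (g : LorentzMetric M) (H H' : Form M 3) : Prop :=
  ∀ (x : M) (b : Module.Basis (Fin 6) ℝ (TangentSpace (𝓡 6) x)),
    IsOrtho (g.val x) b → b.orientation = o.at' x →
    ∀ u v w : TangentSpace (𝓡 6) x,
      H'.1 x ![u, v, w] = (1 / 6 : ℝ) * ∑ i, ∑ j, ∑ k,
        eta i * eta j * eta k * b.det ![u, v, w, b i, b j, b k] * H.1 x ![b i, b j, b k]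

/-- `nabla` is the Levi-Civita connection of `g`. -/
structure IsLeviCivita (g : LorentzMetric M) (nabla : VF M → VF M → VF M) : Prop where
  add_left : ∀ X X' Y, nabla (X + X') Y = nabla X Y + nabla X' Y
  add_right : ∀ X Y Y', nabla X (Y + Y') = nabla X Y + nabla X Y'
  smul_left : ∀ (f : C^∞⟮𝓡 6, M; 𝓘(ℝ, ℝ), ℝ⟯) (X X' Y : VF M), (∀ x, X' x = f x • X x) →
    ∀ x, nabla X' Y x = f x • nabla X Y x
  leibniz : ∀ (f : C^∞⟮𝓡 6, M; 𝓘(ℝ, ℝ), ℝ⟯) (X Y Y' : VF M), (∀ x, Y' x = f x • Y x) →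
    ∀ x, nabla X Y' x = dFun f x (X x) • Y x + f x • nabla X Y x
  torsion_free : ∀ X Y x, nabla X Y x - nabla Y X x = lieAt X Y x
  metric : ∀ (X Y Z : VF M) (x : M), dFun (fun y => g.val y (Y y) (Z y)) x (X x)
    = g.val x (nabla X Y x) (Z x) + g.val x (Y x) (nabla X Z x)

/-- `r = Ric(Y, Z)(x)`, the trace of `X ↦ R(X, Y) Z` on `T_x M`, where
`R(X, Y) Z = ∇_X ∇_Y Z - ∇_Y ∇_X Z - ∇_{[X, Y]} Z`. -/
def IsRicci (nabla : VF M → VF M → VF M) (x : M) (Y Z : VF M) (r : ℝ) : Prop :=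
  ∃ L : TangentSpace (𝓡 6) x →ₗ[ℝ] TangentSpace (𝓡 6) x,
    (∀ X B : VF M, (∀ y, B y = lieAt X Y y) →
      L (X x) = nabla X (nabla Y Z) x - nabla Y (nabla X Z) x - nabla B Z x) ∧
    LinearMap.trace ℝ _ L = r

/-- `(H ∘ H)(u, w) = H_{ukl} H_w{}^{kl}`, in an orthonormal basis `b`. -/
def circ {x : M} (b : Module.Basis (Fin 6) ℝ (TangentSpace (𝓡 6) x)) (H : Form M 3)
    (u w : TangentSpace (𝓡 6) x) : ℝ :=
  ∑ k, ∑ l, eta k * eta l * (H.1 x ![u, b k, b l] * H.1 x ![w, b k, b l])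

/-- `(g, H)` solves the equations of motion of pure `N = 1` six-dimensional supergravity:
`Ric = (1/4) H ∘ H`, `d * H = 0`, `H = * H`. -/
structure IsSugraSolution (o : ManifoldOrientation M) (g : LorentzMetric M) (H : Form M 3) :
    Prop where
  ricci : ∃ nabla : VF M → VF M → VF M, IsLeviCivita g nabla ∧
    ∀ (x : M) (b : Module.Basis (Fin 6) ℝ (TangentSpace (𝓡 6) x)), IsOrtho (g.val x) b →
      ∀ Y Z : VF M, IsRicci nabla x Y Z ((1 / 4 : ℝ) * circ b H (Y x) (Z x))
  star : ∃ sH : Form M 3, IsHodgeStar o g H sH ∧ sH ∈ closed3 M ∧ H = sH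

end Base

/-! ## Courant algebroids -/

section Courant

variable {M : Type*} [TopologicalSpace M] [ChartedSpace R6 M] [IsManifold (𝓡 6) ∞ M]
  (F : Type*) [NormedAddCommGroup F] [NormedSpace ℝ F] [FiniteDimensional ℝ F]
  (E : M → Type*) [TopologicalSpace (TotalSpace F E)] [∀ x, TopologicalSpace (E x)]
  [∀ x, AddCommGroup (E x)] [∀ x, Module ℝ (E x)] [FiberBundle F E] [VectorBundle ℝ F E]

/-- Smooth sections of `E`. -/
abbrev Sec : Type _ := Cₛ^∞⟮𝓡 6; F, E⟯

/-- A vector bundle with a smooth nondegenerate symmetric pairing and a smooth bundle map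
`π : E → TM`. -/
structure AnchoredBundle where
  pair : ∀ x, LinearMap.BilinForm ℝ (E x)
  pair_symm : ∀ x e e', pair x e e' = pair x e' e
  pair_nondeg : ∀ x, (pair x).Nondegenerate
  pair_smooth : ∀ a b : Sec F E, ContMDiff (𝓡 6) 𝓘(ℝ, ℝ) ∞ (fun x => pair x (a x) (b x))
  anchor : ∀ x, E x →ₗ[ℝ] TangentSpace (𝓡 6) x
  anchor_smooth : ∀ a : Sec F E, ContMDiff (𝓡 6) ((𝓡 6).prod 𝓘(ℝ, R6)) ∞
    (fun x => (⟨x, anchor x (a x)⟩ : TangentBundle (𝓡 6) M))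

variable {F E}

/-- The dual `π* : T*M → E` of the anchor under `E ≅ E*`: `⟨π* ξ, e⟩ = ξ(π e)`. -/
def AnchoredBundle.coanchor (A : AnchoredBundle F E) (x : M) :
    Module.Dual ℝ (TangentSpace (𝓡 6) x) →ₗ[ℝ] E x :=
  haveI : FiniteDimensional ℝ (E x) := VectorBundle.finiteDimensional ℝ F E x
  ((LinearMap.BilinForm.toDual (A.pair x) (A.pair_nondeg x)).symm : Module.Dual ℝ (E x) →ₗ[ℝ] E x)
    ∘ₗ (A.anchor x).dualMap

lemma AnchoredBundle.pair_coanchor (A : AnchoredBundle F E) (x : M)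
    (ξ : Module.Dual ℝ (TangentSpace (𝓡 6) x)) (e : E x) :
    A.pair x (A.coanchor x ξ) e = ξ (A.anchor x e) := by
  have : FiniteDimensional ℝ (E x) := VectorBundle.finiteDimensional ℝ F E x
  simp [AnchoredBundle.coanchor, LinearMap.BilinForm.apply_toDual_symm_apply]

/-- The anchor on sections. -/
def AnchoredBundle.anchorSec (A : AnchoredBundle F E) (a : Sec F E) : VF M :=
  ⟨fun x => A.anchor x (a x), A.anchor_smooth a⟩

variable (F E) in
/-- Courant algebroids, with their Dorfman bracket. -/
structure CourantAlgebroid extends AnchoredBundle F E where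
  bracket : Sec F E →ₗ[ℝ] Sec F E →ₗ[ℝ] Sec F E
  jacobi : ∀ a b c, bracket a (bracket b c) = bracket (bracket a b) c + bracket b (bracket a c)
  anchor_bracket : ∀ a b x, anchor x (bracket a b x) =
    lieAt (toAnchoredBundle.anchorSec a) (toAnchoredBundle.anchorSec b) x
  leibniz : ∀ (f : C^∞⟮𝓡 6, M; 𝓘(ℝ, ℝ), ℝ⟯) (a b b' : Sec F E), (∀ x, b' x = f x • b x) →
    ∀ x, bracket a b' x = dFun f x (anchor x (a x)) • b x + f x • bracket a b x
  pair_bracket : ∀ a b c x, dFun (fun y => pair y (b y) (c y)) x (anchor x (a x)) =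
    pair x (bracket a b x) (c x) + pair x (b x) (bracket a c x)
  bracket_symm : ∀ a b x, bracket a b x + bracket b a x =
    toAnchoredBundle.coanchor x (dFun (fun y => pair y (a y) (b y)) x)

namespace CourantAlgebroid

variable (C : CourantAlgebroid F E)

/-- Exactness of `0 → T*M → E → TM → 0`. -/
structure IsExact : Prop where
  inj : ∀ x, Function.Injective (C.coanchor x)
  exact' : ∀ x, LinearMap.range (C.coanchor x) = LinearMap.ker (C.anchor x)
  surj : ∀ x, Function.Surjective (C.anchor x)

/-- The Courant bracket, the skew-symmetrization of the Dorfman bracket. -/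
def courant (a b : Sec F E) : Sec F E := (1 / 2 : ℝ) • (C.bracket a b - C.bracket b a)

/-- Smooth isotropic splittings `s : TM → E` of the anchor. -/
structure Splitting where
  map : ∀ x, TangentSpace (𝓡 6) x →ₗ[ℝ] E x
  smooth' : ∀ X : VF M, ContMDiff (𝓡 6) ((𝓡 6).prod 𝓘(ℝ, F)) ∞
    (fun x => (⟨x, map x (X x)⟩ : TotalSpace F E))
  section' : ∀ x v, C.anchor x (map x v) = v
  isotropic' : ∀ x v w, C.pair x (map x v) (map x w) = 0

variable {C}

/-- The splitting on vector fields. -/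
def Splitting.onVF (s : C.Splitting) (X : VF M) : Sec F E :=
  ⟨fun x => s.map x (X x), s.smooth' X⟩

/-- `H` is the 3-form of the splitting `s`: under `s + π*/2 : TM ⊕ T*M ≅ E` the bracket of `E` is
the standard Dorfman bracket twisted by `H`, that is `[sX, sY] = s[X, Y] + π*(H(X, Y, ·))/2`,
which is to say `H(X, Y, Z) = 2 ⟨[sX, sY], sZ⟩`. -/
def Splitting.IsCurv (s : C.Splitting) (H : Form M 3) : Prop :=
  ∀ (X Y Z : VF M) (x : M), H.1 x ![X x, Y x, Z x] =
    2 * C.pair x (C.bracket (s.onVF X) (s.onVF Y) x) (s.onVF Z x)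

variable (C)

/-- `τ` is the Ševera class of `C`: the de Rham class of the 3-form of an isotropic splitting. -/
def IsSeveraClass (τ : H3dR M) : Prop :=
  ∃ (s : C.Splitting) (H : Form M 3), s.IsCurv H ∧ HasClass H τ

/-- Generalized metrics of signature `(1,5)`, given by the endomorphism `G` with
eigenbundles `V_±`. -/
structure GenMetric where
  G : ∀ x, E x →ₗ[ℝ] E x
  smooth' : ∀ a : Sec F E, ContMDiff (𝓡 6) ((𝓡 6).prod 𝓘(ℝ, F)) ∞
    (fun x => (⟨x, G x (a x)⟩ : TotalSpace F E))
  sq' : ∀ x e, G x (G x e) = e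
  self_adj' : ∀ x e e', C.pair x (G x e) e' = C.pair x e (G x e')
  signature' : ∀ x, ∃ v : Fin 6 → E x, IsOrtho (C.pair x) v ∧
    Submodule.span ℝ (Set.range v) = LinearMap.ker (G x - LinearMap.id)

namespace GenMetric

variable {C} (A : C.GenMetric)

/-- `G` on sections. -/
def onSec (a : Sec F E) : Sec F E := ⟨fun x => A.G x (a x), A.smooth' a⟩

/-- The fibre of `V_+`. -/
abbrev Vplus (x : M) : Submodule ℝ (E x) := LinearMap.ker (A.G x - LinearMap.id)

/-- The fibre of `V_-`. -/
abbrev Vminus (x : M) : Submodule ℝ (E x) := LinearMap.ker (A.G x + LinearMap.id)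

/-- The projections to `V_±` on sections. -/
def plus (a : Sec F E) : Sec F E := (1 / 2 : ℝ) • (a + A.onSec a)
def minus (a : Sec F E) : Sec F E := (1 / 2 : ℝ) • (a - A.onSec a)

/-- Admissibility: `V_+ ∩ π*(T*M) = 0`. -/
def Admissible : Prop := ∀ x, A.Vplus x ⊓ LinearMap.range (C.coanchor x) = ⊥

/-- `A` induces the metric `g` on `M` (the restriction of the pairing to `V_+ ≅ TM`) and, through
its associated isotropic splitting `s(v) = π_+⁻¹(v) - π* g(v) / 2`, the 3-form `H`. -/
def Induces (g : LorentzMetric M) (H : Form M 3) : Prop :=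
  (∀ x, ∀ e ∈ A.Vplus x, ∀ e' ∈ A.Vplus x,
    g.val x (C.anchor x e) (C.anchor x e') = C.pair x e e') ∧
  ∃ s : C.Splitting,
    (∀ x v, s.map x v + (1 / 2 : ℝ) • C.coanchor x (g.val x v) ∈ A.Vplus x) ∧ s.IsCurv H

/-- `A` is self-dual: its 3-form `H`, as a spinor in the splitting of `A`, satisfies `⋆H = H`,
where `⋆ = - e₆ ⋯ e₁` for positive orthonormal bases `e_i = v_i + g(v_i)` of `V_+`. -/
def IsSelfDual (o : ManifoldOrientation M) : Prop :=
  ∃ (g : LorentzMetric M) (H : Form M 3), A.Induces g H ∧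
    ∀ (x : M) (e : Fin 6 → E x), (∀ i, e i ∈ A.Vplus x) → IsOrtho (C.pair x) e →
      o.IsPos x (fun i => C.anchor x (e i)) →
      genStar (g.val x) (fun i => C.anchor x (e i)) (Pi.single 3 (H.1 x)) = Pi.single 3 (H.1 x)

/-- The swap `C_A` of `V_+` and `V_-` with `π ∘ C_A = π`. -/
structure Swap where
  map : ∀ x, E x →ₗ[ℝ] E x
  smooth' : ∀ a : Sec F E, ContMDiff (𝓡 6) ((𝓡 6).prod 𝓘(ℝ, F)) ∞
    (fun x => (⟨x, map x (a x)⟩ : TotalSpace F E))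
  anti' : ∀ x e, A.G x (map x e) = - map x (A.G x e)
  anchor' : ∀ x e, C.anchor x (map x e) = C.anchor x e

variable {A} in
/-- The swap on sections. -/
def Swap.onSec (S : A.Swap) (a : Sec F E) : Sec F E := ⟨fun x => S.map x (a x), S.smooth' a⟩

/-- The Gualtieri–Bismut connection
`D_a b = [a₋, b₊]₊ + [a₊, b₋]₋ + [C a₋, b₋]₋ + [C a₊, b₊]₊`. -/
def bismut (S : A.Swap) (a b : Sec F E) : Sec F E :=
  A.plus (C.bracket (A.minus a) (A.plus b)) + A.minus (C.bracket (A.plus a) (A.minus b))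
    + A.minus (C.bracket (S.onSec (A.minus a)) (A.minus b))
    + A.plus (C.bracket (S.onSec (A.plus a)) (A.plus b))

end GenMetric

/-- The torsion of a generalized connection `D`. -/
def torsion (D : Sec F E → Sec F E → Sec F E) (a b c : Sec F E) (x : M) : ℝ :=
  C.pair x ((D a b - D b a - C.courant a b : Sec F E) x) (c x)
    + (1 / 2 : ℝ) * (C.pair x (D c a x) (b x) - C.pair x (D c b x) (a x))

/-- The generalized curvature of `D` on sections. -/
def genCurv (D : Sec F E → Sec F E → Sec F E) (a b c : Sec F E) : Sec F E :=
  D a (D b c) - D b (D a c) - D (C.courant a b) c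

namespace GenMetric

variable {C} (A : C.GenMetric)

/-- `D` is the canonical Levi-Civita connection `D^B - T_{D^B} / 3` of `A`. -/
def IsCanonicalLC (D : Sec F E → Sec F E → Sec F E) : Prop :=
  ∃ S : A.Swap, ∀ (a b c : Sec F E) (x : M),
    C.pair x (D a b x) (c x) = C.pair x (A.bismut S a b x) (c x)
      - (1 / 3 : ℝ) * C.torsion (A.bismut S) a b c x

/-- `r = GRic(b, c)(x)`, the trace of `a ↦ GR(a, b) c` on the fibre of `V_+`,
for `b` in `V_-` and `c` in `V_+`. -/
def IsGenRicci (D : Sec F E → Sec F E → Sec F E) (x : M) (b c : Sec F E) (r : ℝ) : Prop :=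
  ∃ L : A.Vplus x →ₗ[ℝ] A.Vplus x,
    (∀ (a : Sec F E) (ha : ∀ y, a y ∈ A.Vplus y), (L ⟨a x, ha x⟩ : E x) = C.genCurv D a b c x) ∧
    LinearMap.trace ℝ _ L = r

/-- `GRic = 0`. -/
def GenRicciFlat (D : Sec F E → Sec F E → Sec F E) : Prop :=
  ∀ (x : M) (b c : Sec F E), (∀ y, b y ∈ A.Vminus y) → (∀ y, c y ∈ A.Vplus y) →
    A.IsGenRicci D x b c 0

end GenMetric

/-- The derivative `D^S_a ε` of a spinor field with respect to a section `a` of `E`, in the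
trivialization of the spinor bundle `S(V_+)` given by an orthonormal frame `e` of `V_+`:
`D^S_a ε = π(a)(ε) + (1/4) ∑ η_p η_q ⟨D_a e_p, e_q⟩ γ_p γ_q ε`. -/
def spinDeriv (D : Sec F E → Sec F E → Sec F E) (e : Fin 6 → Sec F E) (a : Sec F E)
    (ε : M → Spinor) (x : M) : Spinor :=
  let dε : Spinor := mfderiv (𝓡 6) 𝓘(ℝ, Spinor) ε x (C.anchor x (a x))
  dε + (1 / 4 : ℝ) • ∑ p, ∑ q, (eta p * eta q * C.pair x (D a (e p) x) (e q x)) •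
        ((gam p * gam q) *ᵥ ε x)

/-- The Dirac operator of `D_+`, in the frame `e` of `V_+`. -/
def diracOp (D : Sec F E → Sec F E → Sec F E) (e : Fin 6 → Sec F E) (ε : M → Spinor) (x : M) :
    Spinor :=
  ∑ i, eta i • (gam i *ᵥ C.spinDeriv D e (e i) ε x)

/-- The rough Laplacian `(D^S_-)* D^S_-` of `D_-`, in the frame `e` of `V_+` and the orthonormal
frame `f` of `V_-`: minus the trace of the second covariant derivative in the directions of `V_-`,
taken with respect to the metric `-⟨·,·⟩` of signature `(1,5)` on `V_-`. -/
def roughLaplacian (D : Sec F E → Sec F E → Sec F E) (e f : Fin 6 → Sec F E) (ε : M → Spinor)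
    (x : M) : Spinor :=
  -∑ j, eta j • (C.spinDeriv D e (f j) (C.spinDeriv D e (f j) ε) x
      - C.spinDeriv D e (D (f j) (f j)) ε x)

namespace GenMetric

variable {C} (A : C.GenMetric)

/-- `κ` is the generalized scalar curvature: the Lichnerowicz formula
`(Dirac_+)² ε = (D^S_-)* D^S_- ε + κ ε` holds for all local sections `ε` of `S_+(V_+)`. Over an
open set `U` with an oriented orthonormal frame `e` of `V_+`, such a section is a smooth map from
`U` to positive chirality spinors. -/
def IsGenScalar (o : ManifoldOrientation M) (D : Sec F E → Sec F E → Sec F E) (κ : M → ℝ) : Prop :=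
  ∀ (U : Set M) (e f : Fin 6 → Sec F E), IsOpen U →
    (∀ x ∈ U, (∀ i, e i x ∈ A.Vplus x) ∧ IsOrtho (C.pair x) (fun i => e i x) ∧
      o.IsPos x (fun i => C.anchor x (e i x))) →
    (∀ x ∈ U, (∀ i, f i x ∈ A.Vminus x) ∧ IsOrtho (-C.pair x) (fun i => f i x)) →
    ∀ ε : M → Spinor, ContMDiffOn (𝓡 6) 𝓘(ℝ, Spinor) ∞ ε U →
      (∀ x ∈ U, chirality *ᵥ ε x = ε x) →
      ∀ x ∈ U, C.diracOp D e (C.diracOp D e ε) x = C.roughLaplacian D e f ε x + κ x • ε x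

/-- The generalized vacuum Einstein equations `GRic = 0`, `GS = 0`, for the canonical Levi-Civita
connection of `A`. -/
def VacuumEinstein (o : ManifoldOrientation M) : Prop :=
  ∃ D : Sec F E → Sec F E → Sec F E, A.IsCanonicalLC D ∧ A.GenRicciFlat D ∧
    A.IsGenScalar o D (fun _ => 0)

/-- `A' = e^B A` for a closed 2-form `B`, where `e^B(e) = e + π*(ι_{π e} B) / 2`. -/
def IsBTransform (A A' : C.GenMetric) : Prop :=
  ∃ B : Form M 2, (∀ (X Y Z : VF M) (x : M), d2 B.1 X Y Z x = 0) ∧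
    ∀ (x : M) (e : E x),
      A'.G x (e + (1 / 2 : ℝ) • C.coanchor x (contract2 (B.1 x) (C.anchor x e))) =
        A.G x e + (1 / 2 : ℝ) • C.coanchor x (contract2 (B.1 x) (C.anchor x (A.G x e)))

end GenMetric

end CourantAlgebroid

end Courant

end GenSugra

end

/-! Geometry of the correspondence. An admissible `V_+` meets the kernel `π*T*M` of the anchor
trivially, so the anchor identifies it with `TM`, and its points are `s v + ½ π* g(v)` for a metric
`g` and an isotropic splitting `s`; the points of `V_-` are the `s v - ½ π* g(v)`. An admissible
generalized metric is therefore the same thing as a pair `(g, s)` (`splitting_add`, `eq_splitting`,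
`genMetric`). Two isotropic splittings differ by `½ π*` of a 2-form `B`, and their 3-forms differ by
`dB` (`exists_isShift`, `IsShift.curv_eq`). Hence the 3-forms that occur are exactly the
representatives of the Ševera class, and for a fixed `(g, H)` the remaining freedom is a closed `B`
(`exists_of_hasClass`, `isBTransform_iff`).

The bracket. The mixed brackets `[X⁻, Y⁺]₊` and `[X⁺, Y⁻]₋` define two metric connections `nabp` and
`nabm` on `TM`. The anchor turns the bracket of `E` into the Lie bracket, so `nabp X Y - nabm Y X =
[X, Y]`: the torsions are opposite, the mean is the Levi-Civita connection, and the difference `K`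
satisfies `g(K(X, Y), Z) = H(X, Y, Z)` (`isLeviCivita`, `two_pair_mid`). Invariance of the pairing
expresses every other component of the bracket through these two connections. The canonical
connection is thereby explicit: on `V_+` it is `∇ + ½ K` in the directions of `V_-` and `∇ + ⅙ K` in
those of `V_+` (`isCanonicalLC_iff`).

The equations. Tracing the mixed curvature gives `GRic(W⁻, Y⁺) = Ric(W, Y) + ½ ∑ η_i (∇_{X_i} H)(W,
Y, X_i) - ¼ (H ∘ H)(W, Y)` (`isGenRicci_iff`). The divergence of a closed self-dual form vanishes
(`div_eq_zero`), so for such forms `GRic = 0` is the Einstein equation. Then `GS = 0` follows: in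
the Lichnerowicz formula the square of the Dirac operator with torsion coefficient `1/6` and the
rough Laplacian with coefficient `1/2` have the same first-order terms, and what remains is built
from `dH`, the divergence of `H`, Clifford squares of `H` and the scalar curvature `¼ |H|²`, all of
which vanish (`lichnerowicz`).

Self-duality is exploited inside the Clifford algebra. If `t` is the Clifford element of a 3-form
and `Γ` the volume element, self-duality reads `t Γ = t`; as `Γ` anticommutes with `t`, it follows
that `t² = 0` (`trivec_sq_eq_zero`). The Dirac operator applied to a closed `H` is a multiple of the
bivector of its divergence, which inherits `δ Γ = δ`, and only the zero bivector satisfies that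
(`biv_eq_zero_of_dual`). The vanishing of `|H|²` comes from the signature, through `∏ η_i = -1`. The
Clifford form and the component form of the star are both translated to one relation on permuted
orthonormal bases, `SelfDual3`.

All operators act on global sections. Bump functions replace local frames and local spinors by
global ones with the same germ, and tensoriality turns expressions in sections into linear maps on
fibres, of which traces can be taken. -/

noncomputable section

namespace GenSugra

set_option linter.unusedSectionVars false


/-! ### Extension of germs and tensoriality -/

section Extension

variable {M : Type*} [TopologicalSpace M] [ChartedSpace R6 M] [IsManifold (𝓡 6) ∞ M] [T2Space M]
  {F : Type*} [NormedAddCommGroup F] [NormedSpace ℝ F] [FiniteDimensional ℝ F]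
  {E : M → Type*} [TopologicalSpace (TotalSpace F E)] [∀ x, TopologicalSpace (E x)]
  [∀ x, AddCommGroup (E x)] [∀ x, Module ℝ (E x)] [FiberBundle F E] [VectorBundle ℝ F E]

/-- Smooth real functions on `M`. -/
abbrev SmoothFun (M : Type*) [TopologicalSpace M] [ChartedSpace R6 M] : Type _ :=
  C^∞⟮𝓡 6, M; 𝓘(ℝ, ℝ), ℝ⟯

/-- The source of the passages from local to global data; the Hausdorff property gives bump
functions whose closed support lies in a prescribed neighbourhood. -/
lemma exists_bump {x : M} {s : Set M} (hs : s ∈ 𝓝 x) :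
    ∃ χ : SmoothFun M, (∀ᶠ y in 𝓝 x, χ y = 1) ∧ tsupport χ ⊆ s := by
  obtain ⟨f, -, hf⟩ := (SmoothBumpFunction.nhds_basis_tsupport (I := 𝓡 6) x).mem_iff.1 hs
  exact ⟨⟨f, f.contMDiff⟩, f.eventuallyEq_one, hf⟩

/-- The product of a smooth function and a smooth section. -/
def fsmul (f : SmoothFun M) (a : Sec F E) : Sec F E :=
  ⟨fun x => f x • a x, f.contMDiff.smul_section a.contMDiff⟩

@[simp] lemma fsmul_apply (f : SmoothFun M) (a : Sec F E) (x : M) : fsmul f a x = f x • a x := rfl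

/-- A locally smooth section agrees near each point with a global one. -/
lemma exists_sec_germ {x : M} {U : Set M} (hU : U ∈ 𝓝 x) {σ : ∀ y, E y}
    (hσ : ContMDiffOn (𝓡 6) ((𝓡 6).prod 𝓘(ℝ, F)) ∞ (fun y => (⟨y, σ y⟩ : TotalSpace F E)) U) :
    ∃ a : Sec F E, ∀ᶠ y in 𝓝 x, a y = σ y := by
  -- The bump lives in the interior of `U`, where `σ` is smooth in the unrestricted sense; off its
  -- support the product is locally zero.
  obtain ⟨χ, h1, h2⟩ := exists_bump (interior_mem_nhds.2 hU)
  refine ⟨⟨fun y => χ y • σ y, fun y => ?_⟩, ?_⟩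
  · by_cases hy : y ∈ tsupport χ
    · exact ContMDiffAt.smul_section (χ.contMDiff y)
        (hσ.contMDiffAt (mem_interior_iff_mem_nhds.1 (h2 hy)))
    · have : ∀ᶠ z in 𝓝 y, χ z = 0 := by
        filter_upwards [(isClosed_tsupport χ).isOpen_compl.mem_nhds hy] with z hz
        exact image_eq_zero_of_notMem_tsupport hz
      have h0 : ContMDiffAt (𝓡 6) ((𝓡 6).prod 𝓘(ℝ, F)) ∞
          (fun y => (⟨y, 0⟩ : TotalSpace F E)) y := (0 : Sec F E).contMDiff y
      refine h0.congr_of_eventuallyEq ?_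
      filter_upwards [this] with z hz
      simp [hz]
  · filter_upwards [h1] with y hy
    change χ y • σ y = σ y
    rw [hy, one_smul]

lemma exists_fun_germ {V : Type*} [NormedAddCommGroup V] [NormedSpace ℝ V] {x : M} {U : Set M}
    (hU : U ∈ 𝓝 x) {f : M → V} (hf : ContMDiffOn (𝓡 6) 𝓘(ℝ, V) ∞ f U) :
    ∃ f' : M → V, ContMDiff (𝓡 6) 𝓘(ℝ, V) ∞ f' ∧ ∀ᶠ y in 𝓝 x, f' y = f y := by
  obtain ⟨χ, h1, h2⟩ := exists_bump (interior_mem_nhds.2 hU)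
  refine ⟨fun y => χ y • f y, fun y => ?_, ?_⟩
  · by_cases hy : y ∈ tsupport χ
    · exact (χ.contMDiff y).smul (hf.contMDiffAt (mem_interior_iff_mem_nhds.1 (h2 hy)))
    · have : ∀ᶠ z in 𝓝 y, χ z = 0 := by
        filter_upwards [(isClosed_tsupport χ).isOpen_compl.mem_nhds hy] with z hz
        exact image_eq_zero_of_notMem_tsupport hz
      refine (contMDiffAt_const (c := (0 : V))).congr_of_eventuallyEq ?_
      filter_upwards [this] with z hz
      simp [hz]
  · filter_upwards [h1] with y hy
    rw [hy, one_smul]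

lemma exists_smoothFun_germ {x : M} {U : Set M}
    (hU : U ∈ 𝓝 x) {f : M → ℝ} (hf : ContMDiffOn (𝓡 6) 𝓘(ℝ, ℝ) ∞ f U) :
    ∃ f' : SmoothFun M, ∀ᶠ y in 𝓝 x, f' y = f y := by
  obtain ⟨f', h, h'⟩ := exists_fun_germ hU hf
  exact ⟨⟨f', h⟩, h'⟩

section Tensorial

variable {V : Type*} [AddCommGroup V] [Module ℝ V] {x : M} {T : Sec F E → V}

/-- Multiplying both sections by a bump function that equals 1 at `x` and is supported where they
agree makes them equal, without changing the value of `T`. -/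
lemma tensorial_germ (hs : ∀ (f : SmoothFun M) (a : Sec F E), T (fsmul f a) = f x • T a)
    {a b : Sec F E} (h : ∀ᶠ y in 𝓝 x, a y = b y) : T a = T b := by
  obtain ⟨χ, h1, h2⟩ := exists_bump h
  have : fsmul χ a = fsmul χ b := by
    ext y
    by_cases hy : y ∈ tsupport χ
    · have : a y = b y := h2 hy
      simp [this]
    · simp [image_eq_zero_of_notMem_tsupport hy]
  have hx := h1.self_of_nhds
  calc T a = T (fsmul χ a) := by rw [hs, hx, one_smul]
    _ = T b := by rw [this, hs, hx, one_smul]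

variable [ContMDiffVectorBundle ∞ F E (𝓡 6)]

variable (F) in
/-- Every smooth section is near `x` a combination of finitely many global sections, with
coefficients whose values at `x` depend linearly on the value of the section at `x`. -/
lemma exists_global_frame (x : M) : ∃ (n : ℕ) (s : Fin n → Sec F E) (c : Fin n → E x →ₗ[ℝ] ℝ),
    ∀ a : Sec F E, ∃ f : Fin n → SmoothFun M, (∀ i, f i x = c i (a x)) ∧
      ∀ᶠ y in 𝓝 x, a y = ∑ i, f i y • s i y := by
  have : ContMDiffVectorBundle 1 F E (𝓡 6) := ContMDiffVectorBundle.of_le (n := ∞) (by simp)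
  let t := trivializationAt F E x
  have ht : t.baseSet ∈ 𝓝 x :=
    t.open_baseSet.mem_nhds (FiberBundle.mem_baseSet_trivializationAt F E x)
  have hx : x ∈ t.baseSet := FiberBundle.mem_baseSet_trivializationAt F E x
  let b := Module.finBasis ℝ F
  have hs := fun i => exists_sec_germ (E := E) ht (t.contMDiffOn_localFrame_baseSet (I := 𝓡 6) ∞ b i)
  choose s hs using hs
  refine ⟨_, s, fun i => t.localFrameCoeff (𝓡 6) b i x, fun a => ?_⟩
  have hf := fun i => exists_smoothFun_germ ht
    (contMDiffOn_baseSet_localFrameCoeff (I := 𝓡 6) (e := t) b a.contMDiff.contMDiffOn i)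
  choose f hf using hf
  refine ⟨f, fun i => (hf i).self_of_nhds, ?_⟩
  filter_upwards [eventually_all.2 hs, eventually_all.2 hf, ht] with y h1 h2 hy
  simp only [h1, h2]
  exact t.eq_sum_localFrameCoeff_smul (I := 𝓡 6) (b := b) (s := fun y => a y) hy

/-- In a frame near `x` the value of `T` is `∑ c_i(a x) T(s_i)`, which involves only the value of
the section at `x`. -/
lemma tensorial_congr (ha : ∀ a b, T (a + b) = T a + T b)
    (hs : ∀ (f : SmoothFun M) (a : Sec F E), T (fsmul f a) = f x • T a)
    {a b : Sec F E} (h : a x = b x) : T a = T b := by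
  obtain ⟨n, s, c, hc⟩ := exists_global_frame (E := E) F x
  have h0 : T 0 = 0 := by simpa using ha 0 0
  have hsum : ∀ g : Fin n → Sec F E, T (∑ i, g i) = ∑ i, T (g i) := fun g => by
    exact map_sum (AddMonoidHom.mk' T ha) g Finset.univ
  have key : ∀ a : Sec F E, T a = ∑ i, c i (a x) • T (s i) := fun a => by
    obtain ⟨f, hf, hf'⟩ := hc a
    rw [tensorial_germ hs (b := ∑ i, fsmul (f i) (s i)), hsum]
    · simp [hs, hf]
    · filter_upwards [hf'] with y hy
      rw [hy]
      have : ∀ (S : Finset (Fin n)) (g : Fin n → Sec F E), (∑ i ∈ S, g i) y = ∑ i ∈ S, g i y :=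
        fun S g => map_sum (ContMDiffSection.coeAddHom (𝓡 6) F ∞ E |> fun φ =>
          (Pi.evalAddMonoidHom (fun y => E y) y).comp φ) g S
      rw [this]; rfl
  rw [key, key, h]

variable (F) in
lemma exists_sec_eq (v : E x) : ∃ a : Sec F E, a x = v := by
  obtain ⟨U, hU, h⟩ := FiberBundle.exists_contMDiffOn_extend (k := ∞) (𝓡 6) F v
  obtain ⟨a, ha⟩ := exists_sec_germ hU h
  exact ⟨a, by rw [ha.self_of_nhds]; exact FiberBundle.extend_apply_self F v⟩

/-- The linear map applies `T` to an arbitrary extension of a vector; tensoriality makes the choice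
irrelevant. Every trace over a fibre below is taken of such a map. -/
lemma exists_linear_of_tensorial (ha : ∀ a b, T (a + b) = T a + T b)
    (hs : ∀ (f : SmoothFun M) (a : Sec F E), T (fsmul f a) = f x • T a) :
    ∃ L : E x →ₗ[ℝ] V, ∀ a, L (a x) = T a := by
  choose e he using fun v : E x => exists_sec_eq (x := x) F v
  refine ⟨⟨⟨fun v => T (e v), fun v w => ?_⟩, fun r v => ?_⟩, fun a => ?_⟩
  · rw [← ha]; exact tensorial_congr ha hs (by simp [he])
  -- Homogeneity over the reals is homogeneity under the constant function `r`.
  · have := hs ⟨fun _ => r, contMDiff_const⟩ (e v)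
    change T _ = r • T _ at this
    simp only [RingHom.id_apply]
    rw [← this]
    exact tensorial_congr ha hs ((he _).trans (congrArg (r • ·) (he v)).symm)
  · exact tensorial_congr ha hs (he _)

end Tensorial

end Extension


/-! ### Derivatives along vector fields and the Lie bracket -/

section Calculus

variable {M : Type*} [TopologicalSpace M] [ChartedSpace R6 M] [IsManifold (𝓡 6) ∞ M] [T2Space M]
  {V : Type*} [NormedAddCommGroup V] [NormedSpace ℝ V]
  {W : Type*} [NormedAddCommGroup W] [NormedSpace ℝ W]

/-- Smooth vector-valued functions on `M`. -/
abbrev SmoothMap (M : Type*) [TopologicalSpace M] [ChartedSpace R6 M] (V : Type*)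
    [NormedAddCommGroup V] [NormedSpace ℝ V] : Type _ :=
  C^∞⟮𝓡 6, M; 𝓘(ℝ, V), V⟯

lemma smoothMap_mdiff (f : SmoothMap M V) (x : M) : MDifferentiableAt (𝓡 6) 𝓘(ℝ, V) f x :=
  f.contMDiff.mdifferentiable (by simp) x

lemma contMDiff_mfderiv_apply {f : M → V} (hf : ContMDiff (𝓡 6) 𝓘(ℝ, V) ∞ f) (X : VF M) :
    ContMDiff (𝓡 6) 𝓘(ℝ, V) ∞ (fun x => (mfderiv (𝓡 6) 𝓘(ℝ, V) f x (X x) : V)) := by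
  have : IsManifold (𝓡 6) 1 M := IsManifold.of_le (n := ∞) (by simp)
  have h1 := hf.contMDiff_tangentMap (m := ∞) (by simp)
  have h2 := h1.comp X.contMDiff
  exact (contMDiff_snd_tangentBundle_modelSpace V 𝓘(ℝ, V)).comp h2

/-- The derivative of a smooth function along a vector field. -/
def der (X : VF M) (f : SmoothMap M V) : SmoothMap M V :=
  ⟨fun x => (mfderiv (𝓡 6) 𝓘(ℝ, V) f x (X x) : V), contMDiff_mfderiv_apply f.contMDiff X⟩

lemma der_apply (X : VF M) (f : SmoothMap M V) (x : M) :
    der X f x = mfderiv (𝓡 6) 𝓘(ℝ, V) f x (X x) := rfl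

lemma dFun_eq_der (X : VF M) (f : SmoothFun M) (x : M) : dFun f x (X x) = der X f x := rfl

lemma der_add_left (X Y : VF M) (f : SmoothMap M V) : der (X + Y) f = der X f + der Y f := by
  ext x
  exact map_add (mfderiv (𝓡 6) 𝓘(ℝ, V) f x) (X x) (Y x)

lemma der_fsmul_left (h : SmoothFun M) (X : VF M) (f : SmoothMap M V) (x : M) :
    der (fsmul h X) f x = h x • der X f x :=
  map_smul (mfderiv (𝓡 6) 𝓘(ℝ, V) f x) (h x) (X x)

lemma der_congr {X Y : VF M} {f h : SmoothMap M V} {x : M} (hX : X x = Y x)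
    (hf : ∀ᶠ y in 𝓝 x, f y = h y) : der X f x = der Y h x := by
  rw [der_apply, der_apply, hX, Filter.EventuallyEq.mfderiv_eq (f₁ := f) (f := h) hf]
  rfl

lemma der_add (X : VF M) (f h : SmoothMap M V) : der X (f + h) = der X f + der X h := by
  ext x
  exact congrArg (fun L => L (X x)) (mfderiv_add (smoothMap_mdiff f x) (smoothMap_mdiff h x))

lemma der_smul (X : VF M) (r : ℝ) (f : SmoothMap M V) : der X (r • f) = r • der X f := by
  ext x
  exact congrArg (fun L => L (X x)) (const_smul_mfderiv (smoothMap_mdiff f x) r)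

lemma der_neg (X : VF M) (f : SmoothMap M V) : der X (-f) = -der X f := by
  have := der_smul X (-1) f
  simpa using this

lemma der_sub (X : VF M) (f h : SmoothMap M V) : der X (f - h) = der X f - der X h := by
  rw [sub_eq_add_neg, der_add, der_neg, sub_eq_add_neg]

lemma der_clm (X : VF M) (L : V →L[ℝ] W) (f : SmoothMap M V) (f' : SmoothMap M W)
    (h : ∀ x, f' x = L (f x)) (x : M) : der X f' x = L (der X f x) := by
  have h1 : (f' : M → W) = L ∘ f := funext h
  have h2 := mfderiv_comp x (I'' := 𝓘(ℝ, W)) (g := L)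
    (L.differentiableAt.mdifferentiableAt) (smoothMap_mdiff f x)
  rw [der_apply, h1, h2]
  change (mfderiv 𝓘(ℝ, V) 𝓘(ℝ, W) L (f x)) (der X f x) = _
  rw [mfderiv_eq_fderiv, L.fderiv]
  rfl

lemma der_smulFun (X : VF M) (f : SmoothFun M) (h k : SmoothMap M V)
    (hk : ∀ x, k x = f x • h x) (x : M) :
    der X k x = der X f x • h x + f x • der X h x := by
  have h1 : (k : M → V) = (f : M → ℝ) • (h : M → V) := funext hk
  have h2 := congrArg (fun L => L (X x))
    (mvfderiv_smul (smoothMap_mdiff f x) (smoothMap_mdiff h x))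
  rw [der_apply, h1, add_comm]
  exact h2

lemma der_mul (X : VF M) (f h : SmoothFun M) : der X (f * h) = der X f * h + f * der X h := by
  ext x
  exact der_smulFun X f h (f * h) (fun _ => rfl) x

lemma der_const (X : VF M) (c : V) (f : SmoothMap M V) (x : M) (hf : ∀ᶠ y in 𝓝 x, f y = c) :
    der X f x = 0 := by
  have h : (f : M → V) =ᶠ[𝓝 x] fun _ => c := hf
  rw [der_apply, h.mfderiv_eq, mfderiv_const]
  rfl

/-- The Lie bracket of vector fields. -/
def lie (X Y : VF M) : VF M :=
  ⟨fun x => lieAt X Y x, fun x => by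
    have : IsManifold (𝓡 6) (minSmoothness ℝ 2) M :=
      IsManifold.of_le (n := ∞) (by simp only [minSmoothness_of_isRCLikeNormedField]; exact ENat.LEInfty.out)
    have : IsManifold (𝓡 6) ((((⊤ : ℕ∞) : WithTop ℕ∞)) + 1) M := IsManifold.of_le (n := ∞) (by simp)
    exact (X.contMDiff x).mlieBracket_vectorField (Y.contMDiff x) (by simp)⟩

lemma lie_apply (X Y : VF M) (x : M) : lie X Y x = lieAt X Y x := rfl

lemma vf_mdiff (X : VF M) (x : M) :
    MDifferentiableAt (𝓡 6) (𝓡 6).tangent (fun y => (⟨y, X y⟩ : TangentBundle (𝓡 6) M)) x :=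
  X.contMDiff.mdifferentiable (by simp) x

lemma lie_skew (X Y : VF M) : lie X Y = -lie Y X := by
  ext x
  exact VectorField.mlieBracket_swap_apply

lemma lie_add_right (X Y Z : VF M) : lie X (Y + Z) = lie X Y + lie X Z := by
  have : IsManifold (𝓡 6) 2 M := IsManifold.of_le (n := ∞) ENat.LEInfty.out
  ext x
  exact VectorField.mlieBracket_add_right (vf_mdiff Y x) (vf_mdiff Z x)

lemma lie_fsmul_right (X Y : VF M) (f : SmoothFun M) :
    lie X (fsmul f Y) = fsmul (der X f) Y + fsmul f (lie X Y) := by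
  have : IsManifold (𝓡 6) 2 M := IsManifold.of_le (n := ∞) ENat.LEInfty.out
  ext x
  exact VectorField.mlieBracket_smul_right (smoothMap_mdiff f x) (vf_mdiff Y x)

lemma lie_jacobi (X Y Z : VF M) : lie X (lie Y Z) = lie (lie X Y) Z + lie Y (lie X Z) := by
  have : IsManifold (𝓡 6) (minSmoothness ℝ 3) M :=
    IsManifold.of_le (n := ∞) (by simp only [minSmoothness_of_isRCLikeNormedField]; exact ENat.LEInfty.out)
  have h : ∀ X : VF M, ∀ x, ContMDiffAt (𝓡 6) (𝓡 6).tangent (minSmoothness ℝ 2)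
    (fun y => (⟨y, X y⟩ : TangentBundle (𝓡 6) M)) x := fun X x => (X.contMDiff x).of_le (by simp only [minSmoothness_of_isRCLikeNormedField]; exact ENat.LEInfty.out)
  ext x
  exact VectorField.leibniz_identity_mlieBracket_apply (h X x) (h Y x) (h Z x)

lemma lie_zero_right (X : VF M) : lie X 0 = 0 := by
  have := lie_add_right X 0 0
  simpa using this

variable (M) in
lemma exists_vf_eq {x : M} (v : TangentSpace (𝓡 6) x) : ∃ X : VF M, X x = v :=
  exists_sec_eq (E := fun x : M => TangentSpace (𝓡 6) x) R6 v

/-- The bracket of vector fields is the commutator of derivations. -/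
lemma der_lie_fun (X Y : VF M) (f : SmoothFun M) :
    der (lie X Y) f = der X (der Y f) - der Y (der X f) := by
  ext x
  -- The Jacobi identity for `X`, `Y`, `fZ`, minus `f` times the one for `X`, `Y`, `Z`, leaves `(XYf
  -- - YXf - [X, Y]f) Z = 0`; a `Z` that does not vanish at `x` lets the factor be removed.
  obtain ⟨Z, hZ⟩ := exists_vf_eq M (x := x) (EuclideanSpace.single (0 : Fin 6) (1 : ℝ))
  have hZ0 : Z x ≠ 0 := by
    rw [hZ]
    intro h
    have := congrFun (congrArg (WithLp.ofLp) (show EuclideanSpace.single (0 : Fin 6) (1 : ℝ) = 0 from h)) 0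
    simp at this
  have h := lie_jacobi X Y (fsmul f Z)
  simp only [lie_fsmul_right, lie_add_right] at h
  have hx := congrArg (fun Z : VF M => Z x) h
  have e := congrArg (fun Z : VF M => Z x) (lie_jacobi X Y Z)
  simp only [ContMDiffSection.coe_add, Pi.add_apply, fsmul_apply] at hx e
  rw [e] at hx
  have : (der X (der Y f) x - der Y (der X f) x - der (lie X Y) f x) • Z x = 0 := by
    rw [sub_smul, sub_smul]
    rw [smul_add] at hx
    rw [sub_sub, sub_eq_zero]
    refine add_right_cancel (b := (der Y f) x • (lie X Z) x + ((der X f) x • (lie Y Z) x +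
      (f x • (lie (lie X Y) Z) x + f x • (lie Y (lie X Z)) x))) ?_
    rw [← add_assoc, hx]
    abel
  rcases smul_eq_zero.1 this with h | h
  · change _ = der X (der Y f) x - der Y (der X f) x
    linarith
  · exact absurd h hZ0

/-- Continuous functionals separate points and commute with differentiation, which reduces the
vector-valued case to the scalar one. -/
lemma der_lie (X Y : VF M) (f : SmoothMap M V) :
    der (lie X Y) f = der X (der Y f) - der Y (der X f) := by
  ext x
  refine (SeparatingDual.eq_iff_forall_dual_eq (R := ℝ)).2 fun L => ?_
  let l : SmoothMap M V → SmoothFun M := fun h =>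
    ⟨fun y => L (h y), L.contMDiff.comp h.contMDiff⟩
  have hl : ∀ (Z : VF M) (h : SmoothMap M V), der Z (l h) = l (der Z h) := fun Z h => by
    ext y
    exact der_clm Z L h (l h) (fun _ => rfl) y
  have := congrArg (fun h : SmoothFun M => h x) (der_lie_fun X Y (l f))
  simp only [hl] at this
  change L _ = L (der X (der Y f) x - der Y (der X f) x)
  rw [map_sub]
  exact this

end Calculus


/-! ### Alternating forms as multilinear maps -/

section Trilinear

variable {V : Type*} [AddCommGroup V] [Module ℝ V]

/-- An alternating 3-form as a trilinear map. -/
def tri (θ : V [⋀^Fin 3]→ₗ[ℝ] ℝ) : V →ₗ[ℝ] V →ₗ[ℝ] V →ₗ[ℝ] ℝ :=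
  LinearMap.mk₂ ℝ (fun a b => (AlternatingMap.ofSubsingleton ℝ V ℝ (0 : Fin 1)).symm
    ((θ.curryLeft a).curryLeft b))
    (fun a a' b => by ext c; simp) (fun r a b => by ext c; simp)
    (fun a b b' => by ext c; simp) (fun r a b => by ext c; simp)

lemma tri_apply (θ : V [⋀^Fin 3]→ₗ[ℝ] ℝ) (a b c : V) : tri θ a b c = θ ![a, b, c] := by
  simp only [tri, LinearMap.mk₂_apply]
  change θ _ = θ _
  congr 1
  funext i
  fin_cases i <;> rfl

lemma tri_skew12 (θ : V [⋀^Fin 3]→ₗ[ℝ] ℝ) (a b c : V) : tri θ a b c = -tri θ b a c := by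
  rw [tri_apply, tri_apply, ← θ.map_swap ![b, a, c] (show (0 : Fin 3) ≠ 1 by decide)]
  congr 1
  funext i
  fin_cases i <;> rfl

lemma tri_skew23 (θ : V [⋀^Fin 3]→ₗ[ℝ] ℝ) (a b c : V) : tri θ a b c = -tri θ a c b := by
  rw [tri_apply, tri_apply, ← θ.map_swap ![a, c, b] (show (1 : Fin 3) ≠ 2 by decide)]
  congr 1
  funext i
  fin_cases i <;> rfl

/-- An alternating 2-form as a bilinear map. -/
def bil (θ : V [⋀^Fin 2]→ₗ[ℝ] ℝ) : V →ₗ[ℝ] V →ₗ[ℝ] ℝ :=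
  LinearMap.mk₂ ℝ (fun a b => θ ![a, b])
    (fun a a' b => by have := (θ.curryLeft.map_add a a'); exact congrArg (fun l => l ![b]) this)
    (fun r a b => by have := (θ.curryLeft.map_smul r a); exact congrArg (fun l => l ![b]) this)
    (fun a b b' => by
      have := ((θ.curryLeft a).curryLeft.map_add b b'); exact congrArg (fun l => l ![]) this)
    (fun r a b => by
      have := ((θ.curryLeft a).curryLeft.map_smul r b); exact congrArg (fun l => l ![]) this)

lemma bil_apply (θ : V [⋀^Fin 2]→ₗ[ℝ] ℝ) (a b : V) : bil θ a b = θ ![a, b] := rfl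

lemma bil_skew (θ : V [⋀^Fin 2]→ₗ[ℝ] ℝ) (a b : V) : bil θ a b = -bil θ b a := by
  rw [bil_apply, bil_apply, ← θ.map_swap ![b, a] (show (0 : Fin 2) ≠ 1 by decide)]
  congr 1
  funext i
  fin_cases i <;> rfl

lemma contract2_apply (θ : V [⋀^Fin 2]→ₗ[ℝ] ℝ) (a b : V) : contract2 θ a b = bil θ a b := by
  change θ _ = θ _
  congr 1
  funext i
  fin_cases i <;> rfl

end Trilinear

/-! ### Metrics, forms and the uniqueness of the Levi-Civita connection -/

section Classical

variable {M : Type*} [TopologicalSpace M] [ChartedSpace R6 M] [IsManifold (𝓡 6) ∞ M]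

/-- The function `g(X, Y)`. -/
def LorentzMetric.fn (g : LorentzMetric M) (X Y : VF M) : SmoothFun M :=
  ⟨fun x => g.val x (X x) (Y x), g.smooth' X Y⟩

lemma LorentzMetric.fn_apply (g : LorentzMetric M) (X Y : VF M) (x : M) :
    g.fn X Y x = g.val x (X x) (Y x) := rfl

lemma form3_vec (H : Form M 3) (X Y Z : VF M) (x : M) :
    H.1 x (fun i => (![X, Y, Z] : Fin 3 → VF M) i x) = H.1 x ![X x, Y x, Z x] := by
  congr 1; funext i; fin_cases i <;> rfl

/-- The function `H(X, Y, Z)`. -/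
def fn3 (H : Form M 3) (X Y Z : VF M) : SmoothFun M :=
  ⟨fun x => tri (H.1 x) (X x) (Y x) (Z x), by
    have h := H.2 ![X, Y, Z]
    refine h.congr fun x => ?_
    rw [form3_vec, tri_apply]⟩

lemma fn3_apply (H : Form M 3) (X Y Z : VF M) (x : M) :
    fn3 H X Y Z x = tri (H.1 x) (X x) (Y x) (Z x) := rfl

/-- The function `B(X, Y)`. -/
def fn2 (B : Form M 2) (X Y : VF M) : SmoothFun M :=
  ⟨fun x => bil (B.1 x) (X x) (Y x), by
    have h := B.2 ![X, Y]
    refine h.congr fun x => ?_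
    rw [bil_apply]
    congr 1; funext i; fin_cases i <;> rfl⟩

lemma fn2_apply (B : Form M 2) (X Y : VF M) (x : M) :
    fn2 B X Y x = bil (B.1 x) (X x) (Y x) := rfl

lemma LorentzMetric.eq_of_inner (g : LorentzMetric M) {x : M} {u v : TangentSpace (𝓡 6) x}
    (h : ∀ w, g.val x u w = g.val x v w) : u = v := by
  obtain ⟨b, hb⟩ := g.signature' x
  refine b.ext_elem fun i => ?_
  have hb' : ∀ i j, g.val x (b i) (b j) = if i = j then eta i else 0 := hb
  have key : ∀ u, g.val x u (b i) = b.repr u i * eta i := fun u => by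
    conv_lhs => rw [← b.sum_repr u]
    simp only [map_sum, map_smul, LinearMap.sum_apply, LinearMap.smul_apply, hb', smul_eq_mul]
    simp
  have := h (b i)
  rw [key, key] at this
  exact mul_right_cancel₀ (by fin_cases i <;> simp [eta]) this

variable [T2Space M]

lemma LorentzMetric.vf_ext (g : LorentzMetric M) {X Y : VF M}
    (h : ∀ Z, g.fn X Z = g.fn Y Z) : X = Y := by
  ext x
  refine g.eq_of_inner fun w => ?_
  obtain ⟨Z, rfl⟩ := exists_vf_eq M w
  exact congrArg (fun f : SmoothFun M => f x) (h Z)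

lemma d3_eq (H : Form M 3) (W X Y Z : VF M) (x : M) : d3 H.1 W X Y Z x =
    der W (fn3 H X Y Z) x - der X (fn3 H W Y Z) x + der Y (fn3 H W X Z) x - der Z (fn3 H W X Y) x
    - fn3 H (lie W X) Y Z x + fn3 H (lie W Y) X Z x - fn3 H (lie W Z) X Y x
    - fn3 H (lie X Y) W Z x + fn3 H (lie X Z) W Y x - fn3 H (lie Y Z) W X x := by
  simp only [d3, ← tri_apply, fn3_apply, lie_apply]
  rfl

lemma d2_eq (B : Form M 2) (X Y Z : VF M) (x : M) : d2 B.1 X Y Z x =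
    der X (fn2 B Y Z) x - der Y (fn2 B X Z) x + der Z (fn2 B X Y) x
    - fn2 B (lie X Y) Z x + fn2 B (lie X Z) Y x - fn2 B (lie Y Z) X x := by
  have h : ∀ A C : VF M, (fun y => B.1 y ![A y, C y]) = fn2 B A C := fun A C => rfl
  simp only [d2, h, dFun_eq_der, fn2_apply, lie_apply, bil_apply]

namespace IsLeviCivita

variable {g : LorentzMetric M} {nab : VF M → VF M → VF M} (hn : IsLeviCivita g nab)
include hn

lemma fsmul_left (f : SmoothFun M) (X Y : VF M) : nab (fsmul f X) Y = fsmul f (nab X Y) := by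
  ext x
  exact hn.smul_left f X _ Y (fun _ => rfl) x

lemma fsmul_right (f : SmoothFun M) (X Y : VF M) :
    nab X (fsmul f Y) = fsmul (der X f) Y + fsmul f (nab X Y) := by
  ext x
  exact hn.leibniz f X Y _ (fun _ => rfl) x

lemma zero_left (Y : VF M) : nab 0 Y = 0 := by simpa using hn.add_left 0 0 Y

lemma zero_right (X : VF M) : nab X 0 = 0 := by simpa using hn.add_right X 0 0

lemma neg_left (X Y : VF M) : nab (-X) Y = -nab X Y := by
  have := hn.add_left X (-X) Y
  rw [add_neg_cancel, hn.zero_left] at this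
  exact (neg_eq_of_add_eq_zero_right this.symm).symm

lemma neg_right (X Y : VF M) : nab X (-Y) = -nab X Y := by
  have := hn.add_right X Y (-Y)
  rw [add_neg_cancel, hn.zero_right] at this
  exact (neg_eq_of_add_eq_zero_right this.symm).symm

lemma sub_left (X X' Y : VF M) : nab (X - X') Y = nab X Y - nab X' Y := by
  rw [sub_eq_add_neg, hn.add_left, hn.neg_left, sub_eq_add_neg]

lemma sub_right (X Y Y' : VF M) : nab X (Y - Y') = nab X Y - nab X Y' := by
  rw [sub_eq_add_neg, hn.add_right, hn.neg_right, sub_eq_add_neg]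

lemma torsion (X Y : VF M) : nab X Y - nab Y X = lie X Y := by
  ext x
  exact hn.torsion_free X Y x

lemma der_metric (X Y Z : VF M) : der X (g.fn Y Z) = g.fn (nab X Y) Z + g.fn Y (nab X Z) := by
  ext x
  exact hn.metric X Y Z x

/-- Locality in the differentiated argument: if `Z` vanishes near `x` and `χ` is a bump supported
there, the Leibniz rule for `χ Z = 0` at `x` leaves only `nab X Z x`. -/
lemma congr_right (X : VF M) {Y Y' : VF M} {x : M} (h : ∀ᶠ y in 𝓝 x, Y y = Y' y) :
    nab X Y x = nab X Y' x := by
  have h0 : ∀ Z : VF M, (∀ᶠ y in 𝓝 x, Z y = 0) → nab X Z x = 0 := fun Z hZ => by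
    obtain ⟨χ, h1, h2⟩ := exists_bump hZ
    have : fsmul χ Z = 0 := by
      ext y
      by_cases hy : y ∈ tsupport χ
      · have : Z y = 0 := h2 hy
        simp [this]
      · simp [image_eq_zero_of_notMem_tsupport hy]
    have h3 := hn.fsmul_right χ X Z
    rw [this, hn.zero_right] at h3
    have h4 := congrArg (fun Z : VF M => Z x) h3
    simp only [ContMDiffSection.coe_add, ContMDiffSection.coe_zero, Pi.add_apply, Pi.zero_apply,
      fsmul_apply, hZ.self_of_nhds, h1.self_of_nhds, smul_zero, zero_add, one_smul] at h4
    exact h4.symm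
  have := h0 (Y - Y') (h.mono fun y hy => by
    rw [ContMDiffSection.coe_sub, Pi.sub_apply, hy, sub_self])
  rw [hn.sub_right, ContMDiffSection.coe_sub, Pi.sub_apply, sub_eq_zero] at this
  exact this

end IsLeviCivita

lemma LorentzMetric.fn_symm (g : LorentzMetric M) (X Y : VF M) : g.fn X Y = g.fn Y X := by
  ext x
  exact g.symm' x _ _

/-- The difference of two such connections is symmetric in its two arguments because the torsions
agree, and skew for `g` because both are metric. A trilinear form symmetric in one pair of slots and
skew in another vanishes. -/
lemma IsLeviCivita.unique {g : LorentzMetric M} {nab nab' : VF M → VF M → VF M}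
    (hn : IsLeviCivita g nab) (hn' : IsLeviCivita g nab') : nab = nab' := by
  funext X Y
  have hs : ∀ X Y x, nab X Y x - nab' X Y x = nab Y X x - nab' Y X x := fun X Y x => by
    have h1 := hn.torsion_free X Y x
    have h2 := hn'.torsion_free X Y x
    rw [← h2, sub_eq_sub_iff_add_eq_add] at h1
    rw [sub_eq_sub_iff_add_eq_add, h1]
    abel
  have hk : ∀ X Y Z x, g.val x (nab X Y x - nab' X Y x) (Z x) =
      - g.val x (nab X Z x - nab' X Z x) (Y x) := fun X Y Z x => by
    have h1 := hn.metric X Y Z x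
    have h2 := hn'.metric X Y Z x
    rw [h1] at h2
    rw [g.symm' x (Y x) (nab X Z x), g.symm' x (Y x) (nab' X Z x)] at h2
    simp only [map_sub, LinearMap.sub_apply]
    linarith
  refine g.vf_ext fun Z => ?_
  ext x
  have h1 := hk X Y Z x
  have h2 := hk Z X Y x
  have h3 := hk Y Z X x
  rw [hs Z X x] at h2
  rw [hs Y Z x] at h3
  rw [hs Y X x] at h3
  simp only [map_sub, LinearMap.sub_apply, LorentzMetric.fn_apply] at *
  linarith

end Classical


/-! ### Orthonormal bases and traces -/

section Trace

variable {V : Type*} [AddCommGroup V] [Module ℝ V] {B : LinearMap.BilinForm ℝ V}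
  {b : Module.Basis (Fin 6) ℝ V}

lemma eta_mul_self (i : Fin 6) : eta i * eta i = 1 := by fin_cases i <;> simp [eta]

lemma eta_ne_zero (i : Fin 6) : eta i ≠ 0 := by fin_cases i <;> simp [eta]

lemma IsOrtho.repr_left (hb : IsOrtho B b) (u : V) (i : Fin 6) :
    b.repr u i = eta i * B u (b i) := by
  have hb' : ∀ i j, B (b i) (b j) = if i = j then eta i else 0 := hb
  conv_rhs => rw [← b.sum_repr u]
  simp only [map_sum, map_smul, LinearMap.sum_apply, LinearMap.smul_apply, hb', smul_eq_mul]
  simp only [mul_ite, mul_zero, Finset.sum_ite_eq', Finset.mem_univ, if_true]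
  rw [mul_left_comm, eta_mul_self, mul_one]

lemma IsOrtho.expand (hb : IsOrtho B b) (u : V) : u = ∑ i, (eta i * B u (b i)) • b i := by
  conv_lhs => rw [← b.sum_repr u]
  simp only [hb.repr_left]

lemma IsOrtho.trace_eq (hb : IsOrtho B b) (L : V →ₗ[ℝ] V) :
    LinearMap.trace ℝ V L = ∑ i, eta i * B (L (b i)) (b i) := by
  rw [LinearMap.trace_eq_matrix_trace ℝ b, Matrix.trace]
  simp only [Matrix.diag_apply, LinearMap.toMatrix_apply, hb.repr_left]

/-- An orthonormal 6-tuple is linearly independent. -/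
lemma IsOrtho.linearIndependent {v : Fin 6 → V} (hv : IsOrtho B v) : LinearIndependent ℝ v := by
  rw [Fintype.linearIndependent_iff]
  intro c hc i
  have h := congrArg (fun u => B u (v i)) hc
  have hv' : ∀ i j, B (v i) (v j) = if i = j then eta i else 0 := hv
  simp only [map_sum, map_smul, LinearMap.sum_apply, LinearMap.smul_apply, hv', smul_eq_mul,
    mul_ite, mul_zero, Finset.sum_ite_eq', Finset.mem_univ, if_true, map_zero,
    LinearMap.zero_apply] at h
  exact (mul_eq_zero.1 h).resolve_right (eta_ne_zero i)

/-- The trace of a bilinear map over an orthonormal basis does not depend on the basis. -/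
lemma IsOrtho.sum_bilin_eq {W : Type*} [AddCommGroup W] [Module ℝ W] (hb : IsOrtho B b)
    (hB : ∀ u v, B u v = B v u)
    {c : Module.Basis (Fin 6) ℝ V} (hc : IsOrtho B c) (P : V →ₗ[ℝ] V →ₗ[ℝ] W) :
    ∑ i, eta i • P (b i) (b i) = ∑ i, eta i • P (c i) (c i) := by
  have hc' : ∀ i j, B (c i) (c j) = if i = j then eta i else 0 := hc
  -- The change of basis between two orthonormal bases preserves the inverse metric, hence any trace
  -- taken with it.
  have key : ∀ k l, ∑ i, eta i * ((eta k * B (b i) (c k)) * (eta l * B (b i) (c l)))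
      = if k = l then eta k else 0 := fun k l => by
    have h1 : B (c k) (c l) = ∑ i, eta i * B (c k) (b i) * B (b i) (c l) := by
      conv_lhs => rw [hb.expand (c k)]
      simp only [map_sum, map_smul, LinearMap.sum_apply, LinearMap.smul_apply, smul_eq_mul]
    have h2 : ∑ i, eta i * ((eta k * B (b i) (c k)) * (eta l * B (b i) (c l)))
        = eta k * eta l * B (c k) (c l) := by
      rw [h1, Finset.mul_sum]
      exact Finset.sum_congr rfl fun i _ => by rw [hB (b i) (c k)]; ring
    rw [h2, hc' k l]
    split_ifs with h
    · rw [h, eta_mul_self, one_mul]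
    · rw [mul_zero]
  have h3 : ∀ i, eta i • P (b i) (b i) = ∑ k, ∑ l,
      (eta i * ((eta k * B (b i) (c k)) * (eta l * B (b i) (c l)))) • P (c k) (c l) := fun i => by
    conv_lhs => rw [hc.expand (b i)]
    simp only [map_sum, map_smul, LinearMap.sum_apply, LinearMap.smul_apply, Finset.smul_sum,
      smul_smul]
    rw [Finset.sum_comm]
    refine Finset.sum_congr rfl fun k _ => Finset.sum_congr rfl fun l _ => ?_
    congr 1
    ring
  simp only [h3]
  rw [Finset.sum_comm]
  refine Finset.sum_congr rfl fun k _ => ?_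
  rw [Finset.sum_comm]
  simp only [← Finset.sum_smul, key]
  simp

end Trace

/-! ### Curvature and the covariant derivative of a 3-form -/

section Curvature

variable {M : Type*} [TopologicalSpace M] [ChartedSpace R6 M] [IsManifold (𝓡 6) ∞ M]
  (g : LorentzMetric M) (H : Form M 3)

namespace LorentzMetric

lemma fn_add_left (X X' Y : VF M) : g.fn (X + X') Y = g.fn X Y + g.fn X' Y := by
  ext x; simp [fn_apply]

lemma fn_add_right (X Y Y' : VF M) : g.fn X (Y + Y') = g.fn X Y + g.fn X Y' := by
  ext x; simp [fn_apply]

lemma fn_sub_left (X X' Y : VF M) : g.fn (X - X') Y = g.fn X Y - g.fn X' Y := by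
  ext x; simp [fn_apply]

lemma fn_sub_right (X Y Y' : VF M) : g.fn X (Y - Y') = g.fn X Y - g.fn X Y' := by
  ext x; simp [fn_apply]

lemma fn_smul_left (r : ℝ) (X Y : VF M) : g.fn (r • X) Y = r • g.fn X Y := by
  ext x; simp [fn_apply]

lemma fn_smul_right (r : ℝ) (X Y : VF M) : g.fn X (r • Y) = r • g.fn X Y := by
  ext x; simp [fn_apply]

lemma fn_fsmul_left (f : SmoothFun M) (X Y : VF M) : g.fn (fsmul f X) Y = f * g.fn X Y := by
  ext x
  change g.val x (f x • X x) (Y x) = f x * g.val x (X x) (Y x)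
  simp

lemma fn_fsmul_right (f : SmoothFun M) (X Y : VF M) : g.fn X (fsmul f Y) = f * g.fn X Y := by
  ext x
  change g.val x (X x) (f x • Y x) = f x * g.val x (X x) (Y x)
  simp

end LorentzMetric

lemma fn3_add_1 (X X' Y Z : VF M) : fn3 H (X + X') Y Z = fn3 H X Y Z + fn3 H X' Y Z := by
  ext x; simp [fn3_apply]

lemma fn3_add_2 (X Y Y' Z : VF M) : fn3 H X (Y + Y') Z = fn3 H X Y Z + fn3 H X Y' Z := by
  ext x; simp [fn3_apply]

lemma fn3_add_3 (X Y Z Z' : VF M) : fn3 H X Y (Z + Z') = fn3 H X Y Z + fn3 H X Y Z' := by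
  ext x; simp [fn3_apply]

lemma fn3_sub_1 (X X' Y Z : VF M) : fn3 H (X - X') Y Z = fn3 H X Y Z - fn3 H X' Y Z := by
  ext x; simp [fn3_apply]

lemma fn3_fsmul_1 (f : SmoothFun M) (X Y Z : VF M) : fn3 H (fsmul f X) Y Z = f * fn3 H X Y Z := by
  ext x
  change tri (H.1 x) (f x • X x) (Y x) (Z x) = f x * tri (H.1 x) (X x) (Y x) (Z x)
  simp

lemma fn3_fsmul_2 (f : SmoothFun M) (X Y Z : VF M) : fn3 H X (fsmul f Y) Z = f * fn3 H X Y Z := by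
  ext x
  change tri (H.1 x) (X x) (f x • Y x) (Z x) = f x * tri (H.1 x) (X x) (Y x) (Z x)
  simp

lemma fn3_fsmul_3 (f : SmoothFun M) (X Y Z : VF M) : fn3 H X Y (fsmul f Z) = f * fn3 H X Y Z := by
  ext x
  change tri (H.1 x) (X x) (Y x) (f x • Z x) = f x * tri (H.1 x) (X x) (Y x) (Z x)
  simp

lemma fn3_skew12 (X Y Z : VF M) : fn3 H X Y Z = -fn3 H Y X Z := by
  ext x; exact tri_skew12 _ _ _ _

lemma fn3_skew23 (X Y Z : VF M) : fn3 H X Y Z = -fn3 H X Z Y := by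
  ext x; exact tri_skew23 _ _ _ _

variable [T2Space M] (nab : VF M → VF M → VF M)

/-- The curvature `R(X, Y) Z`. -/
def curv (X Y Z : VF M) : VF M := nab X (nab Y Z) - nab Y (nab X Z) - nab (lie X Y) Z

/-- The covariant derivative `(∇_X H)(Y, Z, W)`. -/
def nabH (X Y Z W : VF M) : SmoothFun M :=
  der X (fn3 H Y Z W) - fn3 H (nab X Y) Z W - fn3 H Y (nab X Z) W - fn3 H Y Z (nab X W)

lemma nabH_skew12 (X Y Z W : VF M) : nabH H nab X Y Z W = -nabH H nab X Z Y W := by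
  simp only [nabH]
  rw [fn3_skew12 H Y Z, fn3_skew12 H (nab X Y), fn3_skew12 H Y (nab X Z), fn3_skew12 H Y Z (nab X W),
    der_neg]
  abel

lemma nabH_skew23 (X Y Z W : VF M) : nabH H nab X Y Z W = -nabH H nab X Y W Z := by
  simp only [nabH]
  rw [fn3_skew23 H Y Z, fn3_skew23 H (nab X Y), fn3_skew23 H Y (nab X Z), fn3_skew23 H Y Z (nab X W),
    der_neg]
  abel

variable {g nab} (hn : IsLeviCivita g nab)
include hn

lemma nabH_add_1 (X X' Y Z W : VF M) :
    nabH H nab (X + X') Y Z W = nabH H nab X Y Z W + nabH H nab X' Y Z W := by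
  simp only [nabH, hn.add_left, der_add_left, fn3_add_1, fn3_add_2, fn3_add_3]
  abel

lemma nabH_fsmul_1 (f : SmoothFun M) (X Y Z W : VF M) (x : M) :
    nabH H nab (fsmul f X) Y Z W x = f x * nabH H nab X Y Z W x := by
  simp only [nabH, hn.fsmul_left, fn3_fsmul_1, fn3_fsmul_2, fn3_fsmul_3]
  change der (fsmul f X) _ x - f x * _ - f x * _ - f x * _ = f x * (_ - _ - _ - _)
  rw [der_fsmul_left, smul_eq_mul]
  ring

lemma nabH_add_2 (X Y Y' Z W : VF M) :
    nabH H nab X (Y + Y') Z W = nabH H nab X Y Z W + nabH H nab X Y' Z W := by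
  simp only [nabH, hn.add_right, der_add, fn3_add_1]
  abel

lemma nabH_fsmul_2 (f : SmoothFun M) (X Y Z W : VF M) (x : M) :
    nabH H nab X (fsmul f Y) Z W x = f x * nabH H nab X Y Z W x := by
  simp only [nabH, hn.fsmul_right, fn3_fsmul_1, der_mul, fn3_add_1]
  change (der X f x * fn3 H Y Z W x + f x * _) - (der X f x * fn3 H Y Z W x + f x * _)
    - f x * _ - f x * _ = f x * (_ - _ - _ - _)
  ring

/-- The exterior derivative is the skew-symmetrization of the covariant derivative. -/
lemma nabH_closed (hH : H ∈ closed3 M) (W X Y Z : VF M) (x : M) :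
    nabH H nab W X Y Z x - nabH H nab X W Y Z x + nabH H nab Y W X Z x - nabH H nab Z W X Y x
      = 0 := by
  have h := hH W X Y Z x
  rw [d3_eq] at h
  simp only [← hn.torsion, fn3_sub_1] at h
  have e1 := fun A B C : VF M => congrArg (fun f : SmoothFun M => f x) (fn3_skew12 H A B C)
  have e2 := fun A B C : VF M => congrArg (fun f : SmoothFun M => f x) (fn3_skew23 H A B C)
  simp only [nabH]
  simp only [ContMDiffMap.coe_sub, ContMDiffMap.coe_neg, Pi.sub_apply, Pi.neg_apply] at h e1 e2 ⊢
  linear_combination h - e1 X (nab W Y) Z - (e2 X Y (nab W Z) - e1 X (nab W Z) Y)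
    + e1 W (nab X Y) Z + (e2 W Y (nab X Z) - e1 W (nab X Z) Y)
    - e1 W (nab Y X) Z - (e2 W X (nab Y Z) - e1 W (nab Y Z) X)
    + e1 W (nab Z X) Y + (e2 W X (nab Z Y) - e1 W (nab Z Y) X)

/-- Apply `[X, Y] = XY - YX` to the function `g(Z, W)` and expand with metric compatibility; the
mixed first-order terms cancel. -/
lemma curv_metric (X Y Z W : VF M) :
    g.fn (curv nab X Y Z) W + g.fn Z (curv nab X Y W) = 0 := by
  have h := der_lie X Y (g.fn Z W)
  simp only [hn.der_metric, der_add] at h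
  simp only [curv, g.fn_sub_left, g.fn_sub_right]
  rw [← sub_eq_zero] at h
  rw [← neg_eq_zero, ← h]
  abel

lemma curv_skew (X Y Z : VF M) : curv nab X Y Z = -curv nab Y X Z := by
  simp only [curv]
  rw [lie_skew X Y, hn.neg_left]
  abel

/-- This is the Jacobi identity with each bracket of fields rewritten as a commutator of covariant
derivatives. -/
lemma curv_bianchi (X Y Z : VF M) : curv nab X Y Z + curv nab Y Z X + curv nab Z X Y = 0 := by
  have h := lie_jacobi X Y Z
  have h2 : ∀ A B C : VF M, lie A (lie B C) = nab A (nab B C) - nab A (nab C B) - nab (lie B C) A :=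
    fun A B C => by rw [← hn.torsion A, ← hn.sub_right, hn.torsion B C]
  rw [lie_skew (lie X Y) Z] at h
  rw [h2, h2, h2] at h
  simp only [curv]
  have h3 : lie Z X = -lie X Z := lie_skew Z X
  rw [h3, hn.neg_left]
  rw [← sub_eq_zero] at h
  rw [← h]
  abel

lemma curv_add_1 (X X' Y Z : VF M) : curv nab (X + X') Y Z = curv nab X Y Z + curv nab X' Y Z := by
  simp only [curv]
  rw [lie_skew (X + X') Y, lie_add_right, lie_skew Y X, lie_skew Y X']
  simp only [hn.add_left, hn.add_right, hn.neg_left]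
  abel

lemma curv_fsmul_1 (f : SmoothFun M) (X Y Z : VF M) (x : M) :
    curv nab (fsmul f X) Y Z x = f x • curv nab X Y Z x := by
  have h : lie (fsmul f X) Y = fsmul f (lie X Y) - fsmul (der Y f) X := by
    rw [lie_skew (fsmul f X) Y, lie_fsmul_right, lie_skew Y X]
    ext y
    change -(der Y f y • X y + f y • -(lie X Y y)) = f y • lie X Y y - der Y f y • X y
    rw [smul_neg]
    abel
  simp only [curv, h, hn.fsmul_left, hn.fsmul_right, hn.sub_left]
  change f x • nab X (nab Y Z) x - (der Y f x • nab X Z x + f x • nab Y (nab X Z) x)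
    - (f x • nab (lie X Y) Z x - der Y f x • nab X Z x)
    = f x • (nab X (nab Y Z) x - nab Y (nab X Z) x - nab (lie X Y) Z x)
  rw [smul_sub, smul_sub]
  abel

/-- `IsRicci` asks for a linear map with given values on fields. Tensoriality of the curvature in
its first slot supplies one, and the orthonormal basis computes the trace of any such map. -/
lemma isRicci_iff {x : M} {X : Fin 6 → VF M}
    {b : Module.Basis (Fin 6) ℝ (TangentSpace (𝓡 6) x)} (hb : IsOrtho (g.val x) b)
    (hX : ∀ i, X i x = b i) (Y Z : VF M) (r : ℝ) :
    IsRicci nab x Y Z r ↔ ∑ i, eta i * g.fn (curv nab (X i) Y Z) (X i) x = r := by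
  obtain ⟨L, hL⟩ := exists_linear_of_tensorial (F := R6) (x := x)
    (T := fun X : VF M => curv nab X Y Z x) (fun a b => by rw [curv_add_1 hn]; rfl)
    (fun f a => curv_fsmul_1 hn f a Y Z x)
  have key : ∀ L : TangentSpace (𝓡 6) x →ₗ[ℝ] TangentSpace (𝓡 6) x,
      (∀ X : VF M, L (X x) = curv nab X Y Z x) →
      LinearMap.trace ℝ _ L = ∑ i, eta i * g.fn (curv nab (X i) Y Z) (X i) x := fun L hL => by
    rw [hb.trace_eq]
    refine Finset.sum_congr rfl fun i _ => ?_
    rw [← hX, hL, LorentzMetric.fn_apply]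
  constructor
  · rintro ⟨L', h1, h2⟩
    rw [← key L', h2]
    intro X
    exact h1 X (lie X Y) fun y => rfl
  · intro h
    refine ⟨L, fun X B hB => ?_, (key L hL).trans h⟩
    have : B = lie X Y := by ext y; exact hB y
    rw [hL, this]
    rfl

end Curvature


/-! ### Clifford algebra: commutators of bivectors and trivectors -/

section Clifford

/-- Generators of a Clifford algebra of signature `(1,5)`, with `γ_i γ_j + γ_j γ_i = -2 η_ij`. -/
def IsGamma {𝒜 : Type*} [Ring 𝒜] [Algebra ℝ 𝒜] (γ : Fin 6 → 𝒜) : Prop :=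
  ∀ i j, γ i * γ j + γ j * γ i = (if i = j then -2 * eta i else 0) • (1 : 𝒜)

variable {𝒜 : Type*} [Ring 𝒜] [Algebra ℝ 𝒜] {γ : Fin 6 → 𝒜}

/-- The bivector `∑ S_pq γ_p γ_q`. -/
def biv (γ : Fin 6 → 𝒜) (S : Fin 6 → Fin 6 → ℝ) : 𝒜 :=
  ∑ p, ∑ q, S p q • (γ p * γ q)

/-- The trivector `∑ T_pqr γ_p γ_q γ_r`. -/
def trivec (γ : Fin 6 → 𝒜) (T : Fin 6 → Fin 6 → Fin 6 → ℝ) : 𝒜 :=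
  ∑ p, ∑ q, ∑ r, T p q r • (γ p * γ q * γ r)

section Sums

variable {N : Type*} [AddCommMonoid N]

lemma sum3_swap12 (f : Fin 6 → Fin 6 → Fin 6 → N) :
    ∑ i, ∑ p, ∑ q, f i p q = ∑ i, ∑ p, ∑ q, f p i q := Finset.sum_comm

lemma sum3_swap23 (f : Fin 6 → Fin 6 → Fin 6 → N) :
    ∑ i, ∑ p, ∑ q, f i p q = ∑ i, ∑ p, ∑ q, f i q p :=
  Finset.sum_congr rfl fun _ _ => Finset.sum_comm

lemma sum3_swap13 (f : Fin 6 → Fin 6 → Fin 6 → N) :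
    ∑ i, ∑ p, ∑ q, f i p q = ∑ i, ∑ p, ∑ q, f q p i := by
  rw [sum3_swap12, sum3_swap23, sum3_swap12]

lemma sum4_swap12 (f : Fin 6 → Fin 6 → Fin 6 → Fin 6 → N) :
    ∑ i, ∑ p, ∑ q, ∑ r, f i p q r = ∑ i, ∑ p, ∑ q, ∑ r, f p i q r := Finset.sum_comm

lemma sum4_swap23 (f : Fin 6 → Fin 6 → Fin 6 → Fin 6 → N) :
    ∑ i, ∑ p, ∑ q, ∑ r, f i p q r = ∑ i, ∑ p, ∑ q, ∑ r, f i q p r :=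
  Finset.sum_congr rfl fun _ _ => Finset.sum_comm

lemma sum4_swap34 (f : Fin 6 → Fin 6 → Fin 6 → Fin 6 → N) :
    ∑ i, ∑ p, ∑ q, ∑ r, f i p q r = ∑ i, ∑ p, ∑ q, ∑ r, f i p r q :=
  Finset.sum_congr rfl fun _ _ => Finset.sum_congr rfl fun _ _ => Finset.sum_comm

end Sums

namespace IsGamma

variable (hγ : IsGamma γ)
include hγ

/-- Raising an index multiplies a relation by `η_i η_j`, which is 1 on the diagonal. Form components
have lower indices, so they are contracted with the raised generators. -/
lemma up : IsGamma fun i => eta i • γ i := by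
  intro i j
  simp only [smul_mul_smul_comm]
  rw [mul_comm (eta j), ← smul_add, hγ i j, smul_smul]
  congr 1
  split_ifs with h
  · rw [h]; linear_combination (-2 * eta j) * eta_mul_self j
  · rw [mul_zero]

lemma sq (i : Fin 6) : γ i * γ i = (-eta i) • (1 : 𝒜) := by
  have h := hγ i i
  rw [if_pos rfl, ← two_smul ℝ (γ i * γ i)] at h
  have h2 := congrArg (fun a => (1 / 2 : ℝ) • a) h
  simp only [smul_smul] at h2
  rw [show (1 / 2 : ℝ) * 2 = 1 by norm_num, one_smul] at h2
  rw [h2]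
  congr 1
  ring

lemma anti {i j : Fin 6} (h : i ≠ j) : γ i * γ j = -(γ j * γ i) := by
  have := hγ i j
  rw [if_neg h, zero_smul] at this
  exact eq_neg_of_add_eq_zero_left this

lemma swap (i j : Fin 6) :
    γ i * γ j = (if i = j then -2 * eta i else 0) • (1 : 𝒜) - γ j * γ i := by
  rw [← hγ i j]; abel

/-- Moving `γ_j` through `γ_p γ_q` produces two contractions; skewness of `S` makes them equal,
whence the factor 4. Bivectors thus act on the generators as infinitesimal rotations. -/
lemma biv_comm {S : Fin 6 → Fin 6 → ℝ} (hS : ∀ p q, S p q = -S q p) (j : Fin 6) :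
    biv γ S * γ j - γ j * biv γ S = (4 * eta j) • ∑ q, S j q • γ q := by
  have key : ∀ p q, γ p * γ q * γ j - γ j * (γ p * γ q) =
      (if q = j then -2 * eta q else 0) • γ p - (if p = j then -2 * eta p else 0) • γ q := by
    intro p q
    have h1 : γ p * γ q * γ j = (if q = j then -2 * eta q else 0) • γ p - γ p * γ j * γ q := by
      rw [mul_assoc, hγ.swap q j, mul_sub, mul_smul_comm, mul_one, mul_assoc]
    rw [h1, hγ.swap p j, sub_mul, smul_mul_assoc, one_mul, mul_assoc]
    abel
  have h2 : biv γ S * γ j - γ j * biv γ S = ∑ p, ∑ q, S p q •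
      ((if q = j then -2 * eta q else 0) • γ p - (if p = j then -2 * eta p else 0) • γ q) := by
    simp only [biv, Finset.sum_mul, Finset.mul_sum, smul_mul_assoc, mul_smul_comm,
      ← Finset.sum_sub_distrib, ← smul_sub, key]
  rw [h2]
  simp only [smul_sub, Finset.sum_sub_distrib, smul_smul]
  rw [Finset.sum_comm (f := fun p q => (S p q * if p = j then -2 * eta p else 0) • γ q)]
  simp only [mul_ite, mul_zero, ite_smul, zero_smul, Finset.sum_ite_eq', Finset.mem_univ, if_true]
  rw [Finset.smul_sum, ← Finset.sum_sub_distrib]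
  refine Finset.sum_congr rfl fun q _ => ?_
  rw [← sub_smul, smul_smul]
  congr 1
  rw [hS q j]
  ring

lemma biv_mul {S : Fin 6 → Fin 6 → ℝ} (hS : ∀ p q, S p q = -S q p) (j : Fin 6) :
    biv γ S * γ j = γ j * biv γ S + (4 * eta j) • ∑ q, S j q • γ q := by
  rw [← hγ.biv_comm hS j]; abel

/-- The commutator with a bivector is a derivation, so `biv_mul` is applied to each factor of `γ_p
γ_q` and the indices are renamed. -/
lemma biv_comm_biv {S : Fin 6 → Fin 6 → ℝ} (T : Fin 6 → Fin 6 → ℝ) (hS : ∀ p q, S p q = -S q p) :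
    biv γ S * biv γ T - biv γ T * biv γ S =
      biv γ (fun p q => -4 * ∑ k, eta k * (S p k * T k q + S q k * T p k)) := by
  have key : ∀ p q, biv γ S * (γ p * γ q) - γ p * γ q * biv γ S =
      ∑ k, ((4 * eta p * S p k) • (γ k * γ q) + (4 * eta q * S q k) • (γ p * γ k)) := by
    intro p q
    rw [← mul_assoc, hγ.biv_mul hS, add_mul, mul_assoc (γ p), hγ.biv_mul hS, mul_add]
    simp only [smul_mul_assoc, mul_smul_comm, Finset.sum_mul, Finset.mul_sum, Finset.smul_sum,
      Finset.sum_add_distrib, smul_smul, mul_assoc]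
    abel
  have h2 : biv γ S * biv γ T - biv γ T * biv γ S = ∑ p, ∑ q, T p q •
      ∑ k, ((4 * eta p * S p k) • (γ k * γ q) + (4 * eta q * S q k) • (γ p * γ k)) := by
    simp only [← key, smul_sub, Finset.sum_sub_distrib]
    rw [biv.eq_1 γ T]
    simp only [Finset.mul_sum, Finset.sum_mul, smul_mul_assoc, mul_smul_comm]
  rw [h2]
  simp only [Finset.smul_sum, smul_add, smul_smul, Finset.sum_add_distrib, biv, Finset.mul_sum,
    Finset.sum_smul, mul_add, add_smul]
  congr 1
  · rw [sum3_swap13]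
    refine Finset.sum_congr rfl fun p _ => Finset.sum_congr rfl fun q _ =>
      Finset.sum_congr rfl fun k _ => ?_
    rw [hS p k]
    congr 1; ring
  · rw [sum3_swap23]
    refine Finset.sum_congr rfl fun p _ => Finset.sum_congr rfl fun q _ =>
      Finset.sum_congr rfl fun k _ => ?_
    rw [hS q k]
    congr 1; ring

/-- The same derivation property on three factors. With `S` the connection coefficients, this is how
the Christoffel terms of `∇H` appear as a commutator. -/
lemma biv_comm_trivec {S : Fin 6 → Fin 6 → ℝ} (T : Fin 6 → Fin 6 → Fin 6 → ℝ)
    (hS : ∀ p q, S p q = -S q p) :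
    biv γ S * trivec γ T - trivec γ T * biv γ S =
      trivec γ (fun p q r =>
        -4 * ∑ k, eta k * (S p k * T k q r + S q k * T p k r + S r k * T p q k)) := by
  have key : ∀ p q r, biv γ S * (γ p * γ q * γ r) - γ p * γ q * γ r * biv γ S =
      ∑ k, ((4 * eta p * S p k) • (γ k * γ q * γ r) + (4 * eta q * S q k) • (γ p * γ k * γ r)
        + (4 * eta r * S r k) • (γ p * γ q * γ k)) := by
    intro p q r
    rw [← mul_assoc, ← mul_assoc, hγ.biv_mul hS, add_mul, mul_assoc (γ p), hγ.biv_mul hS, mul_add,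
      add_mul, add_mul, mul_assoc (γ p), mul_assoc (γ q), hγ.biv_mul hS, mul_add, mul_add]
    simp only [smul_mul_assoc, mul_smul_comm, Finset.sum_mul, Finset.mul_sum, Finset.smul_sum,
      Finset.sum_add_distrib, smul_smul, mul_assoc]
    abel
  have h2 : biv γ S * trivec γ T - trivec γ T * biv γ S = ∑ p, ∑ q, ∑ r, T p q r •
      ∑ k, ((4 * eta p * S p k) • (γ k * γ q * γ r) + (4 * eta q * S q k) • (γ p * γ k * γ r)
        + (4 * eta r * S r k) • (γ p * γ q * γ k)) := by
    simp only [← key, smul_sub, Finset.sum_sub_distrib]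
    rw [trivec.eq_1 γ T]
    simp only [Finset.mul_sum, Finset.sum_mul, smul_mul_assoc, mul_smul_comm]
  rw [h2]
  simp only [Finset.smul_sum, smul_add, smul_smul, Finset.sum_add_distrib, trivec, Finset.mul_sum,
    Finset.sum_smul, mul_add, add_smul]
  congr 1
  · congr 1
    · rw [sum4_swap34, sum4_swap23, sum4_swap12, sum4_swap23, sum4_swap34]
      refine Finset.sum_congr rfl fun p _ => Finset.sum_congr rfl fun q _ =>
        Finset.sum_congr rfl fun r _ => Finset.sum_congr rfl fun k _ => ?_
      rw [hS p k]
      congr 1; ring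
    · rw [sum4_swap34, sum4_swap23, sum4_swap34]
      refine Finset.sum_congr rfl fun p _ => Finset.sum_congr rfl fun q _ =>
        Finset.sum_congr rfl fun r _ => Finset.sum_congr rfl fun k _ => ?_
      rw [hS q k]
      congr 1; ring
  · rw [sum4_swap34]
    refine Finset.sum_congr rfl fun p _ => Finset.sum_congr rfl fun q _ =>
      Finset.sum_congr rfl fun r _ => Finset.sum_congr rfl fun k _ => ?_
    rw [hS r k]
    congr 1; ring

/-- A multiple of a totally skew trivector by a generator. -/
lemma anti_trivec {T : Fin 6 → Fin 6 → Fin 6 → ℝ} (h12 : ∀ p q r, T p q r = -T q p r)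
    (h23 : ∀ p q r, T p q r = -T p r q) (i : Fin 6) :
    γ i * trivec γ T + trivec γ T * γ i = (-6 * eta i) • biv γ (T i) := by
  -- Carrying `γ_i` through three factors costs three contractions; after summation total skewness
  -- makes them equal, giving `3 · (-2η) = -6η`.
  have key : ∀ p q r, γ i * (γ p * γ q * γ r) + γ p * γ q * γ r * γ i =
      (if p = i then -2 * eta p else 0) • (γ q * γ r) - (if q = i then -2 * eta q else 0) • (γ p * γ r)
      + (if r = i then -2 * eta r else 0) • (γ p * γ q) := by
    intro p q r
    have h1 : γ p * γ q * γ r * γ i = (if r = i then -2 * eta r else 0) • (γ p * γ q)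
        - γ p * (γ q * γ i) * γ r := by
      rw [mul_assoc, hγ.swap r i, mul_sub, mul_smul_comm, mul_one]
      simp only [mul_assoc]
    have h2 : γ p * (γ q * γ i) * γ r = (if q = i then -2 * eta q else 0) • (γ p * γ r)
        - (γ p * γ i) * γ q * γ r := by
      rw [hγ.swap q i, mul_sub, mul_smul_comm, mul_one, sub_mul, smul_mul_assoc]
      simp only [mul_assoc]
    have h3 : (γ p * γ i) * γ q * γ r = (if p = i then -2 * eta p else 0) • (γ q * γ r)
        - γ i * (γ p * γ q * γ r) := by
      rw [hγ.swap p i, sub_mul, sub_mul, smul_mul_assoc, one_mul, smul_mul_assoc]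
      simp only [mul_assoc]
    rw [h1, h2, h3]
    abel
  have h2 : γ i * trivec γ T + trivec γ T * γ i = ∑ p, ∑ q, ∑ r, T p q r •
      ((if p = i then -2 * eta p else 0) • (γ q * γ r) - (if q = i then -2 * eta q else 0) • (γ p * γ r)
      + (if r = i then -2 * eta r else 0) • (γ p * γ q)) := by
    simp only [trivec, Finset.sum_mul, Finset.mul_sum, smul_mul_assoc, mul_smul_comm,
      ← Finset.sum_add_distrib, ← smul_add, key]
  rw [h2]
  simp only [smul_sub, smul_add, Finset.sum_sub_distrib, Finset.sum_add_distrib, smul_smul]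
  rw [sum3_swap12 (f := fun p q r => (T p q r * if p = i then -2 * eta p else 0) • (γ q * γ r)),
    sum3_swap23 (f := fun q p r => (T p q r * if p = i then -2 * eta p else 0) • (γ q * γ r)),
    sum3_swap23 (f := fun p q r => (T p q r * if q = i then -2 * eta q else 0) • (γ p * γ r))]
  simp only [mul_ite, mul_zero, ite_smul, zero_smul, Finset.sum_ite_eq', Finset.mem_univ, if_true,
    biv, Finset.smul_sum, ← Finset.sum_sub_distrib, ← Finset.sum_add_distrib, smul_smul,
    ← sub_smul, ← add_smul]
  refine Finset.sum_congr rfl fun p _ => Finset.sum_congr rfl fun q _ => ?_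
  congr 1
  rw [h12 p i q, h23 p q i, h12 p i q]
  ring

end IsGamma

end Clifford


/-! ### Clifford identities behind the Dirac operator -/

section CliffordIdentities

variable {𝒜 : Type*} [Ring 𝒜] [Algebra ℝ 𝒜] {γ : Fin 6 → 𝒜}

lemma sum4_delta {N : Type*} [AddCommGroup N] [Module ℝ N]
    (c : Fin 6 → Fin 6 → Fin 6 → Fin 6 → ℝ) (a : Fin 6 → Fin 6 → N) :
    ∑ i, ∑ p, ∑ q, ∑ r, (c i p q r * if p = i then -2 * eta p else 0) • a q r
      = (-2 : ℝ) • ∑ q, ∑ r, (∑ i, eta i * c i i q r) • a q r := by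
  rw [sum4_swap23, sum4_swap34]
  simp only [mul_ite, mul_zero, ite_smul, zero_smul, Finset.sum_ite_eq', Finset.mem_univ, if_true,
    Finset.smul_sum, Finset.sum_smul, smul_smul]
  rw [sum3_swap12, sum3_swap23]
  refine Finset.sum_congr rfl fun p _ => Finset.sum_congr rfl fun q _ =>
    Finset.sum_congr rfl fun k _ => ?_
  congr 1
  ring

lemma sum4_congr {N : Type*} [AddCommMonoid N] {f h : Fin 6 → Fin 6 → Fin 6 → Fin 6 → N}
    (H : ∀ i p q r, f i p q r = h i p q r) :
    ∑ i, ∑ p, ∑ q, ∑ r, f i p q r = ∑ i, ∑ p, ∑ q, ∑ r, h i p q r :=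
  Finset.sum_congr rfl fun i _ => Finset.sum_congr rfl fun p _ =>
    Finset.sum_congr rfl fun q _ => Finset.sum_congr rfl fun r _ => H i p q r

namespace IsGamma

variable (hγ : IsGamma γ)
include hγ

lemma sum_up_mul : ∑ i, eta i • (γ i * γ i) = (-6 : ℝ) • (1 : 𝒜) := by
  simp only [hγ.sq, smul_smul]
  rw [← Finset.sum_smul]
  congr 1
  have : ∀ i, eta i * -eta i = -1 := fun i => by
    rw [mul_neg, eta_mul_self]
  simp [this]

/-- The Dirac operator on a 3-form: exterior derivative plus divergence. -/
lemma sum_mul_trivec {N : Fin 6 → Fin 6 → Fin 6 → Fin 6 → ℝ}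
    (h12 : ∀ i p q r, N i p q r = -N i q p r) (h23 : ∀ i p q r, N i p q r = -N i p r q)
    (hd : ∀ i p q r, N i p q r - N p i q r + N q i p r - N r i p q = 0) :
    ∑ i, γ i * trivec γ (N i) = (-3 : ℝ) • biv γ (fun q r => ∑ i, eta i * N i i q r) := by
  set δ := biv γ (fun q r => ∑ i, eta i * N i i q r)
  set m : Fin 6 → Fin 6 → Fin 6 → Fin 6 → 𝒜 := fun i p q r => γ i * γ p * γ q * γ r with hm
  have hS : ∑ i, γ i * trivec γ (N i) = ∑ i, ∑ p, ∑ q, ∑ r, N i p q r • m i p q r := by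
    simp only [trivec, Finset.mul_sum, mul_smul_comm, hm, mul_assoc]
  -- Closedness is paired with the monomials `γ_i γ_p γ_q γ_r`. After renaming indices, `N i p q r`
  -- multiplies four permuted monomials; sorting these costs contractions, all multiples of `δ`, and
  -- the relation becomes `4 S + 12 δ = 0`.
  have h0 : ∑ i, ∑ p, ∑ q, ∑ r,
      (N i p q r - N p i q r + N q i p r - N r i p q) • m i p q r = 0 := by
    simp only [hd, zero_smul, Finset.sum_const_zero]
  simp only [sub_smul, add_smul, Finset.sum_sub_distrib, Finset.sum_add_distrib] at h0
  rw [sum4_swap12 (f := fun i p q r => N p i q r • m i p q r),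
    sum4_swap23 (f := fun i p q r => N q i p r • m i p q r),
    sum4_swap12 (f := fun i q p r => N q i p r • m i p q r),
    sum4_swap34 (f := fun i p q r => N r i p q • m i p q r),
    sum4_swap23 (f := fun i p r q => N r i p q • m i p q r),
    sum4_swap12 (f := fun i r p q => N r i p q • m i p q r)] at h0
  -- `m p i q r`, `m p q i r` and `m p q r i`
  have s1 : ∀ i p q r, m p i q r = (if p = i then -2 * eta p else 0) • (γ q * γ r) - m i p q r := by
    intro i p q r
    simp only [hm]
    rw [hγ.swap p i, sub_mul, sub_mul, smul_mul_assoc, one_mul, smul_mul_assoc]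
  have s2 : ∀ i p q r, m p q i r = (if q = i then -2 * eta q else 0) • (γ p * γ r) - m p i q r := by
    intro i p q r
    simp only [hm]
    rw [mul_assoc (γ p), hγ.swap q i, mul_sub, sub_mul, mul_smul_comm, mul_one, smul_mul_assoc,
      ← mul_assoc]
  have s3 : ∀ i p q r, m p q r i = (if r = i then -2 * eta r else 0) • (γ p * γ q) - m p q i r := by
    intro i p q r
    simp only [hm]
    rw [mul_assoc, hγ.swap r i, mul_sub, mul_smul_comm, mul_one, ← mul_assoc]
  have e1 : ∑ i, ∑ p, ∑ q, ∑ r, (N i p q r * if p = i then -2 * eta p else 0) • (γ q * γ r)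
      = (-2 : ℝ) • δ := sum4_delta N _
  have e2 : ∑ i, ∑ p, ∑ q, ∑ r, (N i p q r * if q = i then -2 * eta q else 0) • (γ p * γ r)
      = (2 : ℝ) • δ := by
    rw [sum4_swap23]
    rw [sum4_delta (fun i p q r => N i q p r)]
    rw [show (2 : ℝ) • δ = (-2 : ℝ) • (-δ) by simp]
    congr 1
    simp only [δ, biv, ← Finset.sum_neg_distrib, ← neg_smul, ← mul_neg]
    refine Finset.sum_congr rfl fun p _ => Finset.sum_congr rfl fun q _ => ?_
    congr 1
    exact Finset.sum_congr rfl fun i _ => by rw [h12 i p i q]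
  have e3 : ∑ i, ∑ p, ∑ q, ∑ r, (N i p q r * if r = i then -2 * eta r else 0) • (γ p * γ q)
      = (-2 : ℝ) • δ := by
    rw [sum4_swap34, sum4_swap23]
    rw [sum4_delta (fun i r p q => N i p q r)]
    congr 1
    simp only [δ, biv]
    refine Finset.sum_congr rfl fun p _ => Finset.sum_congr rfl fun q _ => ?_
    congr 1
    exact Finset.sum_congr rfl fun i _ => by rw [h23 i p q i, h12 i p i q, neg_neg]
  have t1 := sum4_congr fun i p q r => show N i p q r • m p i q r =
    (N i p q r * if p = i then -2 * eta p else 0) • (γ q * γ r) - N i p q r • m i p q r by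
      rw [s1, smul_sub, smul_smul]
  have t2 := sum4_congr fun i p q r => show N i p q r • m p q i r =
    (N i p q r * if q = i then -2 * eta q else 0) • (γ p * γ r) - N i p q r • m p i q r by
      rw [s2, smul_sub, smul_smul]
  have t3 := sum4_congr fun i p q r => show N i p q r • m p q r i =
    (N i p q r * if r = i then -2 * eta r else 0) • (γ p * γ q) - N i p q r • m p q i r by
      rw [s3, smul_sub, smul_smul]
  simp only [Finset.sum_sub_distrib, e1, e2, e3] at t1 t2 t3
  rw [t3, t2, t1] at h0
  rw [hS]
  set S := ∑ i, ∑ p, ∑ q, ∑ r, N i p q r • m i p q r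
  have h4 : (4 : ℝ) • S = (-12 : ℝ) • δ := by
    rw [← sub_eq_zero, ← h0]
    module
  have := congrArg (fun a => (1 / 4 : ℝ) • a) h4
  simp only [smul_smul] at this
  norm_num at this
  rw [this, neg_smul]

/-- The algebraic part of the Lichnerowicz formula. -/
lemma sum_curv {R : Fin 6 → Fin 6 → Fin 6 → Fin 6 → ℝ}
    (h12 : ∀ i j p q, R i j p q = -R j i p q)
    (hb : ∀ i j p q, R i j p q + R j p i q + R p i j q = 0) :
    ∑ i, ∑ j, ∑ p, ∑ q, R i j p q • (γ i * γ j * (γ p * γ q)) =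
      (2 : ℝ) • biv γ (fun j q => ∑ i, eta i * R i j i q) := by
  set c := biv γ (fun j q => ∑ i, eta i * R i j i q) with hc
  set m : Fin 6 → Fin 6 → Fin 6 → Fin 6 → 𝒜 := fun i p q r => γ i * γ p * (γ q * γ r) with hm
  -- The Bianchi identity is paired with the monomials; the two cyclic terms are sorted back to the
  -- first at the cost of Ricci contractions, which leaves `3 S = 6 c`.
  have h0 : ∑ i, ∑ j, ∑ p, ∑ q, (R i j p q + R j p i q + R p i j q) • m i j p q = 0 := by
    simp only [hb, zero_smul, Finset.sum_const_zero]
  simp only [add_smul, Finset.sum_add_distrib] at h0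
  rw [sum4_swap12 (f := fun i j p q => R j p i q • m i j p q),
    sum4_swap23 (f := fun j i p q => R j p i q • m i j p q),
    sum4_swap23 (f := fun i j p q => R p i j q • m i j p q),
    sum4_swap12 (f := fun i p j q => R p i j q • m i j p q)] at h0
  have s1 : ∀ i j p q, m p i j q = m i j p q + (if p = i then -2 * eta p else 0) • (γ j * γ q)
      - (if p = j then -2 * eta p else 0) • (γ i * γ q) := by
    intro i j p q
    simp only [hm]
    rw [hγ.swap p i, sub_mul, smul_mul_assoc, one_mul, ← mul_assoc (γ i * γ p), mul_assoc (γ i),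
      hγ.swap p j, mul_sub, sub_mul, mul_smul_comm, mul_one, smul_mul_assoc]
    simp only [mul_assoc]
    abel
  have s2 : ∀ i j p q, m j p i q = (if p = i then -2 * eta p else 0) • (γ j * γ q) - m j i p q := by
    intro i j p q
    simp only [hm]
    rw [← mul_assoc (γ j * γ p), mul_assoc (γ j), hγ.swap p i, mul_sub, sub_mul, mul_smul_comm,
      mul_one, smul_mul_assoc]
    simp only [mul_assoc]
  have e0 : ∑ i, ∑ j, ∑ p, ∑ q, R i j p q • m j i p q = -∑ i, ∑ j, ∑ p, ∑ q, R i j p q • m i j p q := by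
    rw [sum4_swap12]
    simp only [← Finset.sum_neg_distrib, ← neg_smul]
    refine Finset.sum_congr rfl fun i _ => Finset.sum_congr rfl fun j _ =>
      Finset.sum_congr rfl fun p _ => Finset.sum_congr rfl fun q _ => ?_
    rw [h12 j i]
  have e1 : ∑ i, ∑ j, ∑ p, ∑ q, (R i j p q * if p = i then -2 * eta p else 0) • (γ j * γ q)
      = (-2 : ℝ) • c := by
    rw [sum4_swap23]
    rw [sum4_delta (fun i p j q => R i j p q)]
    rfl
  have e2 : ∑ i, ∑ j, ∑ p, ∑ q, (R i j p q * if p = j then -2 * eta p else 0) • (γ i * γ q)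
      = (2 : ℝ) • c := by
    rw [sum4_swap12, sum4_swap23]
    rw [sum4_delta (fun j p i q => R i j p q)]
    rw [show (2 : ℝ) • c = (-2 : ℝ) • (-c) by simp]
    congr 1
    simp only [c, biv, ← Finset.sum_neg_distrib, ← neg_smul, ← mul_neg]
    refine Finset.sum_congr rfl fun p _ => Finset.sum_congr rfl fun q _ => ?_
    congr 1
    exact Finset.sum_congr rfl fun i _ => by rw [h12 p i]
  have t1 := sum4_congr fun i j p q => show R i j p q • m p i j q = R i j p q • m i j p q +
    (R i j p q * if p = i then -2 * eta p else 0) • (γ j * γ q)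
      - (R i j p q * if p = j then -2 * eta p else 0) • (γ i * γ q) by
      rw [s1, smul_sub, smul_add, smul_smul, smul_smul]
  have t2 := sum4_congr fun i j p q => show R i j p q • m j p i q =
    (R i j p q * if p = i then -2 * eta p else 0) • (γ j * γ q) - R i j p q • m j i p q by
      rw [s2, smul_sub, smul_smul]
  simp only [Finset.sum_sub_distrib, Finset.sum_add_distrib, e0, e1, e2] at t1 t2
  rw [t1, t2] at h0
  set S := ∑ i, ∑ j, ∑ p, ∑ q, R i j p q • m i j p q
  have h4 : (3 : ℝ) • S = (6 : ℝ) • c := by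
    rw [← sub_eq_zero, ← h0]
    module
  have := congrArg (fun a => (1 / 3 : ℝ) • a) h4
  simp only [smul_smul] at this
  norm_num at this
  exact this

/-- Against symmetric coefficients only the anticommutator of the generators survives, and that is a
scalar. This turns the Ricci term of the Lichnerowicz formula into the scalar curvature. -/
lemma biv_symm {S : Fin 6 → Fin 6 → ℝ} (hS : ∀ p q, S p q = S q p) :
    biv γ S = (-∑ p, eta p * S p p) • (1 : 𝒜) := by
  have h : (2 : ℝ) • biv γ S = ∑ p, ∑ q, S p q • (γ p * γ q + γ q * γ p) := by
    simp only [smul_add, Finset.sum_add_distrib]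
    rw [two_smul]
    congr 1
    rw [Finset.sum_comm]
    exact Finset.sum_congr rfl fun p _ => Finset.sum_congr rfl fun q _ => by rw [hS]
  have h2 : (2 : ℝ) • biv γ S = (2 : ℝ) • ((-∑ p, eta p * S p p) • (1 : 𝒜)) := by
    rw [h]
    simp only [hγ _ _, smul_smul, smul_ite, smul_zero, ite_smul, zero_smul, Finset.sum_ite_eq,
      Finset.mem_univ, if_true]
    rw [← Finset.sum_smul, ← Finset.sum_neg_distrib, Finset.mul_sum]
    congr 1
    exact Finset.sum_congr rfl fun p _ => by ring
  exact smul_right_injective 𝒜 (two_ne_zero' ℝ) h2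

section ThreeForm

variable {T : Fin 6 → Fin 6 → Fin 6 → ℝ} (h12 : ∀ p q r, T p q r = -T q p r)
  (h23 : ∀ p q r, T p q r = -T p r q)
include h12 h23

lemma sum_mul_biv : ∑ i, γ i * biv γ (T i) = trivec γ T := by
  simp only [biv, trivec, Finset.mul_sum, mul_smul_comm, mul_assoc]

/-- The sandwich `∑ γ^i c γ_i` multiplies degree `k` by a sign times `6 - 2k`, so it kills the
middle degree 3. Here it follows from `∑ γ^i (γ_i t + t γ_i) = -6 t` and `∑ γ^i γ_i = -6`. -/
lemma sum_sandwich_trivec : ∑ i, eta i • (γ i * trivec γ T * γ i) = 0 := by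
  have h := Finset.sum_congr rfl fun i (_ : i ∈ Finset.univ) =>
    congrArg (fun a => eta i • (γ i * a)) (hγ.anti_trivec h12 h23 i)
  have e1 : ∀ i, eta i • (γ i * (γ i * trivec γ T + trivec γ T * γ i)) =
      (eta i • (γ i * γ i)) * trivec γ T + eta i • (γ i * trivec γ T * γ i) := fun i => by
    rw [mul_add, smul_add, smul_mul_assoc, mul_assoc, mul_assoc]
  have e2 : ∀ i, eta i • (γ i * ((-6 * eta i) • biv γ (T i))) = (-6 : ℝ) • (γ i * biv γ (T i)) :=
    fun i => by
    rw [mul_smul_comm, smul_smul]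
    congr 1
    linear_combination -6 * eta_mul_self i
  simp only [e1, e2, Finset.sum_add_distrib, ← Finset.smul_sum, ← Finset.sum_mul,
    hγ.sum_up_mul, hγ.sum_mul_biv h12 h23] at h
  rw [smul_mul_assoc, one_mul] at h
  exact add_eq_left.1 h

/-- If a 3-form squares to zero, so does the sum of the squares of its contractions. -/
lemma sum_biv_sq (hT : trivec γ T * trivec γ T = 0) :
    ∑ i, eta i • (biv γ (T i) * biv γ (T i)) = 0 := by
  set t := trivec γ T
  -- Contractions of a 3-form are anticommutators with generators. Each term in the sum of their
  -- squares then contains `t * t`, a sandwich of `t`, or the scalar `∑ γ^i γ_i` between two factors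
  -- `t`.
  have hb : ∀ i, biv γ (T i) = (-(1 / 6) * eta i) • (γ i * t + t * γ i) := fun i => by
    rw [hγ.anti_trivec h12 h23 i, smul_smul]
    rw [show -(1 / 6) * eta i * (-6 * eta i) = 1 by linear_combination eta_mul_self i, one_smul]
  have h0 : ∑ i, eta i • (γ i * t * γ i) = 0 := hγ.sum_sandwich_trivec h12 h23
  have h1 : ∀ i, eta i • (biv γ (T i) * biv γ (T i)) = (1 / 36 : ℝ) •
      ((eta i • (γ i * t * γ i)) * t + t * (eta i • (γ i * t * γ i))
        + t * (eta i • (γ i * γ i)) * t) := fun i => by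
    rw [hb, smul_mul_smul_comm, smul_smul]
    rw [show eta i * (-(1 / 6) * eta i * (-(1 / 6) * eta i)) = (1 / 36) * eta i by
      linear_combination (1 / 36 * eta i) * eta_mul_self i, ← smul_smul]
    congr 1
    have e : (γ i * t + t * γ i) * (γ i * t + t * γ i) = γ i * t * γ i * t + t * (γ i * t * γ i)
        + t * (γ i * γ i) * t := by
      have : γ i * t * (t * γ i) = 0 := by
        rw [mul_assoc, ← mul_assoc t, hT, zero_mul, mul_zero]
      rw [mul_add, add_mul, add_mul, this]
      simp only [mul_assoc]
      abel
    rw [e]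
    simp only [smul_add, smul_mul_assoc, mul_smul_comm]
  simp only [h1, ← Finset.smul_sum, Finset.sum_add_distrib, ← Finset.sum_mul, ← Finset.mul_sum, h0,
    hγ.sum_up_mul]
  simp [hT]

end ThreeForm

/-- A bivector is determined by its Clifford element. -/
lemma biv_eq_zero [Nontrivial 𝒜] {S : Fin 6 → Fin 6 → ℝ} (hS : ∀ p q, S p q = -S q p)
    (h : biv γ S = 0) (j k : Fin 6) : S j k = 0 := by
  -- The commutator with `γ_j` extracts a row of `S`, and the anticommutator with `γ_k` then
  -- extracts the entry.
  have h1 := hγ.biv_comm hS j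
  rw [h, zero_mul, mul_zero, sub_zero] at h1
  have h2 : ∑ q, S j q • γ q = 0 :=
    (smul_eq_zero.1 h1.symm).resolve_left (mul_ne_zero four_ne_zero (eta_ne_zero j))
  have h3 : ∑ q, S j q • (γ q * γ k + γ k * γ q) = 0 := by
    have e1 : ∑ q, S j q • (γ q * γ k) = (∑ q, S j q • γ q) * γ k := by
      simp only [Finset.sum_mul, smul_mul_assoc]
    have e2 : ∑ q, S j q • (γ k * γ q) = γ k * ∑ q, S j q • γ q := by
      simp only [Finset.mul_sum, mul_smul_comm]
    simp only [smul_add, Finset.sum_add_distrib]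
    rw [e1, e2, h2, zero_mul, mul_zero, add_zero]
  simp only [hγ _ _, smul_smul, smul_ite, smul_zero, ite_smul, zero_smul, Finset.sum_ite_eq',
    Finset.mem_univ, if_true] at h3
  have h4 := (smul_eq_zero.1 h3).resolve_right one_ne_zero
  have := eta_ne_zero k
  rcases mul_eq_zero.1 h4 with h | h
  · exact h
  · exact absurd h (by simp [this])

/-- There are no self-dual bivectors. -/
lemma biv_eq_zero_of_dual {S : Fin 6 → Fin 6 → ℝ} (hS : ∀ p q, S p q = -S q p) {Γ : 𝒜}
    (hΓ : ∀ i, Γ * γ i = -(γ i * Γ)) (h : biv γ S * Γ = biv γ S) : biv γ S = 0 := by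
  set δ := biv γ S
  -- The sandwich of a bivector is `-2 δ`. As `Γ` anticommutes with the generators, the sandwich of
  -- `δ Γ` has the opposite sign; with `δ Γ = δ` this forces `4 δ = 0`.
  have h1 : ∑ i, eta i • (γ i * δ * γ i) = (-2 : ℝ) • δ := by
    have e : ∀ i, eta i • (γ i * δ * γ i) = (eta i • (γ i * γ i)) * δ +
        (4 : ℝ) • ∑ q, S i q • (γ i * γ q) := fun i => by
      rw [mul_assoc, hγ.biv_mul hS, mul_add, smul_add, ← mul_assoc, smul_mul_assoc, mul_smul_comm,
        smul_smul, Finset.mul_sum, show eta i * (4 * eta i) = 4 by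
          linear_combination 4 * eta_mul_self i]
      simp only [mul_smul_comm]
      rfl
    simp only [e, Finset.sum_add_distrib, ← Finset.sum_mul, hγ.sum_up_mul, ← Finset.smul_sum]
    change _ + (4 : ℝ) • δ = _
    rw [smul_mul_assoc, one_mul, ← add_smul]
    norm_num
  have h2 : ∑ i, eta i • (γ i * (δ * Γ) * γ i) = (2 : ℝ) • δ := by
    have e : ∀ i, eta i • (γ i * (δ * Γ) * γ i) = -((eta i • (γ i * δ * γ i)) * Γ) := fun i => by
      rw [mul_assoc, mul_assoc δ, hΓ, smul_mul_assoc, mul_neg, mul_neg, smul_neg]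
      simp only [mul_assoc]
    simp only [e, Finset.sum_neg_distrib, ← Finset.sum_mul, h1]
    rw [smul_mul_assoc, h, ← neg_smul]
    norm_num
  rw [h, h1] at h2
  have h3 : (4 : ℝ) • δ = 0 := by
    have : (4 : ℝ) • δ = (2 : ℝ) • δ - (-2 : ℝ) • δ := by module
    rw [this, h2, sub_self]
  exact (smul_eq_zero.1 h3).resolve_left four_ne_zero

end IsGamma

end CliffordIdentities


/-! ### Self-dual 3-forms in the Clifford algebra -/

section SelfDual

/-- Adjacent transpositions generate the symmetric group, and each exchanges two anticommuting
neighbours. Quantifying over `c` lets a product `σ τ` be treated by applying the case of `τ` to the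
family `c ∘ σ`. -/
lemma perm_prod_of_anticomm {𝒜 : Type*} [Ring 𝒜] (σ : Equiv.Perm (Fin 6)) : ∀ {c : Fin 6 → 𝒜},
    (∀ i j, i ≠ j → c i * c j = -(c j * c i)) →
    c (σ 0) * c (σ 1) * c (σ 2) * c (σ 3) * c (σ 4) * c (σ 5) =
      (Equiv.Perm.sign σ : ℤ) • (c 0 * c 1 * c 2 * c 3 * c 4 * c 5) := by
  have h : σ ∈ Submonoid.closure
      (Set.range fun i : Fin 5 => Equiv.swap i.castSucc i.succ) := by
    rw [Equiv.Perm.mclosure_swap_castSucc_succ]; trivial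
  induction h using Submonoid.closure_induction with
  | mem s hs =>
    obtain ⟨i, rfl⟩ := hs
    intro c hc
    have hs : Equiv.Perm.sign (Equiv.swap i.castSucc i.succ) = -1 :=
      Equiv.Perm.sign_swap (Fin.castSucc_lt_succ).ne
    simp only [hs]
    fin_cases i
    · change c 1 * c 0 * c 2 * c 3 * c 4 * c 5 = _
      rw [hc 1 0 (by decide)]; simp
    · change c 0 * c 2 * c 1 * c 3 * c 4 * c 5 = _
      rw [mul_assoc (c 0), hc 2 1 (by decide)]; simp [mul_assoc]
    · change c 0 * c 1 * c 3 * c 2 * c 4 * c 5 = _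
      rw [mul_assoc (c 0 * c 1), hc 3 2 (by decide)]; simp [mul_assoc]
    · change c 0 * c 1 * c 2 * c 4 * c 3 * c 5 = _
      rw [mul_assoc (c 0 * c 1 * c 2), hc 4 3 (by decide)]; simp [mul_assoc]
    · change c 0 * c 1 * c 2 * c 3 * c 5 * c 4 = _
      rw [mul_assoc (c 0 * c 1 * c 2 * c 3), hc 5 4 (by decide)]; simp [mul_assoc]
  | one => intro c _; simp
  | mul σ τ _ _ hσ hτ =>
    intro c hc
    have h1 := hτ (c := c ∘ σ) (fun i j h => hc _ _ (σ.injective.ne h))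
    simp only [Function.comp_apply] at h1
    simp only [Equiv.Perm.mul_apply, h1, hσ hc, Equiv.Perm.sign_mul, smul_smul]
    congr 1
    rw [mul_comm]; simp

/-- Every injective triple of indices extends to a permutation. -/
lemma exists_perm_extending {k : ℕ} (hk : k ≤ 6) {f : Fin k → Fin 6} (hf : Function.Injective f) :
    ∃ σ : Equiv.Perm (Fin 6), ∀ i : Fin k, σ (Fin.castLE hk i) = f i := by
  classical
  let F : Fin 6 → Fin 6 := fun j => if h : j.1 < k then f ⟨j.1, h⟩ else 0
  have hF : ∀ i : Fin k, F (Fin.castLE hk i) = f i := fun i => by simp [F]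
  obtain ⟨σ, hσ⟩ := Set.MapsTo.exists_equiv_extend_of_card_eq (α := Fin 6) (s := Set.range (Fin.castLE hk))
    (t := Finset.univ) (f := F) (by simp) (by intro x _; simp) (by
      rintro _ ⟨i, rfl⟩ _ ⟨j, rfl⟩ h
      rw [hF, hF] at h
      rw [hf h])
  refine ⟨σ.trans (Equiv.subtypeUnivEquiv (by simp)), fun i => ?_⟩
  have := hσ _ ⟨i, rfl⟩
  rw [hF] at this
  exact this

lemma exists_perm_triple {p q r : Fin 6} (hpq : p ≠ q) (hpr : p ≠ r) (hqr : q ≠ r) :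
    ∃ σ : Equiv.Perm (Fin 6), σ 0 = p ∧ σ 1 = q ∧ σ 2 = r := by
  obtain ⟨σ, hσ⟩ := exists_perm_extending (k := 3) (by norm_num) (f := ![p, q, r]) (by
    intro i j h
    fin_cases i <;> fin_cases j <;> simp_all)
  exact ⟨σ, hσ 0, hσ 1, hσ 2⟩

/-- Sums over triples of indices as sums over permutations. -/
lemma exists_sum_perm : ∃ N : ℕ, N ≠ 0 ∧ ∀ {W : Type} [AddCommMonoid W]
    (f : Fin 6 → Fin 6 → Fin 6 → W), (∀ p q, f p p q = 0) → (∀ p q, f p q q = 0) →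
    (∀ p q, f p q p = 0) →
    ∑ σ : Equiv.Perm (Fin 6), f (σ 0) (σ 1) (σ 2) = N • ∑ p, ∑ q, ∑ r, f p q r := by
  classical
  -- The constant is the number of permutations with prescribed first three values. Left
  -- multiplication shows that it is the same for all injective triples; only its being nonzero
  -- matters later.
  let S : Fin 6 → Fin 6 → Fin 6 → Finset (Equiv.Perm (Fin 6)) := fun p q r =>
    Finset.univ.filter fun σ => σ 0 = p ∧ σ 1 = q ∧ σ 2 = r
  refine ⟨(S 0 1 2).card, Finset.card_ne_zero_of_mem (a := 1) (by simp [S]), ?_⟩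
  intro W _ f h1 h2 h3
  have hc : ∀ p q r, (S p q r).card • f p q r = (S 0 1 2).card • f p q r := by
    intro p q r
    by_cases hpq : p = q
    · rw [hpq, h1, smul_zero, smul_zero]
    by_cases hqr : q = r
    · rw [hqr, h2, smul_zero, smul_zero]
    by_cases hpr : p = r
    · rw [hpr, h3, smul_zero, smul_zero]
    congr 1
    obtain ⟨τ, a, b, c⟩ := exists_perm_triple hpq hpr hqr
    refine Finset.card_bij' (fun σ _ => τ⁻¹ * σ) (fun σ _ => τ * σ) ?_ ?_ (by simp) (by simp)
    · intro σ hσ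
      simp only [S, Finset.mem_filter, Finset.mem_univ, true_and] at hσ
      simp [S, hσ.1, hσ.2.1, hσ.2.2, Equiv.symm_apply_eq, a, b, c, Equiv.Perm.inv_def]
    · intro σ hσ
      simp only [S, Finset.mem_filter, Finset.mem_univ, true_and] at hσ
      simp [S, hσ.1, hσ.2.1, hσ.2.2, a, b, c]
  simp only [Finset.smul_sum, ← hc]
  have hs : ∀ p q r, (S p q r).card • f p q r =
      ∑ σ : Equiv.Perm (Fin 6), if σ 0 = p ∧ σ 1 = q ∧ σ 2 = r then f p q r else 0 := by
    intro p q r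
    rw [← Finset.sum_filter, Finset.sum_const]
  simp only [hs]
  simp only [Finset.sum_comm (s := (Finset.univ : Finset (Fin 6))) (t := (Finset.univ : Finset (Equiv.Perm (Fin 6))))]
  refine Finset.sum_congr rfl fun σ _ => ?_
  simp [ite_and]

/-- Self-duality of the components `h` of a 3-form in a positive orthonormal basis. -/
def SelfDual3 (h : Fin 6 → Fin 6 → Fin 6 → ℝ) : Prop :=
  ∀ σ : Equiv.Perm (Fin 6), h (σ 0) (σ 1) (σ 2) =
    ((Equiv.Perm.sign σ : ℤ) : ℝ) * (eta (σ 3) * eta (σ 4) * eta (σ 5)) * h (σ 3) (σ 4) (σ 5)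

lemma sign_mul_self_real (σ : Equiv.Perm (Fin 6)) :
    ((Equiv.Perm.sign σ : ℤ) : ℝ) * ((Equiv.Perm.sign σ : ℤ) : ℝ) = 1 := by
  rcases Int.units_eq_one_or (Equiv.Perm.sign σ) with h | h <;> simp [h]

lemma prod_eta_perm (σ : Equiv.Perm (Fin 6)) :
    eta (σ 0) * eta (σ 1) * eta (σ 2) * eta (σ 3) * eta (σ 4) * eta (σ 5) = -1 := by
  have h := Equiv.prod_comp σ eta
  rw [Fin.prod_univ_six, Fin.prod_univ_six] at h
  rw [h]; simp [eta]

/-- The permutation exchanging the first and the last three indices. -/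
def blockSwap : Equiv.Perm (Fin 6) := Equiv.addRight 3

/-- Self-duality turns the norm density on the first three indices into that on the last three, with
the sign `∏ η_i = -1`. Exchanging the two blocks of indices shows that the sums agree, so the norm
equals its negative. -/
lemma SelfDual3.norm_sq_eq_zero {h : Fin 6 → Fin 6 → Fin 6 → ℝ} (hs : SelfDual3 h)
    (h12 : ∀ p q r, h p q r = -h q p r) (h23 : ∀ p q r, h p q r = -h p r q) :
    ∑ p, ∑ q, ∑ r, eta p * eta q * eta r * (h p q r * h p q r) = 0 := by
  obtain ⟨N, hN, hsum⟩ := exists_sum_perm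
  set f : Fin 6 → Fin 6 → Fin 6 → ℝ := fun p q r => eta p * eta q * eta r * (h p q r * h p q r)
  have z1 : ∀ p q, h p p q = 0 := fun p q => by linarith [h12 p p q]
  have z2 : ∀ p q, h p q q = 0 := fun p q => by linarith [h23 p q q]
  have z3 : ∀ p q, h p q p = 0 := fun p q => by linarith [h12 p q p, z2 q p]
  have key := hsum f (by simp [f, z1]) (by simp [f, z2]) (by simp [f, z3])
  have h2 : ∑ σ : Equiv.Perm (Fin 6), f (σ 0) (σ 1) (σ 2) =
      ∑ σ : Equiv.Perm (Fin 6), f (σ 3) (σ 4) (σ 5) :=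
    (Fintype.sum_equiv (Equiv.mulRight blockSwap) _ _ fun σ => rfl).symm
  have h3 : ∀ σ : Equiv.Perm (Fin 6), f (σ 0) (σ 1) (σ 2) = -f (σ 3) (σ 4) (σ 5) := fun σ => by
    have e := prod_eta_perm σ
    have e2 := sign_mul_self_real σ
    simp only [f]
    rw [hs σ]
    generalize ((Equiv.Perm.sign σ : ℤ) : ℝ) = s at *
    have e3 := eta_mul_self (σ 3)
    have e4 := eta_mul_self (σ 4)
    have e5 := eta_mul_self (σ 5)
    generalize eta (σ 0) = a0 at *
    generalize eta (σ 1) = a1 at *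
    generalize eta (σ 2) = a2 at *
    generalize eta (σ 3) = a3 at *
    generalize eta (σ 4) = a4 at *
    generalize eta (σ 5) = a5 at *
    generalize h (σ 3) (σ 4) (σ 5) = t
    calc _ = (a0 * a1 * a2 * a3 * a4 * a5) * (s * s) * (a3 * a4 * a5) * (t * t) := by ring
      _ = _ := by rw [e, e2]; ring
  have h4 : ∑ σ : Equiv.Perm (Fin 6), f (σ 0) (σ 1) (σ 2) = 0 := by
    have : ∑ σ : Equiv.Perm (Fin 6), f (σ 0) (σ 1) (σ 2) =
      -∑ σ : Equiv.Perm (Fin 6), f (σ 3) (σ 4) (σ 5) := by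
      rw [← Finset.sum_neg_distrib]; exact Finset.sum_congr rfl fun σ _ => h3 σ
    linarith
  rw [h4] at key
  have := (smul_eq_zero.1 key.symm).resolve_left hN
  exact this

section Volume

variable {𝒜 : Type} [Ring 𝒜] [Algebra ℝ 𝒜] {γ : Fin 6 → 𝒜}

/-- The volume element `γ_0 ⋯ γ_5`. -/
def volElt (γ : Fin 6 → 𝒜) : 𝒜 := γ 0 * γ 1 * γ 2 * γ 3 * γ 4 * γ 5

namespace IsGamma

variable (hγ : IsGamma γ)
include hγ

/-- The transposition of 0 and `i` puts `γ_i` in front of the volume element up to sign; it then has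
to pass the other five factors, each of which changes the sign. -/
lemma volElt_anti (i : Fin 6) : volElt γ * γ i = -(γ i * volElt γ) := by
  have h := perm_prod_of_anticomm (Equiv.swap 0 i) (c := γ) fun i j h => hγ.anti h
  set σ := Equiv.swap 0 i
  have h0 : σ 0 = i := Equiv.swap_apply_left 0 i
  have hv : volElt γ = (Equiv.Perm.sign σ : ℤ) •
      (γ (σ 0) * γ (σ 1) * γ (σ 2) * γ (σ 3) * γ (σ 4) * γ (σ 5)) := by
    rw [h, smul_smul]
    rcases Int.units_eq_one_or (Equiv.Perm.sign σ) with h | h <;> simp [h, volElt]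
  have ha : ∀ j, j ≠ 0 → γ (σ j) * γ (σ 0) = -(γ (σ 0) * γ (σ j)) := fun j hj =>
    hγ.anti (σ.injective.ne hj)
  rw [hv, ← h0, smul_mul_assoc, mul_smul_comm, ← smul_neg]
  congr 1
  simp only [mul_assoc]
  rw [ha 5 (by decide)]
  simp only [mul_neg, ← mul_assoc]
  rw [mul_assoc _ (γ (σ 4)), ha 4 (by decide)]
  simp only [mul_neg, neg_mul, neg_neg, ← mul_assoc]
  rw [mul_assoc _ (γ (σ 3)), ha 3 (by decide)]
  simp only [mul_neg, neg_mul, ← mul_assoc]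
  rw [mul_assoc _ (γ (σ 2)), ha 2 (by decide)]
  simp only [mul_neg, neg_mul, neg_neg, ← mul_assoc]
  rw [mul_assoc _ (γ (σ 1)), ha 1 (by decide)]
  simp only [mul_neg, neg_mul, ← mul_assoc]

lemma volElt_anti_trivec (h : Fin 6 → Fin 6 → Fin 6 → ℝ) :
    volElt γ * trivec γ h = -(trivec γ h * volElt γ) := by
  simp only [trivec, Finset.mul_sum, Finset.sum_mul, mul_smul_comm, smul_mul_assoc,
    ← Finset.sum_neg_distrib, ← smul_neg]
  refine Finset.sum_congr rfl fun p _ => Finset.sum_congr rfl fun q _ =>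
    Finset.sum_congr rfl fun r _ => ?_
  congr 1
  rw [← mul_assoc, ← mul_assoc, hγ.volElt_anti, neg_mul, mul_assoc (γ p), hγ.volElt_anti, mul_neg,
    neg_neg, ← mul_assoc, mul_assoc, hγ.volElt_anti, mul_neg, mul_assoc (γ p * γ q)]

lemma volElt_comm_biv (S : Fin 6 → Fin 6 → ℝ) : volElt γ * biv γ S = biv γ S * volElt γ := by
  simp only [biv, Finset.mul_sum, Finset.sum_mul, mul_smul_comm, smul_mul_assoc]
  refine Finset.sum_congr rfl fun p _ => Finset.sum_congr rfl fun q _ => ?_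
  congr 1
  rw [← mul_assoc, hγ.volElt_anti, neg_mul, mul_assoc (γ p), hγ.volElt_anti, mul_neg,
    neg_neg, ← mul_assoc]

/-- Clifford multiplication by a self-dual 3-form is chiral. -/
lemma trivec_mul_volElt {h : Fin 6 → Fin 6 → Fin 6 → ℝ} (hs : SelfDual3 h)
    (h12 : ∀ p q r, h p q r = -h q p r) (h23 : ∀ p q r, h p q r = -h p r q) :
    trivec (fun i => eta i • γ i) h * volElt γ = trivec (fun i => eta i • γ i) h := by
  obtain ⟨N, hN, hsum⟩ := exists_sum_perm
  have z1 : ∀ p q, h p p q = 0 := fun p q => by linarith [h12 p p q]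
  have z2 : ∀ p q, h p q q = 0 := fun p q => by linarith [h23 p q q]
  have z3 : ∀ p q, h p q p = 0 := fun p q => by linarith [h12 p q p, z2 q p]
  set f : Fin 6 → Fin 6 → Fin 6 → 𝒜 := fun p q r =>
    h p q r • ((eta p • γ p) * (eta q • γ q) * (eta r • γ r))
  have key := hsum f (by simp [f, z1]) (by simp [f, z2]) (by simp [f, z3])
  have h2 : ∑ σ : Equiv.Perm (Fin 6), f (σ 0) (σ 1) (σ 2) =
      ∑ σ : Equiv.Perm (Fin 6), f (σ 3) (σ 4) (σ 5) :=
    (Fintype.sum_equiv (Equiv.mulRight blockSwap) _ _ fun σ => rfl).symm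
  -- The volume element is written in the order of `σ`: its first three factors are absorbed by the
  -- monomial up to a scalar, and self-duality identifies the coefficient of the complementary
  -- monomial.
  have h3 : ∀ σ : Equiv.Perm (Fin 6), f (σ 0) (σ 1) (σ 2) * volElt γ = f (σ 3) (σ 4) (σ 5) := by
    intro σ
    have hp := perm_prod_of_anticomm σ (c := γ) fun i j h => hγ.anti h
    have hv : volElt γ = ((Equiv.Perm.sign σ : ℤ) : ℝ) •
        (γ (σ 0) * γ (σ 1) * γ (σ 2) * γ (σ 3) * γ (σ 4) * γ (σ 5)) := by
      rw [hp, ← Int.cast_smul_eq_zsmul ℝ, smul_smul, sign_mul_self_real, one_smul]; rfl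
    have hu : (γ (σ 0) * γ (σ 1) * γ (σ 2)) * (γ (σ 0) * γ (σ 1) * γ (σ 2)) =
        (eta (σ 0) * eta (σ 1) * eta (σ 2)) • (1 : 𝒜) := by
      have e : (γ (σ 0) * γ (σ 1) * γ (σ 2)) * (γ (σ 0) * γ (σ 1) * γ (σ 2)) =
          -((γ (σ 0) * γ (σ 0)) * ((γ (σ 1) * γ (σ 1)) * (γ (σ 2) * γ (σ 2)))) := by
        have a20 : γ (σ 2) * γ (σ 0) = -(γ (σ 0) * γ (σ 2)) := hγ.anti (σ.injective.ne (by decide))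
        have a21 : γ (σ 2) * γ (σ 1) = -(γ (σ 1) * γ (σ 2)) := hγ.anti (σ.injective.ne (by decide))
        have a10 : γ (σ 1) * γ (σ 0) = -(γ (σ 0) * γ (σ 1)) := hγ.anti (σ.injective.ne (by decide))
        rw [mul_assoc (γ (σ 0) * γ (σ 1)), ← mul_assoc (γ (σ 2)), ← mul_assoc (γ (σ 2)), a20]
        simp only [neg_mul, mul_neg]
        rw [mul_assoc (γ (σ 0)) (γ (σ 2)), a21]
        simp only [neg_mul, mul_neg, neg_neg, mul_assoc]
        rw [← mul_assoc (γ (σ 1)) (γ (σ 0)), a10]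
        simp only [neg_mul, mul_neg, mul_assoc]
      rw [e, hγ.sq, hγ.sq, hγ.sq, smul_mul_smul_comm, smul_mul_smul_comm, ← neg_smul]
      simp only [mul_one]
      congr 1; ring
    have hm : f (σ 0) (σ 1) (σ 2) * volElt γ =
        (h (σ 0) (σ 1) (σ 2) * ((Equiv.Perm.sign σ : ℤ) : ℝ)) • (γ (σ 3) * γ (σ 4) * γ (σ 5)) := by
      rw [hv]
      simp only [f, smul_mul_assoc, mul_smul_comm, smul_smul]
      have : γ (σ 0) * γ (σ 1) * γ (σ 2) *
          (γ (σ 0) * γ (σ 1) * γ (σ 2) * γ (σ 3) * γ (σ 4) * γ (σ 5)) =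
          (eta (σ 0) * eta (σ 1) * eta (σ 2)) • (γ (σ 3) * γ (σ 4) * γ (σ 5)) := by
        rw [← one_mul (γ (σ 3) * γ (σ 4) * γ (σ 5)), ← smul_mul_assoc, ← hu]
        simp only [mul_assoc]
      rw [this, smul_smul]
      congr 1
      linear_combination (h (σ 0) (σ 1) (σ 2) * ((Equiv.Perm.sign σ : ℤ) : ℝ)) * (
        eta (σ 1) * eta (σ 1) * eta (σ 2) * eta (σ 2) * eta_mul_self (σ 0)
        + eta (σ 2) * eta (σ 2) * eta_mul_self (σ 1) + eta_mul_self (σ 2))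
    rw [hm, hs σ]
    simp only [f, smul_mul_assoc, mul_smul_comm, smul_smul]
    congr 1
    linear_combination (eta (σ 3) * eta (σ 4) * eta (σ 5) * h (σ 3) (σ 4) (σ 5)) *
      sign_mul_self_real σ
  have h4 : ((N : ℝ)) • (trivec (fun i => eta i • γ i) h * volElt γ) =
      (N : ℝ) • trivec (fun i => eta i • γ i) h := by
    have : (∑ σ : Equiv.Perm (Fin 6), f (σ 0) (σ 1) (σ 2)) * volElt γ =
        ∑ σ : Equiv.Perm (Fin 6), f (σ 0) (σ 1) (σ 2) := by
      rw [Finset.sum_mul, h2]; exact Finset.sum_congr rfl fun σ _ => h3 σ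
    rw [key, smul_mul_assoc] at this
    rw [Nat.cast_smul_eq_nsmul, Nat.cast_smul_eq_nsmul]
    exact this
  exact smul_right_injective 𝒜 (Nat.cast_ne_zero.2 hN : (N : ℝ) ≠ 0) h4

/-- With `t ω = t` and `ω t = -t ω` for the volume element `ω`, one gets `t t = t ω t = -t t ω = -t
t`. -/
lemma trivec_sq_eq_zero {h : Fin 6 → Fin 6 → Fin 6 → ℝ} (hs : SelfDual3 h)
    (h12 : ∀ p q r, h p q r = -h q p r) (h23 : ∀ p q r, h p q r = -h p r q) :
    trivec (fun i => eta i • γ i) h * trivec (fun i => eta i • γ i) h = 0 := by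
  set t := trivec (fun i => eta i • γ i) h with ht
  have h1 : t * volElt γ = t := hγ.trivec_mul_volElt hs h12 h23
  have h2 : volElt γ * t = -(t * volElt γ) := by
    have : t = trivec γ (fun p q r => eta p * eta q * eta r * h p q r) := by
      simp only [ht, trivec, smul_mul_assoc, mul_smul_comm, smul_smul]
      refine Finset.sum_congr rfl fun p _ => Finset.sum_congr rfl fun q _ =>
        Finset.sum_congr rfl fun r _ => ?_
      congr 1; ring
    rw [this, hγ.volElt_anti_trivec]
  have h3 : t * t = -(t * t) := by
    calc t * t = t * volElt γ * t := by rw [h1]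
      _ = _ := by rw [mul_assoc, h2, h1, mul_neg]
  have h4 : (2 : ℝ) • (t * t) = 0 := by
    rw [two_smul]
    nth_rewrite 1 [h3]
    exact neg_add_cancel _
  exact (smul_eq_zero.1 h4).resolve_left two_ne_zero

end IsGamma

end Volume

end SelfDual

/-! ### The gamma matrices satisfy the Clifford relations -/

section Gamma

lemma pauli1_sq : pauli1 * pauli1 = 1 := by
  ext i j; fin_cases i <;> fin_cases j <;> simp [pauli1, Matrix.mul_apply]
lemma pauli2_sq : pauli2 * pauli2 = 1 := by
  ext i j; fin_cases i <;> fin_cases j <;> simp [pauli2, Matrix.mul_apply]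
lemma pauli3_sq : pauli3 * pauli3 = 1 := by
  ext i j; fin_cases i <;> fin_cases j <;> simp [pauli3, Matrix.mul_apply]
lemma pauli21 : pauli2 * pauli1 = -(pauli1 * pauli2) := by
  ext i j; fin_cases i <;> fin_cases j <;> simp [pauli1, pauli2, Matrix.mul_apply]
lemma pauli31 : pauli3 * pauli1 = -(pauli1 * pauli3) := by
  ext i j; fin_cases i <;> fin_cases j <;> simp [pauli1, pauli3, Matrix.mul_apply]
lemma pauli32 : pauli3 * pauli2 = -(pauli2 * pauli3) := by
  ext i j; fin_cases i <;> fin_cases j <;> simp [pauli2, pauli3, Matrix.mul_apply]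

lemma neg_kron {m n : Type*} (a : Matrix m m ℂ) (b : Matrix n n ℂ) :
    (-a) ⊗ₖ b = -(a ⊗ₖ b) := by
  ext; simp [Matrix.kroneckerMap_apply]

lemma kron_neg {m n : Type*} (a : Matrix m m ℂ) (b : Matrix n n ℂ) :
    a ⊗ₖ (-b) = -(a ⊗ₖ b) := by
  ext; simp [Matrix.kroneckerMap_apply]

lemma isGamma_gam : IsGamma gam := by
  have e0 : gam 0 = Complex.I • (pauli1 ⊗ₖ ((1 : Matrix (Fin 2) (Fin 2) ℂ) ⊗ₖ (1 : Matrix (Fin 2) (Fin 2) ℂ))) := rfl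
  have e1 : gam 1 = pauli2 ⊗ₖ ((1 : Matrix (Fin 2) (Fin 2) ℂ) ⊗ₖ (1 : Matrix (Fin 2) (Fin 2) ℂ)) := rfl
  have e2 : gam 2 = pauli3 ⊗ₖ (pauli1 ⊗ₖ (1 : Matrix (Fin 2) (Fin 2) ℂ)) := rfl
  have e3 : gam 3 = pauli3 ⊗ₖ (pauli2 ⊗ₖ (1 : Matrix (Fin 2) (Fin 2) ℂ)) := rfl
  have e4 : gam 4 = pauli3 ⊗ₖ (pauli3 ⊗ₖ pauli1) := rfl
  have e5 : gam 5 = pauli3 ⊗ₖ (pauli3 ⊗ₖ pauli2) := rfl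
  -- The relation is symmetric in the two indices, so only the ordered pairs are computed.
  have half : ∀ i j, i ≤ j →
      gam i * gam j + gam j * gam i = (if i = j then -2 * eta i else 0) • (1 : SpinMat) := by
    intro i j hij
    fin_cases i <;> fin_cases j <;> first
      | exact absurd hij (by decide)
      | (simp [e0, e1, e2, e3, e4, e5, ← Matrix.mul_kronecker_mul, pauli1_sq, pauli2_sq, pauli3_sq,
          pauli21, pauli31, pauli32, neg_kron, kron_neg, eta, smul_smul, neg_smul, two_smul]
         try module)
  intro i j
  rcases le_total i j with h | h
  · exact half i j h
  · rw [add_comm, half j i h]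
    by_cases e : i = j
    · rw [e]
    · rw [if_neg e, if_neg (Ne.symm e)]

end Gamma


/-! ### The generalized Hodge star on mixed forms -/

section Star

variable {V : Type*} [AddCommGroup V] [Module ℝ V]

lemma cliffAct_succ (v : V) (ξ : Module.Dual ℝ V) (α : MixedForm V) (k : ℕ) (w : Fin (k + 1) → V) :
    cliffAct v ξ α (k + 1) w = α (k + 2) (Fin.cons v w) +
      ∑ i : Fin (k + 1), (-1) ^ (i : ℕ) * (ξ (w i) * α k (i.removeNth w)) := by
  change (α (k + 2)) (Fin.cons v w) + AlternatingMap.alternatizeUncurryFin _ w = _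
  rw [AlternatingMap.alternatizeUncurryFin_apply]
  simp

/-- When the covector kills all arguments only the contraction survives, which adds `v` as an
argument. In `cliffAct_cons` below `v` is already an argument: the contraction vanishes and the
wedge removes it. In an orthonormal basis these are the only two cases. -/
lemma cliffAct_of_perp {v : V} {ξ : Module.Dual ℝ V} (α : MixedForm V) {k : ℕ} {w : Fin k → V}
    (h : ∀ i, ξ (w i) = 0) : cliffAct v ξ α k w = α (k + 1) (Fin.cons v w) := by
  cases k with
  | zero => rfl
  | succ k => simp [cliffAct_succ, h]

lemma cliffAct_cons {v : V} {ξ : Module.Dual ℝ V} (α : MixedForm V) {k : ℕ} {w : Fin k → V}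
    (h : ∀ i, ξ (w i) = 0) :
    cliffAct v ξ α (k + 1) (Fin.cons v w) = ξ v * α k w := by
  rw [cliffAct_succ, Fin.sum_univ_succ]
  have : (α (k + 2)) (Fin.cons v (Fin.cons v w)) = 0 :=
    (α (k + 2)).map_eq_zero_of_eq _ (i := 0) (j := 1) rfl (by simp)
  rw [this]
  simp [h]

/-- `v + ξ` as an endomorphism of the mixed forms. -/
def cliffEnd (v : V) (ξ : Module.Dual ℝ V) : Module.End ℝ (MixedForm V) where
  toFun := cliffAct v ξ
  map_add' α β := by
    funext k; ext w
    cases k with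
    | zero => rfl
    | succ k =>
      simp only [Pi.add_apply, AlternatingMap.add_apply, cliffAct_succ, mul_add,
        Finset.sum_add_distrib]
      ring
  map_smul' r α := by
    funext k; ext w
    cases k with
    | zero => rfl
    | succ k =>
      simp only [Pi.smul_apply, AlternatingMap.smul_apply, cliffAct_succ, smul_eq_mul, mul_add,
        Finset.mul_sum, RingHom.id_apply]
      congr 1
      exact Finset.sum_congr rfl fun i _ => by ring

/-- The 1-form `ξ` wedged with `α`, in degree `k + 1`. -/
def wedgeOne (ξ : Module.Dual ℝ V) {k : ℕ} (α : V [⋀^Fin k]→ₗ[ℝ] ℝ) : V [⋀^Fin (k + 1)]→ₗ[ℝ] ℝ :=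
  AlternatingMap.alternatizeUncurryFin (LinearMap.smulRight ξ α)

lemma wedgeOne_apply (ξ : Module.Dual ℝ V) {k : ℕ} (α : V [⋀^Fin k]→ₗ[ℝ] ℝ) (w : Fin (k + 1) → V) :
    wedgeOne ξ α w = ∑ i : Fin (k + 1), (-1) ^ (i : ℕ) * (ξ (w i) * α (i.removeNth w)) := by
  rw [wedgeOne, AlternatingMap.alternatizeUncurryFin_apply]
  simp

/-- Contraction is an antiderivation of the wedge product; the first summand of the alternating sum
is the term in which `ξ` meets `v`. -/
lemma wedgeOne_cons (ξ : Module.Dual ℝ V) {k : ℕ} (α : V [⋀^Fin (k + 1)]→ₗ[ℝ] ℝ) (v : V)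
    (w : Fin (k + 1) → V) : wedgeOne ξ α (Fin.cons v w) =
      ξ v * α w - wedgeOne ξ (α.curryLeft v) w := by
  rw [wedgeOne_apply, wedgeOne_apply, Fin.sum_univ_succ, sub_eq_add_neg, ← Finset.sum_neg_distrib]
  congr 1
  · simp
  · refine Finset.sum_congr rfl fun i _ => ?_
    have : Fin.removeNth i.succ (Fin.cons v w : Fin (k + 2) → V) = Fin.cons v (i.removeNth w) := by
      funext l
      refine Fin.cases ?_ (fun l => ?_) l <;> simp [Fin.removeNth_apply]
    rw [this]
    change (-1) ^ (i.succ : ℕ) * (ξ (w i) * _) = -((-1) ^ (i : ℕ) * (ξ (w i) * α (Fin.cons v _)))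
    rw [Fin.val_succ, pow_succ]
    ring

/-- Alternating twice kills a tensor symmetric in its first two slots, here `ξ ⊗ ζ + ζ ⊗ ξ`. -/
lemma wedgeOne_anticomm (ξ ζ : Module.Dual ℝ V) {k : ℕ} (α : V [⋀^Fin k]→ₗ[ℝ] ℝ) :
    wedgeOne ξ (wedgeOne ζ α) + wedgeOne ζ (wedgeOne ξ α) = 0 := by
  have h := AlternatingMap.alternatizeUncurryFin_alternatizeUncurryFinLM_comp_of_symmetric
    (f := LinearMap.smulRight ξ (LinearMap.smulRight ζ α) +
      LinearMap.smulRight ζ (LinearMap.smulRight ξ α)) (fun x y => by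
        simp only [LinearMap.add_apply, LinearMap.smulRight_apply, LinearMap.smul_apply]
        rw [smul_comm (ξ x), smul_comm (ζ x), add_comm])
  rw [← h, LinearMap.comp_add, AlternatingMap.alternatizeUncurryFin_add]
  congr 1 <;>
  · rw [wedgeOne]
    congr 1
    ext x w
    simp [wedgeOne]

lemma curryLeft_swap {k : ℕ} (α : V [⋀^Fin (k + 2)]→ₗ[ℝ] ℝ) (u v : V) :
    (α.curryLeft u).curryLeft v = -(α.curryLeft v).curryLeft u := by
  ext w
  change α (Fin.cons u (Fin.cons v w)) = -α (Fin.cons v (Fin.cons u w))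
  rw [← α.map_swap _ (show (0 : Fin (k + 2)) ≠ 1 by simp)]
  congr 1
  funext i
  refine Fin.cases ?_ (fun i => Fin.cases ?_ (fun i => ?_) i) i
  · simp
  · simp
  · have h1 : Equiv.swap (0 : Fin (k + 2)) 1 i.succ.succ = i.succ.succ :=
      Equiv.swap_apply_of_ne_of_ne (by simp) (by simp [Fin.ext_iff])
    simp [h1]

lemma cliffAct_zero_eq (v : V) (ξ : Module.Dual ℝ V) (α : MixedForm V) :
    cliffAct v ξ α 0 = (α 1).curryLeft v := rfl

lemma cliffAct_succ_eq (v : V) (ξ : Module.Dual ℝ V) (α : MixedForm V) (k : ℕ) :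
    cliffAct v ξ α (k + 1) = (α (k + 2)).curryLeft v + wedgeOne ξ (α k) := rfl

lemma wedgeOne_add (ξ : Module.Dual ℝ V) {k : ℕ} (α β : V [⋀^Fin k]→ₗ[ℝ] ℝ) :
    wedgeOne ξ (α + β) = wedgeOne ξ α + wedgeOne ξ β := by
  ext w
  simp [wedgeOne_apply, mul_add, Finset.sum_add_distrib]

lemma curryLeft_wedgeOne (ξ : Module.Dual ℝ V) {k : ℕ} (α : V [⋀^Fin (k + 1)]→ₗ[ℝ] ℝ) (v : V) :
    (wedgeOne ξ α).curryLeft v = ξ v • α - wedgeOne ξ (α.curryLeft v) := by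
  ext w
  exact wedgeOne_cons ξ α v w

lemma curryLeft_wedgeOne_zero (ξ : Module.Dual ℝ V) (α : V [⋀^Fin 0]→ₗ[ℝ] ℝ) (v : V) :
    (wedgeOne ξ α).curryLeft v = ξ v • α := by
  ext w
  change wedgeOne ξ α (Fin.cons v w) = _
  rw [wedgeOne_apply]
  simp

/-- The Clifford relation. -/
lemma cliffAct_anticomm (u v : V) (ξ ζ : Module.Dual ℝ V) (α : MixedForm V) (k : ℕ) :
    cliffAct u ξ (cliffAct v ζ α) k + cliffAct v ζ (cliffAct u ξ α) k = (ξ v + ζ u) • α k := by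
  -- Degrees 0 and 1 stand apart because no wedge lands in degree 0, and the contraction of `ξ ∧ α`
  -- loses its second term when `α` has degree 0.
  match k with
  | 0 =>
    simp only [cliffAct_zero_eq, cliffAct_succ_eq, AlternatingMap.curryLeft_add,
      LinearMap.add_apply, curryLeft_wedgeOne_zero]
    rw [curryLeft_swap]
    module
  | 1 =>
    simp only [cliffAct_zero_eq, cliffAct_succ_eq, AlternatingMap.curryLeft_add,
      LinearMap.add_apply, curryLeft_wedgeOne]
    rw [curryLeft_swap]
    module
  | k + 2 =>
    simp only [cliffAct_succ_eq, AlternatingMap.curryLeft_add,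
      LinearMap.add_apply, curryLeft_wedgeOne, wedgeOne_add]
    rw [curryLeft_swap]
    rw [show wedgeOne ζ (wedgeOne ξ (α k)) = -wedgeOne ξ (wedgeOne ζ (α k)) from
      eq_neg_of_add_eq_zero_right (wedgeOne_anticomm ξ ζ (α k))]
    module

/-- An alternating form vanishes if it vanishes on the tuples of distinct basis vectors. -/
lemma alternating_eq_zero_of_perm (b : Module.Basis (Fin 6) ℝ V) {k : ℕ} {θ : V [⋀^Fin k]→ₗ[ℝ] ℝ}
    (h : ∀ (hk : k ≤ 6) (σ : Equiv.Perm (Fin 6)), θ (fun i => b (σ (Fin.castLE hk i))) = 0) :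
    θ = 0 := by
  refine Module.Basis.ext_alternating b fun f hf => ?_
  have hk : k ≤ 6 := by simpa using Fintype.card_le_of_injective f hf
  obtain ⟨σ, hσ⟩ := exists_perm_extending hk hf
  have := h hk σ
  simp only [hσ] at this
  simpa using this

section Frame

variable {g : LinearMap.BilinForm ℝ V} {v : Fin 6 → V} {ε : Fin 6 → ℝ}
  (hv : ∀ i j, g (v i) (v j) = if i = j then ε i else 0)
include hv

lemma cliffEnd_of_perp (α : MixedForm V) {k : ℕ} {m : Fin k → Fin 6} {q : Fin 6}
    (h : ∀ i, m i ≠ q) : cliffEnd (v q) (g (v q)) α k (v ∘ m) = α (k + 1) (v ∘ Fin.cons q m) := by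
  rw [Fin.comp_cons]
  exact cliffAct_of_perp α fun i => by rw [Function.comp_apply, hv, if_neg (h i).symm]

lemma cliffEnd_cons (α : MixedForm V) {k : ℕ} {m : Fin k → Fin 6} {q : Fin 6}
    (h : ∀ i, m i ≠ q) :
    cliffEnd (v q) (g (v q)) α (k + 1) (v ∘ Fin.cons q m) = ε q * α k (v ∘ m) := by
  rw [Fin.comp_cons]
  have := cliffAct_cons (v := v q) (ξ := g (v q)) α (w := v ∘ m) fun i => by
    rw [Function.comp_apply, hv, if_neg (h i).symm]
  rw [hv, if_pos rfl] at this
  exact this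

end Frame

section Orthonormal

variable {g : LinearMap.BilinForm ℝ V} {b : Module.Basis (Fin 6) ℝ V} (hb : IsOrtho g b)
include hb

lemma cliffEnd_anticomm (i j : Fin 6) (hij : i ≠ j) :
    cliffEnd (b i) (g (b i)) * cliffEnd (b j) (g (b j)) =
      -(cliffEnd (b j) (g (b j)) * cliffEnd (b i) (g (b i))) := by
  refine LinearMap.ext fun α => ?_
  funext k
  change cliffAct _ _ (cliffAct _ _ α) k = -cliffAct _ _ (cliffAct _ _ α) k
  refine eq_neg_of_add_eq_zero_left ?_
  have h := cliffAct_anticomm (b i) (b j) (g (b i)) (g (b j)) α k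
  rw [hb, hb, if_neg hij, if_neg hij.symm, add_zero, zero_smul] at h
  exact h

/-- The Clifford operators of an orthonormal basis anticommute, so they may be reordered up to sign.
Reversing six factors is an odd permutation, which cancels the `-1` in the definition of the star.
-/
lemma genStar_eq_perm (α : MixedForm V) (σ : Equiv.Perm (Fin 6)) :
    let c : Fin 6 → Module.End ℝ (MixedForm V) := fun i => cliffEnd (b i) (g (b i))
    genStar g b α = ((Equiv.Perm.sign σ : ℤ) : ℝ) •
      c (σ 0) (c (σ 1) (c (σ 2) (c (σ 3) (c (σ 4) (c (σ 5) α))))) := by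
  intro c
  have h1 := perm_prod_of_anticomm Fin.revPerm (c := c) (cliffEnd_anticomm hb)
  have h2 := perm_prod_of_anticomm σ (c := c) (cliffEnd_anticomm hb)
  have hs : (Equiv.Perm.sign (Fin.revPerm : Equiv.Perm (Fin 6)) : ℤ) = -1 := by decide
  rw [hs] at h1
  have h3 : genStar g b α = -(c 5 * c 4 * c 3 * c 2 * c 1 * c 0) α := by
    change (-1 : ℝ) • _ = -_
    funext k; ext w
    change (-1 : ℝ) * _ = -_
    rw [neg_one_mul]; rfl
  have h4 : c 5 * c 4 * c 3 * c 2 * c 1 * c 0 = -(c 0 * c 1 * c 2 * c 3 * c 4 * c 5) :=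
    h1.trans (neg_one_zsmul _)
  have h5 : c 0 * c 1 * c 2 * c 3 * c 4 * c 5 = (Equiv.Perm.sign σ : ℤ) •
      (c (σ 0) * c (σ 1) * c (σ 2) * c (σ 3) * c (σ 4) * c (σ 5)) := by
    rw [h2, smul_smul]
    rcases Int.units_eq_one_or (Equiv.Perm.sign σ) with h | h <;> simp [h]
  rw [h3, h4, LinearMap.neg_apply, neg_neg, h5]
  exact Eq.trans rfl (Int.cast_smul_eq_zsmul ℝ (Equiv.Perm.sign σ : ℤ) _).symm

/-- Evaluate the star on the first `k` vectors of a permuted basis with the operators in the same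
order. The first `k` operators strip the arguments and the remaining `6 - k` contract, so the result
is a component in degree `6 - k`. Only `k = 3` meets the given form, and there the value is the
right-hand side of `SelfDual3`. -/
lemma genStar_eq_self_iff (θ : V [⋀^Fin 3]→ₗ[ℝ] ℝ) :
    genStar g b (Pi.single 3 θ) = Pi.single 3 θ ↔
      SelfDual3 fun p q r => tri θ (b p) (b q) (b r) := by
  set α : MixedForm V := Pi.single 3 θ with hα
  have α3 : α 3 = θ := by rw [hα, Pi.single_eq_same]
  have α0 : ∀ k, k ≠ 3 → α k = 0 := fun k hk => by rw [hα, Pi.single_eq_of_ne hk]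
  have hv : ∀ σ : Equiv.Perm (Fin 6), ∀ i j, g ((b ∘ σ) i) ((b ∘ σ) j) =
      if i = j then (eta ∘ σ) i else 0 := fun σ i j => by
    simp only [Function.comp_apply, hb _ _, σ.injective.eq_iff]
  have key : ∀ σ : Equiv.Perm (Fin 6),
      genStar g b α 3 ((b ∘ σ) ∘ Fin.cons 0 (Fin.cons 1 (Fin.cons 2 ![]))) =
      ((Equiv.Perm.sign σ : ℤ) : ℝ) * (eta (σ 3) * eta (σ 4) * eta (σ 5)) *
        tri θ (b (σ 3)) (b (σ 4)) (b (σ 5)) := by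
    intro σ
    rw [genStar_eq_perm hb α σ]
    change _ * (cliffEnd ((b ∘ σ) 0) (g ((b ∘ σ) 0)) (cliffEnd ((b ∘ σ) 1) (g ((b ∘ σ) 1))
      (cliffEnd ((b ∘ σ) 2) (g ((b ∘ σ) 2)) (cliffEnd ((b ∘ σ) 3) (g ((b ∘ σ) 3))
      (cliffEnd ((b ∘ σ) 4) (g ((b ∘ σ) 4)) (cliffEnd ((b ∘ σ) 5) (g ((b ∘ σ) 5)) α)))))) 3 _ = _
    rw [cliffEnd_cons (hv σ), cliffEnd_cons (hv σ), cliffEnd_cons (hv σ), cliffEnd_of_perp (hv σ),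
      cliffEnd_of_perp (hv σ), cliffEnd_of_perp (hv σ)]
    · have h1 : α 3 ((b ∘ σ) ∘ Fin.cons 5 (Fin.cons 4 (Fin.cons 3 ![]))) =
          -tri θ (b (σ 3)) (b (σ 4)) (b (σ 5)) := by
        rw [α3, tri_skew12, tri_skew23, tri_skew12, neg_neg, neg_neg, tri_apply]
        congr 1
        funext i; fin_cases i <;> rfl
      have h2 := prod_eta_perm σ
      have e3 := eta_mul_self (σ 3)
      have e4 := eta_mul_self (σ 4)
      have e5 := eta_mul_self (σ 5)
      rw [h1]
      simp only [Function.comp_apply]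
      generalize ((Equiv.Perm.sign σ : ℤ) : ℝ) = s at *
      generalize tri θ (b (σ 3)) (b (σ 4)) (b (σ 5)) = t at *
      -- The product of all six signs is `-1`; this minus sign cancels the one from reversing the
      -- last three arguments.
      have e : eta (σ 0) * eta (σ 1) * eta (σ 2) = -(eta (σ 3) * eta (σ 4) * eta (σ 5)) := by
        calc _ = (eta (σ 0) * eta (σ 1) * eta (σ 2)) * (eta (σ 3) * eta (σ 3)) *
              (eta (σ 4) * eta (σ 4)) * (eta (σ 5) * eta (σ 5)) := by rw [e3, e4, e5]; ring
          _ = (eta (σ 0) * eta (σ 1) * eta (σ 2) * eta (σ 3) * eta (σ 4) * eta (σ 5)) *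
              (eta (σ 3) * eta (σ 4) * eta (σ 5)) := by ring
          _ = _ := by rw [h2]; ring
      linear_combination (-s * t) * e
    all_goals decide
  have htri : ∀ σ : Equiv.Perm (Fin 6), θ ((b ∘ σ) ∘ Fin.cons 0 (Fin.cons 1 (Fin.cons 2 ![]))) =
      tri θ (b (σ 0)) (b (σ 1)) (b (σ 2)) := fun σ => by
    rw [tri_apply]
    congr 1
    funext i; fin_cases i <;> rfl
  constructor
  · intro h σ
    have h1 := key σ
    rw [h, α3, htri] at h1
    exact h1
  · intro h
    funext k
    refine sub_eq_zero.1 (alternating_eq_zero_of_perm b fun hk σ => ?_)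
    rw [AlternatingMap.sub_apply, sub_eq_zero]
    have hX := genStar_eq_perm hb α σ
    by_cases hk3 : k = 3
    · subst hk3
      have e : (fun i : Fin 3 => b (σ (Fin.castLE hk i))) =
          (b ∘ σ) ∘ Fin.cons 0 (Fin.cons 1 (Fin.cons 2 ![])) := by
        funext i; fin_cases i <;> rfl
      rw [e, key, α3, htri]
      exact (h σ).symm
    rw [hX, α0 k hk3]
    change _ * (cliffEnd ((b ∘ σ) 0) (g ((b ∘ σ) 0)) (cliffEnd ((b ∘ σ) 1) (g ((b ∘ σ) 1))
      (cliffEnd ((b ∘ σ) 2) (g ((b ∘ σ) 2)) (cliffEnd ((b ∘ σ) 3) (g ((b ∘ σ) 3))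
      (cliffEnd ((b ∘ σ) 4) (g ((b ∘ σ) 4)) (cliffEnd ((b ∘ σ) 5) (g ((b ∘ σ) 5)) α)))))) k _ = 0
    refine mul_eq_zero_of_right _ ?_
    have hcases : k = 0 ∨ k = 1 ∨ k = 2 ∨ k = 4 ∨ k = 5 ∨ k = 6 := by omega
    rcases hcases with rfl | rfl | rfl | rfl | rfl | rfl
    · rw [show (fun i : Fin 0 => b (σ (Fin.castLE hk i))) = (b ∘ σ) ∘ ![] from
        funext fun i => i.elim0]
      rw [cliffEnd_of_perp (hv σ), cliffEnd_of_perp (hv σ), cliffEnd_of_perp (hv σ),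
        cliffEnd_of_perp (hv σ), cliffEnd_of_perp (hv σ), cliffEnd_of_perp (hv σ)]
      · simp [α0]
      all_goals decide
    · rw [show (fun i : Fin 1 => b (σ (Fin.castLE hk i))) = (b ∘ σ) ∘ Fin.cons 0 ![] from
        funext fun i => by fin_cases i; rfl]
      rw [cliffEnd_cons (hv σ), cliffEnd_of_perp (hv σ), cliffEnd_of_perp (hv σ),
        cliffEnd_of_perp (hv σ), cliffEnd_of_perp (hv σ), cliffEnd_of_perp (hv σ)]
      · simp [α0]
      all_goals decide
    · rw [show (fun i : Fin 2 => b (σ (Fin.castLE hk i))) = (b ∘ σ) ∘ Fin.cons 0 (Fin.cons 1 ![])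
        from funext fun i => by fin_cases i <;> rfl]
      rw [cliffEnd_cons (hv σ), cliffEnd_cons (hv σ), cliffEnd_of_perp (hv σ),
        cliffEnd_of_perp (hv σ), cliffEnd_of_perp (hv σ), cliffEnd_of_perp (hv σ)]
      · simp [α0]
      all_goals decide
    · rw [show (fun i : Fin 4 => b (σ (Fin.castLE hk i))) = (b ∘ σ) ∘
        Fin.cons 0 (Fin.cons 1 (Fin.cons 2 (Fin.cons 3 ![]))) from
        funext fun i => by fin_cases i <;> rfl]
      rw [cliffEnd_cons (hv σ), cliffEnd_cons (hv σ), cliffEnd_cons (hv σ), cliffEnd_cons (hv σ),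
        cliffEnd_of_perp (hv σ), cliffEnd_of_perp (hv σ)]
      · simp [α0]
      all_goals decide
    · rw [show (fun i : Fin 5 => b (σ (Fin.castLE hk i))) = (b ∘ σ) ∘
        Fin.cons 0 (Fin.cons 1 (Fin.cons 2 (Fin.cons 3 (Fin.cons 4 ![])))) from
        funext fun i => by fin_cases i <;> rfl]
      rw [cliffEnd_cons (hv σ), cliffEnd_cons (hv σ), cliffEnd_cons (hv σ), cliffEnd_cons (hv σ),
        cliffEnd_cons (hv σ), cliffEnd_of_perp (hv σ)]
      · simp [α0]
      all_goals decide
    · rw [show (fun i : Fin 6 => b (σ (Fin.castLE hk i))) = (b ∘ σ) ∘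
        Fin.cons 0 (Fin.cons 1 (Fin.cons 2 (Fin.cons 3 (Fin.cons 4 (Fin.cons 5 ![]))))) from
        funext fun i => by fin_cases i <;> rfl]
      rw [cliffEnd_cons (hv σ), cliffEnd_cons (hv σ), cliffEnd_cons (hv σ), cliffEnd_cons (hv σ),
        cliffEnd_cons (hv σ), cliffEnd_cons (hv σ)]
      · simp [α0]
      all_goals decide

end Orthonormal

end Star


/-! ### The Hodge star in components -/

section Hodge

variable {V : Type*} [AddCommGroup V] [Module ℝ V]

lemma alternating_sum_apply {ι : Type*} {k : ℕ} (s : Finset ι) (f : ι → V [⋀^Fin k]→ₗ[ℝ] ℝ)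
    (v : Fin k → V) : (∑ i ∈ s, f i) v = ∑ i ∈ s, f i v :=
  map_sum ({ toFun := fun θ => θ v, map_zero' := rfl, map_add' := fun _ _ => rfl } :
    (V [⋀^Fin k]→ₗ[ℝ] ℝ) →+ ℝ) f s

lemma det_perm (b : Module.Basis (Fin 6) ℝ V) (σ : Equiv.Perm (Fin 6)) :
    b.det ![b (σ 0), b (σ 1), b (σ 2), b (σ 3), b (σ 4), b (σ 5)] =
      ((Equiv.Perm.sign σ : ℤ) : ℝ) := by
  have h := b.det.map_perm b σ
  rw [b.det_self] at h
  have e : ![b (σ 0), b (σ 1), b (σ 2), b (σ 3), b (σ 4), b (σ 5)] = b ∘ σ := by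
    funext i; fin_cases i <;> rfl
  rw [e, h]
  simp [Units.smul_def]

/-- The Hodge star of a 3-form, on the first three vectors of a permuted basis. -/
lemma hodge_sum_perm (b : Module.Basis (Fin 6) ℝ V) (θ : V [⋀^Fin 3]→ₗ[ℝ] ℝ)
    (σ : Equiv.Perm (Fin 6)) :
    ∑ i, ∑ j, ∑ k, eta i * eta j * eta k *
      b.det ![b (σ 0), b (σ 1), b (σ 2), b i, b j, b k] * θ ![b i, b j, b k] =
    6 * (((Equiv.Perm.sign σ : ℤ) : ℝ) * (eta (σ 3) * eta (σ 4) * eta (σ 5)) *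
      θ ![b (σ 3), b (σ 4), b (σ 5)]) := by
  set D : V → V → V → ℝ := fun x y z => b.det ![b (σ 0), b (σ 1), b (σ 2), x, y, z] with hD
  have hz : ∀ (w : Fin 6 → V) (i j : Fin 6), i ≠ j → w i = w j → b.det w = 0 :=
    fun w i j h h' => b.det.map_eq_zero_of_eq w h' h
  have D12 : ∀ x y z, D x y z = -D y x z := fun x y z => by
    simp only [hD]
    rw [← b.det.map_swap _ (show (3 : Fin 6) ≠ 4 by decide)]
    congr 1; funext i; fin_cases i <;> rfl
  have D23 : ∀ x y z, D x y z = -D x z y := fun x y z => by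
    simp only [hD]
    rw [← b.det.map_swap _ (show (4 : Fin 6) ≠ 5 by decide)]
    congr 1; funext i; fin_cases i <;> rfl
  -- After reindexing by `σ` the summand is symmetric, as a product of two skew factors. It vanishes
  -- on repeated indices and on the indices 0, 1, 2, which leaves the six equal terms on 3, 4, 5.
  set G : Fin 6 → Fin 6 → Fin 6 → ℝ := fun i j k =>
    eta (σ i) * eta (σ j) * eta (σ k) * D (b (σ i)) (b (σ j)) (b (σ k)) *
      tri θ (b (σ i)) (b (σ j)) (b (σ k)) with hG
  have hs : ∑ i, ∑ j, ∑ k, eta i * eta j * eta k *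
      b.det ![b (σ 0), b (σ 1), b (σ 2), b i, b j, b k] * θ ![b i, b j, b k] =
      ∑ i, ∑ j, ∑ k, G i j k := by
    simp only [← tri_apply]
    rw [← Equiv.sum_comp σ]
    refine Finset.sum_congr rfl fun i _ => ?_
    rw [← Equiv.sum_comp σ]
    refine Finset.sum_congr rfl fun j _ => ?_
    rw [← Equiv.sum_comp σ]
  rw [hs]
  have G12 : ∀ i j k, G i j k = G j i k := fun i j k => by
    simp only [hG]
    rw [D12, tri_skew12]; ring
  have G23 : ∀ i j k, G i j k = G i k j := fun i j k => by
    simp only [hG]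
    rw [D23, tri_skew23]; ring
  have Ga : ∀ i j, G i i j = 0 := fun i j => by
    simp only [hG, hD]
    rw [hz _ 3 4 (by decide) rfl]; ring
  have Gb : ∀ i j, G i j j = 0 := fun i j => by rw [G12, G23, Ga]
  have Gc : ∀ i j, G i j i = 0 := fun i j => by rw [G23, Ga]
  have Z0 : ∀ j k, G 0 j k = 0 := fun j k => by
    simp only [hG, hD]
    rw [hz _ 0 3 (by decide) rfl]; ring
  have Z1 : ∀ j k, G 1 j k = 0 := fun j k => by
    simp only [hG, hD]
    rw [hz _ 1 3 (by decide) rfl]; ring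
  have Z2 : ∀ j k, G 2 j k = 0 := fun j k => by
    simp only [hG, hD]
    rw [hz _ 2 3 (by decide) rfl]; ring
  have Y0 : ∀ j k, G j 0 k = 0 := fun j k => by rw [G12, Z0]
  have Y1 : ∀ j k, G j 1 k = 0 := fun j k => by rw [G12, Z1]
  have Y2 : ∀ j k, G j 2 k = 0 := fun j k => by rw [G12, Z2]
  have X0 : ∀ j k, G j k 0 = 0 := fun j k => by rw [G23, Y0]
  have X1 : ∀ j k, G j k 1 = 0 := fun j k => by rw [G23, Y1]
  have X2 : ∀ j k, G j k 2 = 0 := fun j k => by rw [G23, Y2]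
  simp only [Fin.sum_univ_six, Ga, Gb, Gc, Z0, Z1, Z2, Y0, Y1, Y2, X0, X1, X2, add_zero, zero_add]
  have e1 : G 3 5 4 = G 3 4 5 := G23 _ _ _
  have e2 : G 4 3 5 = G 3 4 5 := G12 _ _ _
  have e3 : G 4 5 3 = G 3 4 5 := by rw [G23, e2]
  have e4 : G 5 3 4 = G 3 4 5 := by rw [G12, e1]
  have e5 : G 5 4 3 = G 3 4 5 := by rw [G12, e3]
  rw [e1, e2, e3, e4, e5]
  simp only [hG, hD, det_perm, tri_apply]
  ring

lemma curryLeft_three (f : V [⋀^Fin 6]→ₗ[ℝ] ℝ) (x y z : V) (m : Fin 3 → V) :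
    (((f.curryLeft x).curryLeft y).curryLeft z) m =
      f (Matrix.vecCons x (Matrix.vecCons y (Matrix.vecCons z m))) := rfl

/-- Both sides are alternating, so it suffices to compare them on vectors of a permuted basis, where
`hodge_sum_perm` evaluates the star. -/
lemma hodge_eq_self_iff (b : Module.Basis (Fin 6) ℝ V) (θ : V [⋀^Fin 3]→ₗ[ℝ] ℝ) :
    (∀ u v w, θ ![u, v, w] = (1 / 6 : ℝ) * ∑ i, ∑ j, ∑ k,
        eta i * eta j * eta k * b.det ![u, v, w, b i, b j, b k] * θ ![b i, b j, b k]) ↔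
      SelfDual3 fun p q r => tri θ (b p) (b q) (b r) := by
  constructor
  · intro h σ
    have := h (b (σ 0)) (b (σ 1)) (b (σ 2))
    rw [hodge_sum_perm] at this
    simp only [tri_apply]
    rw [this]; ring
  · intro h
    -- The star as an alternating form. Contraction puts the basis vectors in front, and exchanging
    -- two blocks of three is an odd permutation, whence the minus sign.
    set R : V [⋀^Fin 3]→ₗ[ℝ] ℝ := (1 / 6 : ℝ) • ∑ i, ∑ j, ∑ k,
      (eta i * eta j * eta k * θ ![b i, b j, b k]) •
        -(((b.det.curryLeft (b i)).curryLeft (b j)).curryLeft (b k)) with hR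
    have hdet : ∀ x y z u v w : V, -b.det ![x, y, z, u, v, w] = b.det ![u, v, w, x, y, z] := by
      intro x y z u v w
      have h := b.det.map_perm ![u, v, w, x, y, z] blockSwap
      have hs : Equiv.Perm.sign blockSwap = -1 := by decide
      rw [hs] at h
      have e : ![u, v, w, x, y, z] ∘ blockSwap = ![x, y, z, u, v, w] := by
        funext i; fin_cases i <;> rfl
      rw [e] at h
      rw [h]; simp
    have hRa : ∀ u v w, R ![u, v, w] = (1 / 6 : ℝ) * ∑ i, ∑ j, ∑ k,
        eta i * eta j * eta k * b.det ![u, v, w, b i, b j, b k] * θ ![b i, b j, b k] := by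
      intro u v w
      simp only [hR, AlternatingMap.smul_apply, alternating_sum_apply, smul_eq_mul,
        AlternatingMap.neg_apply]
      congr 1
      refine Finset.sum_congr rfl fun i _ => Finset.sum_congr rfl fun j _ =>
        Finset.sum_congr rfl fun k _ => ?_
      have hc : (((b.det.curryLeft (b i)).curryLeft (b j)).curryLeft (b k)) ![u, v, w] =
          b.det ![b i, b j, b k, u, v, w] := curryLeft_three _ _ _ _ _
      rw [← hdet, ← hc]
      ring
    have : θ = R := by
      refine sub_eq_zero.1 (alternating_eq_zero_of_perm b fun hk σ => ?_)
      have e : (fun i : Fin 3 => b (σ (Fin.castLE hk i))) = ![b (σ 0), b (σ 1), b (σ 2)] := by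
        funext i; fin_cases i <;> rfl
      rw [e, AlternatingMap.sub_apply, sub_eq_zero, hRa, hodge_sum_perm]
      have := h σ
      simp only [tri_apply] at this
      rw [this]; ring
    intro u v w
    rw [← hRa, ← this]

end Hodge

/-! ### Local orthonormal frames -/

section Frames

variable {M : Type*} [TopologicalSpace M] [ChartedSpace R6 M] [IsManifold (𝓡 6) ∞ M]

/-- The 3-form `H` is self-dual on all positive orthonormal bases. -/
def SelfDualForm (o : ManifoldOrientation M) (g : LorentzMetric M) (H : Form M 3) : Prop :=
  ∀ (x : M) (b : Module.Basis (Fin 6) ℝ (TangentSpace (𝓡 6) x)),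
    IsOrtho (g.val x) b → b.orientation = o.at' x →
    SelfDual3 fun p q r => tri (H.1 x) (b p) (b q) (b r)

lemma isHodgeStar_self_iff (o : ManifoldOrientation M) (g : LorentzMetric M) (H : Form M 3) :
    IsHodgeStar o g H H ↔ SelfDualForm o g H :=
  ⟨fun h x b hb ho => (hodge_eq_self_iff b _).1 (h x b hb ho),
    fun h x b hb ho => (hodge_eq_self_iff b _).2 (h x b hb ho)⟩

variable [T2Space M]

lemma vf_sum_apply {ι : Type*} (s : Finset ι) (f : ι → VF M) (x : M) :
    (∑ i ∈ s, f i : VF M) x = ∑ i ∈ s, f i x :=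
  map_sum ({ toFun := fun X => X x, map_zero' := rfl, map_add' := fun _ _ => rfl } :
    VF M →+ TangentSpace (𝓡 6) x) f s

/-- Every orthonormal basis at a point extends to a local orthonormal frame. -/
lemma exists_ortho_frame (g : LorentzMetric M) {x : M}
    {b : Module.Basis (Fin 6) ℝ (TangentSpace (𝓡 6) x)} (hb : IsOrtho (g.val x) b) :
    ∃ X : Fin 6 → VF M, (∀ i, X i x = b i) ∧ ∀ᶠ y in 𝓝 x, IsOrtho (g.val y) fun i => X i y := by
  have hb' : ∀ i j, g.val x (b i) (b j) = if i = j then eta i else 0 := hb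
  -- Gram–Schmidt, one vector at a time. The values at `x` are already orthonormal and stay
  -- unchanged, which keeps the norms nonzero, with the right sign, near `x` despite the indefinite
  -- signature.
  have step : ∀ n : ℕ, n ≤ 6 → ∃ X : Fin 6 → VF M, (∀ i, X i x = b i) ∧
      ∀ᶠ y in 𝓝 x, ∀ i j : Fin 6, i.1 < n → j.1 < n →
        g.fn (X i) (X j) y = if i = j then eta i else 0 := by
    intro n
    induction n with
    | zero =>
      intro _
      choose X hX using fun i => exists_vf_eq M (b i)
      exact ⟨X, hX, Filter.Eventually.of_forall fun y i j h => absurd h (by omega)⟩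
    | succ n ih =>
      intro hn
      obtain ⟨X, hX, hO⟩ := ih (by omega)
      set N : Fin 6 := ⟨n, by omega⟩ with hN
      set s : Finset (Fin 6) := Finset.univ.filter fun j => j.1 < n with hs
      set Z : VF M := X N - ∑ j ∈ s, fsmul (eta j • g.fn (X N) (X j)) (X j) with hZ
      have hZy : ∀ y, Z y = X N y - ∑ j ∈ s, (eta j * g.fn (X N) (X j) y) • X j y := fun y => by
        rw [hZ]
        change X N y - (∑ j ∈ s, fsmul (eta j • g.fn (X N) (X j)) (X j) : VF M) y = _
        congr 1
        rw [vf_sum_apply]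
        rfl
      have hZx : Z x = b N := by
        rw [hZy, hX]
        refine sub_eq_self.2 (Finset.sum_eq_zero fun j hj => ?_)
        have : N ≠ j := by
          rintro rfl
          simp [hs, hN] at hj
        rw [g.fn_apply, hX, hX, hb', if_neg this, mul_zero, zero_smul]
      have hq : eta N * g.fn Z Z x = 1 := by
        rw [g.fn_apply, hZx, hb', if_pos rfl, eta_mul_self]
      have hpos : ∀ᶠ y in 𝓝 x, 0 < eta N * g.fn Z Z y := by
        have hc : Continuous fun y => eta N * g.fn Z Z y :=
          continuous_const.mul (g.fn Z Z).contMDiff.continuous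
        exact hc.continuousAt.eventually (lt_mem_nhds (show 0 < eta N * g.fn Z Z x by rw [hq]; norm_num))
      -- The normalizing factor is smooth only where the norm has the right sign, so a global
      -- function with the same germ takes its place.
      obtain ⟨f, hf⟩ := exists_smoothFun_germ (f := fun y => (Real.sqrt (eta N * g.fn Z Z y))⁻¹)
        (U := {y | 0 < eta N * g.fn Z Z y}) hpos (by
          intro y hy
          have h1 : ContMDiffAt (𝓡 6) 𝓘(ℝ, ℝ) ∞ (fun y => eta N * g.fn Z Z y) y :=
            contMDiffAt_const.mul ((g.fn Z Z).contMDiff y)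
          have hy' : 0 < eta N * g.fn Z Z y := hy
          have h2 : ContDiffAt ℝ ∞ (fun t : ℝ => (Real.sqrt t)⁻¹) (eta N * g.fn Z Z y) :=
            (Real.contDiffAt_sqrt hy'.ne').inv (Real.sqrt_pos.2 hy').ne'
          exact (h2.contMDiffAt.comp y h1).contMDiffWithinAt)
      refine ⟨Function.update X N (fsmul f Z), fun i => ?_, ?_⟩
      · by_cases hi : i = N
        · subst hi
          rw [Function.update_self]
          change f x • Z x = _
          rw [hf.self_of_nhds, hq, hZx]; simp
        · rw [Function.update_of_ne hi, hX]
      · filter_upwards [hO, hf, hpos] with y h1 h2 h3 i j hi hj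
        have hZX : ∀ j : Fin 6, j.1 < n → g.fn Z (X j) y = 0 := fun j hj => by
          rw [g.fn_apply, hZy, map_sub, map_sum, LinearMap.sub_apply, LinearMap.sum_apply]
          simp only [map_smul, LinearMap.smul_apply, smul_eq_mul]
          rw [Finset.sum_eq_single j]
          · change _ - eta j * _ * g.fn (X j) (X j) y = 0
            rw [h1 j j hj hj, if_pos rfl, g.fn_apply]
            linear_combination (-(g.val y (X N y) (X j y))) * eta_mul_self j
          · intro k hk hkj
            have : g.val y (X k y) (X j y) = 0 := by
              have := h1 k j (by simpa [hs] using hk) hj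
              rwa [if_neg hkj] at this
            rw [this, mul_zero]
          · intro h; exact absurd (by simp [hs, hj]) h
        have hlt : ∀ i : Fin 6, i.1 < n + 1 → i ≠ N → i.1 < n := fun i h h' => by
          have : i.1 ≠ n := fun e => h' (Fin.ext e)
          omega
        by_cases hiN : i = N <;> by_cases hjN : j = N
        · rw [hiN, hjN, Function.update_self, if_pos rfl, g.fn_fsmul_left, g.fn_fsmul_right]
          change f y * (f y * g.fn Z Z y) = eta N
          rw [h2]
          have h5 := Real.mul_self_sqrt h3.le
          have h6 := (Real.sqrt_pos.2 h3).ne'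
          have h7 := eta_mul_self N
          set r := Real.sqrt (eta N * g.fn Z Z y)
          field_simp
          linear_combination (-(g.fn Z Z y)) * h7 - eta N * h5
        · rw [hiN, Function.update_self, Function.update_of_ne hjN, if_neg (Ne.symm hjN),
            g.fn_fsmul_left]
          change f y * g.fn Z (X j) y = 0
          rw [hZX j (hlt j hj hjN), mul_zero]
        · rw [hjN, Function.update_self, Function.update_of_ne hiN, if_neg hiN, g.fn_symm,
            g.fn_fsmul_left]
          change f y * g.fn Z (X i) y = 0
          rw [hZX i (hlt i hi hiN), mul_zero]
        · rw [Function.update_of_ne hjN, Function.update_of_ne hiN]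
          exact h1 i j (hlt i hi hiN) (hlt j hj hjN)
  obtain ⟨X, hX, hO⟩ := step 6 le_rfl
  exact ⟨X, hX, hO.mono fun y h i j => h i j i.2 j.2⟩

end Frames


/-! ### A closed self-dual form is divergence free: in a frame -/

section Divergence

variable {M : Type*} [TopologicalSpace M] [ChartedSpace R6 M] [IsManifold (𝓡 6) ∞ M]

lemma finrank_tangent (x : M) : Module.finrank ℝ (TangentSpace (𝓡 6) x) = 6 := by
  change Module.finrank ℝ R6 = 6
  simp

/-- An orthonormal 6-tuple of tangent vectors is a basis. -/
lemma IsOrtho.exists_basis {x : M} {B : LinearMap.BilinForm ℝ (TangentSpace (𝓡 6) x)}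
    {v : Fin 6 → TangentSpace (𝓡 6) x} (hv : IsOrtho B v) :
    ∃ b : Module.Basis (Fin 6) ℝ (TangentSpace (𝓡 6) x), (∀ i, b i = v i) ∧ IsOrtho B b := by
  refine ⟨basisOfLinearIndependentOfCardEqFinrank hv.linearIndependent
    (by rw [finrank_tangent]; simp), fun i => by simp, ?_⟩
  rw [coe_basisOfLinearIndependentOfCardEqFinrank]
  exact hv

variable [T2Space M] {g : LorentzMetric M}

/-- The determinant of the local oriented frame in the orthonormal one has entries `η_i g(Y_j,
X_i)`; it is continuous and positive at `x`, hence positive nearby. -/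
lemma frame_pos_eventually (o : ManifoldOrientation M) {X : Fin 6 → VF M} {x : M}
    (hX : ∀ᶠ y in 𝓝 x, IsOrtho (g.val y) fun i => X i y) (hp : o.IsPos x fun i => X i x) :
    ∀ᶠ y in 𝓝 x, o.IsPos y fun i => X i y := by
  obtain ⟨Y, hY⟩ := o.locally_frame' x
  set F : M → Matrix (Fin 6) (Fin 6) ℝ := fun y => Matrix.of fun i j => eta i * g.fn (Y j) (X i) y
  have hF : Continuous fun y => (F y).det := by
    refine Continuous.matrix_det (continuous_matrix fun i j => ?_)
    exact continuous_const.mul (g.fn (Y j) (X i)).contMDiff.continuous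
  have key : ∀ y (b c : Module.Basis (Fin 6) ℝ (TangentSpace (𝓡 6) y)), IsOrtho (g.val y) b →
      (∀ i, b i = X i y) → (∀ i, c i = Y i y) → b.det c = (F y).det := by
    intro y b c hb hbX hcY
    rw [Module.Basis.det_apply]
    congr 1
    ext i j
    rw [Module.Basis.toMatrix_apply, hb.repr_left, hbX, hcY]
    rfl
  have hx : 0 < (F x).det := by
    obtain ⟨b, hbX, hbo⟩ := hp
    obtain ⟨c, hcY, hco⟩ := hY.self_of_nhds
    have hb : IsOrtho (g.val x) b := by
      have := hX.self_of_nhds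
      rwa [← funext hbX] at this
    rw [← key x b c hb hbX hcY]
    exact (b.orientation_eq_iff_det_pos c).1 (hbo.trans hco.symm)
  filter_upwards [hX, hY, hF.continuousAt.eventually (lt_mem_nhds hx)] with y h1 h2 h3
  obtain ⟨b, hbX, hb⟩ := h1.exists_basis
  obtain ⟨c, hcY, hco⟩ := h2
  refine ⟨b, hbX, ?_⟩
  rw [← hco]
  refine (b.orientation_eq_iff_det_pos c).2 ?_
  rw [key y b c hb hbX hcY]
  exact h3

/-- The components of a self-dual form in a positive orthonormal tuple. -/
lemma SelfDualForm.selfDual3 {o : ManifoldOrientation M} {H : Form M 3} (hs : SelfDualForm o g H)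
    {X : Fin 6 → VF M} {y : M} (hX : IsOrtho (g.val y) fun i => X i y)
    (hp : o.IsPos y fun i => X i y) : SelfDual3 fun p q r => fn3 H (X p) (X q) (X r) y := by
  obtain ⟨b, hb, hbo⟩ := hp
  have h := hs y b (by rwa [← funext hb] at hX) hbo
  simp only [hb] at h
  exact h

variable {nab : VF M → VF M → VF M} (hn : IsLeviCivita g nab) {X : Fin 6 → VF M} {x : M}
  (hX : ∀ᶠ y in 𝓝 x, IsOrtho (g.val y) fun i => X i y)
include hn hX

/-- The connection coefficients in an orthonormal frame are skew. -/
lemma conn_skew (Z : VF M) (p q : Fin 6) :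
    g.fn (nab Z (X p)) (X q) x = -g.fn (nab Z (X q)) (X p) x := by
  have h := congrArg (fun f : SmoothFun M => f x) (hn.der_metric Z (X p) (X q))
  have h0 : der Z (g.fn (X p) (X q)) x = 0 :=
    der_const Z (if p = q then eta p else 0) _ x (hX.mono fun y hy => hy p q)
  rw [h0, g.fn_symm (X p)] at h
  change (0 : ℝ) = _ + _ at h
  linarith

lemma conn_expand (Z : VF M) (p : Fin 6) :
    nab Z (X p) x = ∑ k, (eta k * g.fn (nab Z (X p)) (X k) x) • X k x := by
  obtain ⟨b, hb, hbo⟩ := hX.self_of_nhds.exists_basis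
  conv_lhs => rw [hbo.expand (nab Z (X p) x)]
  simp only [hb]
  rfl

/-- The covariant derivative of `H` in an orthonormal frame. -/
lemma nabH_frame (H : Form M 3) (Z : VF M) (p q r : Fin 6) :
    nabH H nab Z (X p) (X q) (X r) x = der Z (fn3 H (X p) (X q) (X r)) x
      - ∑ k, eta k * (g.fn (nab Z (X p)) (X k) x * fn3 H (X k) (X q) (X r) x
        + g.fn (nab Z (X q)) (X k) x * fn3 H (X p) (X k) (X r) x
        + g.fn (nab Z (X r)) (X k) x * fn3 H (X p) (X q) (X k) x) := by
  change der Z _ x - tri (H.1 x) (nab Z (X p) x) (X q x) (X r x)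
    - tri (H.1 x) (X p x) (nab Z (X q) x) (X r x) - tri (H.1 x) (X p x) (X q x) (nab Z (X r) x) = _
  rw [conn_expand hn hX Z p, conn_expand hn hX Z q, conn_expand hn hX Z r]
  simp only [map_sum, map_smul, LinearMap.sum_apply, LinearMap.smul_apply, smul_eq_mul, mul_add,
    Finset.sum_add_distrib, fn3_apply, mul_assoc]
  ring

variable {o : ManifoldOrientation M} {H : Form M 3} (hs : SelfDualForm o g H)
  (hp : ∀ᶠ y in 𝓝 x, o.IsPos y fun i => X i y)
include hs hp

/-- The covariant derivative of a self-dual form is self-dual. In a frame `∇_Z h` is `Z(h) + ¼ [ω,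
h]`. The first term is self-dual because the relation has constant coefficients and holds near `x`,
the second because bivectors commute with the volume element. -/
lemma trivec_nabH_mul_volElt (Z : VF M) :
    trivec (fun i => eta i • gam i) (fun p q r => nabH H nab Z (X p) (X q) (X r) x) * volElt gam =
      trivec (fun i => eta i • gam i) (fun p q r => nabH H nab Z (X p) (X q) (X r) x) := by
  set u : Fin 6 → SpinMat := fun i => eta i • gam i
  set h : Fin 6 → Fin 6 → Fin 6 → ℝ := fun p q r => fn3 H (X p) (X q) (X r) x
  set dh : Fin 6 → Fin 6 → Fin 6 → ℝ := fun p q r => der Z (fn3 H (X p) (X q) (X r)) x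
  set S : Fin 6 → Fin 6 → ℝ := fun p q => g.fn (nab Z (X p)) (X q) x
  have hh12 : ∀ p q r, h p q r = -h q p r := fun p q r => by simp only [h]; rw [fn3_skew12]; rfl
  have hh23 : ∀ p q r, h p q r = -h p r q := fun p q r => by simp only [h]; rw [fn3_skew23]; rfl
  have hd12 : ∀ p q r, dh p q r = -dh q p r := fun p q r => by
    simp only [dh]; rw [fn3_skew12, der_neg]; rfl
  have hd23 : ∀ p q r, dh p q r = -dh p r q := fun p q r => by
    simp only [dh]; rw [fn3_skew23, der_neg]; rfl
  have hd : SelfDual3 dh := by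
    intro σ
    simp only [dh]
    set c := ((Equiv.Perm.sign σ : ℤ) : ℝ) * (eta (σ 3) * eta (σ 4) * eta (σ 5))
    have e := der_smul Z c (fn3 H (X (σ 3)) (X (σ 4)) (X (σ 5)))
    have e2 := congrArg (fun f : SmoothFun M => f x) e
    change _ = c * der Z (fn3 H (X (σ 3)) (X (σ 4)) (X (σ 5))) x at e2
    rw [← e2]
    refine der_congr rfl ?_
    filter_upwards [hX, hp] with y h1 h2
    exact hs.selfDual3 h1 h2 σ
  have hcomm := isGamma_gam.up.biv_comm_trivec (S := S) h (fun p q => conn_skew hn hX Z p q)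
  have hk : trivec u (fun p q r => nabH H nab Z (X p) (X q) (X r) x) =
      trivec u dh + (1 / 4 : ℝ) • (biv u S * trivec u h - trivec u h * biv u S) := by
    rw [hcomm]
    simp only [trivec, Finset.smul_sum, ← Finset.sum_add_distrib]
    refine Finset.sum_congr rfl fun p _ => Finset.sum_congr rfl fun q _ =>
      Finset.sum_congr rfl fun r _ => ?_
    rw [smul_smul, ← add_smul]
    congr 1
    rw [nabH_frame hn hX]
    simp only [dh, S, h]
    ring
  have h1 := isGamma_gam.trivec_mul_volElt hd hd12 hd23
  have h2 := isGamma_gam.trivec_mul_volElt (hs.selfDual3 hX.self_of_nhds hp.self_of_nhds) hh12 hh23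
  have h3 : volElt gam * biv u S = biv u S * volElt gam := by
    have : biv u S = biv gam fun p q => eta p * eta q * S p q := by
      simp only [biv, u, smul_mul_smul_comm, smul_smul]
      refine Finset.sum_congr rfl fun p _ => Finset.sum_congr rfl fun q _ => ?_
      congr 1; ring
    rw [this, isGamma_gam.volElt_comm_biv]
  rw [hk, add_mul, h1, smul_mul_assoc, sub_mul, mul_assoc, h2, mul_assoc (trivec u h), ← h3,
    ← mul_assoc (trivec u h), h2]

/-- A closed self-dual form is divergence free, in a frame. -/
lemma div_frame_eq_zero (hH : H ∈ closed3 M) (q r : Fin 6) :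
    ∑ i, eta i * nabH H nab (X i) (X i) (X q) (X r) x = 0 := by
  set u : Fin 6 → SpinMat := fun i => eta i • gam i with hu
  have hsum := isGamma_gam.up.sum_mul_trivec
    (N := fun i p q r => nabH H nab (X i) (X p) (X q) (X r) x)
    (fun i p q r => by rw [nabH_skew12]; rfl) (fun i p q r => by rw [nabH_skew23]; rfl)
    (fun i p q r => nabH_closed H hn hH _ _ _ _ x)
  set δ : Fin 6 → Fin 6 → ℝ := fun q r => ∑ i, eta i * nabH H nab (X i) (X i) (X q) (X r) x with hδ
  change _ = (-3 : ℝ) • biv u δ at hsum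
  have hδs : ∀ q r, δ q r = -δ r q := fun q r => by
    simp only [hδ, ← Finset.sum_neg_distrib]
    exact Finset.sum_congr rfl fun i _ => by rw [nabH_skew23]; exact mul_neg _ _
  -- By `hsum` the bivector of the divergence is a multiple of `∑ γ^i ∇_i H`, and every `∇_i H` is
  -- fixed by right multiplication by the volume element.
  have h1 : biv u δ * volElt gam = biv u δ := by
    have h2 : ((-3 : ℝ) • biv u δ) * volElt gam = (-3 : ℝ) • biv u δ := by
      rw [← hsum, Finset.sum_mul]
      refine Finset.sum_congr rfl fun i _ => ?_
      rw [mul_assoc, trivec_nabH_mul_volElt hn hX hs hp]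
    rw [smul_mul_assoc] at h2
    exact smul_right_injective SpinMat (by norm_num : (-3 : ℝ) ≠ 0) h2
  have h2 := isGamma_gam.up.biv_eq_zero_of_dual hδs (Γ := volElt gam) (fun i => by
    rw [mul_smul_comm, smul_mul_assoc, isGamma_gam.volElt_anti, smul_neg]) h1
  exact isGamma_gam.up.biv_eq_zero hδs h2 q r

end Divergence

/-! ### A closed self-dual form is divergence free: invariantly -/

section Divergence

variable {M : Type*} [TopologicalSpace M] [ChartedSpace R6 M] [IsManifold (𝓡 6) ∞ M] [T2Space M]
  {g : LorentzMetric M} {nab : VF M → VF M → VF M} (hn : IsLeviCivita g nab)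
  {o : ManifoldOrientation M} {H : Form M 3}
include hn

lemma nabH_congr {Z Z' X X' Y Y' W W' : VF M} {x : M} (hZ : Z x = Z' x) (hX : X x = X' x)
    (hY : Y x = Y' x) (hW : W x = W' x) : nabH H nab Z X Y W x = nabH H nab Z' X' Y' W' x := by
  have c1 : ∀ {Z Z' : VF M} (X Y W : VF M), Z x = Z' x →
      nabH H nab Z X Y W x = nabH H nab Z' X Y W x := fun X Y W h =>
    tensorial_congr (T := fun Z : VF M => nabH H nab Z X Y W x)
      (fun a b => by rw [nabH_add_1 H hn]; rfl) (fun f a => nabH_fsmul_1 H hn f a X Y W x) h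
  have c2 : ∀ {X X' : VF M} (Z Y W : VF M), X x = X' x →
      nabH H nab Z X Y W x = nabH H nab Z X' Y W x := fun Z Y W h =>
    tensorial_congr (T := fun X : VF M => nabH H nab Z X Y W x)
      (fun a b => by rw [nabH_add_2 H hn]; rfl) (fun f a => nabH_fsmul_2 H hn f Z a Y W x) h
  have c3 : ∀ {Y Y' : VF M} (Z X W : VF M), Y x = Y' x →
      nabH H nab Z X Y W x = nabH H nab Z X Y' W x := fun Z X W h => by
    rw [nabH_skew12, nabH_skew12 H nab Z X]
    exact congrArg Neg.neg (c2 Z X W h)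
  have c4 : ∀ {W W' : VF M} (Z X Y : VF M), W x = W' x →
      nabH H nab Z X Y W x = nabH H nab Z X Y W' x := fun Z X Y h => by
    rw [nabH_skew23, nabH_skew23 H nab Z X Y]
    exact congrArg Neg.neg (c3 Z X Y h)
  rw [c1 X Y W hZ, c2 Z' Y W hX, c3 Z' X' W hY, c4 Z' X' Y' hW]

/-- A closed self-dual form is divergence free. -/
lemma div_eq_zero (hs : SelfDualForm o g H) (hH : H ∈ closed3 M) {x : M} {X : Fin 6 → VF M}
    (hX : IsOrtho (g.val x) fun i => X i x) (W Y : VF M) :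
    ∑ i, eta i * nabH H nab (X i) W Y (X i) x = 0 := by
  obtain ⟨b, hb, hbo⟩ := hX.exists_basis
  -- The given tuple may be negatively oriented. Correcting the orientation only changes signs of
  -- vectors, and each vector occurs twice in the divergence.
  set c := b.adjustToOrientation (o.at' x) with hc
  have hcX : ∀ i, c i = X i x ∨ c i = -X i x := fun i => by
    rw [← hb i]; exact b.adjustToOrientation_apply_eq_or_eq_neg (o.at' x) i
  have hcO : IsOrtho (g.val x) c := fun i j => by
    have hb' : ∀ i j, g.val x (X i x) (X j x) = if i = j then eta i else 0 := hX
    by_cases hij : i = j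
    · subst hij
      rcases hcX i with h | h <;> simp [h, hb']
    · rcases hcX i with h | h <;> rcases hcX j with h' | h' <;> simp [h, h', hb', hij]
  obtain ⟨Z, hZ, hO⟩ := exists_ortho_frame g hcO
  have hp := frame_pos_eventually o hO ⟨c, fun i => (hZ i).symm, b.orientation_adjustToOrientation _⟩
  have hZX : ∀ (i) (W Y : VF M), nabH H nab (X i) W Y (X i) x = nabH H nab (Z i) W Y (Z i) x := by
    intro i W Y
    rcases hcX i with h | h
    · have e : X i x = Z i x := by rw [hZ, h]
      exact nabH_congr hn e rfl rfl e
    · have e : X i x = (-Z i : VF M) x := by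
        change _ = -Z i x
        rw [hZ, h, neg_neg]
      rw [nabH_congr hn e rfl rfl e]
      have h1 : ∀ A B C D : VF M, nabH H nab (-A) B C D x = -nabH H nab A B C D x := fun A B C D => by
        have := nabH_add_1 H hn A (-A) B C D
        have h0 : nabH H nab 0 B C D = 0 := by simpa using nabH_add_1 H hn 0 0 B C D
        rw [add_neg_cancel, h0] at this
        have := congrArg (fun f : SmoothFun M => f x) this
        change (0 : ℝ) = _ + _ at this
        linarith
      have h2 : ∀ A B C D : VF M, nabH H nab A (-B) C D x = -nabH H nab A B C D x := fun A B C D => by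
        have := nabH_add_2 H hn A B (-B) C D
        have h0 : nabH H nab A 0 C D = 0 := by simpa using nabH_add_2 H hn A 0 0 C D
        rw [add_neg_cancel, h0] at this
        have := congrArg (fun f : SmoothFun M => f x) this
        change (0 : ℝ) = _ + _ at this
        linarith
      rw [h1, nabH_skew23, nabH_skew12, neg_neg, h2, nabH_skew12, nabH_skew23]
      change - -(- -_) = _
      rw [neg_neg, neg_neg]
  simp only [hZX]
  have hD : ∀ q r, ∑ i, eta i * nabH H nab (Z i) (Z q) (Z r) (Z i) x = 0 := fun q r => by
    rw [← div_frame_eq_zero hn hO hs hp hH q r]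
    refine Finset.sum_congr rfl fun i _ => ?_
    rw [nabH_skew23, nabH_skew12, neg_neg]
  -- A tensorial functional that vanishes on the frame vanishes; this is applied once to each of the
  -- two free arguments.
  have lin : ∀ T : VF M → ℝ, (∀ a b, T (a + b) = T a + T b) →
      (∀ (f : SmoothFun M) a, T (fsmul f a) = f x * T a) → (∀ i, T (Z i) = 0) → ∀ W, T W = 0 := by
    intro T ha hf h0 W
    obtain ⟨L, hL⟩ := exists_linear_of_tensorial (F := R6) (x := x) (T := T) ha hf
    rw [← hL, hcO.expand (W x), map_sum]
    refine Finset.sum_eq_zero fun i _ => ?_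
    rw [map_smul, ← hZ, hL, h0, smul_zero]
  refine lin (fun W => ∑ i, eta i * nabH H nab (Z i) W Y (Z i) x) (fun a b => ?_) (fun f a => ?_)
    (fun q => ?_) W
  · rw [← Finset.sum_add_distrib]
    refine Finset.sum_congr rfl fun i _ => ?_
    rw [nabH_add_2 H hn]; exact mul_add _ _ _
  · rw [Finset.mul_sum]
    refine Finset.sum_congr rfl fun i _ => ?_
    rw [nabH_fsmul_2 H hn]; ring
  refine lin (fun Y => ∑ i, eta i * nabH H nab (Z i) (Z q) Y (Z i) x) (fun a b => ?_) (fun f a => ?_)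
    (hD q) Y
  · rw [← Finset.sum_add_distrib]
    refine Finset.sum_congr rfl fun i _ => ?_
    rw [nabH_skew12, nabH_add_2 H hn, nabH_skew12 H nab _ (Z q) a, nabH_skew12 H nab _ (Z q) b]
    change eta i * -(nabH H nab (Z i) a (Z q) (Z i) x + nabH H nab (Z i) b (Z q) (Z i) x) =
      eta i * -nabH H nab (Z i) a (Z q) (Z i) x + eta i * -nabH H nab (Z i) b (Z q) (Z i) x
    ring
  · rw [Finset.mul_sum]
    refine Finset.sum_congr rfl fun i _ => ?_
    rw [nabH_skew12, nabH_skew12 H nab _ (Z q) a]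
    change _ * -(nabH _ _ _ _ _ _ x) = _ * (_ * -_)
    rw [nabH_fsmul_2 H hn]; ring

end Divergence


/-! ### The bundles `V_±` as graphs over the tangent bundle -/

section Lifts

variable {M : Type*} [TopologicalSpace M] [ChartedSpace R6 M] [IsManifold (𝓡 6) ∞ M]
  {F : Type*} [NormedAddCommGroup F] [NormedSpace ℝ F] [FiniteDimensional ℝ F]
  {E : M → Type*} [TopologicalSpace (TotalSpace F E)] [∀ x, TopologicalSpace (E x)]
  [∀ x, AddCommGroup (E x)] [∀ x, Module ℝ (E x)] [FiberBundle F E] [VectorBundle ℝ F E]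
  [ContMDiffVectorBundle ∞ F E (𝓡 6)]
  {C : CourantAlgebroid F E}

lemma CourantAlgebroid.IsExact.anchor_coanchor (hC : C.IsExact) (x : M)
    (ξ : Module.Dual ℝ (TangentSpace (𝓡 6) x)) : C.anchor x (C.coanchor x ξ) = 0 := by
  have : C.coanchor x ξ ∈ LinearMap.ker (C.anchor x) := by
    rw [← hC.exact' x]; exact LinearMap.mem_range_self _ _
  exact this

lemma CourantAlgebroid.pair_ext {x : M} {e e' : E x} (h : ∀ f, C.pair x e f = C.pair x e' f) :
    e = e' := by
  rw [← sub_eq_zero]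
  refine (C.pair_nondeg x).1 _ fun f => ?_
  rw [map_sub, LinearMap.sub_apply, h, sub_self]

namespace CourantAlgebroid.GenMetric

variable {A : C.GenMetric}

lemma mem_Vplus {x : M} {e : E x} : e ∈ A.Vplus x ↔ A.G x e = e := by
  rw [LinearMap.mem_ker, LinearMap.sub_apply, LinearMap.id_apply, sub_eq_zero]

lemma mem_Vminus {x : M} {e : E x} : e ∈ A.Vminus x ↔ A.G x e = -e := by
  rw [LinearMap.mem_ker, LinearMap.add_apply, LinearMap.id_apply, add_eq_zero_iff_eq_neg]

lemma plus_apply (a : Sec F E) (x : M) : A.plus a x = (1 / 2 : ℝ) • (a x + A.G x (a x)) := rfl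

lemma minus_apply (a : Sec F E) (x : M) : A.minus a x = (1 / 2 : ℝ) • (a x - A.G x (a x)) := rfl

lemma plus_mem (a : Sec F E) (x : M) : A.plus a x ∈ A.Vplus x := by
  rw [mem_Vplus, plus_apply, map_smul, map_add, A.sq', add_comm]

lemma minus_mem (a : Sec F E) (x : M) : A.minus a x ∈ A.Vminus x := by
  rw [mem_Vminus, minus_apply, map_smul, map_sub, A.sq', ← smul_neg, neg_sub]

lemma plus_add_minus (a : Sec F E) : A.plus a + A.minus a = a := by
  ext x
  change A.plus a x + A.minus a x = a x
  rw [plus_apply, minus_apply]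
  module

lemma pair_Vplus_Vminus {x : M} {e e' : E x} (h : e ∈ A.Vplus x) (h' : e' ∈ A.Vminus x) :
    C.pair x e e' = 0 := by
  have h1 := A.self_adj' x e e'
  rw [mem_Vplus.1 h, mem_Vminus.1 h', map_neg] at h1
  linarith

lemma finrank_Vplus (x : M) : Module.finrank ℝ (A.Vplus x) = 6 := by
  obtain ⟨v, hv, hs⟩ := A.signature' x
  rw [Vplus, ← hs, finrank_span_eq_card hv.linearIndependent]
  simp

/-- By exactness the kernel of the anchor is `π*T*M`, which admissibility separates from `V_+`. With
the dimension count this makes the anchor an isomorphism on `V_+`. -/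
lemma Admissible.eq_zero (hA : A.Admissible) (hC : C.IsExact) {x : M} {e : E x}
    (he : e ∈ A.Vplus x) (h : C.anchor x e = 0) : e = 0 := by
  have h1 : e ∈ A.Vplus x ⊓ LinearMap.range (C.coanchor x) := by
    refine ⟨he, ?_⟩
    rw [hC.exact' x]
    exact h
  rw [hA x] at h1
  exact h1

variable (hC : C.IsExact) (hA : A.Admissible)

/-- The inverse `TM → V_+` of the anchor. -/
def upAt (x : M) : TangentSpace (𝓡 6) x →ₗ[ℝ] E x :=
  haveI : FiniteDimensional ℝ (E x) := VectorBundle.finiteDimensional ℝ F E x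
  haveI : FiniteDimensional ℝ (TangentSpace (𝓡 6) x) :=
    inferInstanceAs (FiniteDimensional ℝ R6)
  (A.Vplus x).subtype ∘ₗ (LinearEquiv.ofInjectiveOfFinrankEq
    ((C.anchor x).domRestrict (A.Vplus x))
    ((injective_iff_map_eq_zero _).2 fun e he => Subtype.ext (hA.eq_zero hC e.2 he))
    (by rw [finrank_Vplus, finrank_tangent])).symm

lemma upAt_mem (x : M) (v : TangentSpace (𝓡 6) x) : upAt hC hA x v ∈ A.Vplus x :=
  Submodule.coe_mem _

lemma anchor_upAt (x : M) (v : TangentSpace (𝓡 6) x) : C.anchor x (upAt hC hA x v) = v := by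
  have : FiniteDimensional ℝ (E x) := VectorBundle.finiteDimensional ℝ F E x
  have : FiniteDimensional ℝ (TangentSpace (𝓡 6) x) := inferInstanceAs (FiniteDimensional ℝ R6)
  exact LinearEquiv.apply_symm_apply (LinearEquiv.ofInjectiveOfFinrankEq
    ((C.anchor x).domRestrict (A.Vplus x))
    ((injective_iff_map_eq_zero _).2 fun e he => Subtype.ext (hA.eq_zero hC e.2 he))
    (by rw [finrank_Vplus, finrank_tangent])) v

include hC hA in
lemma Vplus_ext {x : M} {e e' : E x} (he : e ∈ A.Vplus x) (he' : e' ∈ A.Vplus x)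
    (h : C.anchor x e = C.anchor x e') : e = e' :=
  sub_eq_zero.1 (hA.eq_zero hC (Submodule.sub_mem _ he he') (by rw [map_sub, h, sub_self]))

lemma upAt_anchor {x : M} {e : E x} (he : e ∈ A.Vplus x) : upAt hC hA x (C.anchor x e) = e :=
  Vplus_ext hC hA (upAt_mem hC hA x _) he (anchor_upAt hC hA x _)

/-- The metric on `TM ≅ V_+`. -/
def metricAt (x : M) : LinearMap.BilinForm ℝ (TangentSpace (𝓡 6) x) :=
  (C.pair x).compl₁₂ (upAt hC hA x) (upAt hC hA x)

lemma metricAt_apply (x : M) (v w : TangentSpace (𝓡 6) x) :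
    metricAt hC hA x v w = C.pair x (upAt hC hA x v) (upAt hC hA x w) := rfl

/-- The inverse `TM → V_-` of the anchor. -/
def dnAt (x : M) : TangentSpace (𝓡 6) x →ₗ[ℝ] E x :=
  upAt hC hA x - C.coanchor x ∘ₗ metricAt hC hA x

lemma dnAt_apply (x : M) (v : TangentSpace (𝓡 6) x) :
    dnAt hC hA x v = upAt hC hA x v - C.coanchor x (metricAt hC hA x v) := rfl

lemma anchor_dnAt (x : M) (v : TangentSpace (𝓡 6) x) : C.anchor x (dnAt hC hA x v) = v := by
  rw [dnAt_apply, map_sub, hC.anchor_coanchor, sub_zero, anchor_upAt]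

/-- Both the lift to `V_+` and `π* g(v)` pair with `e` to `g(v, π e)`, so their difference is
orthogonal to `V_+`. -/
lemma pair_dnAt_Vplus {x : M} (v : TangentSpace (𝓡 6) x) {e : E x} (he : e ∈ A.Vplus x) :
    C.pair x (dnAt hC hA x v) e = 0 := by
  rw [dnAt_apply, map_sub, LinearMap.sub_apply, C.pair_coanchor, metricAt_apply,
    upAt_anchor hC hA he, sub_self]

/-- By self-adjointness `e + G e` pairs with `f` as `e` does with `f + G f`, which lies in `V_+`;
nondegeneracy then gives `G e = -e`. -/
lemma mem_Vminus_of_perp {x : M} {e : E x} (h : ∀ e' ∈ A.Vplus x, C.pair x e e' = 0) :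
    e ∈ A.Vminus x := by
  rw [mem_Vminus, ← add_eq_zero_iff_eq_neg]
  refine C.pair_ext fun f => ?_
  have hf : f + A.G x f ∈ A.Vplus x := by rw [mem_Vplus, map_add, A.sq', add_comm]
  have := h _ hf
  rw [map_add] at this
  rw [map_add, LinearMap.add_apply, A.self_adj', map_zero, LinearMap.zero_apply, add_comm, this]

lemma dnAt_mem (x : M) (v : TangentSpace (𝓡 6) x) : dnAt hC hA x v ∈ A.Vminus x :=
  mem_Vminus_of_perp fun _ he => pair_dnAt_Vplus hC hA v he

include hC hA in
-- The difference is some `π* ξ` lying in `V_-`. Pairing it with the lifts to `V_+` gives `ξ(v)` on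
-- one side and zero on the other.
lemma Vminus_ext {x : M} {e e' : E x} (he : e ∈ A.Vminus x) (he' : e' ∈ A.Vminus x)
    (h : C.anchor x e = C.anchor x e') : e = e' := by
  have h1 : e - e' ∈ LinearMap.range (C.coanchor x) := by
    rw [hC.exact' x, LinearMap.mem_ker, map_sub, h, sub_self]
  obtain ⟨ξ, hξ⟩ := h1
  have h2 : ξ = 0 := by
    refine LinearMap.ext fun v => ?_
    have h3 := C.pair_coanchor x ξ (upAt hC hA x v)
    rw [hξ, anchor_upAt, C.pair_symm, pair_Vplus_Vminus (upAt_mem hC hA x v)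
      (Submodule.sub_mem _ he he')] at h3
    exact h3.symm
  rw [h2, map_zero] at hξ
  exact sub_eq_zero.1 hξ.symm

lemma dnAt_anchor {x : M} {e : E x} (he : e ∈ A.Vminus x) : dnAt hC hA x (C.anchor x e) = e :=
  Vminus_ext hC hA (dnAt_mem hC hA x _) he (anchor_dnAt hC hA x _)

end CourantAlgebroid.GenMetric

end Lifts


/-! ### Smooth coefficients in a local frame -/

section FrameCoefficients

variable {M : Type*} [TopologicalSpace M] [ChartedSpace R6 M] [IsManifold (𝓡 6) ∞ M] [T2Space M]

/-- Evaluation of smooth functions at a point. -/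
def evalHom (x : M) : SmoothFun M →+* ℝ :=
  (Pi.evalRingHom (fun _ : M => ℝ) x).comp ContMDiffMap.coeFnRingHom

lemma evalHom_apply (x : M) (f : SmoothFun M) : evalHom x f = f x := rfl

/-- Smooth functions are locally invertible where they do not vanish. -/
lemma exists_local_inv (f : SmoothFun M) {x : M} (hx : f x ≠ 0) :
    ∃ h : SmoothFun M, ∀ᶠ y in 𝓝 x, h y * f y = 1 := by
  have hU : {y | f y ≠ 0} ∈ 𝓝 x :=
    f.contMDiff.continuous.continuousAt.eventually (isOpen_ne.mem_nhds hx)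
  obtain ⟨h, hh⟩ := exists_smoothFun_germ hU (f := fun y => (f y)⁻¹) fun y hy =>
    (ContMDiffAt.inv₀ (f.contMDiff y) hy).contMDiffWithinAt
  exact ⟨h, by filter_upwards [hh, hU] with y h1 h2; rw [h1, inv_mul_cancel₀ h2]⟩

/-- Vector fields are smooth combinations of a local frame. -/
lemma exists_frame_coeff {x : M} {W : Fin 6 → VF M} (hW : LinearIndependent ℝ fun i => W i x)
    (X : VF M) : ∃ c : Fin 6 → SmoothFun M, ∀ᶠ y in 𝓝 x, X y = ∑ i, c i y • W i y := by
  have : IsManifold (𝓡 6) 1 M := IsManifold.of_le (n := ∞) (by simp)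
  let t := trivializationAt R6 (fun x : M => TangentSpace (𝓡 6) x) x
  have ht : t.baseSet ∈ 𝓝 x := t.open_baseSet.mem_nhds (FiberBundle.mem_baseSet_trivializationAt R6 _ x)
  have hx : x ∈ t.baseSet := FiberBundle.mem_baseSet_trivializationAt R6 _ x
  let b := (EuclideanSpace.basisFun (Fin 6) ℝ).toBasis
  have hf := fun (Y : VF M) j => exists_smoothFun_germ ht
    (contMDiffOn_baseSet_localFrameCoeff (I := 𝓡 6) (e := t) b Y.contMDiff.contMDiffOn j)
  choose f hf using hf
  have hexp : ∀ Y : VF M, ∀ᶠ y in 𝓝 x, Y y = ∑ j, f Y j y • t.localFrame b j y := fun Y => by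
    filter_upwards [eventually_all.2 (hf Y), ht] with y h hy
    simp only [h]
    exact t.eq_sum_localFrameCoeff_smul (I := 𝓡 6) (b := b) (s := fun y => Y y) hy
  let m : Matrix (Fin 6) (Fin 6) (SmoothFun M) := Matrix.of fun i j => f (W i) j
  have hdet : m.det x ≠ 0 := by
    rw [← evalHom_apply, RingHom.map_det]
    have h1 : LinearIndependent ℝ ((evalHom x).mapMatrix m).row := by
      rw [Fintype.linearIndependent_iff] at hW ⊢
      intro r hr
      refine hW r ?_
      have h2 : ∀ i, W i x = ∑ j, f (W i) j x • t.localFrame b j x := fun i =>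
        (hexp (W i)).self_of_nhds
      simp only [h2, Finset.smul_sum, smul_smul]
      rw [Finset.sum_comm]
      refine Finset.sum_eq_zero fun j _ => ?_
      rw [← Finset.sum_smul]
      have := congrFun hr j
      rw [Finset.sum_apply] at this
      rw [show ∑ i, r i * f (W i) j x = 0 from this, zero_smul]
    exact ((Matrix.isUnit_iff_isUnit_det _).1 (Matrix.linearIndependent_rows_iff_isUnit.1 h1)).ne_zero
  -- Cramer's rule over the ring of smooth functions; `δ` is a global function that inverts the
  -- determinant near `x`.
  obtain ⟨δ, hδ⟩ := exists_local_inv _ hdet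
  refine ⟨fun i => δ * ∑ k, f X k * m.adjugate k i, ?_⟩
  filter_upwards [hδ, hexp X, eventually_all.2 fun i => hexp (W i)] with y h1 h2 h3
  have hmul : ∀ k j, ∑ i, m.adjugate k i * m i j = if k = j then m.det else 0 := fun k j => by
    have := congrFun (congrFun m.adjugate_mul k) j
    rw [Matrix.mul_apply] at this
    rw [this, Matrix.smul_apply, Matrix.one_apply]
    simp
  have key : ∀ j, ∑ i, (δ * ∑ k, f X k * m.adjugate k i) * m i j = δ * m.det * f X j := fun j => by
    calc _ = δ * ∑ k, f X k * ∑ i, m.adjugate k i * m i j := by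
          simp only [Finset.mul_sum, Finset.sum_mul]
          rw [Finset.sum_comm]
          exact Finset.sum_congr rfl fun k _ => Finset.sum_congr rfl fun i _ => by ring
      _ = _ := by
          simp only [hmul, mul_ite, mul_zero, Finset.sum_ite_eq', Finset.mem_univ, if_true]
          ring
  rw [h2]
  have h4 : ∀ i, (δ * ∑ k, f X k * m.adjugate k i) y • W i y =
      ∑ j, ((δ * ∑ k, f X k * m.adjugate k i) * m i j) y • t.localFrame b j y := fun i => by
    rw [h3 i, Finset.smul_sum]
    exact Finset.sum_congr rfl fun j _ => smul_smul _ _ _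
  simp only [h4]
  rw [Finset.sum_comm]
  refine Finset.sum_congr rfl fun j _ => ?_
  rw [← Finset.sum_smul]
  congr 1
  have := congrArg (evalHom y) (key j)
  rw [map_sum] at this
  exact (this.trans (by rw [map_mul, map_mul, evalHom_apply, evalHom_apply, h1, one_mul]; rfl)).symm

end FrameCoefficients

/-! ### Smooth lifts of vector fields to `V_±` -/

section Lifts

variable {M : Type*} [TopologicalSpace M] [ChartedSpace R6 M] [IsManifold (𝓡 6) ∞ M] [T2Space M]
  {F : Type*} [NormedAddCommGroup F] [NormedSpace ℝ F] [FiniteDimensional ℝ F]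
  {E : M → Type*} [TopologicalSpace (TotalSpace F E)] [∀ x, TopologicalSpace (E x)]
  [∀ x, AddCommGroup (E x)] [∀ x, Module ℝ (E x)] [FiberBundle F E] [VectorBundle ℝ F E]
  [ContMDiffVectorBundle ∞ F E (𝓡 6)]
  {C : CourantAlgebroid F E}

lemma sec_sum_apply {ι : Type*} (s : Finset ι) (f : ι → Sec F E) (x : M) :
    (∑ i ∈ s, f i : Sec F E) x = ∑ i ∈ s, f i x :=
  map_sum ({ toFun := fun X => X x, map_zero' := rfl, map_add' := fun _ _ => rfl } :
    Sec F E →+ E x) f s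

/-- Smoothness of a right inverse of the anchor with values in the image of a projection. -/
lemma CourantAlgebroid.smooth_of_projection {L : ∀ x, TangentSpace (𝓡 6) x →ₗ[ℝ] E x}
    {P : Sec F E → Sec F E} (h1 : ∀ a x, L x (C.anchor x (P a x)) = P a x)
    (h2 : ∀ x v, ∃ a, P a x = L x v) (h3 : ∀ x v, C.anchor x (L x v) = v) (X : VF M) :
    ContMDiff (𝓡 6) ((𝓡 6).prod 𝓘(ℝ, F)) ∞ (fun x => (⟨x, L x (X x)⟩ : TotalSpace F E)) := by
  intro x
  let b : Module.Basis (Fin 6) ℝ (TangentSpace (𝓡 6) x) :=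
    (EuclideanSpace.basisFun (Fin 6) ℝ).toBasis
  -- The sections `P (a i)` lie in the image of the projection and their anchors form a frame near
  -- `x`. The lift of `X` is then their combination with the coefficients of `X` in this frame.
  choose a hw using fun i => h2 x (b i)
  have hlin : LinearIndependent ℝ fun i => C.anchorSec (P (a i)) x := by
    have : (fun i => C.anchorSec (P (a i)) x) = b := by
      funext i
      change C.anchor x (P (a i) x) = _
      rw [hw, h3]
    rw [this]
    exact b.linearIndependent
  obtain ⟨c, hc⟩ := exists_frame_coeff hlin X
  refine ((∑ i, fsmul (c i) (P (a i)) : Sec F E).contMDiff x).congr_of_eventuallyEq ?_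
  filter_upwards [hc] with y hy
  congr 1
  rw [hy, map_sum, sec_sum_apply]
  refine Finset.sum_congr rfl fun i _ => ?_
  rw [map_smul, fsmul_apply]
  congr 1
  exact h1 (a i) y

namespace CourantAlgebroid

variable (C) in
/-- The function `⟨a, b⟩`. -/
def pairFn (a b : Sec F E) : SmoothFun M := ⟨fun x => C.pair x (a x) (b x), C.pair_smooth a b⟩

lemma pairFn_apply (a b : Sec F E) (x : M) : C.pairFn a b x = C.pair x (a x) (b x) := rfl

variable (C) in
/-- Smooth lifts `up`, `dn` of vector fields to two orthogonal complementary subbundles on which the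
pairing is `g` and `-g`, with the corresponding projections `pu`, `pd`. -/
structure LiftPair (g : LorentzMetric M) where
  up : VF M →ₗ[ℝ] Sec F E
  dn : VF M →ₗ[ℝ] Sec F E
  pu : Sec F E →ₗ[ℝ] VF M
  pd : Sec F E →ₗ[ℝ] VF M
  up_fsmul : ∀ (f : SmoothFun M) X, up (fsmul f X) = fsmul f (up X)
  dn_fsmul : ∀ (f : SmoothFun M) X, dn (fsmul f X) = fsmul f (dn X)
  pair_up_up : ∀ X Y, C.pairFn (up X) (up Y) = g.fn X Y
  pair_dn_dn : ∀ X Y, C.pairFn (dn X) (dn Y) = -g.fn X Y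
  pair_up_dn : ∀ X Y, C.pairFn (up X) (dn Y) = 0
  anchor_up : ∀ X, C.anchorSec (up X) = X
  anchor_dn : ∀ X, C.anchorSec (dn X) = X
  decomp : ∀ a, up (pu a) + dn (pd a) = a

namespace GenMetric

variable {A : C.GenMetric} (hC : C.IsExact) (hA : A.Admissible)

lemma upAt_smooth (X : VF M) : ContMDiff (𝓡 6) ((𝓡 6).prod 𝓘(ℝ, F)) ∞
    (fun x => (⟨x, upAt hC hA x (X x)⟩ : TotalSpace F E)) := by
  refine smooth_of_projection (P := A.plus) (fun a x => upAt_anchor hC hA (plus_mem a x))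
    (fun x v => ?_) (anchor_upAt hC hA) X
  obtain ⟨a, ha⟩ := exists_sec_eq (E := E) F (upAt hC hA x v)
  refine ⟨a, ?_⟩
  rw [plus_apply, ha, mem_Vplus.1 (upAt_mem hC hA x _)]
  module

lemma dnAt_smooth (X : VF M) : ContMDiff (𝓡 6) ((𝓡 6).prod 𝓘(ℝ, F)) ∞
    (fun x => (⟨x, dnAt hC hA x (X x)⟩ : TotalSpace F E)) := by
  refine smooth_of_projection (P := A.minus) (fun a x => dnAt_anchor hC hA (minus_mem a x))
    (fun x v => ?_) (anchor_dnAt hC hA) X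
  obtain ⟨a, ha⟩ := exists_sec_eq (E := E) F (dnAt hC hA x v)
  refine ⟨a, ?_⟩
  rw [minus_apply, ha, mem_Vminus.1 (dnAt_mem hC hA x _)]
  module

/-- The metric induced by an admissible generalized metric. -/
def metric : LorentzMetric M where
  val := metricAt hC hA
  symm' x v w := C.pair_symm x _ _
  smooth' X Y := C.pair_smooth ⟨_, upAt_smooth hC hA X⟩ ⟨_, upAt_smooth hC hA Y⟩
  signature' x := by
    obtain ⟨v, hv, hs⟩ := A.signature' x
    have hm : ∀ i, v i ∈ A.Vplus x := fun i => by
      have : v i ∈ Submodule.span ℝ (Set.range v) := Submodule.subset_span ⟨i, rfl⟩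
      rwa [hs] at this
    have h : IsOrtho (metricAt hC hA x) fun i => C.anchor x (v i) := fun i j => by
      rw [metricAt_apply, upAt_anchor hC hA (hm i), upAt_anchor hC hA (hm j)]
      exact hv i j
    obtain ⟨b, -, hb⟩ := h.exists_basis
    exact ⟨b, hb⟩

lemma pair_dnAt_dnAt (x : M) (v w : TangentSpace (𝓡 6) x) :
    C.pair x (dnAt hC hA x v) (dnAt hC hA x w) = -metricAt hC hA x v w := by
  rw [dnAt_apply hC hA x w, map_sub, pair_dnAt_Vplus hC hA v (upAt_mem hC hA x w), C.pair_symm,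
    C.pair_coanchor, anchor_dnAt, zero_sub, metricAt_apply, metricAt_apply, C.pair_symm]

/-- The lifts of vector fields to `V_±`. -/
def lift : C.LiftPair (metric hC hA) where
  up := { toFun := fun X => ⟨fun x => upAt hC hA x (X x), upAt_smooth hC hA X⟩
          map_add' := fun X Y => by ext x; exact map_add (upAt hC hA x) (X x) (Y x)
          map_smul' := fun r X => by ext x; exact map_smul (upAt hC hA x) r (X x) }
  dn := { toFun := fun X => ⟨fun x => dnAt hC hA x (X x), dnAt_smooth hC hA X⟩
          map_add' := fun X Y => by ext x; exact map_add (dnAt hC hA x) (X x) (Y x)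
          map_smul' := fun r X => by ext x; exact map_smul (dnAt hC hA x) r (X x) }
  pu := { toFun := fun a => C.anchorSec (A.plus a)
          map_add' := fun a b => by
            ext x
            change C.anchor x ((1 / 2 : ℝ) • (a x + b x + A.G x (a x + b x))) =
              C.anchor x ((1 / 2 : ℝ) • (a x + A.G x (a x))) +
              C.anchor x ((1 / 2 : ℝ) • (b x + A.G x (b x)))
            rw [← map_add, map_add (A.G x)]
            congr 1
            module
          map_smul' := fun r a => by
            ext x
            change C.anchor x ((1 / 2 : ℝ) • (r • a x + A.G x (r • a x))) =
              r • C.anchor x ((1 / 2 : ℝ) • (a x + A.G x (a x)))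
            rw [← map_smul, map_smul (A.G x)]
            congr 1
            module }
  pd := { toFun := fun a => C.anchorSec (A.minus a)
          map_add' := fun a b => by
            ext x
            change C.anchor x ((1 / 2 : ℝ) • (a x + b x - A.G x (a x + b x))) =
              C.anchor x ((1 / 2 : ℝ) • (a x - A.G x (a x))) +
              C.anchor x ((1 / 2 : ℝ) • (b x - A.G x (b x)))
            rw [← map_add, map_add (A.G x)]
            congr 1
            module
          map_smul' := fun r a => by
            ext x
            change C.anchor x ((1 / 2 : ℝ) • (r • a x - A.G x (r • a x))) =
              r • C.anchor x ((1 / 2 : ℝ) • (a x - A.G x (a x)))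
            rw [← map_smul, map_smul (A.G x)]
            congr 1
            module }
  up_fsmul f X := by ext x; exact map_smul (upAt hC hA x) (f x) (X x)
  dn_fsmul f X := by ext x; exact map_smul (dnAt hC hA x) (f x) (X x)
  pair_up_up X Y := rfl
  pair_dn_dn X Y := by ext x; exact pair_dnAt_dnAt hC hA x _ _
  pair_up_dn X Y := by
    ext x
    exact pair_Vplus_Vminus (upAt_mem hC hA x (X x)) (dnAt_mem hC hA x (Y x))
  anchor_up X := by ext x; exact anchor_upAt hC hA x _
  anchor_dn X := by ext x; exact anchor_dnAt hC hA x _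
  decomp a := by
    ext x
    change upAt hC hA x (C.anchor x (A.plus a x)) + dnAt hC hA x (C.anchor x (A.minus a x)) = a x
    rw [upAt_anchor hC hA (plus_mem a x), dnAt_anchor hC hA (minus_mem a x)]
    exact congrArg (fun s : Sec F E => s x) (plus_add_minus (A := A) a)

end GenMetric

end CourantAlgebroid

end Lifts


/-! ### Skew tensorial maps are differential forms -/

section Forms

variable {M : Type*} [TopologicalSpace M] [ChartedSpace R6 M] [IsManifold (𝓡 6) ∞ M] [T2Space M]

/-- Skew tensorial maps are forms. -/
lemma exists_form3 (T : VF M → VF M → VF M → SmoothFun M) (h12 : ∀ X Y Z, T X Y Z = -T Y X Z)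
    (h23 : ∀ X Y Z, T X Y Z = -T X Z Y) (hadd : ∀ X X' Y Z, T (X + X') Y Z = T X Y Z + T X' Y Z)
    (hsmul : ∀ f X Y Z, T (fsmul f X) Y Z = f * T X Y Z) :
    ∃ H : Form M 3, ∀ X Y Z, fn3 H X Y Z = T X Y Z := by
  -- The form is evaluated on chosen global extensions of its arguments; `cc` below shows that the
  -- choice does not matter.
  choose ext hext using fun (x : M) (v : TangentSpace (𝓡 6) x) => exists_vf_eq M v
  have hadd2 : ∀ X Y Y' Z, T X (Y + Y') Z = T X Y Z + T X Y' Z := fun X Y Y' Z => by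
    rw [h12, hadd, h12 Y, h12 Y']; abel
  have hadd3 : ∀ X Y Z Z', T X Y (Z + Z') = T X Y Z + T X Y Z' := fun X Y Z Z' => by
    rw [h23, hadd2, h23 X Z, h23 X Z']; abel
  have hsmul2 : ∀ f X Y Z, T X (fsmul f Y) Z = f * T X Y Z := fun f X Y Z => by
    rw [h12, hsmul, h12 Y]; ring
  have c1 : ∀ {x : M} {X X' : VF M} (Y Z : VF M), X x = X' x → T X Y Z x = T X' Y Z x :=
    fun {x} {X X'} Y Z h => tensorial_congr (T := fun X : VF M => T X Y Z x)
      (fun a b => by rw [hadd]; rfl) (fun f a => by rw [hsmul]; rfl) h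
  have c2 : ∀ {x : M} {Y Y' : VF M} (X Z : VF M), Y x = Y' x → T X Y Z x = T X Y' Z x :=
    fun {x} {Y Y'} X Z h => by
      rw [h12, h12 X]; exact congrArg Neg.neg (c1 X Z h)
  have c3 : ∀ {x : M} {Z Z' : VF M} (X Y : VF M), Z x = Z' x → T X Y Z x = T X Y Z' x :=
    fun {x} {Z Z'} X Y h => by
      rw [h23 X Y Z, h23 X Y Z']; exact congrArg Neg.neg (c2 X Y h)
  have cc : ∀ {x : M} {X X' Y Y' Z Z' : VF M}, X x = X' x → Y x = Y' x → Z x = Z' x →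
      T X Y Z x = T X' Y' Z' x := fun {x} {X X' Y Y' Z Z'} a b c => by
    rw [c1 Y Z a, c2 X' Z b, c3 X' Y' c]
  let cst : ℝ → SmoothFun M := fun r => ⟨fun _ => r, contMDiff_const⟩
  have hc : ∀ (r : ℝ) (X : VF M), r • X = fsmul (cst r) X := fun r X => rfl
  have r1 : ∀ (r : ℝ) X Y Z x, T (r • X) Y Z x = r * T X Y Z x := fun r X Y Z x => by
    rw [hc, hsmul]; rfl
  have r2 : ∀ (r : ℝ) X Y Z x, T X (r • Y) Z x = r * T X Y Z x := fun r X Y Z x => by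
    rw [hc, hsmul2]; rfl
  have r3 : ∀ (r : ℝ) X Y Z x, T X Y (r • Z) x = r * T X Y Z x := fun r X Y Z x => by
    rw [hc, h23, hsmul2, h23 X Z Y]
    change -(r * -T X Y Z x) = _
    ring
  have z1 : ∀ X Z, T X X Z = 0 := fun X Z => by
    ext x
    have := congrArg (fun f : SmoothFun M => f x) (h12 X X Z)
    change T X X Z x = -T X X Z x at this
    change T X X Z x = 0
    linarith
  have z2 : ∀ X Z, T X Z Z = 0 := fun X Z => by
    ext x
    have := congrArg (fun f : SmoothFun M => f x) (h23 X Z Z)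
    change T X Z Z x = -T X Z Z x at this
    change T X Z Z x = 0
    linarith
  have z3 : ∀ X Z, T X Z X = 0 := fun X Z => by rw [h12, z2, neg_zero]
  let θ : ∀ x : M, (TangentSpace (𝓡 6) x) [⋀^Fin 3]→ₗ[ℝ] ℝ := fun x =>
    { toFun := fun m => T (ext x (m 0)) (ext x (m 1)) (ext x (m 2)) x
      map_update_add' := by
        intro inst m i u v
        obtain rfl : inst = instDecidableEqFin 3 := Subsingleton.elim _ _
        fin_cases i
        · simp only [Fin.zero_eta, Function.update_self, ne_eq, Fin.reduceEq, not_false_eq_true,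
            Function.update_of_ne]
          rw [c1 (X' := ext x u + ext x v) _ _ (by simp [hext]), hadd]; rfl
        · simp only [Fin.mk_one, Function.update_self, ne_eq, Fin.reduceEq, not_false_eq_true,
            Function.update_of_ne]
          rw [c2 (Y' := ext x u + ext x v) _ _ (by simp [hext]), hadd2]; rfl
        · simp only [Fin.reduceFinMk, Function.update_self, ne_eq, Fin.reduceEq, not_false_eq_true,
            Function.update_of_ne]
          rw [c3 (Z' := ext x u + ext x v) _ _ (by simp [hext]), hadd3]; rfl
      map_update_smul' := by
        intro inst m i r u
        obtain rfl : inst = instDecidableEqFin 3 := Subsingleton.elim _ _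
        fin_cases i
        · simp only [Fin.zero_eta, Function.update_self, ne_eq, Fin.reduceEq, not_false_eq_true,
            Function.update_of_ne]
          rw [c1 (X' := r • ext x u) _ _ (by simp [hext]), r1]; rfl
        · simp only [Fin.mk_one, Function.update_self, ne_eq, Fin.reduceEq, not_false_eq_true,
            Function.update_of_ne]
          rw [c2 (Y' := r • ext x u) _ _ (by simp [hext]), r2]; rfl
        · simp only [Fin.reduceFinMk, Function.update_self, ne_eq, Fin.reduceEq, not_false_eq_true,
            Function.update_of_ne]
          rw [c3 (Z' := r • ext x u) _ _ (by simp [hext]), r3]; rfl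
      map_eq_zero_of_eq' := by
        intro m i j hij hne
        fin_cases i <;> fin_cases j <;> first
          | exact absurd rfl hne
          | (simp only [Fin.zero_eta, Fin.mk_one, Fin.reduceFinMk] at hij
             simp only [hij, z1, z2, z3]; rfl) }
  refine ⟨⟨θ, fun X => ?_⟩, fun X Y Z => ?_⟩
  · refine (T (X 0) (X 1) (X 2)).contMDiff.congr fun x => ?_
    exact cc (hext _ _) (hext _ _) (hext _ _)
  · ext x
    rw [fn3_apply, tri_apply]
    exact cc (hext _ _) (hext _ _) (hext _ _)

end Forms

/-! ### The bracket in terms of two metric connections -/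

section LiftCalculus

variable {M : Type*} [TopologicalSpace M] [ChartedSpace R6 M] [IsManifold (𝓡 6) ∞ M] [T2Space M]
  {F : Type*} [NormedAddCommGroup F] [NormedSpace ℝ F] [FiniteDimensional ℝ F]
  {E : M → Type*} [TopologicalSpace (TotalSpace F E)] [∀ x, TopologicalSpace (E x)]
  [∀ x, AddCommGroup (E x)] [∀ x, Module ℝ (E x)] [FiberBundle F E] [VectorBundle ℝ F E]
  [ContMDiffVectorBundle ∞ F E (𝓡 6)]
  {C : CourantAlgebroid F E}

namespace CourantAlgebroid

lemma pairFn_symm (a b : Sec F E) : C.pairFn a b = C.pairFn b a := by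
  ext x; exact C.pair_symm x _ _

lemma pairFn_add_left (a a' b : Sec F E) : C.pairFn (a + a') b = C.pairFn a b + C.pairFn a' b := by
  ext x; simp [pairFn_apply]

lemma pairFn_add_right (a b b' : Sec F E) : C.pairFn a (b + b') = C.pairFn a b + C.pairFn a b' := by
  ext x; simp [pairFn_apply]

lemma pairFn_neg_left (a b : Sec F E) : C.pairFn (-a) b = -C.pairFn a b := by
  ext x; simp [pairFn_apply]

lemma pairFn_smul_left (r : ℝ) (a b : Sec F E) : C.pairFn (r • a) b = r • C.pairFn a b := by
  ext x; simp [pairFn_apply]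

lemma pairFn_smul_right (r : ℝ) (a b : Sec F E) : C.pairFn a (r • b) = r • C.pairFn a b := by
  ext x; simp [pairFn_apply]

lemma pairFn_fsmul_left (f : SmoothFun M) (a b : Sec F E) :
    C.pairFn (fsmul f a) b = f * C.pairFn a b := by
  ext x
  change C.pair x (f x • a x) (b x) = f x * C.pair x (a x) (b x)
  simp

lemma sec_ext {a b : Sec F E} (h : ∀ c, C.pairFn a c = C.pairFn b c) : a = b := by
  ext x
  refine C.pair_ext fun f => ?_
  obtain ⟨c, rfl⟩ := exists_sec_eq (E := E) F f
  exact congrArg (fun f : SmoothFun M => f x) (h c)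

lemma der_pairFn (a b c : Sec F E) : der (C.anchorSec a) (C.pairFn b c) =
    C.pairFn (C.bracket a b) c + C.pairFn b (C.bracket a c) := by
  ext x; exact C.pair_bracket a b c x

lemma pairFn_bracket_symm (a b c : Sec F E) : C.pairFn (C.bracket a b) c +
    C.pairFn (C.bracket b a) c = der (C.anchorSec c) (C.pairFn a b) := by
  ext x
  have h := congrArg (fun e => C.pair x e (c x)) (C.bracket_symm a b x)
  simp only [map_add, LinearMap.add_apply] at h
  rw [C.pair_coanchor] at h
  exact h

lemma anchorSec_bracket (a b : Sec F E) : C.anchorSec (C.bracket a b) =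
    lie (C.anchorSec a) (C.anchorSec b) := by
  ext x; exact C.anchor_bracket a b x

lemma bracket_fsmul (f : SmoothFun M) (a b : Sec F E) : C.bracket a (fsmul f b) =
    fsmul (der (C.anchorSec a) f) b + fsmul f (C.bracket a b) := by
  ext x; exact C.leibniz f a b (fsmul f b) (fun _ => rfl) x

lemma anchorSec_add (a b : Sec F E) : C.anchorSec (a + b) = C.anchorSec a + C.anchorSec b := by
  ext x; exact map_add (C.anchor x) _ _

/-- The symmetric part of the bracket is known, so the Leibniz rule in the second argument yields
one in the first; the extra term comes from differentiating `f ⟨a, b⟩`. -/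
lemma pairFn_fsmul_bracket (f : SmoothFun M) (a b c : Sec F E) :
    C.pairFn (C.bracket (fsmul f a) b) c = f * C.pairFn (C.bracket a b) c
      - der (C.anchorSec b) f * C.pairFn a c + C.pairFn a b * der (C.anchorSec c) f := by
  have h1 := C.pairFn_bracket_symm (fsmul f a) b c
  have h2 := C.pairFn_bracket_symm a b c
  rw [bracket_fsmul, pairFn_fsmul_left, der_mul, pairFn_add_left, pairFn_fsmul_left,
    pairFn_fsmul_left] at h1
  linear_combination h1 - f * h2

namespace LiftPair

variable {g : LorentzMetric M} (L : C.LiftPair g)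

lemma pairFn_up (a : Sec F E) (Z : VF M) : C.pairFn a (L.up Z) = g.fn (L.pu a) Z := by
  conv_lhs => rw [← L.decomp a]
  rw [pairFn_add_left, L.pair_up_up, C.pairFn_symm (L.dn _), L.pair_up_dn, add_zero]

lemma pairFn_dn (a : Sec F E) (Z : VF M) : C.pairFn a (L.dn Z) = -g.fn (L.pd a) Z := by
  conv_lhs => rw [← L.decomp a]
  rw [pairFn_add_left, L.pair_dn_dn, L.pair_up_dn, zero_add]

lemma pu_up (X : VF M) : L.pu (L.up X) = X :=
  g.vf_ext fun Z => by rw [← pairFn_up, L.pair_up_up]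

lemma pd_up (X : VF M) : L.pd (L.up X) = 0 :=
  g.vf_ext fun Z => by
    rw [← neg_inj, ← pairFn_dn, L.pair_up_dn]; ext x; simp [g.fn_apply]

lemma pd_dn (X : VF M) : L.pd (L.dn X) = X :=
  g.vf_ext fun Z => by rw [← neg_inj, ← pairFn_dn, L.pair_dn_dn]

lemma pu_dn (X : VF M) : L.pu (L.dn X) = 0 :=
  g.vf_ext fun Z => by
    rw [← pairFn_up, C.pairFn_symm, L.pair_up_dn]; ext x; simp [g.fn_apply]

lemma anchorSec_eq (a : Sec F E) : C.anchorSec a = L.pu a + L.pd a := by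
  conv_lhs => rw [← L.decomp a]
  rw [anchorSec_add, L.anchor_up, L.anchor_dn]

/-- The connection `X, Y ↦ π [X⁻, Y⁺]₊`. -/
def nabp (X Y : VF M) : VF M := L.pu (C.bracket (L.dn X) (L.up Y))

/-- The connection `X, Y ↦ π [X⁺, Y⁻]₋`. -/
def nabm (X Y : VF M) : VF M := L.pd (C.bracket (L.up X) (L.dn Y))

lemma fn_nabp (X Y Z : VF M) :
    g.fn (L.nabp X Y) Z = C.pairFn (C.bracket (L.dn X) (L.up Y)) (L.up Z) := (L.pairFn_up _ _).symm

lemma fn_nabm (X Y Z : VF M) :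
    g.fn (L.nabm X Y) Z = -C.pairFn (C.bracket (L.up X) (L.dn Y)) (L.dn Z) := by
  rw [L.pairFn_dn, neg_neg]; rfl

lemma nabp_add_left (X X' Y : VF M) : L.nabp (X + X') Y = L.nabp X Y + L.nabp X' Y := by
  simp [nabp]

lemma nabp_add_right (X Y Y' : VF M) : L.nabp X (Y + Y') = L.nabp X Y + L.nabp X Y' := by
  simp [nabp]

lemma nabm_add_left (X X' Y : VF M) : L.nabm (X + X') Y = L.nabm X Y + L.nabm X' Y := by
  simp [nabm]

lemma nabm_add_right (X Y Y' : VF M) : L.nabm X (Y + Y') = L.nabm X Y + L.nabm X Y' := by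
  simp [nabm]

/-- The two derivative terms of `pairFn_fsmul_bracket` carry a pairing between `V_-` and `V_+`,
which vanishes; so the mixed bracket is tensorial in its first argument. -/
lemma nabp_fsmul_left (f : SmoothFun M) (X Y : VF M) : L.nabp (fsmul f X) Y = fsmul f (L.nabp X Y) :=
  g.vf_ext fun Z => by
    rw [fn_nabp, L.dn_fsmul, pairFn_fsmul_bracket, C.pairFn_symm (L.dn X), C.pairFn_symm (L.dn X),
      L.pair_up_dn, L.pair_up_dn, g.fn_fsmul_left, fn_nabp]
    ring

lemma nabm_fsmul_left (f : SmoothFun M) (X Y : VF M) : L.nabm (fsmul f X) Y = fsmul f (L.nabm X Y) :=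
  g.vf_ext fun Z => by
    rw [fn_nabm, L.up_fsmul, pairFn_fsmul_bracket, L.pair_up_dn, L.pair_up_dn, g.fn_fsmul_left,
      fn_nabm]
    ring

lemma nabp_fsmul_right (f : SmoothFun M) (X Y : VF M) : L.nabp X (fsmul f Y) =
    fsmul (der X f) Y + fsmul f (L.nabp X Y) :=
  g.vf_ext fun Z => by
    rw [fn_nabp, L.up_fsmul, bracket_fsmul, pairFn_add_left, pairFn_fsmul_left, pairFn_fsmul_left,
      L.pair_up_up, L.anchor_dn, g.fn_add_left, g.fn_fsmul_left, g.fn_fsmul_left, fn_nabp]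

lemma nabm_fsmul_right (f : SmoothFun M) (X Y : VF M) : L.nabm X (fsmul f Y) =
    fsmul (der X f) Y + fsmul f (L.nabm X Y) :=
  g.vf_ext fun Z => by
    rw [fn_nabm, L.dn_fsmul, bracket_fsmul, pairFn_add_left, pairFn_fsmul_left, pairFn_fsmul_left,
      L.pair_dn_dn, L.anchor_up, g.fn_add_left, g.fn_fsmul_left, g.fn_fsmul_left, fn_nabm]
    ring

/-- Invariance of the pairing under the bracket, restricted to sections of `V_+`. -/
lemma nabp_metric (X Y Z : VF M) :
    der X (g.fn Y Z) = g.fn (L.nabp X Y) Z + g.fn Y (L.nabp X Z) := by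
  have h := C.der_pairFn (L.dn X) (L.up Y) (L.up Z)
  rw [L.anchor_dn, L.pair_up_up, C.pairFn_symm (L.up Y), ← fn_nabp, ← fn_nabp, g.fn_symm _ Y] at h
  exact h

lemma nabm_metric (X Y Z : VF M) :
    der X (g.fn Y Z) = g.fn (L.nabm X Y) Z + g.fn Y (L.nabm X Z) := by
  have h := C.der_pairFn (L.up X) (L.dn Y) (L.dn Z)
  rw [L.anchor_up, L.pair_dn_dn, der_neg, C.pairFn_symm (L.dn Y)] at h
  rw [g.fn_symm Y (L.nabm X Z), fn_nabm, fn_nabm]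
  linear_combination -h

/-- The symmetric part of the bracket is the image of `d⟨a, b⟩`, and this pairing vanishes
identically. -/
lemma bracket_up_dn (X Y : VF M) : C.bracket (L.up X) (L.dn Y) = -C.bracket (L.dn Y) (L.up X) := by
  refine C.sec_ext fun c => ?_
  have h := C.pairFn_bracket_symm (L.up X) (L.dn Y) c
  rw [L.pair_up_dn] at h
  have h0 : der (C.anchorSec c) (0 : SmoothFun M) = 0 := by
    have := der_add (C.anchorSec c) (0 : SmoothFun M) 0
    simpa using this
  rw [h0] at h
  rw [pairFn_neg_left]
  exact eq_neg_of_add_eq_zero_left h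

/-- Apply the anchor to `[X⁻... , Y⁺]`, that is to the bracket of `L.dn X` and `L.up Y`: its `V_+`
part gives `nabp X Y` and, by `bracket_up_dn`, its `V_-` part gives `-nabm Y X`. -/
lemma nabp_sub_nabm (X Y : VF M) : L.nabp X Y - L.nabm Y X = lie X Y := by
  have h := C.anchorSec_bracket (L.dn X) (L.up Y)
  rw [L.anchor_dn, L.anchor_up, L.anchorSec_eq] at h
  rw [← h, nabp, nabm, bracket_up_dn, map_neg, sub_neg_eq_add]

/-- The Levi-Civita connection in terms of the brackets. -/
def nab (X Y : VF M) : VF M := (1 / 2 : ℝ) • (L.nabp X Y + L.nabm X Y)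

/-- The difference of the two connections. -/
def K (X Y : VF M) : VF M := L.nabp X Y - L.nabm X Y

lemma nabp_eq (X Y : VF M) : L.nabp X Y = L.nab X Y + (1 / 2 : ℝ) • L.K X Y := by
  simp only [nab, K]; module

lemma nabm_eq (X Y : VF M) : L.nabm X Y = L.nab X Y - (1 / 2 : ℝ) • L.K X Y := by
  simp only [nab, K]; module

/-- Both connections are metric, and by `nabp_sub_nabm` their torsions are opposite, so the mean is
metric and torsion free. -/
lemma isLeviCivita : IsLeviCivita g L.nab where
  add_left X X' Y := by simp only [nab, nabp_add_left, nabm_add_left]; module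
  add_right X Y Y' := by simp only [nab, nabp_add_right, nabm_add_right]; module
  smul_left f X X' Y h x := by
    have e : X' = fsmul f X := by ext x; exact h x
    rw [e, nab, nabp_fsmul_left, nabm_fsmul_left]
    change (1 / 2 : ℝ) • (f x • L.nabp X Y x + f x • L.nabm X Y x) =
      f x • (1 / 2 : ℝ) • (L.nabp X Y x + L.nabm X Y x)
    module
  leibniz f X Y Y' h x := by
    have e : Y' = fsmul f Y := by ext x; exact h x
    rw [e, nab, nabp_fsmul_right, nabm_fsmul_right]
    change (1 / 2 : ℝ) • ((dFun f x (X x) • Y x + f x • L.nabp X Y x) +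
      (dFun f x (X x) • Y x + f x • L.nabm X Y x)) =
      dFun f x (X x) • Y x + f x • (1 / 2 : ℝ) • (L.nabp X Y x + L.nabm X Y x)
    module
  torsion_free X Y x := by
    have h1 := L.nabp_sub_nabm X Y
    have h2 := L.nabp_sub_nabm Y X
    have h3 : L.nab X Y - L.nab Y X = lie X Y := by
      have : L.nab X Y - L.nab Y X = (1 / 2 : ℝ) • ((L.nabp X Y - L.nabm Y X) -
          (L.nabp Y X - L.nabm X Y)) := by simp only [nab]; module
      rw [this, h1, h2, lie_skew Y X]; module
    exact congrArg (fun Z : VF M => Z x) h3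
  metric X Y Z x := by
    have h1 := L.nabp_metric X Y Z
    have h2 := L.nabm_metric X Y Z
    have h3 : der X (g.fn Y Z) = g.fn (L.nab X Y) Z + g.fn Y (L.nab X Z) := by
      simp only [nab, g.fn_smul_left, g.fn_smul_right, g.fn_add_left, g.fn_add_right]
      calc der X (g.fn Y Z) = (1 / 2 : ℝ) • (der X (g.fn Y Z) + der X (g.fn Y Z)) := by module
        _ = _ := by nth_rewrite 1 [h1]; rw [h2]; module
    exact congrArg (fun f : SmoothFun M => f x) h3

lemma K_fsmul_left (f : SmoothFun M) (X Y : VF M) : L.K (fsmul f X) Y = fsmul f (L.K X Y) := by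
  rw [K, nabp_fsmul_left, nabm_fsmul_left]
  ext x
  exact (smul_sub (f x) _ _).symm

lemma K_skew (X Y : VF M) : L.K X Y = -L.K Y X := by
  have h1 := L.nabp_sub_nabm X Y
  have h2 := L.nabp_sub_nabm Y X
  rw [lie_skew Y X, ← h1] at h2
  simp only [K]
  have h3 : L.nabp X Y = L.nabm Y X - (L.nabp Y X - L.nabm X Y) := by rw [h2]; abel
  rw [h3]; abel

/-- Two metric connections differ by a `g`-skew endomorphism. Together with `K_skew` this makes
`g(K(X, Y), Z)` totally skew. -/
lemma fn_K_skew (X Y Z : VF M) : g.fn (L.K X Y) Z = -g.fn (L.K X Z) Y := by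
  have h1 := L.nabp_metric X Y Z
  rw [L.nabm_metric, g.fn_symm Y, g.fn_symm Y] at h1
  simp only [K, g.fn_sub_left]
  linear_combination -h1

/-- Differentiating `⟨Y⁺, Z⁻⟩ = 0` along `X⁺` moves the bracket onto `Z⁻`, where it is mixed. -/
lemma pairFn_up_up_dn (X Y Z : VF M) : C.pairFn (C.bracket (L.up X) (L.up Y)) (L.dn Z) =
    g.fn (L.nabp Z X) Y := by
  have h := C.der_pairFn (L.up X) (L.up Y) (L.dn Z)
  have h0 : der (C.anchorSec (L.up X)) (0 : SmoothFun M) = 0 := by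
    have := der_add (C.anchorSec (L.up X)) (0 : SmoothFun M) 0
    simpa using this
  rw [L.pair_up_dn, h0, bracket_up_dn, C.pairFn_symm (L.up Y), pairFn_neg_left, ← fn_nabp] at h
  linear_combination -h

lemma pairFn_dn_dn_up (X Y Z : VF M) : C.pairFn (C.bracket (L.dn X) (L.dn Y)) (L.up Z) =
    -g.fn (L.nabm Z X) Y := by
  have h := C.der_pairFn (L.dn X) (L.dn Y) (L.up Z)
  have h0 : der (C.anchorSec (L.dn X)) (0 : SmoothFun M) = 0 := by
    have := der_add (C.anchorSec (L.dn X)) (0 : SmoothFun M) 0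
    simpa using this
  have h1 : C.bracket (L.dn X) (L.up Z) = -C.bracket (L.up Z) (L.dn X) := by
    rw [bracket_up_dn, neg_neg]
  rw [C.pairFn_symm (L.dn Y) (L.up Z), L.pair_up_dn, h0, h1, C.pairFn_symm (L.dn Y),
    pairFn_neg_left] at h
  rw [fn_nabm]
  linear_combination -h

/-- The difference of the two lifts of `X` is `π* g(X)`, whose pairing reads off the anchor. This
yields the unmixed components of the bracket from the mixed ones. -/
lemma pairFn_up_sub_dn (X : VF M) (a : Sec F E) : C.pairFn a (L.up X) - C.pairFn a (L.dn X) =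
    g.fn (C.anchorSec a) X := by
  rw [L.pairFn_up, L.pairFn_dn, L.anchorSec_eq, g.fn_add_left, sub_neg_eq_add]

lemma pairFn_up_up_up (X Y Z : VF M) : C.pairFn (C.bracket (L.up X) (L.up Y)) (L.up Z) =
    g.fn (lie X Y) Z + g.fn (L.nabp Z X) Y := by
  have h := L.pairFn_up_sub_dn Z (C.bracket (L.up X) (L.up Y))
  rw [pairFn_up_up_dn, anchorSec_bracket, L.anchor_up, L.anchor_up] at h
  linear_combination h

lemma pairFn_dn_dn_dn (X Y Z : VF M) : C.pairFn (C.bracket (L.dn X) (L.dn Y)) (L.dn Z) =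
    -g.fn (lie X Y) Z - g.fn (L.nabm Z X) Y := by
  have h := L.pairFn_up_sub_dn Z (C.bracket (L.dn X) (L.dn Y))
  rw [pairFn_dn_dn_up, anchorSec_bracket, L.anchor_dn, L.anchor_dn] at h
  linear_combination -h

/-- The isotropic lift `s = (up + dn) / 2`. -/
def mid (X : VF M) : Sec F E := (1 / 2 : ℝ) • (L.up X + L.dn X)

/-- The 3-form of the isotropic splitting. -/
lemma two_pair_mid (X Y Z : VF M) :
    (2 : ℝ) • C.pairFn (C.bracket (L.mid X) (L.mid Y)) (L.mid Z) = g.fn (L.K X Y) Z := by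
  have e1 : C.pairFn (C.bracket (L.up X) (L.dn Y)) (L.up Z) = -g.fn (L.nabp Y X) Z := by
    rw [bracket_up_dn, pairFn_neg_left, fn_nabp]
  have e2 : C.pairFn (C.bracket (L.dn X) (L.up Y)) (L.dn Z) = g.fn (L.nabm Y X) Z := by
    rw [fn_nabm, bracket_up_dn, pairFn_neg_left, neg_neg]
  have e3 : C.pairFn (C.bracket (L.up X) (L.dn Y)) (L.dn Z) = -g.fn (L.nabm X Y) Z := by
    rw [fn_nabm, neg_neg]
  have k1 : g.fn (L.K Z X) Y = g.fn (L.K X Y) Z := by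
    rw [K_skew]
    have : g.fn (-L.K X Z) Y = -g.fn (L.K X Z) Y := by ext x; simp [g.fn_apply]
    rw [this, ← fn_K_skew]
  have k2 : g.fn (L.K Y X) Z = -g.fn (L.K X Y) Z := by
    rw [K_skew]; ext x; simp [g.fn_apply]
  simp only [mid, map_smul, map_add, LinearMap.add_apply, LinearMap.smul_apply, pairFn_smul_left,
    pairFn_smul_right, pairFn_add_left, pairFn_add_right, pairFn_up_up_up, pairFn_up_up_dn,
    pairFn_dn_dn_up, pairFn_dn_dn_dn, e1, e2, e3, ← fn_nabp]
  have k3 : g.fn (L.K Z X) Y = g.fn (L.nabp Z X) Y - g.fn (L.nabm Z X) Y := g.fn_sub_left _ _ _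
  have k4 : g.fn (L.K Y X) Z = g.fn (L.nabp Y X) Z - g.fn (L.nabm Y X) Z := g.fn_sub_left _ _ _
  have k5 : g.fn (L.K X Y) Z = g.fn (L.nabp X Y) Z - g.fn (L.nabm X Y) Z := g.fn_sub_left _ _ _
  -- The components of the bracket of midpoints assemble into this combination, in which total
  -- skewness of `K` makes the weights add up to `2 + 1 + 1 = 4`.
  have : g.fn (L.K X Y) Z = (1 / 4 : ℝ) • ((2 : ℝ) • g.fn (L.K Z X) Y + g.fn (L.K X Y) Z
      - g.fn (L.K Y X) Z) := by
    rw [k1, k2]; module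
  rw [this, k3, k4, k5]
  module

end LiftPair

end CourantAlgebroid

end LiftCalculus


/-! ### The canonical Levi-Civita connection -/

section CanonicalConnection

variable {M : Type*} [TopologicalSpace M] [ChartedSpace R6 M] [IsManifold (𝓡 6) ∞ M] [T2Space M]
  {F : Type*} [NormedAddCommGroup F] [NormedSpace ℝ F] [FiniteDimensional ℝ F]
  {E : M → Type*} [TopologicalSpace (TotalSpace F E)] [∀ x, TopologicalSpace (E x)]
  [∀ x, AddCommGroup (E x)] [∀ x, Module ℝ (E x)] [FiberBundle F E] [VectorBundle ℝ F E]
  [ContMDiffVectorBundle ∞ F E (𝓡 6)]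
  {C : CourantAlgebroid F E}

namespace CourantAlgebroid

namespace LiftPair

variable {g : LorentzMetric M} (L : C.LiftPair g)

/-- The Gualtieri–Bismut connection of a pair of lifts. -/
def bis (a b : Sec F E) : Sec F E :=
  L.up (L.nabp (C.anchorSec a) (L.pu b)) + L.dn (L.nabm (C.anchorSec a) (L.pd b))

/-- The canonical Levi-Civita connection of a pair of lifts. -/
def canon (a b : Sec F E) : Sec F E :=
  L.up (L.nab (C.anchorSec a) (L.pu b) + (1 / 2 : ℝ) • L.K (L.pd a) (L.pu b)
      + (1 / 6 : ℝ) • L.K (L.pu a) (L.pu b))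
    + L.dn (L.nab (C.anchorSec a) (L.pd b) - (1 / 2 : ℝ) • L.K (L.pu a) (L.pd b)
      - (1 / 6 : ℝ) • L.K (L.pd a) (L.pd b))

lemma pairFn_lift (X U : VF M) (c : Sec F E) : C.pairFn (L.up X + L.dn U) c =
    g.fn X (L.pu c) - g.fn U (L.pd c) := by
  conv_lhs => rw [← L.decomp c]
  rw [pairFn_add_left, pairFn_add_right, pairFn_add_right, L.pair_up_up, L.pair_dn_dn,
    C.pairFn_symm (L.dn U), L.pair_up_dn, L.pair_up_dn]
  ring

/-- The bracket in terms of the two connections. -/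
lemma pairFn_bracket (X U Y W Z V : VF M) :
    C.pairFn (C.bracket (L.up X + L.dn U) (L.up Y + L.dn W)) (L.up Z + L.dn V) =
      g.fn (lie X Y) Z + g.fn (L.nabp Z X) Y + g.fn (L.nabp V X) Y
      - g.fn (L.nabp W X) Z - g.fn (L.nabm X W) V + g.fn (L.nabp U Y) Z + g.fn (L.nabm Y U) V
      - g.fn (L.nabm Z U) W - g.fn (lie U W) V - g.fn (L.nabm V U) W := by
  have e1 : C.pairFn (C.bracket (L.up X) (L.dn W)) (L.up Z) = -g.fn (L.nabp W X) Z := by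
    rw [bracket_up_dn, pairFn_neg_left, fn_nabp]
  have e2 : C.pairFn (C.bracket (L.dn U) (L.up Y)) (L.dn V) = g.fn (L.nabm Y U) V := by
    rw [fn_nabm, bracket_up_dn, pairFn_neg_left, neg_neg]
  have e3 : C.pairFn (C.bracket (L.up X) (L.dn W)) (L.dn V) = -g.fn (L.nabm X W) V := by
    rw [fn_nabm, neg_neg]
  simp only [map_add, LinearMap.add_apply, pairFn_add_left, pairFn_add_right, pairFn_up_up_up,
    pairFn_up_up_dn, pairFn_dn_dn_up, pairFn_dn_dn_dn, e1, e2, e3, ← fn_nabp]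
  ring

/-- Expanding the bracket through `nabp` and `nabm`, the mixed components cancel and the components
with all arguments in one of `V_±` reduce to `K`. -/
lemma torsion_bis (a b c : Sec F E) (x : M) : C.torsion L.bis a b c x =
    g.fn (L.K (L.pu a) (L.pu b)) (L.pu c) x + g.fn (L.K (L.pd a) (L.pd b)) (L.pd c) x := by
  have hdef : C.torsion L.bis a b c x = C.pairFn (L.bis a b) c x - C.pairFn (L.bis b a) c x
      - (1 / 2) * (C.pairFn (C.bracket a b) c x - C.pairFn (C.bracket b a) c x)
      + (1 / 2) * (C.pairFn (L.bis c a) b x - C.pairFn (L.bis c b) a x) := by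
    change C.pair x (L.bis a b x - L.bis b a x - (1 / 2 : ℝ) • (C.bracket a b x - C.bracket b a x))
      (c x) + _ = _
    simp only [map_sub, map_smul, LinearMap.sub_apply, LinearMap.smul_apply, smul_eq_mul]
    rfl
  rw [hdef]
  have ea := L.anchorSec_eq a
  have eb := L.anchorSec_eq b
  have ec := L.anchorSec_eq c
  have b1 := L.pairFn_bracket (L.pu a) (L.pd a) (L.pu b) (L.pd b) (L.pu c) (L.pd c)
  have b2 := L.pairFn_bracket (L.pu b) (L.pd b) (L.pu a) (L.pd a) (L.pu c) (L.pd c)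
  simp only [L.decomp] at b1 b2
  rw [b1, b2]
  simp only [bis, pairFn_lift, ea, eb, ec, nabp_add_left, nabm_add_left, g.fn_add_left]
  generalize L.pu a = X
  generalize L.pd a = U
  generalize L.pu b = Y
  generalize L.pd b = W
  generalize L.pu c = Z
  generalize L.pd c = V
  have l1 := congrArg (fun A => g.fn A Z x) (L.nabp_sub_nabm X Y)
  have l2 := congrArg (fun A => g.fn A Z x) (L.nabp_sub_nabm Y X)
  have l3 := congrArg (fun A => g.fn A Z x) (lie_skew X Y)
  have l4 := congrArg (fun A => g.fn A V x) (L.nabp_sub_nabm U W)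
  have l5 := congrArg (fun A => g.fn A V x) (L.nabp_sub_nabm W U)
  have l6 := congrArg (fun A => g.fn A V x) (lie_skew U W)
  have n1 : ∀ A B : VF M, g.fn (-A) B = -g.fn A B := fun A B => by ext x; simp [g.fn_apply]
  simp only [g.fn_sub_left, n1] at l1 l2 l3 l4 l5 l6
  simp only [K, g.fn_sub_left]
  change g.fn _ _ x - g.fn _ _ x = _ at l1 l2 l4 l5
  change _ = -(g.fn _ _ x) at l3 l6
  simp only [ContMDiffMap.coe_add, ContMDiffMap.coe_sub, Pi.add_apply, Pi.sub_apply]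
  linarith

end LiftPair

namespace GenMetric

variable {A : C.GenMetric} (hC : C.IsExact) (hA : A.Admissible)

lemma plus_eq (a : Sec F E) : A.plus a = (lift hC hA).up ((lift hC hA).pu a) := by
  ext x; exact (upAt_anchor hC hA (plus_mem a x)).symm

lemma minus_eq (a : Sec F E) : A.minus a = (lift hC hA).dn ((lift hC hA).pd a) := by
  ext x; exact (dnAt_anchor hC hA (minus_mem a x)).symm

/-- A swap sends `V_+` into `V_-` without changing the anchor, and elements of `V_-` are determined
by their anchor. So there is at most one swap. -/
lemma swap_up (S : A.Swap) (X : VF M) : S.onSec ((lift hC hA).up X) = (lift hC hA).dn X := by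
  ext x
  refine Vminus_ext hC hA ?_ (dnAt_mem hC hA x (X x)) ?_
  · rw [mem_Vminus]
    refine (S.anti' x _).trans ?_
    have : A.G x ((lift hC hA).up X x) = (lift hC hA).up X x :=
      mem_Vplus.1 (upAt_mem hC hA x (X x))
    rw [this]; rfl
  · exact (S.anchor' x _).trans ((anchor_upAt hC hA x _).trans (anchor_dnAt hC hA x _).symm)

lemma swap_dn (S : A.Swap) (X : VF M) : S.onSec ((lift hC hA).dn X) = (lift hC hA).up X := by
  ext x
  refine Vplus_ext hC hA ?_ (upAt_mem hC hA x (X x)) ?_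
  · rw [mem_Vplus]
    refine (S.anti' x _).trans ?_
    have : A.G x ((lift hC hA).dn X x) = -(lift hC hA).dn X x :=
      mem_Vminus.1 (dnAt_mem hC hA x (X x))
    rw [this, map_neg, neg_neg]; rfl
  · exact (S.anchor' x _).trans ((anchor_dnAt hC hA x _).trans (anchor_upAt hC hA x _).symm)

/-- Replacing the swapped lifts turns the two unmixed terms into mixed brackets, which combine with
the other two into derivatives along the whole anchor of `a`. -/
lemma bismut_eq (S : A.Swap) (a b : Sec F E) : A.bismut S a b = (lift hC hA).bis a b := by
  have ha := (lift hC hA).anchorSec_eq a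
  simp only [bismut, plus_eq hC hA, minus_eq hC hA, swap_up, swap_dn, LiftPair.bis, ha,
    LinearMap.add_apply, map_add, LiftPair.nabp, LiftPair.nabm]
  abel

/-- The swap of an admissible generalized metric. -/
def swap : A.Swap where
  map x := dnAt hC hA x ∘ₗ C.anchor x ∘ₗ ((1 / 2 : ℝ) • (LinearMap.id + A.G x)) +
    upAt hC hA x ∘ₗ C.anchor x ∘ₗ ((1 / 2 : ℝ) • (LinearMap.id - A.G x))
  smooth' a := ((lift hC hA).dn ((lift hC hA).pu a) + (lift hC hA).up ((lift hC hA).pd a)).contMDiff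
  anti' x e := by
    simp only [LinearMap.add_apply, LinearMap.comp_apply, LinearMap.smul_apply,
      LinearMap.sub_apply, LinearMap.id_apply, A.sq', map_add, map_sub, map_smul,
      mem_Vminus.1 (dnAt_mem hC hA x _), mem_Vplus.1 (upAt_mem hC hA x _)]
    module
  anchor' x e := by
    simp only [LinearMap.add_apply, LinearMap.comp_apply, LinearMap.smul_apply,
      LinearMap.sub_apply, LinearMap.id_apply, map_add, map_sub, map_smul, anchor_upAt, anchor_dnAt]
    module

/-- The canonical Levi-Civita connection is unique and given by an explicit formula. -/
lemma isCanonicalLC_iff (D : Sec F E → Sec F E → Sec F E) :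
    A.IsCanonicalLC D ↔ D = (lift hC hA).canon := by
  set L := lift hC hA
  have key : ∀ (S : A.Swap) (a b c : Sec F E) (x : M), C.pair x (A.bismut S a b x) (c x)
      - (1 / 3 : ℝ) * C.torsion (A.bismut S) a b c x = C.pairFn (L.canon a b) c x := by
    intro S a b c x
    have hb : A.bismut S = L.bis := by funext a b; exact bismut_eq hC hA S a b
    rw [hb, L.torsion_bis]
    change C.pairFn (L.bis a b) c x - _ = _
    rw [LiftPair.bis, LiftPair.canon, L.pairFn_lift, L.pairFn_lift, L.anchorSec_eq]
    -- On the pure parts the torsion term reduces the coefficient of `K` from `½` to `½ - ⅓ = ⅙`; on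
    -- the mixed parts it stays `½`.
    simp only [LiftPair.nabp_eq, LiftPair.nabm_eq]
    have k1 : ∀ X Y Z, L.K (X + Y) Z = L.K X Z + L.K Y Z := fun X Y Z => by
      simp only [LiftPair.K, LiftPair.nabp_add_left, LiftPair.nabm_add_left]; abel
    simp only [k1, LorentzMetric.fn_add_left, LorentzMetric.fn_sub_left, LorentzMetric.fn_smul_left,
      smul_add]
    simp only [ContMDiffMap.coe_add, ContMDiffMap.coe_sub, Pi.add_apply, Pi.sub_apply,
      ContMDiffMap.coe_smul, Pi.smul_apply, smul_eq_mul]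
    ring
  constructor
  · rintro ⟨S, hS⟩
    funext a b
    refine C.sec_ext fun c => ?_
    ext x
    rw [← key S, ← hS]
    rfl
  · rintro rfl
    exact ⟨swap hC hA, fun a b c x => by rw [key]; rfl⟩

end GenMetric

end CourantAlgebroid

end CanonicalConnection


/-! ### The generalized Ricci tensor -/

section GeneralizedRicci

variable {M : Type*} [TopologicalSpace M] [ChartedSpace R6 M] [IsManifold (𝓡 6) ∞ M] [T2Space M]
  {F : Type*} [NormedAddCommGroup F] [NormedSpace ℝ F] [FiniteDimensional ℝ F]
  {E : M → Type*} [TopologicalSpace (TotalSpace F E)] [∀ x, TopologicalSpace (E x)]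
  [∀ x, AddCommGroup (E x)] [∀ x, Module ℝ (E x)] [FiberBundle F E] [VectorBundle ℝ F E]
  [ContMDiffVectorBundle ∞ F E (𝓡 6)]
  {C : CourantAlgebroid F E}

namespace CourantAlgebroid

namespace LiftPair

variable {g : LorentzMetric M} (L : C.LiftPair g)

lemma K_add_left (X X' Y : VF M) : L.K (X + X') Y = L.K X Y + L.K X' Y := by
  simp only [K, nabp_add_left, nabm_add_left]; abel

lemma K_add_right (X Y Y' : VF M) : L.K X (Y + Y') = L.K X Y + L.K X Y' := by
  simp only [K, nabp_add_right, nabm_add_right]; abel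

lemma K_smul_left (r : ℝ) (X Y : VF M) : L.K (r • X) Y = r • L.K X Y := by
  simp only [K, nabp, nabm, map_smul, LinearMap.smul_apply]; module

lemma K_smul_right (r : ℝ) (X Y : VF M) : L.K X (r • Y) = r • L.K X Y := by
  simp only [K, nabp, nabm, map_smul]; module

lemma nab_smul_right (r : ℝ) (X Y : VF M) : L.nab X (r • Y) = r • L.nab X Y := by
  simp only [nab, nabp, nabm, map_smul]; module

lemma canon_up (a : Sec F E) (Y : VF M) : L.canon a (L.up Y) =
    L.up (L.nab (C.anchorSec a) Y + (1 / 2 : ℝ) • L.K (L.pd a) Y + (1 / 6 : ℝ) • L.K (L.pu a) Y) := by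
  have h1 : L.nab (C.anchorSec a) 0 = 0 := by simpa using L.nab_smul_right 0 (C.anchorSec a) 0
  have h2 : ∀ X, L.K X 0 = 0 := fun X => by simpa using L.K_smul_right 0 X 0
  simp [canon, pu_up, pd_up, h1, h2]

/-- The mixed component of the generalized curvature. -/
def mixedCurv (W Y X : VF M) : VF M :=
  curv L.nab X W Y
    + (1 / 2 : ℝ) • (L.nab X (L.K W Y) - L.K (L.nab X W) Y - L.K W (L.nab X Y))
    - (1 / 6 : ℝ) • (L.nab W (L.K X Y) - L.K X (L.nab W Y) - L.K (L.nab W X) Y)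
    + (1 / 12 : ℝ) • (L.K X (L.K W Y) - L.K W (L.K X Y)) + (1 / 6 : ℝ) • L.K (L.K X W) Y

/-- The connection preserves `V_+`, acting as `∇ + ½ K` along `V_-` and as `∇ + ⅙ K` along `V_+`.
The bracket of `X⁺` and `W⁻` is already skew and has the components `-nabp W X` and `nabm X W`,
along which `D` differentiates in the last term. -/
lemma genCurv_mixed (X W Y : VF M) :
    C.genCurv L.canon (L.up X) (L.dn W) (L.up Y) = L.up (L.mixedCurv W Y X) := by
  have hc : C.courant (L.up X) (L.dn W) = C.bracket (L.up X) (L.dn W) := by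
    have : C.bracket (L.dn W) (L.up X) = -C.bracket (L.up X) (L.dn W) := by
      rw [bracket_up_dn, neg_neg]
    rw [courant, this]; module
  have hu : L.pu (C.bracket (L.up X) (L.dn W)) = -L.nabp W X := by
    rw [bracket_up_dn, map_neg]; rfl
  have hd : L.pd (C.bracket (L.up X) (L.dn W)) = L.nabm X W := rfl
  have hl : C.anchorSec (C.bracket (L.up X) (L.dn W)) = lie X W := by
    rw [anchorSec_bracket, L.anchor_up, L.anchor_dn]
  have h0 : ∀ Z, L.K 0 Z = 0 := fun Z => by simpa using L.K_smul_left 0 0 Z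
  have hs : L.K (L.K W X) Y = -L.K (L.K X W) Y := by
    rw [L.K_skew W X, ← neg_one_smul ℝ, K_smul_left, neg_one_smul]
  have hneg : ∀ A B, L.K (-A) B = -L.K A B := fun A B => by
    rw [← neg_one_smul ℝ, K_smul_left, neg_one_smul]
  simp only [genCurv, hc, canon_up, hu, hd, hl, L.anchor_up, L.anchor_dn, pu_up, pd_up, pu_dn,
    pd_dn, h0, smul_zero, add_zero, ← map_sub]
  congr 1
  simp only [nabp_eq, nabm_eq, sub_eq_add_neg, hneg, K_add_left, K_add_right, K_smul_left,
    K_smul_right, L.isLeviCivita.add_right, nab_smul_right, hs, mixedCurv, curv]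
  module

variable {H : Form M 3} (hH : ∀ X Y Z, fn3 H X Y Z = g.fn (L.K X Y) Z)
include hH

lemma fn_nab_K (X W Y V : VF M) :
    g.fn (L.nab X (L.K W Y) - L.K (L.nab X W) Y - L.K W (L.nab X Y)) V = nabH H L.nab X W Y V := by
  have h := L.isLeviCivita.der_metric X (L.K W Y) V
  simp only [nabH, hH, g.fn_sub_left]
  rw [h]
  ring

lemma fn_mixedCurv (W Y X V : VF M) : g.fn (L.mixedCurv W Y X) V =
    g.fn (curv L.nab X W Y) V + (1 / 2 : ℝ) • nabH H L.nab X W Y V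
      - (1 / 6 : ℝ) • nabH H L.nab W X Y V
      + (1 / 12 : ℝ) • (fn3 H X (L.K W Y) V - fn3 H W (L.K X Y) V)
      + (1 / 6 : ℝ) • fn3 H (L.K X W) Y V := by
  have h2 : g.fn (L.nab W (L.K X Y) - L.K X (L.nab W Y) - L.K (L.nab W X) Y) V =
      nabH H L.nab W X Y V := by
    rw [← L.fn_nab_K hH]
    congr 1
    abel
  rw [mixedCurv, g.fn_add_left, g.fn_add_left, g.fn_sub_left, g.fn_add_left, g.fn_smul_left,
    g.fn_smul_left, g.fn_smul_left, g.fn_smul_left, L.fn_nab_K hH, h2, g.fn_sub_left, hH, hH, hH]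

/-- Once written with the curvature, `∇H` and `H`, the expression contains no derivative of `X`, so
its tensoriality is visible. -/
lemma mixedCurv_linear (W Y : VF M) (x : M) : ∃ T : TangentSpace (𝓡 6) x →ₗ[ℝ] TangentSpace (𝓡 6) x,
    ∀ X : VF M, T (X x) = L.mixedCurv W Y X x := by
  refine exists_linear_of_tensorial (F := R6) (x := x) (T := fun X : VF M => L.mixedCurv W Y X x)
    (fun a b => ?_) (fun f a => ?_)
  · have : L.mixedCurv W Y (a + b) = L.mixedCurv W Y a + L.mixedCurv W Y b := by
      refine g.vf_ext fun V => ?_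
      simp only [g.fn_add_left, L.fn_mixedCurv hH, curv_add_1 L.isLeviCivita,
        nabH_add_1 H L.isLeviCivita, nabH_add_2 H L.isLeviCivita, fn3_add_1, fn3_add_2, K_add_left]
      module
    rw [this]; rfl
  · refine g.eq_of_inner fun v => ?_
    obtain ⟨V, rfl⟩ := exists_vf_eq M v
    have h := fun X => congrArg (fun φ : SmoothFun M => φ x) (L.fn_mixedCurv hH W Y X V)
    have e : ∀ (r : ℝ) (φ : SmoothFun M), (r • φ) x = r * φ x := fun _ _ => rfl
    simp only [ContMDiffMap.coe_add, ContMDiffMap.coe_sub, Pi.add_apply, Pi.sub_apply, e,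
      g.fn_apply] at h
    have m : ∀ (f φ : SmoothFun M), (f * φ) x = f x * φ x := fun _ _ => rfl
    rw [map_smul, LinearMap.smul_apply, smul_eq_mul, h, h, curv_fsmul_1 L.isLeviCivita,
      nabH_fsmul_1 H L.isLeviCivita, nabH_fsmul_2 H L.isLeviCivita, K_fsmul_left, K_fsmul_left,
      fn3_fsmul_1, fn3_fsmul_2, fn3_fsmul_1, m, m, m, map_smul, LinearMap.smul_apply, smul_eq_mul]
    ring

/-- In the trace `X_i` fills two slots, which kills `∇_W H` and one quadratic term by skewness. The
other quadratic terms are multiples of `g(K(X_i, W), K(X_i, Y))` with total weight `-(1/12 + 1/6) =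
-1/4`. -/
lemma sum_mixedCurv {x : M} {X : Fin 6 → VF M}
    {b : Module.Basis (Fin 6) ℝ (TangentSpace (𝓡 6) x)} (hb : IsOrtho (g.val x) b)
    (hX : ∀ i, X i x = b i) (W Y : VF M) :
    ∑ i, eta i * g.fn (L.mixedCurv W Y (X i)) (X i) x =
      ∑ i, eta i * g.fn (curv L.nab (X i) W Y) (X i) x
        + (1 / 2) * ∑ i, eta i * nabH H L.nab (X i) W Y (X i) x
        - (1 / 4) * circ b H (W x) (Y x) := by
  have hq : ∀ i, g.fn (L.mixedCurv W Y (X i)) (X i) x = g.fn (curv L.nab (X i) W Y) (X i) x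
      + (1 / 2) * nabH H L.nab (X i) W Y (X i) x
      - (1 / 4) * g.fn (L.K (X i) W) (L.K (X i) Y) x := fun i => by
    have h := congrArg (fun φ : SmoothFun M => φ x) (L.fn_mixedCurv hH W Y (X i) (X i))
    have e : ∀ (r : ℝ) (φ : SmoothFun M), (r • φ) x = r * φ x := fun _ _ => rfl
    simp only [ContMDiffMap.coe_add, ContMDiffMap.coe_sub, Pi.add_apply, Pi.sub_apply, e] at h
    have s12 := fun A B D : VF M => congrArg (fun f : SmoothFun M => f x) (fn3_skew12 H A B D)
    have s23 := fun A B D : VF M => congrArg (fun f : SmoothFun M => f x) (fn3_skew23 H A B D)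
    have n23 := congrArg (fun f : SmoothFun M => f x) (nabH_skew23 H L.nab W (X i) Y (X i))
    have n12 := congrArg (fun f : SmoothFun M => f x) (nabH_skew12 H L.nab W (X i) (X i) Y)
    simp only [ContMDiffMap.coe_neg, Pi.neg_apply] at s12 s23 n23 n12
    have k1 : fn3 H (X i) W (L.K (X i) Y) x = g.fn (L.K (X i) W) (L.K (X i) Y) x := by rw [hH]
    have k2 : fn3 H (X i) Y (L.K (X i) W) x = g.fn (L.K (X i) W) (L.K (X i) Y) x := by
      rw [hH, g.fn_symm]
    have a1 := s23 (X i) (L.K W Y) (X i)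
    have a2 := s12 (X i) (X i) (L.K W Y)
    have a3 := s23 W (L.K (X i) Y) (X i)
    have a4 := s12 W (X i) (L.K (X i) Y)
    have a5 := s23 (L.K (X i) W) Y (X i)
    have a6 := s12 (L.K (X i) W) (X i) Y
    have a7 := s23 (X i) (L.K (X i) W) Y
    linarith
  have hk : ∀ i, g.fn (L.K (X i) W) (L.K (X i) Y) x = ∑ l, eta l *
      (H.1 x ![W x, b i, b l] * H.1 x ![Y x, b i, b l]) := fun i => by
    have e : ∀ (W : VF M) l, g.val x (L.K (X i) W x) (b l) = -H.1 x ![W x, b i, b l] := fun W l => by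
      rw [← hX l, ← g.fn_apply, ← hH, fn3_apply, hX, hX, tri_skew12, tri_apply]
    rw [g.fn_apply, hb.expand (L.K (X i) Y x), map_sum]
    refine Finset.sum_congr rfl fun l _ => ?_
    rw [map_smul, e, e, smul_eq_mul]
    ring
  simp only [hq, hk, circ, Finset.mul_sum, ← Finset.sum_add_distrib, ← Finset.sum_sub_distrib]
  refine Finset.sum_congr rfl fun i _ => ?_
  rw [mul_sub, mul_add, Finset.mul_sum]
  congr 1
  · ring
  · exact Finset.sum_congr rfl fun l _ => by ring

end LiftPair

namespace GenMetric

variable {A : C.GenMetric} (hC : C.IsExact) (hA : A.Admissible)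

lemma exists_up {a : Sec F E} (ha : ∀ y, a y ∈ A.Vplus y) : ∃ X, a = (lift hC hA).up X :=
  ⟨C.anchorSec a, by ext y; exact (upAt_anchor hC hA (ha y)).symm⟩

lemma exists_dn {a : Sec F E} (ha : ∀ y, a y ∈ A.Vminus y) : ∃ X, a = (lift hC hA).dn X :=
  ⟨C.anchorSec a, by ext y; exact (dnAt_anchor hC hA (ha y)).symm⟩

/-- The anchor as an isomorphism `V₊ ≅ TM`. -/
def upEquiv (x : M) : TangentSpace (𝓡 6) x ≃ₗ[ℝ] A.Vplus x where
  toFun v := ⟨upAt hC hA x v, upAt_mem hC hA x v⟩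
  map_add' v w := Subtype.ext (map_add _ v w)
  map_smul' r v := Subtype.ext (map_smul _ r v)
  invFun e := C.anchor x e
  left_inv v := anchor_upAt hC hA x v
  right_inv e := Subtype.ext (upAt_anchor hC hA e.2)

/-- The generalized Ricci tensor of the canonical Levi-Civita connection. -/
lemma isGenRicci_iff {H : Form M 3}
    (hH : ∀ X Y Z, fn3 H X Y Z = (metric hC hA).fn ((lift hC hA).K X Y) Z) {x : M}
    {X : Fin 6 → VF M} {b : Module.Basis (Fin 6) ℝ (TangentSpace (𝓡 6) x)}
    (hb : IsOrtho ((metric hC hA).val x) b) (hX : ∀ i, X i x = b i) (W Y : VF M) (r : ℝ) :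
    A.IsGenRicci (lift hC hA).canon x ((lift hC hA).dn W) ((lift hC hA).up Y) r ↔
      ∑ i, eta i * (metric hC hA).fn (curv (lift hC hA).nab (X i) W Y) (X i) x
        + (1 / 2) * ∑ i, eta i * nabH H (lift hC hA).nab (X i) W Y (X i) x
        - (1 / 4) * circ b H (W x) (Y x) = r := by
  set L := lift hC hA
  rw [← L.sum_mixedCurv hH hb hX]
  obtain ⟨T, hT⟩ := L.mixedCurv_linear hH W Y x
  have htr : LinearMap.trace ℝ _ T = ∑ i, eta i * (metric hC hA).fn (L.mixedCurv W Y (X i)) (X i) x := by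
    rw [hb.trace_eq]
    refine Finset.sum_congr rfl fun i _ => ?_
    rw [← hX, hT, LorentzMetric.fn_apply]
  -- The endomorphism of the fibre of `V_+` is conjugate, through the anchor, to one of the tangent
  -- space, so the traces agree.
  have hconj : ∀ Z : VF M, (((upEquiv hC hA x).conj T ⟨L.up Z x, upAt_mem hC hA x (Z x)⟩ : A.Vplus x) :
      E x) = C.genCurv L.canon (L.up Z) (L.dn W) (L.up Y) x := fun Z => by
    rw [L.genCurv_mixed, LinearEquiv.conj_apply_apply]
    have e : (upEquiv hC hA x).symm ⟨L.up Z x, upAt_mem hC hA x (Z x)⟩ = Z x :=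
      (upEquiv hC hA x).symm_apply_apply (Z x)
    rw [e, hT]
    rfl
  rw [← htr]
  constructor
  · rintro ⟨S, h1, h2⟩
    rw [← h2, ← LinearMap.trace_conj' T (upEquiv hC hA x)]
    congr 1
    refine LinearMap.ext fun e => ?_
    obtain ⟨v, rfl⟩ := (upEquiv hC hA x).surjective e
    obtain ⟨Z, rfl⟩ := exists_vf_eq M v
    exact Subtype.ext ((hconj Z).trans (h1 (L.up Z) fun y => upAt_mem hC hA y (Z y)).symm)
  · intro h
    refine ⟨(upEquiv hC hA x).conj T, fun a ha => ?_, (LinearMap.trace_conj' T _).trans h⟩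
    obtain ⟨Z, rfl⟩ := exists_up hC hA ha
    rw [← hconj Z]

end GenMetric

end CourantAlgebroid

end GeneralizedRicci


/-! ### Spin connections with torsion in a frame -/

section SpinConnection

variable {M : Type*} [TopologicalSpace M] [ChartedSpace R6 M] [IsManifold (𝓡 6) ∞ M] [T2Space M]

/-- Bitensorial maps are bilinear maps of the values of their arguments. -/
lemma exists_bilin_of_tensorial {V : Type*} [AddCommGroup V] [Module ℝ V] {x : M}
    {T : VF M → VF M → V} (a1 : ∀ Z Z' W, T (Z + Z') W = T Z W + T Z' W)
    (a2 : ∀ Z W W', T Z (W + W') = T Z W + T Z W')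
    (s1 : ∀ (f : SmoothFun M) Z W, T (fsmul f Z) W = f x • T Z W)
    (s2 : ∀ (f : SmoothFun M) Z W, T Z (fsmul f W) = f x • T Z W) :
    ∃ P : TangentSpace (𝓡 6) x →ₗ[ℝ] TangentSpace (𝓡 6) x →ₗ[ℝ] V,
      ∀ Z W : VF M, P (Z x) (W x) = T Z W := by
  choose L hL using fun Z => exists_linear_of_tensorial (F := R6) (x := x) (T := T Z) (a2 Z)
    (fun f W => s2 f Z W)
  obtain ⟨P, hP⟩ := exists_linear_of_tensorial (F := R6) (x := x) (T := L)
    (fun Z Z' => LinearMap.ext fun v => by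
      obtain ⟨W, rfl⟩ := exists_vf_eq M v
      rw [LinearMap.add_apply, hL, hL, hL, a1])
    (fun f Z => LinearMap.ext fun v => by
      obtain ⟨W, rfl⟩ := exists_vf_eq M v
      rw [LinearMap.smul_apply, hL, hL, s1])
  exact ⟨P, fun Z W => by rw [hP, hL]⟩

/-- The gamma matrices with raised index. -/
def gamUp (i : Fin 6) : SpinMat := eta i • gam i

lemma isGamma_gamUp : IsGamma gamUp := isGamma_gam.up

/-- A matrix as a real linear map of spinors. -/
def matCLM (A : SpinMat) : Spinor →L[ℝ] Spinor :=
  LinearMap.toContinuousLinearMap (A.mulVecLin.restrictScalars ℝ)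

/-- The action of a constant matrix on spinor fields. -/
def matAct (A : SpinMat) (ψ : SmoothMap M Spinor) : SmoothMap M Spinor :=
  ⟨fun y => matCLM A (ψ y), (matCLM A).contMDiff.comp ψ.contMDiff⟩

lemma matAct_apply (A : SpinMat) (ψ : SmoothMap M Spinor) (y : M) : matAct A ψ y = A *ᵥ ψ y := rfl

lemma der_matAct (Z : VF M) (A : SpinMat) (ψ : SmoothMap M Spinor) :
    der Z (matAct A ψ) = matAct A (der Z ψ) := by
  ext1 y
  exact der_clm Z (matCLM A) ψ _ (fun _ => rfl) y

lemma smoothMap_sum_apply {V : Type*} [NormedAddCommGroup V] [NormedSpace ℝ V] {ι : Type*}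
    (s : Finset ι) (f : ι → SmoothMap M V) (y : M) : (∑ i ∈ s, f i) y = ∑ i ∈ s, f i y :=
  map_sum ((Pi.evalAddMonoidHom (fun _ : M => V) y).comp ContMDiffMap.coeFnAddMonoidHom) f s

lemma smoothMap_add_apply {V : Type*} [NormedAddCommGroup V] [NormedSpace ℝ V]
    (f h : SmoothMap M V) (y : M) : (f + h) y = f y + h y := rfl

lemma smoothMap_fun_smul_apply (f : SmoothFun M) (ψ : SmoothMap M Spinor) (y : M) :
    (f • ψ) y = f y • ψ y := rfl

/-- The action of a field of bivectors on spinor fields. -/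
def bivAct (S : Fin 6 → Fin 6 → SmoothFun M) (ψ : SmoothMap M Spinor) : SmoothMap M Spinor :=
  ∑ p, ∑ q, S p q • matAct (gamUp p * gamUp q) ψ

lemma biv_mulVec (S : Fin 6 → Fin 6 → ℝ) (v : Spinor) :
    biv gamUp S *ᵥ v = ∑ p, ∑ q, S p q • ((gamUp p * gamUp q) *ᵥ v) := by
  simp only [biv, Matrix.sum_mulVec, Matrix.smul_mulVec]

lemma bivAct_apply (S : Fin 6 → Fin 6 → SmoothFun M) (ψ : SmoothMap M Spinor) (y : M) :
    bivAct S ψ y = biv gamUp (fun p q => S p q y) *ᵥ ψ y := by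
  rw [biv_mulVec, bivAct]
  simp only [smoothMap_sum_apply]
  rfl

lemma der_sum {V : Type*} [NormedAddCommGroup V] [NormedSpace ℝ V] (Z : VF M) {ι : Type*}
    (s : Finset ι) (f : ι → SmoothMap M V) : der Z (∑ i ∈ s, f i) = ∑ i ∈ s, der Z (f i) := by
  classical
  induction s using Finset.induction_on with
  | empty =>
    have := der_add Z (0 : SmoothMap M V) 0
    rw [add_zero] at this
    simpa using this
  | insert a s ha ih => rw [Finset.sum_insert ha, Finset.sum_insert ha, der_add, ih]

lemma der_fun_smul (Z : VF M) (f : SmoothFun M) (ψ : SmoothMap M Spinor) :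
    der Z (f • ψ) = der Z f • ψ + f • der Z ψ := by
  ext1 y
  exact der_smulFun Z f ψ _ (fun _ => rfl) y

lemma der_bivAct (Z : VF M) (S : Fin 6 → Fin 6 → SmoothFun M) (ψ : SmoothMap M Spinor) :
    der Z (bivAct S ψ) = bivAct (fun p q => der Z (S p q)) ψ + bivAct S (der Z ψ) := by
  simp only [bivAct, der_sum, der_fun_smul, der_matAct, Finset.sum_add_distrib]

lemma bivAct_fun_smul (S : Fin 6 → Fin 6 → SmoothFun M) (f : SmoothFun M) (ψ : SmoothMap M Spinor) :
    bivAct S (f • ψ) = f • bivAct S ψ := by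
  ext1 y
  change bivAct S (f • ψ) y = f y • bivAct S ψ y
  rw [bivAct_apply, bivAct_apply]
  exact Matrix.mulVec_smul _ (f y) (ψ y)

lemma biv_add (γ : Fin 6 → SpinMat) (S T : Fin 6 → Fin 6 → ℝ) :
    biv γ (fun p q => S p q + T p q) = biv γ S + biv γ T := by
  simp only [biv, add_smul, Finset.sum_add_distrib]

lemma biv_smul (γ : Fin 6 → SpinMat) (r : ℝ) (S : Fin 6 → Fin 6 → ℝ) :
    biv γ (fun p q => r * S p q) = r • biv γ S := by
  simp only [biv, mul_smul, Finset.smul_sum]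

variable (g : LorentzMetric M) (H : Form M 3) (nab : VF M → VF M → VF M) (X : Fin 6 → VF M)

/-- The connection coefficients in the frame `X`. -/
def connCoeff (Z : VF M) (p q : Fin 6) : SmoothFun M := g.fn (nab Z (X p)) (X q)

/-- The spin connection in the frame `X`. -/
def spinNab (Z : VF M) (ψ : SmoothMap M Spinor) : SmoothMap M Spinor :=
  der Z ψ + (1 / 4 : ℝ) • bivAct (connCoeff g nab X Z) ψ

/-- Clifford multiplication by `ι_Z H` in the frame `X`. -/
def formAct (Z : VF M) (ψ : SmoothMap M Spinor) : SmoothMap M Spinor :=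
  bivAct (fun p q => fn3 H Z (X p) (X q)) ψ

/-- The spin connection with torsion `c H`. -/
def spinTor (c : ℝ) (Z : VF M) (ψ : SmoothMap M Spinor) : SmoothMap M Spinor :=
  spinNab g nab X Z ψ + (c / 4) • formAct H X Z ψ

variable {g H nab X}

lemma spinNab_apply (Z : VF M) (ψ : SmoothMap M Spinor) (y : M) : spinNab g nab X Z ψ y =
    der Z ψ y + (1 / 4 : ℝ) • (biv gamUp (fun p q => connCoeff g nab X Z p q y) *ᵥ ψ y) := by
  rw [← bivAct_apply]; rfl

lemma formAct_apply (Z : VF M) (ψ : SmoothMap M Spinor) (y : M) : formAct H X Z ψ y =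
    biv gamUp (fun p q => fn3 H Z (X p) (X q) y) *ᵥ ψ y := bivAct_apply _ _ _

lemma spinTor_apply (c : ℝ) (Z : VF M) (ψ : SmoothMap M Spinor) (y : M) :
    spinTor g H nab X c Z ψ y = spinNab g nab X Z ψ y + (c / 4) • formAct H X Z ψ y := rfl

lemma formAct_add_left (Z W : VF M) (ψ : SmoothMap M Spinor) :
    formAct H X (Z + W) ψ = formAct H X Z ψ + formAct H X W ψ := by
  simp only [formAct, bivAct, fn3_add_1, add_smul, Finset.sum_add_distrib]

lemma formAct_fsmul_left (f : SmoothFun M) (Z : VF M) (ψ : SmoothMap M Spinor) :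
    formAct H X (fsmul f Z) ψ = f • formAct H X Z ψ := by
  simp only [formAct, bivAct, fn3_fsmul_1, mul_smul, Finset.smul_sum]

lemma bivAct_add_right (S : Fin 6 → Fin 6 → SmoothFun M) (ψ φ : SmoothMap M Spinor) :
    bivAct S (ψ + φ) = bivAct S ψ + bivAct S φ := by
  ext1 y
  change bivAct S (ψ + φ) y = bivAct S ψ y + bivAct S φ y
  rw [bivAct_apply, bivAct_apply, bivAct_apply]
  exact Matrix.mulVec_add _ (ψ y) (φ y)

lemma bivAct_smul_right (S : Fin 6 → Fin 6 → SmoothFun M) (r : ℝ) (ψ : SmoothMap M Spinor) :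
    bivAct S (r • ψ) = r • bivAct S ψ := by
  ext1 y
  change bivAct S (r • ψ) y = r • bivAct S ψ y
  rw [bivAct_apply, bivAct_apply]
  exact Matrix.mulVec_smul _ r (ψ y)

lemma spinNab_add_right (Z : VF M) (ψ φ : SmoothMap M Spinor) :
    spinNab g nab X Z (ψ + φ) = spinNab g nab X Z ψ + spinNab g nab X Z φ := by
  simp only [spinNab, der_add, bivAct_add_right, smul_add]; abel

lemma spinNab_smul_right (Z : VF M) (r : ℝ) (ψ : SmoothMap M Spinor) :
    spinNab g nab X Z (r • ψ) = r • spinNab g nab X Z ψ := by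
  simp only [spinNab, der_smul, bivAct_smul_right, smul_add]; module

lemma formAct_add_right (Z : VF M) (ψ φ : SmoothMap M Spinor) :
    formAct H X Z (ψ + φ) = formAct H X Z ψ + formAct H X Z φ := bivAct_add_right _ _ _

lemma spinTor_add_right (c : ℝ) (Z : VF M) (ψ φ : SmoothMap M Spinor) :
    spinTor g H nab X c Z (ψ + φ) = spinTor g H nab X c Z ψ + spinTor g H nab X c Z φ := by
  simp only [spinTor, spinNab_add_right, formAct_add_right, smul_add]; abel

lemma spinTor_fun_smul (c : ℝ) (Z : VF M) (f : SmoothFun M) (ψ : SmoothMap M Spinor) (y : M) :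
    spinTor g H nab X c Z (f • ψ) y = der Z f y • ψ y + f y • spinTor g H nab X c Z ψ y := by
  simp only [spinTor, spinNab, formAct, der_fun_smul, bivAct_fun_smul]
  change (der Z f y • ψ y + f y • der Z ψ y) + (1 / 4 : ℝ) • (f y • bivAct _ ψ y)
    + (c / 4) • (f y • bivAct _ ψ y) = _ + f y • ((_ + (1 / 4 : ℝ) • bivAct _ ψ y)
    + (c / 4) • bivAct _ ψ y)
  module

variable (hn : IsLeviCivita g nab)
include hn

lemma spinNab_add_left (Z W : VF M) (ψ : SmoothMap M Spinor) :
    spinNab g nab X (Z + W) ψ = spinNab g nab X Z ψ + spinNab g nab X W ψ := by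
  have : bivAct (connCoeff g nab X (Z + W)) ψ = bivAct (connCoeff g nab X Z) ψ
      + bivAct (connCoeff g nab X W) ψ := by
    simp only [bivAct, connCoeff, hn.add_left, g.fn_add_left, add_smul, Finset.sum_add_distrib]
  simp only [spinNab, der_add_left, this, smul_add]; abel

lemma spinNab_fsmul_left (f : SmoothFun M) (Z : VF M) (ψ : SmoothMap M Spinor) (y : M) :
    spinNab g nab X (fsmul f Z) ψ y = f y • spinNab g nab X Z ψ y := by
  have : bivAct (connCoeff g nab X (fsmul f Z)) ψ = f • bivAct (connCoeff g nab X Z) ψ := by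
    simp only [bivAct, connCoeff, hn.fsmul_left, g.fn_fsmul_left, mul_smul, Finset.smul_sum]
  rw [spinNab, this]
  change der (fsmul f Z) ψ y + (1 / 4 : ℝ) • (f y • bivAct _ ψ y) =
    f y • (der Z ψ y + (1 / 4 : ℝ) • bivAct _ ψ y)
  rw [der_fsmul_left]
  module

lemma spinTor_add_left (c : ℝ) (Z W : VF M) (ψ : SmoothMap M Spinor) :
    spinTor g H nab X c (Z + W) ψ = spinTor g H nab X c Z ψ + spinTor g H nab X c W ψ := by
  simp only [spinTor, spinNab_add_left hn, formAct_add_left, smul_add]; abel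

lemma spinTor_fsmul_left (c : ℝ) (f : SmoothFun M) (Z : VF M) (ψ : SmoothMap M Spinor) :
    spinTor g H nab X c (fsmul f Z) ψ = f • spinTor g H nab X c Z ψ := by
  ext1 y
  change spinTor g H nab X c (fsmul f Z) ψ y = f y • spinTor g H nab X c Z ψ y
  rw [spinTor_apply, spinTor_apply, spinNab_fsmul_left hn, formAct_fsmul_left]
  change _ + (c / 4) • (f y • formAct H X Z ψ y) = _
  module

/-- The second covariant derivative of the connection with torsion is a bilinear map. -/
lemma exists_second_derivative (c : ℝ) (ψ : SmoothMap M Spinor) (x : M) :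
    ∃ P : TangentSpace (𝓡 6) x →ₗ[ℝ] TangentSpace (𝓡 6) x →ₗ[ℝ] Spinor, ∀ Z W : VF M,
      P (Z x) (W x) = spinTor g H nab X c Z (spinTor g H nab X c W ψ) x
        - spinTor g H nab X c (nab Z W) ψ x := by
  set T : VF M → VF M → Spinor := fun Z W => spinTor g H nab X c Z (spinTor g H nab X c W ψ) x
        - spinTor g H nab X c (nab Z W) ψ x with hT
  have a1 : ∀ Z Z' W, T (Z + Z') W = T Z W + T Z' W := fun Z Z' W => by
    simp only [hT, hn.add_left, spinTor_add_left hn, smoothMap_add_apply]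
    abel
  have a2 : ∀ Z W W', T Z (W + W') = T Z W + T Z W' := fun Z W W' => by
    simp only [hT, hn.add_right, spinTor_add_left hn, spinTor_add_right, smoothMap_add_apply]
    abel
  have s1 : ∀ (f : SmoothFun M) Z W, T (fsmul f Z) W = f x • T Z W := fun f Z W => by
    simp only [hT, hn.fsmul_left, spinTor_fsmul_left hn, smoothMap_fun_smul_apply]
    rw [smul_sub]
  -- The derivative of `f` along `Z` appears once from the outer covariant derivative and once from
  -- `∇_Z (f W)`, and the two cancel.
  have s2 : ∀ (f : SmoothFun M) Z W, T Z (fsmul f W) = f x • T Z W := fun f Z W => by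
    simp only [hT, hn.fsmul_right, spinTor_add_left hn, spinTor_fsmul_left hn, spinTor_fun_smul,
      smoothMap_add_apply, smoothMap_fun_smul_apply]
    module
  exact exists_bilin_of_tensorial a1 a2 s1 s2

variable {x : M} (hX : ∀ᶠ y in 𝓝 x, IsOrtho (g.val y) fun i => X i y)
include hX

lemma connCoeff_skew (Z : VF M) (p q : Fin 6) :
    connCoeff g nab X Z p q x = -connCoeff g nab X Z q p x := conn_skew hn hX Z p q

/-- Clifford multiplication is parallel. By `biv_mul` the term `¼ ω` rotates the generator with
factor `¼ · 4 = 1`, which is the displayed correction for the non-parallel frame. -/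
lemma spinNab_matAct (Z : VF M) (i : Fin 6) (ψ : SmoothMap M Spinor) :
    spinNab g nab X Z (matAct (gamUp i) ψ) x = gamUp i *ᵥ spinNab g nab X Z ψ x
      + eta i • ∑ q, connCoeff g nab X Z i q x • (gamUp q *ᵥ ψ x) := by
  rw [spinNab_apply, spinNab_apply, der_matAct, matAct_apply, matAct_apply, Matrix.mulVec_mulVec,
    isGamma_gamUp.biv_mul (connCoeff_skew hn hX Z), Matrix.add_mulVec, Matrix.smul_mulVec,
    Matrix.sum_mulVec, Matrix.mulVec_add, Matrix.mulVec_smul, Matrix.mulVec_mulVec]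
  simp only [Matrix.smul_mulVec]
  module

/-- Leibniz rule for the Clifford action of `ι_W H`: the commutator of the connection bivector with
that of `ι_W H` supplies the Christoffel terms that complete the derivative of the components to
`∇H`. -/
lemma spinNab_formAct (Z W : VF M) (ψ : SmoothMap M Spinor) :
    spinNab g nab X Z (formAct H X W ψ) x =
      biv gamUp (fun p q => nabH H nab Z W (X p) (X q) x) *ᵥ ψ x
      + formAct H X (nab Z W) ψ x + formAct H X W (spinNab g nab X Z ψ) x := by
  have hcomm := isGamma_gamUp.biv_comm_biv (fun p q => fn3 H W (X p) (X q) x)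
    (connCoeff_skew hn hX Z)
  have h1 : biv gamUp (fun p q => der Z (fn3 H W (X p) (X q)) x) =
      biv gamUp (fun p q => nabH H nab Z W (X p) (X q) x)
      + biv gamUp (fun p q => fn3 H (nab Z W) (X p) (X q) x)
      + (-1 / 4 : ℝ) • biv gamUp (fun p q => -4 * ∑ k, eta k * (connCoeff g nab X Z p k x *
        fn3 H W (X k) (X q) x + connCoeff g nab X Z q k x * fn3 H W (X p) (X k) x)) := by
    rw [← biv_smul, ← biv_add, ← biv_add]
    congr 1
    funext p q
    change _ = (der Z _ x - fn3 H (nab Z W) (X p) (X q) x - tri (H.1 x) (W x) (nab Z (X p) x) (X q x)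
      - tri (H.1 x) (W x) (X p x) (nab Z (X q) x)) + _ + _
    rw [conn_expand hn hX Z p, conn_expand hn hX Z q]
    simp only [map_sum, map_smul, LinearMap.sum_apply, LinearMap.smul_apply, smul_eq_mul, mul_add,
      Finset.sum_add_distrib, fn3_apply, mul_assoc, connCoeff]
    ring
  rw [← hcomm] at h1
  rw [spinNab_apply]
  have h2 : der Z (formAct H X W ψ) x = biv gamUp (fun p q => der Z (fn3 H W (X p) (X q)) x) *ᵥ ψ x
      + formAct H X W (der Z ψ) x := by
    rw [formAct, der_bivAct, ← bivAct_apply]; rfl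
  rw [h2, h1, formAct_apply, formAct_apply, formAct_apply, formAct_apply, spinNab_apply]
  simp only [Matrix.add_mulVec, Matrix.smul_mulVec, Matrix.sub_mulVec, Matrix.mulVec_add,
    Matrix.mulVec_smul, Matrix.mulVec_mulVec]
  module

/-- The derivatives and the commutator of the connection bivectors assemble into the curvature of
`nab`; the quadratic terms in `hder` come from differentiating `g(∇_W X_p, X_q)` in its second slot.
-/
lemma spinNab_comm (Z W : VF M) (ψ : SmoothMap M Spinor) :
    spinNab g nab X Z (spinNab g nab X W ψ) x - spinNab g nab X W (spinNab g nab X Z ψ) x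
      - spinNab g nab X (lie Z W) ψ x =
      (1 / 4 : ℝ) • (biv gamUp (fun p q => g.fn (curv nab Z W (X p)) (X q) x) *ᵥ ψ x) := by
  have hcomm := isGamma_gamUp.biv_comm_biv (fun p q => connCoeff g nab X W p q x)
    (connCoeff_skew hn hX Z)
  have hder : ∀ Z W p q, der Z (connCoeff g nab X W p q) x = g.fn (nab Z (nab W (X p))) (X q) x
      + ∑ k, eta k * (connCoeff g nab X W p k x * connCoeff g nab X Z q k x) := fun Z W p q => by
    rw [connCoeff, hn.der_metric]
    change _ + g.val x (nab W (X p) x) (nab Z (X q) x) = _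
    rw [conn_expand hn hX Z q, map_sum]
    congr 1
    refine Finset.sum_congr rfl fun k _ => ?_
    rw [map_smul, smul_eq_mul]
    simp only [connCoeff, g.fn_apply]
    ring
  have h1 : biv gamUp (fun p q => g.fn (curv nab Z W (X p)) (X q) x) =
      biv gamUp (fun p q => der Z (connCoeff g nab X W p q) x)
      + (-1 : ℝ) • biv gamUp (fun p q => der W (connCoeff g nab X Z p q) x)
      + (-1 : ℝ) • biv gamUp (fun p q => connCoeff g nab X (lie Z W) p q x)
      + (1 / 4 : ℝ) • biv gamUp (fun p q => -4 * ∑ k, eta k * (connCoeff g nab X Z p k x *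
        connCoeff g nab X W k q x + connCoeff g nab X Z q k x * connCoeff g nab X W p k x)) := by
    simp only [← biv_smul, ← biv_add]
    congr 1
    funext p q
    rw [hder, hder]
    have hs : ∀ k, connCoeff g nab X W k q x = -connCoeff g nab X W q k x := fun k =>
      connCoeff_skew hn hX W k q
    simp only [hs, curv, g.fn_sub_left]
    change g.fn _ _ x - g.fn _ _ x - g.fn (nab (lie Z W) (X p)) (X q) x = _
    simp only [mul_add, Finset.sum_add_distrib, mul_neg, neg_mul, Finset.sum_neg_distrib]
    have e : ∀ k, eta k * (connCoeff g nab X W p k x * connCoeff g nab X Z q k x) =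
      eta k * (connCoeff g nab X Z q k x * connCoeff g nab X W p k x) := fun k => by ring
    simp only [e]
    rw [connCoeff.eq_1 g nab X (lie Z W)]
    ring
  rw [← hcomm] at h1
  have h2 : ∀ Z W, der Z (spinNab g nab X W ψ) x = der Z (der W ψ) x + (1 / 4 : ℝ) •
      (biv gamUp (fun p q => der Z (connCoeff g nab X W p q) x) *ᵥ ψ x
        + biv gamUp (fun p q => connCoeff g nab X W p q x) *ᵥ der Z ψ x) := fun Z W => by
    rw [spinNab, der_add, der_smul, der_bivAct, ← bivAct_apply, ← bivAct_apply]
    rfl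
  have h3 : der (lie Z W) ψ x = der Z (der W ψ) x - der W (der Z ψ) x := by
    rw [der_lie]; rfl
  rw [spinNab_apply Z (spinNab g nab X W ψ), spinNab_apply W (spinNab g nab X Z ψ),
    spinNab_apply (lie Z W), h2, h2, h3, spinNab_apply, spinNab_apply, h1]
  simp only [Matrix.add_mulVec, Matrix.smul_mulVec, Matrix.sub_mulVec, Matrix.mulVec_add,
    Matrix.mulVec_smul, Matrix.mulVec_mulVec]
  module

end SpinConnection


/-! ### The Lichnerowicz formula -/

section Lichnerowicz

variable {M : Type*} [TopologicalSpace M] [ChartedSpace R6 M] [IsManifold (𝓡 6) ∞ M] [T2Space M]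

variable (g : LorentzMetric M) (H : Form M 3) (nab : VF M → VF M → VF M) (X : Fin 6 → VF M) in
/-- The Dirac operator of the connection with torsion. -/
def diracTor (c : ℝ) (ψ : SmoothMap M Spinor) : SmoothMap M Spinor :=
  ∑ i, matAct (gamUp i) (spinTor g H nab X c (X i) ψ)

variable {g : LorentzMetric M} {H : Form M 3} {nab : VF M → VF M → VF M} {X : Fin 6 → VF M}

lemma diracTor_apply (c : ℝ) (ψ : SmoothMap M Spinor) (y : M) : diracTor g H nab X c ψ y =
    ∑ i, gamUp i *ᵥ spinTor g H nab X c (X i) ψ y := smoothMap_sum_apply _ _ _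

variable (hn : IsLeviCivita g nab) {x : M}
  (hX : ∀ᶠ y in 𝓝 x, IsOrtho (g.val y) fun i => X i y)
include hn

lemma spinTor_sum (c : ℝ) (ψ : SmoothMap M Spinor) {Z : VF M} {a : Fin 6 → ℝ}
    (hZ : Z x = ∑ k, a k • X k x) :
    spinTor g H nab X c Z ψ x = ∑ k, a k • spinTor g H nab X c (X k) ψ x := by
  obtain ⟨L, hL⟩ := exists_linear_of_tensorial (F := R6) (x := x)
    (T := fun Z : VF M => spinTor g H nab X c Z ψ x)
    (fun a b => by rw [spinTor_add_left hn]; rfl) (fun f a => by rw [spinTor_fsmul_left hn]; rfl)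
  simp only [← hL, hZ, map_sum, map_smul]

include hX

/-- The frame corrections of `spinNab_matAct` can be moved, by skewness of the connection
coefficients, from the gamma matrices to the differentiating fields; there they become derivatives
along `∇_Z X_i`. -/
lemma spinNab_diracTor (c : ℝ) (Z : VF M) (ψ : SmoothMap M Spinor) :
    spinNab g nab X Z (diracTor g H nab X c ψ) x = ∑ i, gamUp i *ᵥ
      (spinNab g nab X Z (spinTor g H nab X c (X i) ψ) x - spinTor g H nab X c (nab Z (X i)) ψ x) := by
  have hsum : spinNab g nab X Z (diracTor g H nab X c ψ) =
      ∑ i, spinNab g nab X Z (matAct (gamUp i) (spinTor g H nab X c (X i) ψ)) :=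
    map_sum (AddMonoidHom.mk' (spinNab g nab X Z) (spinNab_add_right Z)) _ _
  have h2 : ∀ q, spinTor g H nab X c (nab Z (X q)) ψ x =
      ∑ k, (eta k * connCoeff g nab X Z q k x) • spinTor g H nab X c (X k) ψ x := fun q =>
    spinTor_sum hn c ψ (conn_expand hn hX Z q)
  rw [hsum, smoothMap_sum_apply]
  simp only [spinNab_matAct hn hX, h2, Matrix.mulVec_sub, Matrix.mulVec_sum, Matrix.mulVec_smul,
    Finset.sum_add_distrib, Finset.sum_sub_distrib]
  rw [sub_eq_add_neg]
  congr 1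
  simp only [Finset.smul_sum, smul_smul, ← Finset.sum_neg_distrib]
  rw [Finset.sum_comm]
  refine Finset.sum_congr rfl fun q _ => Finset.sum_congr rfl fun k _ => ?_
  rw [connCoeff_skew hn hX Z k q, mul_neg, neg_smul]

lemma spinNab_spinTor_frame (c : ℝ) (Z W : VF M) (ψ : SmoothMap M Spinor) :
    spinNab g nab X Z (spinTor g H nab X c W ψ) x - spinTor g H nab X c (nab Z W) ψ x =
      (spinNab g nab X Z (spinNab g nab X W ψ) x - spinNab g nab X (nab Z W) ψ x)
      + (c / 4) • (biv gamUp (fun p q => nabH H nab Z W (X p) (X q) x) *ᵥ ψ x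
        + biv gamUp (fun p q => fn3 H W (X p) (X q) x) *ᵥ spinNab g nab X Z ψ x) := by
  rw [spinTor, spinNab_add_right, spinNab_smul_right, spinTor_apply]
  change _ + (c / 4) • spinNab g nab X Z (formAct H X W ψ) x - _ = _
  rw [spinNab_formAct hn hX, formAct_apply W]
  module

/-- The antisymmetric part of the second covariant derivative is the curvature. -/
lemma second_derivative_comm (Z W : VF M) (ψ : SmoothMap M Spinor) :
    (spinNab g nab X Z (spinNab g nab X W ψ) x - spinNab g nab X (nab Z W) ψ x)
      - (spinNab g nab X W (spinNab g nab X Z ψ) x - spinNab g nab X (nab W Z) ψ x) =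
      (1 / 4 : ℝ) • (biv gamUp (fun p q => g.fn (curv nab Z W (X p)) (X q) x) *ᵥ ψ x) := by
  have h1 : nab Z W = lie Z W + nab W Z := by rw [← hn.torsion]; abel
  rw [← spinNab_comm hn hX, h1, spinNab_add_left hn, smoothMap_add_apply]
  abel

/-- The square of the untwisted Dirac operator when the scalar curvature vanishes. -/
lemma sum_second_derivative {Q : Fin 6 → Fin 6 → ℝ}
    (hR : ∀ q r, ∑ i, eta i * g.fn (curv nab (X i) (X q) (X r)) (X i) x = Q q r)
    (hQ : ∀ q r, Q q r = Q r q) (hQ0 : ∑ p, eta p * Q p p = 0) (ψ : SmoothMap M Spinor) :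
    ∑ j, ∑ i, (gamUp j * gamUp i) *ᵥ (spinNab g nab X (X j) (spinNab g nab X (X i) ψ) x
      - spinNab g nab X (nab (X j) (X i)) ψ x) =
    -∑ i, eta i • (spinNab g nab X (X i) (spinNab g nab X (X i) ψ) x
      - spinNab g nab X (nab (X i) (X i)) ψ x) := by
  set N : Fin 6 → Fin 6 → Spinor := fun j i => spinNab g nab X (X j) (spinNab g nab X (X i) ψ) x
      - spinNab g nab X (nab (X j) (X i)) ψ x with hN
  set R : Fin 6 → Fin 6 → Fin 6 → Fin 6 → ℝ := fun i j p q =>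
    g.fn (curv nab (X j) (X i) (X p)) (X q) x with hRdef
  have neg_fn : ∀ A B : VF M, g.fn (-A) B x = -g.fn A B x := fun A B => by simp [g.fn_apply]
  have hcomm : ∀ j i, N i j = N j i - (1 / 4 : ℝ) • (biv gamUp (R i j) *ᵥ ψ x) := fun j i => by
    rw [← second_derivative_comm hn hX (X j) (X i) ψ]; simp only [hN]; abel
  -- The Bianchi identity reduces the curvature term to its Ricci contraction; as `Q` is symmetric
  -- only its trace is left, and that is zero by assumption.
  have hcurv := isGamma_gamUp.sum_curv (R := R)
    (fun i j p q => by simp only [hRdef]; rw [curv_skew hn, neg_fn])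
    (fun i j p q => by
      have := curv_bianchi hn (X j) (X i) (X p)
      have := congrArg (fun A => g.fn A (X q) x) this
      simp only [g.fn_add_left] at this
      change (_ + _) + _ = g.fn 0 (X q) x at this
      have h0 : g.fn 0 (X q) x = 0 := by simp [g.fn_apply]
      rw [h0] at this
      simp only [hRdef]
      linarith)
  have hRQ : (fun j q => ∑ i, eta i * R i j i q) = Q := by
    funext j q
    rw [← hR]
    refine Finset.sum_congr rfl fun i _ => ?_
    simp only [hRdef]
    rw [curv_skew hn, neg_fn]
    have := congrArg (fun f : SmoothFun M => f x) (curv_metric hn (X i) (X j) (X i) (X q))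
    rw [g.fn_symm (X i)] at this
    change _ + _ = (0 : ℝ) at this
    linear_combination -eta i * this
  rw [hRQ, isGamma_gamUp.biv_symm hQ, hQ0, neg_zero, zero_smul, smul_zero] at hcurv
  have hzero : ∑ j, ∑ i, (gamUp i * gamUp j) *ᵥ (biv gamUp (R i j) *ᵥ ψ x) = 0 := by
    have : ∑ j, ∑ i, (gamUp i * gamUp j) *ᵥ (biv gamUp (R i j) *ᵥ ψ x) =
        (∑ i, ∑ j, ∑ p, ∑ q, R i j p q • (gamUp i * gamUp j * (gamUp p * gamUp q))) *ᵥ ψ x := by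
      rw [Finset.sum_comm]
      simp only [Matrix.sum_mulVec, biv, Matrix.smul_mulVec, Matrix.mulVec_sum, Matrix.mulVec_smul,
        Matrix.mulVec_mulVec]
    rw [this, hcurv, Matrix.zero_mulVec]
  -- As the curvature contribution vanishes, the order of the two gammas may be exchanged; averaging
  -- both orders leaves only the diagonal terms.
  have h2 : (2 : ℝ) • ∑ j, ∑ i, (gamUp j * gamUp i) *ᵥ N j i =
      (2 : ℝ) • -∑ i, eta i • N i i := by
    have e1 : ∑ j, ∑ i, (gamUp j * gamUp i) *ᵥ N j i =
        ∑ j, ∑ i, (gamUp i * gamUp j) *ᵥ N j i := by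
      calc _ = ∑ j, ∑ i, (gamUp i * gamUp j) *ᵥ N i j := Finset.sum_comm
        _ = ∑ j, ∑ i, ((gamUp i * gamUp j) *ᵥ N j i
            - (1 / 4 : ℝ) • ((gamUp i * gamUp j) *ᵥ (biv gamUp (R i j) *ᵥ ψ x))) :=
          Finset.sum_congr rfl fun j _ => Finset.sum_congr rfl fun i _ => by
            rw [hcomm j i, Matrix.mulVec_sub, Matrix.mulVec_smul]
        _ = _ := by
          simp only [Finset.sum_sub_distrib, ← Finset.smul_sum, hzero, smul_zero, sub_zero]
    have hg : ∀ i j, gamUp i * gamUp j + gamUp j * gamUp i =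
      (if i = j then -2 * eta i else 0) • (1 : SpinMat) := isGamma_gamUp
    have hterm : ∀ j i, (gamUp j * gamUp i) *ᵥ N j i + (gamUp i * gamUp j) *ᵥ N j i =
        if j = i then (-2 * eta j) • N j i else 0 := fun j i => by
      rw [← Matrix.add_mulVec, hg]
      split_ifs
      · rw [Matrix.smul_mulVec, Matrix.one_mulVec]
      · rw [zero_smul, Matrix.zero_mulVec]
    rw [two_smul]
    nth_rewrite 2 [e1]
    simp only [← Finset.sum_add_distrib, hterm, Finset.sum_ite_eq, Finset.mem_univ, if_true,
      mul_smul, ← Finset.smul_sum]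
    module
  exact smul_right_injective Spinor (two_ne_zero' ℝ) h2

/-- The Lichnerowicz formula for a closed self-dual 3-form satisfying the Einstein equation. -/
lemma lichnerowicz {o : ManifoldOrientation M} (hs : SelfDualForm o g H) (hH : H ∈ closed3 M)
    (hp : ∀ᶠ y in 𝓝 x, o.IsPos y fun i => X i y)
    (hR : ∀ q r, ∑ i, eta i * g.fn (curv nab (X i) (X q) (X r)) (X i) x = (1 / 4) * ∑ k, ∑ l,
      eta k * eta l * (fn3 H (X q) (X k) (X l) x * fn3 H (X r) (X k) (X l) x))
    (ψ : SmoothMap M Spinor) :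
    diracTor g H nab X (1 / 6) (diracTor g H nab X (1 / 6) ψ) x =
      -∑ i, eta i • (spinTor g H nab X (1 / 2) (X i) (spinTor g H nab X (1 / 2) (X i) ψ) x
        - spinTor g H nab X (1 / 2) (nab (X i) (X i)) ψ x) := by
  set h : Fin 6 → Fin 6 → Fin 6 → ℝ := fun p q r => fn3 H (X p) (X q) (X r) x with hh
  have h12 : ∀ p q r, h p q r = -h q p r := fun p q r => by simp only [h]; rw [fn3_skew12]; rfl
  have h23 : ∀ p q r, h p q r = -h p r q := fun p q r => by simp only [h]; rw [fn3_skew23]; rfl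
  have hsd : SelfDual3 h := hs.selfDual3 hX.self_of_nhds hp.self_of_nhds
  set t := trivec gamUp h with ht
  set B : Fin 6 → SpinMat := fun i => biv gamUp (h i) with hB
  set p : Fin 6 → Spinor := fun i => spinNab g nab X (X i) ψ x with hpdef
  set N : Fin 6 → Fin 6 → Spinor := fun j i => spinNab g nab X (X j) (spinNab g nab X (X i) ψ) x
      - spinNab g nab X (nab (X j) (X i)) ψ x with hN
  set D : Fin 6 → Fin 6 → SpinMat := fun j i =>
    biv gamUp (fun p q => nabH H nab (X j) (X i) (X p) (X q) x) with hD
  -- Self-duality enters here, in `hdiv` and through the vanishing norm in `hNN`; together they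
  -- remove every term of order zero.
  have htt : t * t = 0 := isGamma_gam.trivec_sq_eq_zero hsd h12 h23
  have htB : ∑ i, gamUp i * B i = t := isGamma_gamUp.sum_mul_biv h12 h23
  have hBB : ∑ i, eta i • (B i * B i) = 0 := isGamma_gamUp.sum_biv_sq h12 h23 htt
  have hanti : ∀ i, gamUp i * t + t * gamUp i = (-6 * eta i) • B i :=
    isGamma_gamUp.anti_trivec h12 h23
  have hdiv : (fun q r => ∑ i, eta i * nabH H nab (X i) (X i) (X q) (X r) x) = fun _ _ => 0 := by
    funext q r
    exact div_frame_eq_zero hn hX hs hp hH q r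
  have hDD : ∑ i, eta i • D i i = 0 := by
    have : ∑ i, eta i • D i i =
        biv gamUp fun q r => ∑ i, eta i * nabH H nab (X i) (X i) (X q) (X r) x := by
      simp only [hD, biv, Finset.smul_sum, Finset.sum_smul, smul_smul]
      rw [sum3_swap12, sum3_swap23]
    rw [this, hdiv]
    simp [biv]
  have huD : ∑ j, gamUp j * ∑ i, gamUp i * D j i = 0 := by
    have h1 : ∀ j, ∑ i, gamUp i * D j i =
        trivec gamUp (fun p q r => nabH H nab (X j) (X p) (X q) (X r) x) := fun j =>
      isGamma_gamUp.sum_mul_biv (T := fun p q r => nabH H nab (X j) (X p) (X q) (X r) x)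
        (fun p q r => by rw [nabH_skew12]; rfl) (fun p q r => by rw [nabH_skew23]; rfl)
    simp only [h1]
    rw [isGamma_gamUp.sum_mul_trivec (N := fun i p q r => nabH H nab (X i) (X p) (X q) (X r) x)
      (fun i p q r => by rw [nabH_skew12]; rfl) (fun i p q r => by rw [nabH_skew23]; rfl)
      (fun i p q r => nabH_closed H hn hH _ _ _ _ x), hdiv]
    simp [biv]
  have hNN : ∑ j, ∑ i, (gamUp j * gamUp i) *ᵥ N j i = -∑ i, eta i • N i i := by
    refine sum_second_derivative hn hX hR (fun q r => ?_) ?_ ψ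
    · congr 1
      exact Finset.sum_congr rfl fun k _ => Finset.sum_congr rfl fun l _ => by ring
    · have := hsd.norm_sq_eq_zero h12 h23
      have e : ∑ p, eta p * ((1 / 4) * ∑ k, ∑ l, eta k * eta l * (h p k l * h p k l)) =
          (1 / 4) * ∑ p, ∑ q, ∑ r, eta p * eta q * eta r * (h p q r * h p q r) := by
        simp only [Finset.mul_sum]
        exact Finset.sum_congr rfl fun _ _ => Finset.sum_congr rfl fun _ _ =>
          Finset.sum_congr rfl fun _ _ => by ring
      exact e.trans (by rw [this, mul_zero])
  have hframe : ∀ (c : ℝ) j i, spinNab g nab X (X j) (spinTor g H nab X c (X i) ψ) x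
      - spinTor g H nab X c (nab (X j) (X i)) ψ x = N j i + (c / 4) • (D j i *ᵥ ψ x + B i *ᵥ p j) :=
    fun c j i => spinNab_spinTor_frame hn hX c (X j) (X i) ψ
  have hform : ∀ i (φ : SmoothMap M Spinor), formAct H X (X i) φ x = B i *ᵥ φ x := fun i φ =>
    formAct_apply (X i) φ x
  have htor : ∀ c i, spinTor g H nab X c (X i) ψ x = p i + (c / 4) • (B i *ᵥ ψ x) := fun c i => by
    rw [spinTor_apply, hform]
  -- With `c = 1/2` each torsion term has weight `c/4 = 1/8`: the first-order term occurs twice, and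
  -- the quadratic one has weight `1/64`.
  have hL : ∀ i, spinTor g H nab X (1 / 2) (X i) (spinTor g H nab X (1 / 2) (X i) ψ) x
        - spinTor g H nab X (1 / 2) (nab (X i) (X i)) ψ x =
      N i i + (1 / 8 : ℝ) • (D i i *ᵥ ψ x) + (1 / 4 : ℝ) • (B i *ᵥ p i)
        + (1 / 64 : ℝ) • ((B i * B i) *ᵥ ψ x) := fun i => by
    have h1 := hframe (1 / 2) i i
    rw [spinTor_apply, hform, htor, add_sub_right_comm, h1, Matrix.mulVec_add, Matrix.mulVec_smul,
      Matrix.mulVec_mulVec]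
    module
  have hchi : diracTor g H nab X (1 / 6) ψ x = ∑ i, gamUp i *ᵥ p i + (1 / 24 : ℝ) • (t *ᵥ ψ x) := by
    rw [diracTor_apply, ← htB]
    simp only [htor, Matrix.mulVec_add, Matrix.mulVec_smul, Matrix.mulVec_mulVec,
      Finset.sum_add_distrib, Matrix.sum_mulVec, Finset.smul_sum]
    congr 1
    exact Finset.sum_congr rfl fun i _ => by congr 1; norm_num
  -- With `c = 1/6` the weights are `c/4 = 1/24` and `1/576`. Applying the torsion to `∑ γ^i p_i`
  -- supplies the second half of the anticommutators of `t` with the generators.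
  have hDir : diracTor g H nab X (1 / 6) (diracTor g H nab X (1 / 6) ψ) x =
      ∑ j, ∑ i, (gamUp j * gamUp i) *ᵥ N j i
      + (1 / 24 : ℝ) • ((∑ j, gamUp j * ∑ i, gamUp i * D j i) *ᵥ ψ x
        + ∑ j, (gamUp j * t + t * gamUp j) *ᵥ p j) + (1 / 576 : ℝ) • ((t * t) *ᵥ ψ x) := by
    have e1 : ∀ j, spinTor g H nab X (1 / 6) (X j) (diracTor g H nab X (1 / 6) ψ) x =
        ∑ i, gamUp i *ᵥ N j i + (1 / 24 : ℝ) • ((∑ i, gamUp i * D j i) *ᵥ ψ x + t *ᵥ p j)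
        + (1 / 24 : ℝ) • (B j *ᵥ diracTor g H nab X (1 / 6) ψ x) := fun j => by
      rw [spinTor_apply, hform, spinNab_diracTor hn hX, ← htB]
      simp only [hframe, Matrix.mulVec_add, Matrix.mulVec_smul, Matrix.mulVec_mulVec,
        Finset.sum_add_distrib, Matrix.sum_mulVec, ← Finset.smul_sum]
      module
    rw [diracTor_apply]
    simp only [e1, Matrix.mulVec_add, Matrix.mulVec_smul, Finset.sum_add_distrib,
      ← Finset.smul_sum, Matrix.mulVec_mulVec, Matrix.mulVec_sum, Matrix.add_mulVec]
    rw [← Matrix.sum_mulVec, ← Matrix.sum_mulVec, htB, hchi]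
    simp only [Matrix.mulVec_add, Matrix.mulVec_smul, Matrix.mulVec_mulVec, Matrix.mulVec_sum]
    module
  rw [hDir, htt, huD, hNN, Matrix.zero_mulVec, smul_zero, add_zero, zero_add]
  -- The first-order terms now match: the anticommutator contributes `(1/24)(-6 η_i) = -η_i/4`, the
  -- same as the rough Laplacian. This ties the coefficient `1/6` to `1/2`.
  simp only [hL, hanti, smul_add, Finset.sum_add_distrib, Matrix.smul_mulVec]
  have z1 : ∑ i, eta i • (1 / 8 : ℝ) • (D i i *ᵥ ψ x) = 0 := by
    have : ∑ i, eta i • (1 / 8 : ℝ) • (D i i *ᵥ ψ x) = (1 / 8 : ℝ) • ((∑ i, eta i • D i i) *ᵥ ψ x) := by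
      simp only [Matrix.sum_mulVec, Matrix.smul_mulVec, Finset.smul_sum]
      exact Finset.sum_congr rfl fun i _ => smul_comm _ _ _
    rw [this, hDD, Matrix.zero_mulVec, smul_zero]
  have z2 : ∑ i, eta i • (1 / 64 : ℝ) • ((B i * B i) *ᵥ ψ x) = 0 := by
    have : ∑ i, eta i • (1 / 64 : ℝ) • ((B i * B i) *ᵥ ψ x) =
        (1 / 64 : ℝ) • ((∑ i, eta i • (B i * B i)) *ᵥ ψ x) := by
      simp only [Matrix.sum_mulVec, Matrix.smul_mulVec, Finset.smul_sum]
      exact Finset.sum_congr rfl fun i _ => smul_comm _ _ _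
    rw [this, hBB, Matrix.zero_mulVec, smul_zero]
  rw [z1, z2, add_zero, add_zero, neg_add]
  congr 1
  rw [Finset.smul_sum, ← Finset.sum_neg_distrib]
  refine Finset.sum_congr rfl fun i _ => ?_
  module

end Lichnerowicz


/-! ### The generalized scalar curvature -/

section GeneralizedScalar

variable {M : Type*} [TopologicalSpace M] [ChartedSpace R6 M] [IsManifold (𝓡 6) ∞ M] [T2Space M]
  {F : Type*} [NormedAddCommGroup F] [NormedSpace ℝ F] [FiniteDimensional ℝ F]
  {E : M → Type*} [TopologicalSpace (TotalSpace F E)] [∀ x, TopologicalSpace (E x)]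
  [∀ x, AddCommGroup (E x)] [∀ x, Module ℝ (E x)] [FiberBundle F E] [VectorBundle ℝ F E]
  [ContMDiffVectorBundle ∞ F E (𝓡 6)]
  {C : CourantAlgebroid F E}

lemma formAct_congr {H : Form M 3} {X : Fin 6 → VF M} {Z W : VF M} {y : M} (h : Z y = W y)
    (ψ : SmoothMap M Spinor) : formAct H X Z ψ y = formAct H X W ψ y := by
  simp only [formAct_apply, fn3_apply, h]

lemma formAct_eq_zero {H : Form M 3} {X : Fin 6 → VF M} {Z : VF M} {y : M} (h : Z y = 0)
    (ψ : SmoothMap M Spinor) : formAct H X Z ψ y = 0 := by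
  simp [formAct_apply, fn3_apply, h, biv]

lemma spinNab_congr_left {g : LorentzMetric M} {nab : VF M → VF M → VF M}
    (hn : IsLeviCivita g nab) {X : Fin 6 → VF M} {Z W : VF M} {y : M} (h : Z y = W y)
    (ψ : SmoothMap M Spinor) : spinNab g nab X Z ψ y = spinNab g nab X W ψ y :=
  tensorial_congr (T := fun Z : VF M => spinNab g nab X Z ψ y)
    (fun a b => by rw [spinNab_add_left hn]; rfl) (fun f a => spinNab_fsmul_left hn f a ψ y) h

/-- The Lichnerowicz formula, with the rough Laplacian taken in a second orthonormal frame. -/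
lemma lichnerowicz_frame {o : ManifoldOrientation M} {g : LorentzMetric M} {H : Form M 3}
    {nab : VF M → VF M → VF M} (hn : IsLeviCivita g nab) {X Y : Fin 6 → VF M} {x : M}
    (hX : ∀ᶠ y in 𝓝 x, IsOrtho (g.val y) fun i => X i y) (hY : IsOrtho (g.val x) fun i => Y i x)
    (hs : SelfDualForm o g H) (hH : H ∈ closed3 M)
    (hp : ∀ᶠ y in 𝓝 x, o.IsPos y fun i => X i y)
    (hR : ∀ b : Module.Basis (Fin 6) ℝ (TangentSpace (𝓡 6) x),
      IsOrtho (g.val x) b → ∀ Y Z : VF M, IsRicci nab x Y Z ((1 / 4 : ℝ) * circ b H (Y x) (Z x)))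
    (ψ : SmoothMap M Spinor) :
    diracTor g H nab X (1 / 6) (diracTor g H nab X (1 / 6) ψ) x =
      -∑ j, eta j • (spinTor g H nab X (1 / 2) (Y j) (spinTor g H nab X (1 / 2) (Y j) ψ) x
        - spinTor g H nab X (1 / 2) (nab (Y j) (Y j)) ψ x) := by
  obtain ⟨bX, hbX, hbXO⟩ := hX.self_of_nhds.exists_basis
  obtain ⟨bY, hbY, hbYO⟩ := hY.exists_basis
  -- The second covariant derivative is bilinear at `x`, so its trace may be computed in `X`, the
  -- frame in which spinors are trivialized, instead of `Y`.
  obtain ⟨P, hP⟩ := exists_second_derivative (H := H) (X := X) hn (1 / 2) ψ x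
  have hRic : ∀ q r, ∑ i, eta i * g.fn (curv nab (X i) (X q) (X r)) (X i) x =
      (1 / 4) * ∑ k, ∑ l, eta k * eta l *
        (fn3 H (X q) (X k) (X l) x * fn3 H (X r) (X k) (X l) x) := fun q r => by
    rw [(isRicci_iff hn hbXO (fun i => (hbX i).symm) (X q) (X r) _).1
      (hR bX hbXO (X q) (X r)), circ]
    simp only [fn3_apply, tri_apply, hbX]
  have hB := hbXO.sum_bilin_eq (g.symm' x) hbYO P
  simp only [hbX, hbY, hP] at hB
  rw [← hB]
  exact lichnerowicz hn hX hs hH hp hRic ψ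

namespace CourantAlgebroid

namespace LiftPair

variable {g : LorentzMetric M} (L : C.LiftPair g)

lemma pu_canon (a b : Sec F E) : L.pu (L.canon a b) = L.nab (C.anchorSec a) (L.pu b)
    + (1 / 2 : ℝ) • L.K (L.pd a) (L.pu b) + (1 / 6 : ℝ) • L.K (L.pu a) (L.pu b) := by
  rw [canon, map_add, pu_up, pu_dn, add_zero]

lemma pd_canon (a b : Sec F E) : L.pd (L.canon a b) = L.nab (C.anchorSec a) (L.pd b)
    - (1 / 2 : ℝ) • L.K (L.pu a) (L.pd b) - (1 / 6 : ℝ) • L.K (L.pd a) (L.pd b) := by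
  rw [canon, map_add, pd_up, pd_dn, zero_add]

end LiftPair

namespace GenMetric

variable {A : C.GenMetric} (hC : C.IsExact) (hA : A.Admissible)

lemma pu_of_mem {a : Sec F E} {y : M} (h : a y ∈ A.Vplus y) :
    (lift hC hA).pu a y = C.anchorSec a y := by
  change C.anchor y (A.plus a y) = C.anchor y (a y)
  rw [plus_apply, mem_Vplus.1 h]
  congr 1
  module

lemma pd_of_mem {a : Sec F E} {y : M} (h : a y ∈ A.Vplus y) : (lift hC hA).pd a y = 0 := by
  change C.anchor y (A.minus a y) = 0
  rw [minus_apply, mem_Vplus.1 h, sub_self, smul_zero, map_zero]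

lemma pd_of_mem_minus {a : Sec F E} {y : M} (h : a y ∈ A.Vminus y) :
    (lift hC hA).pd a y = C.anchorSec a y := by
  change C.anchor y (A.minus a y) = C.anchor y (a y)
  rw [minus_apply, mem_Vminus.1 h]
  congr 1
  module

lemma pu_of_mem_minus {a : Sec F E} {y : M} (h : a y ∈ A.Vminus y) : (lift hC hA).pu a y = 0 := by
  change C.anchor y (A.plus a y) = 0
  rw [plus_apply, mem_Vminus.1 h, add_neg_cancel, smul_zero, map_zero]

variable {H : Form M 3} (hH : ∀ X Y Z, fn3 H X Y Z = (metric hC hA).fn ((lift hC hA).K X Y) Z)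
  {U : Set M} (hU : IsOpen U) {e f : Fin 6 → Sec F E}
include hH hU

/-- The spin connection induced by the canonical connection, in terms of classical ones. -/
lemma spinDeriv_eq (he : ∀ x ∈ U, ∀ i, e i x ∈ A.Vplus x) (a : Sec F E) {φ : M → Spinor}
    {ψ : SmoothMap M Spinor} {y : M} (hy : y ∈ U) (hφ : ∀ᶠ z in 𝓝 y, φ z = ψ z) :
    C.spinDeriv (lift hC hA).canon e a φ y =
      spinNab (metric hC hA) (lift hC hA).nab (fun i => C.anchorSec (e i)) (C.anchorSec a) ψ y
      + (1 / 8 : ℝ) • formAct H (fun i => C.anchorSec (e i)) ((lift hC hA).pd a) ψ y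
      + (1 / 24 : ℝ) • formAct H (fun i => C.anchorSec (e i)) ((lift hC hA).pu a) ψ y := by
  set L := lift hC hA
  set X : Fin 6 → VF M := fun i => C.anchorSec (e i) with hX
  have hd : (mfderiv (𝓡 6) 𝓘(ℝ, Spinor) φ y (C.anchor y (a y)) : Spinor) =
      der (C.anchorSec a) ψ y := by
    rw [der_apply, Filter.EventuallyEq.mfderiv_eq (f₁ := φ) (f := ψ) hφ]; rfl
  -- The sections `e p` lie in `V_+` only over `U`, so the projection and the anchor agree only as
  -- germs; locality of `nab` makes this sufficient.
  have hpu : ∀ p, ∀ᶠ z in 𝓝 y, L.pu (e p) z = X p z := fun p => by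
    filter_upwards [hU.mem_nhds hy] with z hz
    exact pu_of_mem hC hA (he z hz p)
  have hcoef : ∀ p q, C.pair y (L.canon a (e p) y) (e q y) =
      connCoeff (metric hC hA) L.nab X (C.anchorSec a) p q y
        + (1 / 2) * fn3 H (L.pd a) (X p) (X q) y + (1 / 6) * fn3 H (L.pu a) (X p) (X q) y := by
    intro p q
    have e1 : e q y = L.up (X q) y := (upAt_anchor hC hA (he y hy q)).symm
    have e2 : C.pair y (L.canon a (e p) y) (L.up (X q) y) = C.pairFn (L.canon a (e p)) (L.up (X q)) y :=
      rfl
    have e3 : ∀ Z, fn3 H Z (L.pu (e p)) (X q) y = fn3 H Z (X p) (X q) y := fun Z => by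
      rw [fn3_apply, fn3_apply, (hpu p).self_of_nhds]
    rw [e1, e2, L.pairFn_up, L.pu_canon, LorentzMetric.fn_add_left, LorentzMetric.fn_add_left,
      LorentzMetric.fn_smul_left, LorentzMetric.fn_smul_left, ← hH, ← hH, ← e3, ← e3]
    change (metric hC hA).val y (L.nab (C.anchorSec a) (L.pu (e p)) y) (X q y) + _ + _ = _
    rw [L.isLeviCivita.congr_right (C.anchorSec a) (hpu p)]
    rfl
  have hb : ∀ c : Fin 6 → Fin 6 → ℝ, ∑ p, ∑ q, (eta p * eta q * c p q) • ((gam p * gam q) *ᵥ ψ y) =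
      biv gamUp c *ᵥ ψ y := fun c => by
    rw [biv_mulVec]
    refine Finset.sum_congr rfl fun p _ => Finset.sum_congr rfl fun q _ => ?_
    rw [gamUp, gamUp, smul_mul_smul_comm, Matrix.smul_mulVec, smul_smul]
    congr 1; ring
  have hs : C.spinDeriv L.canon e a φ y = der (C.anchorSec a) ψ y
      + (1 / 4 : ℝ) • ∑ p, ∑ q, (eta p * eta q * C.pair y (L.canon a (e p) y) (e q y)) •
        ((gam p * gam q) *ᵥ φ y) := by rw [← hd]; rfl
  rw [hs, hφ.self_of_nhds, hb]
  simp only [hcoef]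
  rw [biv_add, biv_add, biv_smul, biv_smul, spinNab_apply, formAct_apply, formAct_apply,
    Matrix.add_mulVec, Matrix.add_mulVec, Matrix.smul_mulVec, Matrix.smul_mulVec]
  module

lemma diracOp_eq (he : ∀ x ∈ U, ∀ i, e i x ∈ A.Vplus x) {φ : M → Spinor}
    {ψ : SmoothMap M Spinor} {y : M} (hy : y ∈ U) (hφ : ∀ᶠ z in 𝓝 y, φ z = ψ z) :
    C.diracOp (lift hC hA).canon e φ y = diracTor (metric hC hA) H (lift hC hA).nab
      (fun i => C.anchorSec (e i)) (1 / 6) ψ y := by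
  rw [diracTor_apply, diracOp]
  refine Finset.sum_congr rfl fun i _ => ?_
  rw [spinDeriv_eq hC hA hH hU he (e i) hy hφ, formAct_eq_zero (pd_of_mem hC hA (he y hy i)),
    smul_zero, add_zero, formAct_congr (pu_of_mem hC hA (he y hy i)), spinTor_apply, gamUp,
    Matrix.smul_mulVec]
  norm_num

lemma spinDeriv_minus (he : ∀ x ∈ U, ∀ i, e i x ∈ A.Vplus x) {a : Sec F E} {φ : M → Spinor}
    {ψ : SmoothMap M Spinor} {y : M} (hy : y ∈ U) (hφ : ∀ᶠ z in 𝓝 y, φ z = ψ z) {Z : VF M}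
    (hu : (lift hC hA).pu a y = 0) (hd : (lift hC hA).pd a y = Z y) :
    C.spinDeriv (lift hC hA).canon e a φ y = spinTor (metric hC hA) H (lift hC hA).nab
      (fun i => C.anchorSec (e i)) (1 / 2) Z ψ y := by
  have hZ : C.anchorSec a y = Z y := by
    rw [(lift hC hA).anchorSec_eq a]
    exact (congrArg₂ (· + ·) hu hd).trans (zero_add _)
  rw [spinDeriv_eq hC hA hH hU he a hy hφ, formAct_eq_zero hu, smul_zero, add_zero,
    formAct_congr hd, spinTor_apply, spinNab_congr_left (lift hC hA).isLeviCivita hZ]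
  norm_num

omit hU in
lemma K_congr {Z Z' W W' : VF M} {x : M} (h1 : Z x = Z' x) (h2 : W x = W' x) :
    (lift hC hA).K Z W x = (lift hC hA).K Z' W' x := by
  refine (metric hC hA).eq_of_inner fun v => ?_
  obtain ⟨V, rfl⟩ := exists_vf_eq M v
  have e1 := congrArg (fun φ : SmoothFun M => φ x) (hH Z W V)
  have e2 := congrArg (fun φ : SmoothFun M => φ x) (hH Z' W' V)
  simp only [fn3_apply, LorentzMetric.fn_apply] at e1 e2
  rw [← e1, ← e2, h1, h2]

/-- The connection preserves `V_-`; the argument is in terms of germs because `a` lies in `V_-` only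
over `U`. -/
lemma pu_canon_self {a : Sec F E} (ha : ∀ z ∈ U, a z ∈ A.Vminus z) {x : M} (hx : x ∈ U) :
    (lift hC hA).pu ((lift hC hA).canon a a) x = 0 := by
  set L := lift hC hA
  have hun : ∀ᶠ z in 𝓝 x, L.pu a z = (0 : VF M) z := by
    filter_upwards [hU.mem_nhds hx] with z hz using pu_of_mem_minus hC hA (ha z hz)
  have hK0 : ∀ Z : VF M, L.K Z (L.pu a) x = 0 := fun Z => by
    have h0 : L.K Z 0 = 0 := by simpa using L.K_smul_right 0 Z 0
    rw [K_congr hC hA hH rfl hun.self_of_nhds, h0]; rfl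
  rw [L.pu_canon]
  change L.nab (C.anchorSec a) (L.pu a) x + (1 / 2 : ℝ) • L.K (L.pd a) (L.pu a) x
    + (1 / 6 : ℝ) • L.K (L.pu a) (L.pu a) x = 0
  rw [L.isLeviCivita.congr_right _ hun, L.isLeviCivita.zero_right, hK0, hK0, smul_zero, smul_zero,
    add_zero, add_zero]
  rfl

/-- On the diagonal the torsion `K(a, a)` vanishes by skewness, so the correction term in the rough
Laplacian is the Levi-Civita one. -/
lemma pd_canon_self {a : Sec F E} (ha : ∀ z ∈ U, a z ∈ A.Vminus z) {x : M} (hx : x ∈ U) :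
    (lift hC hA).pd ((lift hC hA).canon a a) x =
      (lift hC hA).nab (C.anchorSec a) (C.anchorSec a) x := by
  set L := lift hC hA
  have hun : L.pu a x = (0 : VF M) x := pu_of_mem_minus hC hA (ha x hx)
  have hdn : ∀ᶠ z in 𝓝 x, L.pd a z = C.anchorSec a z := by
    filter_upwards [hU.mem_nhds hx] with z hz using pd_of_mem_minus hC hA (ha z hz)
  have hK1 : L.K (L.pu a) (L.pd a) x = 0 := by
    have h0 : L.K 0 (L.pd a) = 0 := by simpa using L.K_smul_left 0 0 (L.pd a)
    rw [K_congr hC hA hH hun rfl, h0]; rfl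
  have hK2 : L.K (L.pd a) (L.pd a) x = 0 := by
    have h0 := congrArg (fun V : VF M => V x) (L.K_skew (L.pd a) (L.pd a))
    have h1 : (2 : ℝ) • L.K (L.pd a) (L.pd a) x = 0 := by
      rw [two_smul]
      nth_rewrite 1 [show L.K (L.pd a) (L.pd a) x = -L.K (L.pd a) (L.pd a) x from h0]
      exact neg_add_cancel _
    exact (smul_eq_zero.1 h1).resolve_left two_ne_zero
  rw [L.pd_canon]
  change L.nab (C.anchorSec a) (L.pd a) x - (1 / 2 : ℝ) • L.K (L.pu a) (L.pd a) x
    - (1 / 6 : ℝ) • L.K (L.pd a) (L.pd a) x = _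
  rw [L.isLeviCivita.congr_right _ hdn, hK1, hK2, smul_zero, smul_zero, sub_zero, sub_zero]

lemma diracOp_sq_eq (he : ∀ x ∈ U, ∀ i, e i x ∈ A.Vplus x) {φ : M → Spinor}
    {ψ : SmoothMap M Spinor} {x : M} (hx : x ∈ U) (hφ : ∀ᶠ z in 𝓝 x, φ z = ψ z) :
    C.diracOp (lift hC hA).canon e (C.diracOp (lift hC hA).canon e φ) x =
      diracTor (metric hC hA) H (lift hC hA).nab (fun i => C.anchorSec (e i)) (1 / 6)
        (diracTor (metric hC hA) H (lift hC hA).nab (fun i => C.anchorSec (e i)) (1 / 6) ψ) x := by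
  have hφ2 := hφ.eventually_nhds
  have h : ∀ᶠ z in 𝓝 x, C.diracOp (lift hC hA).canon e φ z =
      diracTor (metric hC hA) H (lift hC hA).nab (fun i => C.anchorSec (e i)) (1 / 6) ψ z := by
    filter_upwards [hφ2, hU.mem_nhds hx] with z hz hzU
    exact diracOp_eq hC hA hH hU he hzU hz
  exact diracOp_eq hC hA hH hU he hx h

lemma roughLaplacian_eq (he : ∀ x ∈ U, ∀ i, e i x ∈ A.Vplus x)
    (hf : ∀ x ∈ U, ∀ i, f i x ∈ A.Vminus x) {φ : M → Spinor}
    {ψ : SmoothMap M Spinor} {x : M} (hx : x ∈ U) (hφ : ∀ᶠ z in 𝓝 x, φ z = ψ z) :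
    C.roughLaplacian (lift hC hA).canon e f φ x = -∑ j, eta j •
      (spinTor (metric hC hA) H (lift hC hA).nab (fun i => C.anchorSec (e i)) (1 / 2)
        (C.anchorSec (f j)) (spinTor (metric hC hA) H (lift hC hA).nab
          (fun i => C.anchorSec (e i)) (1 / 2) (C.anchorSec (f j)) ψ) x
      - spinTor (metric hC hA) H (lift hC hA).nab (fun i => C.anchorSec (e i)) (1 / 2)
        ((lift hC hA).nab (C.anchorSec (f j)) (C.anchorSec (f j))) ψ x) := by
  have hφ2 := hφ.eventually_nhds
  rw [roughLaplacian]
  congr 1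
  refine Finset.sum_congr rfl fun j _ => ?_
  have h : ∀ᶠ z in 𝓝 x, C.spinDeriv (lift hC hA).canon e (f j) φ z =
      spinTor (metric hC hA) H (lift hC hA).nab (fun i => C.anchorSec (e i)) (1 / 2)
        (C.anchorSec (f j)) ψ z := by
    filter_upwards [hφ2, hU.mem_nhds hx] with z hz hzU
    exact spinDeriv_minus hC hA hH hU he hzU hz (pu_of_mem_minus hC hA (hf z hzU j))
      (pd_of_mem_minus hC hA (hf z hzU j))
  rw [spinDeriv_minus hC hA hH hU he hx h (pu_of_mem_minus hC hA (hf x hx j))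
      (pd_of_mem_minus hC hA (hf x hx j)),
    spinDeriv_minus hC hA hH hU he hx hφ
      (pu_canon_self hC hA hH hU (fun z hz => hf z hz j) hx)
      (pd_canon_self hC hA hH hU (fun z hz => hf z hz j) hx)]

omit hU in
/-- The generalized scalar curvature of a solution vanishes. -/
lemma isGenScalar_zero {o : ManifoldOrientation M} (hs : SelfDualForm o (metric hC hA) H)
    (hcl : H ∈ closed3 M)
    (hR : ∀ (x : M) (b : Module.Basis (Fin 6) ℝ (TangentSpace (𝓡 6) x)),
      IsOrtho ((metric hC hA).val x) b → ∀ Y Z : VF M,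
        IsRicci (lift hC hA).nab x Y Z ((1 / 4 : ℝ) * circ b H (Y x) (Z x))) :
    A.IsGenScalar o (lift hC hA).canon fun _ => 0 := by
  intro U e f hU he hf ε hε _ x hx
  have he1 : ∀ x ∈ U, ∀ i, e i x ∈ A.Vplus x := fun x hx => (he x hx).1
  have hXO : ∀ y ∈ U, IsOrtho ((metric hC hA).val y) fun i => C.anchorSec (e i) y :=
      fun y hy i j => by
    change C.pair y (upAt hC hA y (C.anchor y (e i y))) (upAt hC hA y (C.anchor y (e j y))) = _
    rw [upAt_anchor hC hA (he1 y hy i), upAt_anchor hC hA (he1 y hy j)]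
    exact (he y hy).2.1 i j
  have hYO : IsOrtho ((metric hC hA).val x) fun j => C.anchorSec (f j) x := fun i j => by
    have h1 := pair_dnAt_dnAt hC hA x (C.anchor x (f i x)) (C.anchor x (f j x))
    rw [dnAt_anchor hC hA ((hf x hx).1 i), dnAt_anchor hC hA ((hf x hx).1 j)] at h1
    have h2 := (hf x hx).2 i j
    change -(C.pair x (f i x) (f j x)) = _ at h2
    rw [h1, neg_neg] at h2
    exact h2
  have hXn : ∀ᶠ y in 𝓝 x, IsOrtho ((metric hC hA).val y) fun i => C.anchorSec (e i) y := by
    filter_upwards [hU.mem_nhds hx] with y hy using hXO y hy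
  have hXp : ∀ᶠ y in 𝓝 x, o.IsPos y fun i => C.anchorSec (e i) y := by
    filter_upwards [hU.mem_nhds hx] with y hy using (he y hy).2.2
  -- The spinor is smooth only on `U`. All operators involved are local, so a global spinor with the
  -- same germ at `x` may replace it.
  obtain ⟨ψ', hψ', hεψ⟩ := exists_fun_germ (hU.mem_nhds hx) hε
  obtain ⟨ψ, hψ⟩ : ∃ ψ : SmoothMap M Spinor, ∀ z, ψ z = ψ' z := ⟨⟨ψ', hψ'⟩, fun _ => rfl⟩
  have hφ : ∀ᶠ z in 𝓝 x, ε z = ψ z := hεψ.mono fun z hz => hz.symm.trans (hψ z).symm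
  rw [zero_smul, add_zero, diracOp_sq_eq hC hA hH hU he1 hx hφ,
    roughLaplacian_eq hC hA hH hU he1 (fun x hx => (hf x hx).1) hx hφ]
  exact lichnerowicz_frame (lift hC hA).isLeviCivita hXn hYO hs hcl hXp (hR x) ψ

end GenMetric

end CourantAlgebroid

end GeneralizedScalar


/-! ### Exterior derivatives and de Rham classes -/

section ExteriorDerivative

variable {M : Type*} [TopologicalSpace M] [ChartedSpace R6 M] [IsManifold (𝓡 6) ∞ M]

lemma contract2_eq {V : Type*} [AddCommGroup V] [Module ℝ V] (θ : V [⋀^Fin 2]→ₗ[ℝ] ℝ) (a : V) :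
    contract2 θ a = bil θ a := LinearMap.ext (contract2_apply θ a)

/-- Smooth skew bilinear forms are 2-forms. -/
lemma exists_form2 (β : ∀ x : M, LinearMap.BilinForm ℝ (TangentSpace (𝓡 6) x))
    (hskew : ∀ x v w, β x v w = -β x w v)
    (hβ : ∀ X Y : VF M, ContMDiff (𝓡 6) 𝓘(ℝ, ℝ) ∞ fun x => β x (X x) (Y x)) :
    ∃ B : Form M 2, ∀ x, bil (B.1 x) = β x := by
  have h0 : ∀ x v, β x v v = 0 := fun x v => by
    have := hskew x v v
    linarith
  refine ⟨⟨fun x =>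
    { toFun := fun m => β x (m 0) (m 1)
      map_update_add' := by
        intro inst m i u v
        obtain rfl : inst = instDecidableEqFin 2 := Subsingleton.elim _ _
        fin_cases i <;> simp
      map_update_smul' := by
        intro inst m i r u
        obtain rfl : inst = instDecidableEqFin 2 := Subsingleton.elim _ _
        fin_cases i <;> simp
      map_eq_zero_of_eq' := by
        intro m i j hm hij
        fin_cases i <;> fin_cases j
        · exact absurd rfl hij
        · change β x (m 0) (m 1) = 0
          rw [show m 0 = m 1 from hm, h0]
        · change β x (m 0) (m 1) = 0
          rw [show m 1 = m 0 from hm, h0]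
        · exact absurd rfl hij }, fun X => hβ (X 0) (X 1)⟩, fun x => ?_⟩
  ext v w
  rfl

variable [T2Space M]

lemma form3_ext {H H' : Form M 3} (h : ∀ X Y Z, fn3 H X Y Z = fn3 H' X Y Z) : H = H' := by
  refine Subtype.ext (funext fun x => AlternatingMap.ext fun m => ?_)
  choose X hX using fun i => exists_vf_eq M (m i)
  have h1 := congrArg (fun f : SmoothFun M => f x) (h (X 0) (X 1) (X 2))
  change tri (H.1 x) _ _ _ = tri (H'.1 x) _ _ _ at h1
  rw [hX, hX, hX, tri_apply, tri_apply] at h1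
  have hm : ![m 0, m 1, m 2] = m := by funext i; fin_cases i <;> rfl
  rwa [hm] at h1

lemma fn2_skew (B : Form M 2) (X Y : VF M) : fn2 B X Y = -fn2 B Y X := by
  ext x; exact bil_skew _ _ _

lemma fn2_add_left (B : Form M 2) (X X' Y : VF M) : fn2 B (X + X') Y = fn2 B X Y + fn2 B X' Y := by
  ext x; simp [fn2_apply]

lemma fn2_neg_left (B : Form M 2) (X Y : VF M) : fn2 B (-X) Y = -fn2 B X Y := by
  ext x; simp [fn2_apply]

lemma fn2_zero_right (B : Form M 2) (X : VF M) : fn2 B X 0 = 0 := by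
  ext x; simp [fn2_apply]

/-- The exterior derivative of a 2-form, on vector fields. -/
def extDeriv2 (B : Form M 2) (X Y Z : VF M) : SmoothFun M :=
  der X (fn2 B Y Z) - der Y (fn2 B X Z) + der Z (fn2 B X Y)
    - fn2 B (lie X Y) Z + fn2 B (lie X Z) Y - fn2 B (lie Y Z) X

lemma extDeriv2_apply (B : Form M 2) (X Y Z : VF M) (x : M) :
    extDeriv2 B X Y Z x = d2 B.1 X Y Z x := by
  rw [d2_eq]; rfl

lemma fn2_jacobi (B : Form M 2) (X Y Z W : VF M) : fn2 B (lie (lie X Y) Z) W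
    - fn2 B (lie (lie X Z) Y) W + fn2 B (lie (lie Y Z) X) W = 0 := by
  have h := lie_jacobi X Y Z
  rw [lie_skew X (lie Y Z), lie_skew Y (lie X Z)] at h
  have h2 := congrArg (fun V => fn2 B V W) h
  simp only [fn2_add_left, fn2_neg_left] at h2
  linear_combination -h2

/-- `d ∘ d = 0` on 2-forms. -/
lemma mem_closed3_of_eq_extDeriv2 {H : Form M 3} {B : Form M 2}
    (h : ∀ X Y Z, fn3 H X Y Z = extDeriv2 B X Y Z) : H ∈ closed3 M := by
  intro W X Y Z x
  have key : der W (fn3 H X Y Z) - der X (fn3 H W Y Z) + der Y (fn3 H W X Z) - der Z (fn3 H W X Y)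
      - fn3 H (lie W X) Y Z + fn3 H (lie W Y) X Z - fn3 H (lie W Z) X Y
      - fn3 H (lie X Y) W Z + fn3 H (lie X Z) W Y - fn3 H (lie Y Z) W X = 0 := by
    -- Second derivatives cancel once brackets act as commutators; what remains are double brackets,
    -- removed by the Jacobi identity, and pairs of brackets, removed by skewness of `B`.
    simp only [h, extDeriv2, der_add, der_sub, der_lie]
    linear_combination fn2_jacobi B W X Y Z - fn2_jacobi B W X Z Y + fn2_jacobi B W Y Z X
      - fn2_jacobi B X Y Z W + fn2_skew B (lie Y Z) (lie W X) - fn2_skew B (lie X Z) (lie W Y)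
      + fn2_skew B (lie X Y) (lie W Z)
  rw [d3_eq]
  exact congrArg (fun f : SmoothFun M => f x) key

lemma mem_exact3_iff {H : Form M 3} :
    H ∈ exact3 M ↔ ∃ B : Form M 2, ∀ X Y Z, fn3 H X Y Z = extDeriv2 B X Y Z := by
  refine exists_congr fun B => ⟨fun h X Y Z => ?_, fun h X Y Z x => ?_⟩
  · ext x
    rw [fn3_apply, tri_apply, extDeriv2_apply]
    exact h X Y Z x
  · rw [← extDeriv2_apply, ← h, fn3_apply, tri_apply]

lemma exact3_le_closed3 : exact3 M ≤ closed3 M := fun _ hH => by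
  obtain ⟨B, hB⟩ := mem_exact3_iff.1 hH
  exact mem_closed3_of_eq_extDeriv2 hB

/-- Closedness of `H'` need not be assumed: it differs from the closed form `H` by an exact form,
which is closed. -/
lemma HasClass.iff_sub_mem {H H' : Form M 3} {τ : H3dR M} (h : HasClass H τ) :
    HasClass H' τ ↔ H' - H ∈ exact3 M := by
  obtain ⟨hH, rfl⟩ := h
  refine ⟨fun ⟨h', e⟩ => by simpa [Submodule.mem_comap] using (Submodule.Quotient.eq ((exact3 M).comap (closed3 M).subtype)).1 e, fun h' => ?_⟩
  have hc : H' ∈ closed3 M := by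
    have := Submodule.add_mem _ (exact3_le_closed3 h') hH
    rwa [sub_add_cancel] at this
  exact ⟨hc, (Submodule.Quotient.eq ((exact3 M).comap (closed3 M).subtype)).2 h'⟩

lemma fn3_sub (H H' : Form M 3) (X Y Z : VF M) : fn3 (H - H') X Y Z = fn3 H X Y Z - fn3 H' X Y Z := by
  ext x
  change tri (H.1 x - H'.1 x) (X x) (Y x) (Z x) = tri (H.1 x) (X x) (Y x) (Z x)
    - tri (H'.1 x) (X x) (Y x) (Z x)
  simp only [tri_apply]
  rfl

end ExteriorDerivative

/-! ### Smoothness detected by the pairing -/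

section SmoothSections

variable {M : Type*} [TopologicalSpace M] [ChartedSpace R6 M] [IsManifold (𝓡 6) ∞ M] [T2Space M]
  {F : Type*} [NormedAddCommGroup F] [NormedSpace ℝ F] [FiniteDimensional ℝ F]
  {E : M → Type*} [TopologicalSpace (TotalSpace F E)] [∀ x, TopologicalSpace (E x)]
  [∀ x, AddCommGroup (E x)] [∀ x, Module ℝ (E x)] [FiberBundle F E] [VectorBundle ℝ F E]
  [ContMDiffVectorBundle ∞ F E (𝓡 6)]
  {C : CourantAlgebroid F E}

/-- A section whose pairings with smooth sections are smooth is smooth. -/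
lemma CourantAlgebroid.contMDiff_of_pair {σ : ∀ x, E x}
    (h : ∀ a : Sec F E, ContMDiff (𝓡 6) 𝓘(ℝ, ℝ) ∞ fun x => C.pair x (σ x) (a x)) :
    ContMDiff (𝓡 6) ((𝓡 6).prod 𝓘(ℝ, F)) ∞ (fun x => (⟨x, σ x⟩ : TotalSpace F E)) := by
  intro x
  let t := trivializationAt F E x
  have hx : x ∈ t.baseSet := FiberBundle.mem_baseSet_trivializationAt F E x
  have ht : t.baseSet ∈ 𝓝 x := t.open_baseSet.mem_nhds hx
  let b := Module.finBasis ℝ F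
  have hs := fun i => exists_sec_germ ht (t.contMDiffOn_localFrame_baseSet (I := 𝓡 6) ∞ b i)
  choose e he using hs
  let P : Sec F E → SmoothFun M := fun a => ⟨fun y => C.pair y (σ y) (a y), h a⟩
  let m : Matrix _ _ (SmoothFun M) := Matrix.of fun i j => C.pairFn (e i) (e j)
  -- The Gram matrix of a local frame is invertible at `x` by nondegeneracy, so Cramer's rule
  -- recovers the coefficients of `σ` smoothly from its pairings.
  have hdet : m.det x ≠ 0 := by
    have hb : ∀ i, e i x = t.basisAt b hx i := fun i => by
      rw [(he i).self_of_nhds, t.localFrame_apply_of_mem_baseSet b hx]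
    rw [← evalHom_apply, RingHom.map_det]
    have hm : (evalHom x).mapMatrix m = LinearMap.BilinForm.toMatrix (t.basisAt b hx) (C.pair x) := by
      ext i j
      rw [LinearMap.BilinForm.toMatrix_apply, ← hb, ← hb]
      rfl
    rw [hm]
    exact (LinearMap.BilinForm.nondegenerate_iff_det_ne_zero _).1 (C.pair_nondeg x)
  obtain ⟨δ, hδ⟩ := exists_local_inv _ hdet
  refine ((∑ k, fsmul (δ * ∑ l, m.adjugate l k * P (e l)) (e k) : Sec F E).contMDiff x
    ).congr_of_eventuallyEq ?_
  filter_upwards [hδ, ht, eventually_all.2 he] with y h1 hy h2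
  congr 1
  have hb : ∀ i, e i y = t.basisAt b hy i := fun i => by
    rw [h2, t.localFrame_apply_of_mem_baseSet b hy]
  have hσ := (t.basisAt b hy).sum_repr (σ y)
  set c := (t.basisAt b hy).repr (σ y)
  rw [sec_sum_apply, ← hσ]
  refine Finset.sum_congr rfl fun k _ => ?_
  rw [fsmul_apply, hb]
  congr 1
  have hP : ∀ l, evalHom y (P (e l)) = ∑ j, c j * evalHom y (m j l) := fun l => by
    change C.pair y (σ y) (e l y) = ∑ j, c j * C.pair y (e j y) (e l y)
    rw [← hσ, map_sum, LinearMap.sum_apply]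
    exact Finset.sum_congr rfl fun j _ => by rw [map_smul, LinearMap.smul_apply, hb j, smul_eq_mul]
  have hmul : ∀ j, ∑ l, evalHom y (m j l) * evalHom y (m.adjugate l k) =
      if j = k then evalHom y m.det else 0 := fun j => by
    have := congrArg (evalHom y) (congrFun (congrFun m.mul_adjugate j) k)
    rw [Matrix.mul_apply, map_sum, Matrix.smul_apply, Matrix.one_apply] at this
    simp only [map_mul] at this
    rw [this]
    split_ifs <;> simp
  rw [← evalHom_apply y, map_mul, map_sum]
  simp only [map_mul, hP, Finset.mul_sum]
  rw [Finset.sum_comm]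
  calc c k = evalHom y δ * evalHom y m.det * c k := by
        rw [evalHom_apply, evalHom_apply, h1, one_mul]
    _ = evalHom y δ * ∑ j, c j * ∑ l, evalHom y (m j l) * evalHom y (m.adjugate l k) := by
        simp only [hmul, mul_ite, mul_zero, Finset.sum_ite_eq', Finset.mem_univ, if_true]
        ring
    _ = _ := by
        simp only [Finset.mul_sum]
        exact Finset.sum_congr rfl fun j _ => Finset.sum_congr rfl fun l _ => by ring

end SmoothSections


/-! ### Isotropic splittings and the Ševera class -/

section Splittings

variable {M : Type*} [TopologicalSpace M] [ChartedSpace R6 M] [IsManifold (𝓡 6) ∞ M] [T2Space M]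
  {F : Type*} [NormedAddCommGroup F] [NormedSpace ℝ F] [FiniteDimensional ℝ F]
  {E : M → Type*} [TopologicalSpace (TotalSpace F E)] [∀ x, TopologicalSpace (E x)]
  [∀ x, AddCommGroup (E x)] [∀ x, Module ℝ (E x)] [FiberBundle F E] [VectorBundle ℝ F E]
  [ContMDiffVectorBundle ∞ F E (𝓡 6)]
  {C : CourantAlgebroid F E}

namespace CourantAlgebroid

namespace Splitting

lemma anchorSec_onVF (s : C.Splitting) (X : VF M) : C.anchorSec (s.onVF X) = X := by
  ext x; exact s.section' x (X x)

lemma pairFn_onVF (s : C.Splitting) (X Y : VF M) : C.pairFn (s.onVF X) (s.onVF Y) = 0 := by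
  ext x; exact s.isotropic' x (X x) (Y x)

lemma onVF_add (s : C.Splitting) (X Y : VF M) : s.onVF (X + Y) = s.onVF X + s.onVF Y := by
  ext x; exact map_add (s.map x) (X x) (Y x)

lemma onVF_fsmul (s : C.Splitting) (f : SmoothFun M) (X : VF M) :
    s.onVF (fsmul f X) = fsmul f (s.onVF X) := by
  ext x; exact map_smul (s.map x) (f x) (X x)

/-- The components of the 3-form of a splitting. -/
def curv (s : C.Splitting) (X Y Z : VF M) : SmoothFun M :=
  (2 : ℝ) • C.pairFn (C.bracket (s.onVF X) (s.onVF Y)) (s.onVF Z)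

lemma isCurv_iff {s : C.Splitting} {H : Form M 3} :
    s.IsCurv H ↔ ∀ X Y Z, fn3 H X Y Z = s.curv X Y Z := by
  refine ⟨fun h X Y Z => ?_, fun h X Y Z x => ?_⟩
  · ext x
    rw [fn3_apply, tri_apply, h X Y Z x]
    rfl
  · rw [← tri_apply, ← fn3_apply, h]
    rfl

/-- Isotropy makes all pairings between lifted fields vanish. This removes the symmetric part of the
bracket and the derivative terms of the Leibniz rules, so the expression is skew and tensorial. -/
lemma exists_isCurv (s : C.Splitting) : ∃ H, s.IsCurv H := by
  simp only [isCurv_iff]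
  have h0 : ∀ X : VF M, der X (0 : SmoothFun M) = 0 := fun X => by
    simpa using der_add X (0 : SmoothFun M) 0
  refine exists_form3 s.curv (fun X Y Z => ?_) (fun X Y Z => ?_) (fun X X' Y Z => ?_)
    fun f X Y Z => ?_
  · have h := pairFn_bracket_symm (C := C) (s.onVF X) (s.onVF Y) (s.onVF Z)
    rw [pairFn_onVF, h0] at h
    rw [curv, curv, eq_neg_of_add_eq_zero_left h, smul_neg]
  · have h := der_pairFn (C := C) (s.onVF X) (s.onVF Y) (s.onVF Z)
    rw [pairFn_onVF, h0, C.pairFn_symm (s.onVF Y)] at h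
    rw [curv, curv, eq_neg_of_add_eq_zero_left h.symm, smul_neg]
  · rw [curv, onVF_add, map_add, LinearMap.add_apply, pairFn_add_left, smul_add]
    rfl
  · rw [curv, onVF_fsmul, pairFn_fsmul_bracket]
    simp only [pairFn_onVF, curv]
    ext x
    simp

lemma IsCurv.unique {s : C.Splitting} {H H' : Form M 3} (h : s.IsCurv H) (h' : s.IsCurv H') :
    H = H' :=
  form3_ext fun X Y Z => by rw [isCurv_iff.1 h, isCurv_iff.1 h']

lemma ext_map {s s' : C.Splitting} (h : ∀ x v, s.map x v = s'.map x v) : s = s' := by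
  obtain ⟨m, _, _, _⟩ := s
  obtain ⟨m', _, _, _⟩ := s'
  have : m = m' := funext fun x => LinearMap.ext (h x)
  subst this
  rfl

/-- `s'` is the splitting `s` shifted by the 2-form `B`. -/
def IsShift (s s' : C.Splitting) (B : Form M 2) : Prop :=
  ∀ x v, s'.map x v = s.map x v + (1 / 2 : ℝ) • C.coanchor x (bil (B.1 x) v)

/-- The 3-form changes by `dB` under a shift by `B`. -/
lemma IsShift.curv_eq (hC : C.IsExact) {s s' : C.Splitting} {B : Form M 2} (h : s.IsShift s' B)
    (X Y Z : VF M) : s'.curv X Y Z = s.curv X Y Z + extDeriv2 B X Y Z := by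
  have h0 : ∀ f : SmoothFun M, der 0 f = 0 := fun f => by
    ext x; exact map_zero (mfderiv (𝓡 6) 𝓘(ℝ, ℝ) f x)
  have hl : ∀ X : VF M, lie 0 X = 0 := fun X => by rw [lie_skew, lie_zero_right, neg_zero]
  set β : VF M → Sec F E := fun X => (2 : ℝ) • (s'.onVF X - s.onVF X) with hβ
  have hβx : ∀ X x, β X x = C.coanchor x (bil (B.1 x) (X x)) := fun X x => by
    change (2 : ℝ) • (s'.map x (X x) - s.map x (X x)) = _
    rw [h, add_sub_cancel_left, smul_smul]
    norm_num
  have hs' : ∀ X, s'.onVF X = s.onVF X + (1 / 2 : ℝ) • β X := fun X => by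
    simp only [β]
    module
  have hβa : ∀ X, C.anchorSec (β X) = 0 := fun X => by
    ext x
    change C.anchor x (β X x) = 0
    rw [hβx, hC.anchor_coanchor]
  have hβp : ∀ X c, C.pairFn (β X) c = fn2 B X (C.anchorSec c) := fun X c => by
    ext x
    change C.pair x (β X x) (c x) = _
    rw [hβx, C.pair_coanchor]
    rfl
  have hβp' : ∀ X c, C.pairFn c (β X) = fn2 B X (C.anchorSec c) := fun X c => by
    rw [pairFn_symm, hβp]
  have h1 : ∀ a c, C.pairFn (C.bracket a c) (β Z) =
      fn2 B Z (lie (C.anchorSec a) (C.anchorSec c)) := fun a c => by rw [hβp', anchorSec_bracket]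
  have h2 : ∀ X Y, C.pairFn (C.bracket (s.onVF X) (β Y)) (s.onVF Z) =
      der X (fn2 B Y Z) - fn2 B Y (lie X Z) := fun X Y => by
    have := der_pairFn (C := C) (s.onVF X) (β Y) (s.onVF Z)
    rw [hβp, hβp, anchorSec_bracket] at this
    simp only [anchorSec_onVF] at this
    rw [this, add_sub_cancel_right]
  have h3 : C.pairFn (C.bracket (β X) (s.onVF Y)) (s.onVF Z) = der Z (fn2 B X Y) -
      (der Y (fn2 B X Z) - fn2 B X (lie Y Z)) := by
    have := pairFn_bracket_symm (C := C) (β X) (s.onVF Y) (s.onVF Z)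
    rw [hβp, h2] at this
    simp only [anchorSec_onVF] at this
    rw [← this, add_sub_cancel_right]
  have h4 : C.pairFn (C.bracket (β X) (β Y)) (s.onVF Z) = 0 := by
    have := der_pairFn (C := C) (β X) (β Y) (s.onVF Z)
    rw [hβa, h0, hβp, anchorSec_bracket, hβa, hl,
      fn2_zero_right, add_zero] at this
    exact this.symm
  simp only [curv, hs', map_add, map_smul, LinearMap.add_apply, LinearMap.smul_apply,
    pairFn_add_left, pairFn_add_right, pairFn_smul_left, pairFn_smul_right, h1, h2, h3, h4, hβa,
    anchorSec_onVF, lie_zero_right, hl, fn2_zero_right, extDeriv2]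
  rw [fn2_skew B (lie X Y), fn2_skew B (lie X Z), fn2_skew B (lie Y Z)]
  module

/-- The 2-form is `B(v, w) = 2⟨s'v, s w⟩`. Its skewness expresses that both splittings are
isotropic, and the factor 2 matches the `½` in the shift. -/
lemma exists_isShift (hC : C.IsExact) (s s' : C.Splitting) : ∃ B, s.IsShift s' B := by
  have hdiff : ∀ x v, ∃ ξ, s'.map x v = s.map x v + C.coanchor x ξ := fun x v => by
    have : s'.map x v - s.map x v ∈ LinearMap.range (C.coanchor x) := by
      rw [hC.exact' x, LinearMap.mem_ker, map_sub, s'.section', s.section', sub_self]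
    obtain ⟨ξ, hξ⟩ := this
    exact ⟨ξ, by rw [hξ]; abel⟩
  obtain ⟨B, hB⟩ := exists_form2 (fun x => (2 : ℝ) • (C.pair x).compl₁₂ (s'.map x) (s.map x))
    (fun x v w => by
      obtain ⟨ξ, hξ⟩ := hdiff x v
      obtain ⟨ζ, hζ⟩ := hdiff x w
      have h := s'.isotropic' x v w
      change (2 : ℝ) * C.pair x (s'.map x v) (s.map x w)
        = -((2 : ℝ) * C.pair x (s'.map x w) (s.map x v))
      rw [hζ, map_add, C.pair_symm x (s'.map x v) (C.coanchor x ζ), C.pair_coanchor,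
        s'.section'] at h
      rw [hζ, map_add, LinearMap.add_apply, s.isotropic', C.pair_coanchor, s.section']
      linarith)
    (fun X Y => contMDiff_const.mul (C.pair_smooth (s'.onVF X) (s.onVF Y)))
  refine ⟨B, fun x v => ?_⟩
  obtain ⟨ξ, hξ⟩ := hdiff x v
  have : bil (B.1 x) v = (2 : ℝ) • ξ := by
    ext w
    rw [hB]
    change (2 : ℝ) * C.pair x (s'.map x v) (s.map x w) = 2 * ξ w
    rw [hξ, map_add, LinearMap.add_apply, s.isotropic', C.pair_coanchor, s.section', zero_add]
  rw [this, hξ, map_smul, smul_smul]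
  norm_num

/-- The shifted splitting is isotropic because `B` is skew, and smooth because its new part pairs
smoothly with every section. -/
lemma exists_shift (hC : C.IsExact) (s : C.Splitting) (B : Form M 2) : ∃ s', s.IsShift s' B := by
  refine ⟨{ map := fun x => s.map x + (1 / 2 : ℝ) • C.coanchor x ∘ₗ bil (B.1 x)
            smooth' := fun X => ?_
            section' := fun x v => ?_
            isotropic' := fun x v w => ?_ }, fun x v => rfl⟩
  · have h : ContMDiff (𝓡 6) ((𝓡 6).prod 𝓘(ℝ, F)) ∞
        (fun x => (⟨x, C.coanchor x (bil (B.1 x) (X x))⟩ : TotalSpace F E)) :=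
      contMDiff_of_pair fun a => (fn2 B X (C.anchorSec a)).contMDiff.congr fun x =>
        C.pair_coanchor x _ _
    exact (s.onVF X + (1 / 2 : ℝ) • (⟨_, h⟩ : Sec F E)).contMDiff
  · change C.anchor x (s.map x v + (1 / 2 : ℝ) • C.coanchor x (bil (B.1 x) v)) = v
    rw [map_add, map_smul, hC.anchor_coanchor, smul_zero, add_zero, s.section']
  · change C.pair x (s.map x v + (1 / 2 : ℝ) • C.coanchor x (bil (B.1 x) v))
      (s.map x w + (1 / 2 : ℝ) • C.coanchor x (bil (B.1 x) w)) = 0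
    simp only [map_add, map_smul, LinearMap.add_apply, LinearMap.smul_apply, s.isotropic',
      C.pair_coanchor, s.section', hC.anchor_coanchor, map_zero,
      C.pair_symm x (s.map x v) (C.coanchor x _)]
    rw [bil_skew]
    simp

/-- The 3-form of every isotropic splitting represents the Ševera class. -/
lemma IsCurv.hasClass (hC : C.IsExact) {τ : H3dR M} (hτ : C.IsSeveraClass τ) {s : C.Splitting}
    {H : Form M 3} (h : s.IsCurv H) : HasClass H τ := by
  obtain ⟨s₀, H₀, h₀, hτ⟩ := hτ
  obtain ⟨B, hB⟩ := exists_isShift hC s₀ s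
  refine hτ.iff_sub_mem.2 (mem_exact3_iff.2 ⟨B, fun X Y Z => ?_⟩)
  rw [fn3_sub, isCurv_iff.1 h, isCurv_iff.1 h₀, hB.curv_eq hC, add_sub_cancel_left]

/-- Every representative of the Ševera class is the 3-form of a splitting. -/
lemma exists_of_hasClass (hC : C.IsExact) {τ : H3dR M} (hτ : C.IsSeveraClass τ)
    {H : Form M 3} (h : HasClass H τ) : ∃ s : C.Splitting, s.IsCurv H := by
  obtain ⟨s₀, H₀, h₀, hτ⟩ := hτ
  obtain ⟨B, hB⟩ := mem_exact3_iff.1 (hτ.iff_sub_mem.1 h)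
  obtain ⟨s, hs⟩ := exists_shift hC s₀ B
  refine ⟨s, isCurv_iff.2 fun X Y Z => ?_⟩
  rw [hs.curv_eq hC, ← isCurv_iff.1 h₀, ← hB, fn3_sub, add_sub_cancel]

end Splitting

end CourantAlgebroid

end Splittings


/-! ### From generalized metrics to pairs of a metric and a 3-form -/

section Correspondence

variable {M : Type*} [TopologicalSpace M] [ChartedSpace R6 M] [IsManifold (𝓡 6) ∞ M] [T2Space M]
  {F : Type*} [NormedAddCommGroup F] [NormedSpace ℝ F] [FiniteDimensional ℝ F]
  {E : M → Type*} [TopologicalSpace (TotalSpace F E)] [∀ x, TopologicalSpace (E x)]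
  [∀ x, AddCommGroup (E x)] [∀ x, Module ℝ (E x)] [FiberBundle F E] [VectorBundle ℝ F E]
  [ContMDiffVectorBundle ∞ F E (𝓡 6)]
  {C : CourantAlgebroid F E}

lemma LorentzMetric.ext_val {g g' : LorentzMetric M} (h : ∀ x v w, g.val x v w = g'.val x v w) :
    g = g' := by
  obtain ⟨m, _, _, _⟩ := g
  obtain ⟨m', _, _, _⟩ := g'
  have : m = m' := funext fun x => LinearMap.ext fun v => LinearMap.ext (h x v)
  subst this
  rfl

namespace CourantAlgebroid

namespace GenMetric

section Image

variable {A : C.GenMetric} (hC : C.IsExact) (hA : A.Admissible)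

/-- The isotropic splitting of an admissible generalized metric. -/
def splitting : C.Splitting where
  map x := (1 / 2 : ℝ) • (upAt hC hA x + dnAt hC hA x)
  smooth' X := ((lift hC hA).mid X).contMDiff
  section' x v := by
    rw [LinearMap.smul_apply, LinearMap.add_apply, map_smul, map_add, anchor_upAt, anchor_dnAt]
    module
  isotropic' x v w := by
    simp only [LinearMap.smul_apply, LinearMap.add_apply, map_smul, map_add, pair_dnAt_dnAt,
      pair_dnAt_Vplus hC hA v (upAt_mem hC hA x w),
      pair_Vplus_Vminus (upAt_mem hC hA x v) (dnAt_mem hC hA x w), metricAt_apply]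
    simp

lemma splitting_add (x : M) (v : TangentSpace (𝓡 6) x) : (splitting hC hA).map x v +
    (1 / 2 : ℝ) • C.coanchor x (metricAt hC hA x v) = upAt hC hA x v := by
  change (1 / 2 : ℝ) • (upAt hC hA x v + dnAt hC hA x v) + _ = _
  rw [dnAt_apply]
  module

/-- The splitting of `A` is the midpoint of the lifts to `V_+` and `V_-`, so `two_pair_mid` computes
its 3-form. -/
lemma isCurv_splitting_iff {H : Form M 3} : (splitting hC hA).IsCurv H ↔
    ∀ X Y Z, fn3 H X Y Z = (metric hC hA).fn ((lift hC hA).K X Y) Z := by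
  rw [Splitting.isCurv_iff]
  refine forall₃_congr fun X Y Z => ?_
  rw [← LiftPair.two_pair_mid]
  rfl

lemma eq_metric {g : LorentzMetric M} (h : ∀ x, ∀ e ∈ A.Vplus x, ∀ e' ∈ A.Vplus x,
    g.val x (C.anchor x e) (C.anchor x e') = C.pair x e e') : g = metric hC hA := by
  refine LorentzMetric.ext_val fun x v w => ?_
  have := h x _ (upAt_mem hC hA x v) _ (upAt_mem hC hA x w)
  rwa [anchor_upAt, anchor_upAt] at this

/-- The condition says that `s v + ½ π* g(v)` is the element of `V_+` over `v`, and such an element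
is unique. -/
lemma eq_splitting {s : C.Splitting} (h : ∀ x v, s.map x v + (1 / 2 : ℝ) •
    C.coanchor x ((metric hC hA).val x v) ∈ A.Vplus x) : s = splitting hC hA := by
  refine Splitting.ext_map fun x v => ?_
  have h1 := upAt_anchor hC hA (h x v)
  rw [map_add, map_smul, hC.anchor_coanchor, smul_zero, add_zero, s.section',
    ← splitting_add] at h1
  exact (add_right_cancel h1).symm

lemma induces_iff {g : LorentzMetric M} {H : Form M 3} :
    A.Induces g H ↔ g = metric hC hA ∧ (splitting hC hA).IsCurv H := by
  constructor
  · rintro ⟨hg, s, hs, hH⟩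
    obtain rfl := eq_metric hC hA hg
    exact ⟨rfl, eq_splitting hC hA hs ▸ hH⟩
  · rintro ⟨rfl, hH⟩
    refine ⟨fun x e he e' he' => ?_, splitting hC hA, fun x v => ?_, hH⟩
    · change C.pair x (upAt hC hA x (C.anchor x e)) (upAt hC hA x (C.anchor x e')) = _
      rw [upAt_anchor hC hA he, upAt_anchor hC hA he']
    · have := splitting_add hC hA x v
      change _ + (1 / 2 : ℝ) • C.coanchor x (metricAt hC hA x v) ∈ _
      rw [this]
      exact upAt_mem hC hA x v

end Image

section BField

variable {A A' : C.GenMetric} (hC : C.IsExact) (hA : A.Admissible) (hA' : A'.Admissible)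

/-- The generalized metrics with the same induced metric and 3-form are those that differ by a
closed `B`-field. -/
lemma isBTransform_iff {H H' : Form M 3} (hH : (splitting hC hA).IsCurv H)
    (hH' : (splitting hC hA').IsCurv H') :
    A.IsBTransform A' ↔ metric hC hA = metric hC hA' ∧ H = H' := by
  constructor
  · rintro ⟨B, hB, h⟩
    -- The transformation carries `V_+` of `A` into `V_+` of `A'` over the identity of `TM`;
    -- elements there are determined by their anchor.
    have hup : ∀ x v, upAt hC hA' x v = upAt hC hA x v +
        (1 / 2 : ℝ) • C.coanchor x (bil (B.1 x) v) := fun x v => by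
      have h1 := h x (upAt hC hA x v)
      rw [mem_Vplus.1 (upAt_mem hC hA x v), anchor_upAt, contract2_eq, ← mem_Vplus] at h1
      have h2 := upAt_anchor hC hA' h1
      rwa [map_add, map_smul, hC.anchor_coanchor, smul_zero, add_zero, anchor_upAt] at h2
    have hg : metric hC hA = metric hC hA' := LorentzMetric.ext_val fun x v w => by
      change C.pair x (upAt hC hA x v) (upAt hC hA x w) =
        C.pair x (upAt hC hA' x v) (upAt hC hA' x w)
      rw [hup, hup]
      simp only [map_add, map_smul, LinearMap.add_apply, LinearMap.smul_apply,
        C.pair_symm x (upAt hC hA x v) (C.coanchor x _), C.pair_coanchor, anchor_upAt,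
        hC.anchor_coanchor, map_zero]
      rw [bil_skew]
      simp
    refine ⟨hg, ?_⟩
    have hs : (splitting hC hA).IsShift (splitting hC hA') B := fun x v => by
      have h1 := splitting_add hC hA x v
      have h2 := splitting_add hC hA' x v
      have h3 : metricAt hC hA x v = metricAt hC hA' x v :=
        congrArg (fun g : LorentzMetric M => g.val x v) hg
      rw [hup, ← h1, h3] at h2
      rw [eq_sub_of_add_eq h2]
      abel
    refine form3_ext fun X Y Z => ?_
    rw [Splitting.isCurv_iff.1 hH, Splitting.isCurv_iff.1 hH', hs.curv_eq hC]
    ext x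
    have := hB X Y Z x
    rw [← extDeriv2_apply] at this
    change _ = _ + extDeriv2 B X Y Z x
    rw [this, add_zero]
  · rintro ⟨hg, rfl⟩
    -- As the metrics agree, the `B` that relates the splittings shifts the lifts to both `V_+` and
    -- `V_-`. Equality of the 3-forms says that it is closed.
    obtain ⟨B, hB⟩ := Splitting.exists_isShift hC (splitting hC hA) (splitting hC hA')
    have hup : ∀ x v, upAt hC hA' x v = upAt hC hA x v +
        (1 / 2 : ℝ) • C.coanchor x (bil (B.1 x) v) := fun x v => by
      have h3 : metricAt hC hA x v = metricAt hC hA' x v :=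
        congrArg (fun g : LorentzMetric M => g.val x v) hg
      rw [← splitting_add, ← splitting_add, hB x v, h3]
      abel
    have hdn : ∀ x v, dnAt hC hA' x v = dnAt hC hA x v +
        (1 / 2 : ℝ) • C.coanchor x (bil (B.1 x) v) := fun x v => by
      have h3 : metricAt hC hA x v = metricAt hC hA' x v :=
        congrArg (fun g : LorentzMetric M => g.val x v) hg
      rw [dnAt_apply, dnAt_apply, hup, h3]
      abel
    refine ⟨B, fun X Y Z x => ?_, fun x e => ?_⟩
    · have := hB.curv_eq hC X Y Z
      rw [← Splitting.isCurv_iff.1 hH, ← Splitting.isCurv_iff.1 hH', left_eq_add] at this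
      rw [← extDeriv2_apply, this]
      rfl
    · obtain ⟨v, w, rfl⟩ : ∃ v w, e = upAt hC hA x v + dnAt hC hA x w := by
        obtain ⟨a, rfl⟩ := exists_sec_eq (E := E) F e
        exact ⟨_, _, (congrArg (fun s : Sec F E => s x) ((lift hC hA).decomp a)).symm⟩
      have h1 := mem_Vplus.1 (upAt_mem hC hA x v)
      have h2 := mem_Vminus.1 (dnAt_mem hC hA x w)
      have h3 := mem_Vplus.1 (upAt_mem hC hA' x v)
      have h4 := mem_Vminus.1 (dnAt_mem hC hA' x w)
      have e1 : upAt hC hA x v + dnAt hC hA x w + (1 / 2 : ℝ) • C.coanchor x (contract2 (B.1 x)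
          (C.anchor x (upAt hC hA x v + dnAt hC hA x w))) =
          upAt hC hA' x v + dnAt hC hA' x w := by
        rw [contract2_eq, hup, hdn, map_add, anchor_upAt, anchor_dnAt, map_add, map_add]
        module
      rw [e1, map_add, map_add, h1, h2, h3, h4, contract2_eq, hup, hdn, map_add, map_neg,
        anchor_upAt, anchor_dnAt, map_add, map_add, map_neg, map_neg]
      module

end BField

end GenMetric

end CourantAlgebroid

end Correspondence


/-! ### From a metric and a splitting to a generalized metric -/

section Reconstruction

variable {M : Type*} [TopologicalSpace M] [ChartedSpace R6 M] [IsManifold (𝓡 6) ∞ M] [T2Space M]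

namespace LorentzMetric

variable (g : LorentzMetric M)

lemma exists_sharp (x : M) : ∃ S : Module.Dual ℝ (TangentSpace (𝓡 6) x) →ₗ[ℝ] TangentSpace (𝓡 6) x,
    ∀ ξ, g.val x (S ξ) = ξ := by
  obtain ⟨b, hb⟩ := g.signature' x
  have hb' : ∀ i j, g.val x (b i) (b j) = if i = j then eta i else 0 := hb
  refine ⟨∑ i, eta i • (LinearMap.applyₗ (b i)).smulRight (b i), fun ξ => b.ext fun j => ?_⟩
  simp only [LinearMap.sum_apply, map_sum, LinearMap.smul_apply, LinearMap.smulRight_apply, map_smul,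
    hb', LinearMap.applyₗ_apply_apply, smul_eq_mul, mul_ite, mul_zero, Finset.sum_ite_eq',
    Finset.mem_univ, if_true]
  rw [mul_comm (ξ (b j)), ← mul_assoc, eta_mul_self, one_mul]

/-- The vector dual to a covector. -/
def sharp (x : M) : Module.Dual ℝ (TangentSpace (𝓡 6) x) →ₗ[ℝ] TangentSpace (𝓡 6) x :=
  (g.exists_sharp x).choose

@[simp] lemma val_sharp (x : M) (ξ : Module.Dual ℝ (TangentSpace (𝓡 6) x)) :
    g.val x (g.sharp x ξ) = ξ := (g.exists_sharp x).choose_spec ξ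

@[simp] lemma sharp_val (x : M) (v : TangentSpace (𝓡 6) x) : g.sharp x (g.val x v) = v :=
  g.eq_of_inner fun w => by rw [val_sharp]

lemma apply_sharp_comm (x : M) (ξ ζ : Module.Dual ℝ (TangentSpace (𝓡 6) x)) :
    ξ (g.sharp x ζ) = ζ (g.sharp x ξ) := by
  have h1 := congrArg (fun l => l (g.sharp x ζ)) (g.val_sharp x ξ)
  have h2 := congrArg (fun l => l (g.sharp x ξ)) (g.val_sharp x ζ)
  exact h1.symm.trans ((g.symm' x _ _).trans h2)

/-- The inverse metric in an orthonormal tuple; in a local frame this formula shows smoothness of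
the reconstructed involution. -/
lemma apply_sharp {x : M} {v : Fin 6 → TangentSpace (𝓡 6) x} (hv : IsOrtho (g.val x) v)
    (ξ ζ : Module.Dual ℝ (TangentSpace (𝓡 6) x)) :
    ξ (g.sharp x ζ) = ∑ i, eta i * (ζ (v i) * ξ (v i)) := by
  obtain ⟨b, hb, hbO⟩ := hv.exists_basis
  have h : g.sharp x ζ = ∑ i, (eta i * ζ (v i)) • v i := by
    refine g.eq_of_inner fun w => ?_
    rw [val_sharp]
    refine congrArg (fun l : Module.Dual ℝ _ => l w) (b.ext fun j => ?_ : ζ = g.val x _)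
    have hv' : ∀ i j, g.val x (v i) (v j) = if i = j then eta i else 0 := hv
    simp only [hb, map_sum, map_smul, LinearMap.sum_apply, LinearMap.smul_apply, hv', smul_eq_mul,
      mul_ite, mul_zero, Finset.sum_ite_eq', Finset.mem_univ, if_true]
    rw [mul_right_comm, eta_mul_self, one_mul]
  rw [h, map_sum]
  exact Finset.sum_congr rfl fun i _ => by rw [map_smul, smul_eq_mul, mul_assoc]

end LorentzMetric

variable {F : Type*} [NormedAddCommGroup F] [NormedSpace ℝ F] [FiniteDimensional ℝ F]
  {E : M → Type*} [TopologicalSpace (TotalSpace F E)] [∀ x, TopologicalSpace (E x)]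
  [∀ x, AddCommGroup (E x)] [∀ x, Module ℝ (E x)] [FiberBundle F E] [VectorBundle ℝ F E]
  [ContMDiffVectorBundle ∞ F E (𝓡 6)]
  {C : CourantAlgebroid F E}

namespace CourantAlgebroid

namespace Splitting

variable (s : C.Splitting) (g : LorentzMetric M)

/-- The `T*M`-component of an element of `E`. -/
def covec (x : M) : E x →ₗ[ℝ] Module.Dual ℝ (TangentSpace (𝓡 6) x) := (C.pair x).compl₂ (s.map x)

lemma covec_apply (x : M) (e : E x) (v : TangentSpace (𝓡 6) x) :
    s.covec x e v = C.pair x e (s.map x v) := rfl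

lemma decomp (hC : C.IsExact) (x : M) (e : E x) :
    s.map x (C.anchor x e) + C.coanchor x (s.covec x e) = e := by
  have : e - s.map x (C.anchor x e) ∈ LinearMap.range (C.coanchor x) := by
    rw [hC.exact' x, LinearMap.mem_ker, map_sub, s.section', sub_self]
  obtain ⟨ξ, hξ⟩ := this
  have hξ' : e = s.map x (C.anchor x e) + C.coanchor x ξ := by rw [hξ]; abel
  have : s.covec x e = ξ := by
    ext w
    rw [covec_apply, hξ', map_add, LinearMap.add_apply, s.isotropic', C.pair_coanchor, s.section',
      zero_add]
  rw [this, ← hξ']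

@[simp] lemma covec_map (x : M) (v : TangentSpace (𝓡 6) x) : s.covec x (s.map x v) = 0 :=
  LinearMap.ext (s.isotropic' x v)

@[simp] lemma covec_coanchor (x : M) (ξ : Module.Dual ℝ (TangentSpace (𝓡 6) x)) :
    s.covec x (C.coanchor x ξ) = ξ := by
  ext w
  rw [covec_apply, C.pair_coanchor, s.section']

/-- The involution with `+1`-eigenbundle the graph `{s v + π* g(v) / 2}`. -/
def graphInv (x : M) : E x →ₗ[ℝ] E x :=
  (2 : ℝ) • s.map x ∘ₗ g.sharp x ∘ₗ s.covec x
    + (1 / 2 : ℝ) • C.coanchor x ∘ₗ g.val x ∘ₗ C.anchor x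

lemma graphInv_apply (x : M) (e : E x) : s.graphInv g x e =
    (2 : ℝ) • s.map x (g.sharp x (s.covec x e))
      + (1 / 2 : ℝ) • C.coanchor x (g.val x (C.anchor x e)) := rfl

lemma anchor_graphInv (hC : C.IsExact) (x : M) (e : E x) :
    C.anchor x (s.graphInv g x e) = (2 : ℝ) • g.sharp x (s.covec x e) := by
  simp only [graphInv_apply, map_add, map_smul, hC.anchor_coanchor, smul_zero, add_zero,
    s.section']

lemma covec_graphInv (x : M) (e : E x) :
    s.covec x (s.graphInv g x e) = (1 / 2 : ℝ) • g.val x (C.anchor x e) := by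
  simp only [graphInv_apply, map_add, map_smul, covec_map, s.covec_coanchor, smul_zero, zero_add]

lemma pair_graphInv (x : M) (e f : E x) : C.pair x (s.graphInv g x e) f =
    2 * s.covec x f (g.sharp x (s.covec x e))
      + (1 / 2) * g.val x (C.anchor x e) (C.anchor x f) := by
  simp only [graphInv_apply, map_add, LinearMap.add_apply, map_smul, LinearMap.smul_apply,
    C.pair_coanchor, C.pair_symm x _ f, ← covec_apply, smul_eq_mul]

/-- The lift of the tangent space to the graph. -/
def graph (x : M) : TangentSpace (𝓡 6) x →ₗ[ℝ] E x :=
  s.map x + (1 / 2 : ℝ) • C.coanchor x ∘ₗ g.val x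

lemma graph_apply (x : M) (v : TangentSpace (𝓡 6) x) :
    s.graph g x v = s.map x v + (1 / 2 : ℝ) • C.coanchor x (g.val x v) := rfl

lemma anchor_graph (hC : C.IsExact) (x : M) (v : TangentSpace (𝓡 6) x) :
    C.anchor x (s.graph g x v) = v := by
  rw [graph_apply, map_add, map_smul, hC.anchor_coanchor, smul_zero, add_zero, s.section']

lemma graphInv_graph (hC : C.IsExact) (x : M) (v : TangentSpace (𝓡 6) x) :
    s.graphInv g x (s.graph g x v) = s.graph g x v := by
  rw [graphInv_apply, anchor_graph s g hC, graph_apply]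
  simp only [map_add, map_smul, covec_map, s.covec_coanchor, zero_add, LorentzMetric.sharp_val,
    smul_smul]
  norm_num

lemma pair_graph (hC : C.IsExact) (x : M) (v w : TangentSpace (𝓡 6) x) :
    C.pair x (s.graph g x v) (s.graph g x w) = g.val x v w := by
  rw [← graphInv_graph s g hC x v, pair_graphInv, anchor_graph s g hC, anchor_graph s g hC,
    graph_apply, graph_apply]
  simp only [map_add, map_smul, covec_map, s.covec_coanchor, zero_add, LorentzMetric.sharp_val,
    LinearMap.smul_apply, smul_eq_mul]
  rw [g.symm' x w v]
  ring

/-- For a fixed vector `covec_graphInv` gives the covector part as `½ g(π e)`, so the vector lies on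
the graph. -/
lemma eq_graph (hC : C.IsExact) {x : M} {e : E x} (h : s.graphInv g x e = e) :
    e = s.graph g x (C.anchor x e) := by
  have h1 := covec_graphInv s g x e
  rw [h] at h1
  conv_lhs => rw [← s.decomp hC x e, h1, map_smul]
  rfl

/-- Pairings with test sections are, in a local orthonormal frame, polynomials in smooth functions,
which suffices by `contMDiff_of_pair`. -/
lemma graphInv_smooth (a : Sec F E) : ContMDiff (𝓡 6) ((𝓡 6).prod 𝓘(ℝ, F)) ∞
    (fun x => (⟨x, s.graphInv g x (a x)⟩ : TotalSpace F E)) := by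
  refine contMDiff_of_pair (C := C) fun c x => ?_
  obtain ⟨b, hb⟩ := g.signature' x
  obtain ⟨X, -, hX⟩ := exists_ortho_frame g hb
  let f : SmoothFun M := (2 : ℝ) • ∑ i, eta i • (C.pairFn a (s.onVF (X i)) * C.pairFn c (s.onVF (X i)))
    + (1 / 2 : ℝ) • g.fn (C.anchorSec a) (C.anchorSec c)
  refine (f.contMDiff x).congr_of_eventuallyEq ?_
  filter_upwards [hX] with y hy
  rw [pair_graphInv, g.apply_sharp hy]
  change _ = evalHom y ((2 : ℝ) • ∑ i, eta i • (C.pairFn a (s.onVF (X i)) * C.pairFn c (s.onVF (X i))))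
    + (1 / 2 : ℝ) * g.val y (C.anchor y (a y)) (C.anchor y (c y))
  congr 1

/-- The generalized metric of a pair of a metric and an isotropic splitting. -/
def genMetric (hC : C.IsExact) : C.GenMetric where
  G := s.graphInv g
  smooth' := s.graphInv_smooth g
  sq' x e := by
    rw [graphInv_apply s g x (s.graphInv g x e), anchor_graphInv s g hC, covec_graphInv,
      map_smul, map_smul, map_smul, map_smul, LorentzMetric.val_sharp, LorentzMetric.sharp_val,
      smul_smul, smul_smul]
    norm_num
    exact s.decomp hC x e
  self_adj' x e e' := by
    rw [C.pair_symm x e, pair_graphInv, pair_graphInv, g.apply_sharp_comm, g.symm' x]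
  signature' x := by
    obtain ⟨b, hb⟩ := g.signature' x
    refine ⟨fun i => s.graph g x (b i), fun i j => ?_, le_antisymm ?_ fun e he => ?_⟩
    · rw [pair_graph s g hC]
      exact hb i j
    · rw [Submodule.span_le]
      rintro _ ⟨i, rfl⟩
      change s.graphInv g x (s.graph g x (b i)) - s.graph g x (b i) = 0
      rw [graphInv_graph s g hC, sub_self]
    · have he' : s.graphInv g x e = e := sub_eq_zero.1 he
      rw [eq_graph s g hC he', ← b.sum_repr (C.anchor x e), map_sum]
      refine Submodule.sum_mem _ fun i _ => ?_
      rw [map_smul]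
      exact Submodule.smul_mem _ _ (Submodule.subset_span ⟨i, rfl⟩)

lemma mem_Vplus_genMetric (hC : C.IsExact) {x : M} {e : E x} :
    e ∈ (s.genMetric g hC).Vplus x ↔ e = s.graph g x (C.anchor x e) :=
  GenMetric.mem_Vplus.trans ⟨fun h => s.eq_graph g hC h, fun h => by
    rw [h]; exact s.graphInv_graph g hC x _⟩

lemma admissible_genMetric (hC : C.IsExact) : (s.genMetric g hC).Admissible := fun x => by
  refine (Submodule.eq_bot_iff _).2 fun e he => ?_
  have h1 : e ∈ LinearMap.range (C.coanchor x) := he.2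
  rw [hC.exact' x, LinearMap.mem_ker] at h1
  rw [(s.mem_Vplus_genMetric g hC).1 he.1, h1, map_zero]

lemma induces_genMetric (hC : C.IsExact) {H : Form M 3} (hH : s.IsCurv H) :
    (s.genMetric g hC).Induces g H := by
  refine ⟨fun x e he e' he' => ?_, s, fun x v => ?_, hH⟩
  · rw [mem_Vplus_genMetric] at he he'
    conv_rhs => rw [he, he']
    rw [pair_graph s g hC]
  · rw [← graph_apply, mem_Vplus_genMetric, anchor_graph s g hC]

end Splitting

end CourantAlgebroid

end Reconstruction


/-! ### The equations of motion -/

section Equations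

variable {M : Type*} [TopologicalSpace M] [ChartedSpace R6 M] [IsManifold (𝓡 6) ∞ M] [T2Space M]
  {F : Type*} [NormedAddCommGroup F] [NormedSpace ℝ F] [FiniteDimensional ℝ F]
  {E : M → Type*} [TopologicalSpace (TotalSpace F E)] [∀ x, TopologicalSpace (E x)]
  [∀ x, AddCommGroup (E x)] [∀ x, Module ℝ (E x)] [FiberBundle F E] [VectorBundle ℝ F E]
  [ContMDiffVectorBundle ∞ F E (𝓡 6)]
  {C : CourantAlgebroid F E}

namespace CourantAlgebroid

namespace GenMetric

variable {A : C.GenMetric} (hC : C.IsExact) (hA : A.Admissible) {H : Form M 3}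
  (hH : (splitting hC hA).IsCurv H) (o : ManifoldOrientation M)

include hH

/-- The anchor matches orthonormal bases of `V_+` with those of `TM` and the metric and 3-form are
determined by `A`, so `genStar_eq_self_iff` applies basis by basis. -/
lemma isSelfDual_iff : A.IsSelfDual o ↔ SelfDualForm o (metric hC hA) H := by
  constructor
  · rintro ⟨g, H', hI, h⟩ x b hb ho
    obtain ⟨rfl, hH'⟩ := (induces_iff hC hA).1 hI
    obtain rfl := hH.unique hH'
    have hb' : (fun i => C.anchor x (upAt hC hA x (b i))) = b :=
      funext fun i => anchor_upAt hC hA x (b i)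
    have := h x (fun i => upAt hC hA x (b i)) (fun i => upAt_mem hC hA x _) hb
      ⟨b, fun i => (congrFun hb' i).symm, ho⟩
    rw [hb'] at this
    exact (genStar_eq_self_iff hb _).1 this
  · intro h
    refine ⟨_, H, (induces_iff hC hA).2 ⟨rfl, hH⟩, fun x e he hO ⟨b, hb, ho⟩ => ?_⟩
    have hbe : (fun i => C.anchor x (e i)) = b := funext fun i => (hb i).symm
    have hbO : IsOrtho ((metric hC hA).val x) b := fun i j => by
      change C.pair x (upAt hC hA x (b i)) (upAt hC hA x (b j)) = _
      rw [hb, hb, upAt_anchor hC hA (he i), upAt_anchor hC hA (he j)]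
      exact hO i j
    rw [hbe]
    exact (genStar_eq_self_iff hbO _).2 (h x b hbO ho)

variable {o}

/-- By `div_eq_zero` the divergence term of the generalized Ricci tensor drops out. Sections of
`V_∓` are lifts of vector fields, so both sides quantify over the same data. -/
lemma genRicciFlat_iff (hs : SelfDualForm o (metric hC hA) H) (hcl : H ∈ closed3 M) :
    A.GenRicciFlat (lift hC hA).canon ↔
      ∀ (x : M) (b : Module.Basis (Fin 6) ℝ (TangentSpace (𝓡 6) x)),
        IsOrtho ((metric hC hA).val x) b → ∀ Y Z : VF M,
          IsRicci (lift hC hA).nab x Y Z ((1 / 4 : ℝ) * circ b H (Y x) (Z x)) := by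
  have key : ∀ (x : M) (b : Module.Basis (Fin 6) ℝ (TangentSpace (𝓡 6) x)),
      IsOrtho ((metric hC hA).val x) b → ∀ Y Z : VF M,
        (A.IsGenRicci (lift hC hA).canon x ((lift hC hA).dn Y) ((lift hC hA).up Z) 0 ↔
          IsRicci (lift hC hA).nab x Y Z ((1 / 4 : ℝ) * circ b H (Y x) (Z x))) := by
    intro x b hb Y Z
    obtain ⟨X, hX, hXO⟩ := exists_ortho_frame _ hb
    rw [isGenRicci_iff hC hA ((isCurv_splitting_iff hC hA).1 hH) hb hX,
      isRicci_iff (lift hC hA).isLeviCivita hb hX,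
      div_eq_zero (lift hC hA).isLeviCivita hs hcl hXO.self_of_nhds, mul_zero, add_zero, sub_eq_zero]
  constructor
  · intro h x b hb Y Z
    exact (key x b hb Y Z).1 (h x _ _ (fun y => dnAt_mem hC hA y _) fun y => upAt_mem hC hA y _)
  · intro h x a c ha hc
    obtain ⟨Y, rfl⟩ := exists_dn hC hA ha
    obtain ⟨Z, rfl⟩ := exists_up hC hA hc
    obtain ⟨b, hb⟩ := (metric hC hA).signature' x
    exact (key x b hb Y Z).2 (h x b hb Y Z)

/-- The generalized vacuum Einstein equations are the supergravity equations. -/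
lemma isSugraSolution_iff (hcl : H ∈ closed3 M) : (A.IsSelfDual o ∧ A.VacuumEinstein o) ↔
    IsSugraSolution o (metric hC hA) H := by
  rw [isSelfDual_iff hC hA hH]
  constructor
  · rintro ⟨hs, D, hD, hR, -⟩
    obtain rfl := (isCanonicalLC_iff hC hA D).1 hD
    exact ⟨⟨_, (lift hC hA).isLeviCivita, (genRicciFlat_iff hC hA hH hs hcl).1 hR⟩,
      H, (isHodgeStar_self_iff o _ H).2 hs, hcl, rfl⟩
  · rintro ⟨⟨nab, hn, hR⟩, _, hS, -, rfl⟩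
    have hs := (isHodgeStar_self_iff o _ H).1 hS
    -- The given Levi-Civita connection is the one built from the brackets; the Einstein equation
    -- then yields both `GRic = 0` and, through the Lichnerowicz formula, `GS = 0`.
    obtain rfl := hn.unique (lift hC hA).isLeviCivita
    exact ⟨hs, _, (isCanonicalLC_iff hC hA _).2 rfl, (genRicciFlat_iff hC hA hH hs hcl).2 hR,
      isGenScalar_zero hC hA ((isCurv_splitting_iff hC hA).1 hH) hs hcl hR⟩

end GenMetric

end CourantAlgebroid

end Equations

end GenSugra

end

theorem mainTheorem1 {M : Type*} [TopologicalSpace M] [ChartedSpace GenSugra.R6 M]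
    [IsManifold (𝓡 6) ∞ M] [T2Space M] [SecondCountableTopology M]
    {F : Type*} [NormedAddCommGroup F] [NormedSpace ℝ F] [FiniteDimensional ℝ F]
    {E : M → Type*} [TopologicalSpace (TotalSpace F E)] [∀ x, TopologicalSpace (E x)]
    [∀ x, AddCommGroup (E x)] [∀ x, Module ℝ (E x)] [FiberBundle F E] [VectorBundle ℝ F E]
    [ContMDiffVectorBundle ∞ F E (𝓡 6)]
    (o : GenSugra.ManifoldOrientation M) (C : GenSugra.CourantAlgebroid F E) (hC : C.IsExact)
    (τ : GenSugra.H3dR M) (hτ : C.IsSeveraClass τ) :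
    ∃ Φ : {A : C.GenMetric // A.Admissible} → GenSugra.LorentzMetric M × GenSugra.Form M 3,
      (∀ A g H, A.1.Induces g H ↔ Φ A = (g, H)) ∧
      (∀ g H, GenSugra.HasClass H τ ↔ ∃ A, Φ A = (g, H)) ∧
      (∀ A A', Φ A = Φ A' ↔ A.1.IsBTransform A'.1) ∧
      (∀ A, (A.1.IsSelfDual o ∧ A.1.VacuumEinstein o) ↔
        GenSugra.IsSugraSolution o (Φ A).1 (Φ A).2) := by
  -- The 3-form is a chosen one, but a splitting has only one 3-form, so `Induces` is the graph of
  -- `Φ`.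
  let Φ : {A : C.GenMetric // A.Admissible} → GenSugra.LorentzMetric M × GenSugra.Form M 3 :=
    fun A => (GenSugra.CourantAlgebroid.GenMetric.metric hC A.2,
      (GenSugra.CourantAlgebroid.GenMetric.splitting hC A.2).exists_isCurv.choose)
  have hΦ : ∀ A : {A : C.GenMetric // A.Admissible},
      (GenSugra.CourantAlgebroid.GenMetric.splitting hC A.2).IsCurv (Φ A).2 := fun A =>
    (GenSugra.CourantAlgebroid.GenMetric.splitting hC A.2).exists_isCurv.choose_spec
  have hI : ∀ A g H, A.1.Induces g H ↔ Φ A = (g, H) := fun A g H => by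
    rw [GenSugra.CourantAlgebroid.GenMetric.induces_iff hC A.2, Prod.ext_iff]
    exact ⟨fun h => ⟨h.1.symm, (hΦ A).unique h.2⟩, fun h => ⟨h.1.symm, (show (Φ A).2 = H from h.2) ▸ hΦ A⟩⟩
  refine ⟨Φ, hI, fun g H => ⟨fun h => ?_, ?_⟩, fun A A' => ?_, fun A => ?_⟩
  · obtain ⟨s, hs⟩ := GenSugra.CourantAlgebroid.Splitting.exists_of_hasClass hC hτ h
    exact ⟨⟨s.genMetric g hC, s.admissible_genMetric g hC⟩,
      (hI _ _ _).1 (s.induces_genMetric g hC hs)⟩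
  · rintro ⟨A, hA⟩
    have h := hΦ A
    rw [hA] at h
    exact h.hasClass hC hτ
  · rw [Prod.ext_iff]
    exact (GenSugra.CourantAlgebroid.GenMetric.isBTransform_iff hC A.2 A'.2 (hΦ A) (hΦ A')).symm
  · exact GenSugra.CourantAlgebroid.GenMetric.isSugraSolution_iff hC A.2 (hΦ A)
      ((hΦ A).hasClass hC hτ).1
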